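/- **Systems.** Let $\mathcal E$ be a set of exponential signatures. Each $\sigma\in\mathcal E$ comes with the sets of those $i\ge 0$ such that the multiplexing $?_{m_i}$ is allowed on $\sigma$ and of those $i\ge2$ such that the contraction $?_{c_i}$ is allowed on $\sigma$; let $\le_g,\le_f,\le_u$ be binary relations on $\mathcal E$. Formulas are the closed formulas built from atoms and their duals, $1,\bot,0,\top,\otimes,\oplus,\&$ and the multiplicative disjunction (par), the exponentials $?_\sigma,!_\sigma$ ($\sigma\in\mathcal E$) and the fixed points $\mu X.A$, $\nu X.A$. The pre-proofs of $\mu\mathrm{superLL}^\infty(\mathcal E,\le_g,\le_f,\le_u)$ are the possibly infinite trees built from the rules of linear logic without exponentials (identity, cut, exchange being implicit), the unfolding of $\mu$ and of $\nu$, the multicut $(\mathrm{mcut})$ (any positive finite number of premises, wired into a tree by a cut relation $\perp\!\!\!\perp$ between dual occurrences, every uncut occurrence being sent to the conclusion), and the exponential rules $$\frac{\vdash\Gamma,\overbrace{A,\dots,A}^{i}}{\vdash\Gamma,?_\sigma A}\,?_{m_i}\qquad \frac{\vdash\Gamma,\overbrace{?_\sigma A,\dots,?_\sigma A}^{i}}{\vdash\Gamma,?_\sigma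 A}\,?_{c_i}\qquad \frac{\vdash A,?_{\vec\tau}\Delta}{\vdash\, !_\sigma A,?_{\vec\tau}\Delta}\,!_g\qquad \frac{\vdash A,\Delta}{\vdash\, !_\sigma A,?_{\vec\tau}\Delta}\,!_f\qquad \frac{\vdash A,B}{\vdash\, !_\sigma A,?_\tau B}\,!_u$$ where $?_{m_i}$ and $?_{c_i}$ must be allowed on $\sigma$, and $\sigma\le_g\tau_j$ for all $j$, $\sigma\le_f\tau_j$ for all $j$, and $\sigma\le_u\tau$, respectively. A pre-proof is a proof if every infinite branch carries, from some point on, a thread of formula occurrences whose least infinitely recurring formula is a $\nu$-formula that is unfolded infinitely often on it. $\mu\mathrm{LL}^\infty$ is the same system with one signature and the exponential rules weakening $?_w=?_{m_0}$, dereliction $?_d=?_{m_1}$, contraction $?_c=?_{c_2}$ and promotion $!_p=\,!_g$. **Translation.** $\pi^\circ$ is obtained from $\pi$ by forgetting all signatures and replacing: $?_{m_0}$ by $?_w$; $?_{m_i}$ ($i\ge1$) by $i-1$ contractions followed upwards by $i$ derelictions; $?_{c_i}$ by $i-1$ contractions; $!_g$ by $!_p$; $!_f$ and $!_u$ by $!_p$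 with derelictions of all context formulas above it. When a contraction is repeated it always acts on the last copy, and the derelictions are in the order of the sequent. **Steps.** $\pi\rightsquigarrow\pi'$ is one multicut reduction, at any place in the pre-proof $\pi$, whose result is again a pre-proof of $\mu\mathrm{superLL}^\infty(\mathcal E,\le_g,\le_f,\le_u)$. The reductions are: * the usual non-exponential commutations and key cases of multicut elimination; * the commutations of $?_{m_i}$ and $?_{c_i}$ below the multicut; * the commutations of promotions with principal formula in the conclusion of the multicut, all other premises ending with promotions: a $!_g$ commutes as a $!_g$. A $!_f$ commutes as a $!_f$, opening all the premises, if every $!_g$ among them has an empty context; otherwise as a $!_g$, its premise being completed by derelictions $?_{m_1}$ of its context. A $!_u$ commutes as a $!_u$, opening all premises, if they all end with $!_u$; as a $!_f$, opening all premises, if some premise ends with $!_f$ and all the $!_g$ have an empty context; in the remaining situations, where following the chain of $!_u$ from it one first meets a $!_f$ (and some other premise beyond it is a $!_g$ with non-empty context) or a $!_g$, it commutes as a $!_g$, the chain and the promotion met being opened, the latter, if it is a $!_f$, with derelictions $?_{m_1}$ of its context added; * the key case of $?_{c_i}$ against the tree $\mathcal C$ of premises, all ending with promotions, that are connected to its principal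 formula: $\mathcal C$ is copied $i$ times, and the conclusion formulas coming from $\mathcal C$ are contracted below the multicut by $i$-ary derived contractions; * the key case of $?_{m_i}$ against such a tree $\mathcal C$: $\mathcal C$ is copied $i$ times; in each copy the $!_f$ and $!_u$ reached from the principal formula without crossing a $!_g$, and the first $!_g$ met, are opened; below the multicut, the conclusion formulas coming from the opened $!_f$ and $!_u$ receive $i$-ary derived multiplexings, and those coming from the other members of $\mathcal C$ receive $i$-ary derived contractions (for $i=0$, all receive weakenings $?_{m_0}$). A derived rule of arity $i\ge1$ is any derivation of it from rules $?_{c_j}$ and $?_{m_j}$, $j\geq 1$, of the system. Call it *linear* if all its rules but the $?_{m_1}$ act on the last of the current copies of the formula; a single rule $?_{c_i}$ or $?_{m_i}$ is linear. The steps $\to$ of $\mu\mathrm{LL}^\infty$ are the multicut reductions between $\mu\mathrm{LL}^\infty$ pre-proofs: the non-exponential ones, the commutations of $?_w,?_d,?_c,!_p$, and the key cases of $?_w$, $?_d$ and $?_c$ against $!_p$. **Statement.** Let $\pi_0$ be a $\mu\mathrm{superLL}^\infty(\mathcal E,\le_g,\le_f,\le_u)$ proof and let $\pi_0\rightsquigarrow\pi_1$.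 There are $n\in\mathbb N$ and $\mu\mathrm{LL}^\infty$ proofs $\theta_0,\dots,\theta_n$ with $$\pi_0^\circ=\theta_0\to\theta_1\to\dots\to\theta_n,$$ such that $\pi_1^\circ$ is obtained from $\theta_n$ by finitely many permutations of two consecutive rules among $?_w,?_d,?_c$ acting on distinct formula occurrences of their conclusion, all performed on rules that have just moved below the multicut. Here the derived contractions and multiplexings occurring in $\pi_0\rightsquigarrow\pi_1$ are linear. If they are arbitrary, the same holds when the permutations include, besides these, the re-association of two contractions producing three copies of the same formula. -/

import Mathlib

set_option linter.unusedVariables false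

namespace SuperLL

universe u

/-! ## Formulas

Fixed-point variables are de Bruijn indices; sequents only ever contain closed formulas.
`E` is the set of exponential signatures; plain linear logic formulas are `Fm Unit`. -/

inductive Fm (E : Type u) : Type u
  | atom (a : ℕ) | natom (a : ℕ) | var (k : ℕ)
  | one | bot | zero | top
  | tens (A B : Fm E) | par (A B : Fm E) | plus (A B : Fm E) | wth (A B : Fm E)
  | quest (s : E) (A : Fm E) | bang (s : E) (A : Fm E)
  | mu (A : Fm E) | nu (A : Fm E)

namespace Fm

variable {E : Type u}

/-- Linear negation (fixed-point variables are left unchanged). -/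
def neg : Fm E → Fm E
  | atom a => natom a | natom a => atom a | var k => var k
  | one => bot | bot => one | zero => top | top => zero
  | tens A B => par A.neg B.neg | par A B => tens A.neg B.neg
  | plus A B => wth A.neg B.neg | wth A B => plus A.neg B.neg
  | quest s A => bang s A.neg | bang s A => quest s A.neg
  | mu A => nu A.neg | nu A => mu A.neg

/-- Substitution of the closed formula `G` for the variable `k`. -/
def subst (G : Fm E) : ℕ → Fm E → Fm E
  | _, atom a => atom a | _, natom a => natom a
  | k, var j => if j = k then G else var j
  | _, one => one | _, bot => bot | _, zero => zero | _, top => top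
  | k, tens A B => tens (subst G k A) (subst G k B)
  | k, par A B => par (subst G k A) (subst G k B)
  | k, plus A B => plus (subst G k A) (subst G k B)
  | k, wth A B => wth (subst G k A) (subst G k B)
  | k, quest s A => quest s (subst G k A)
  | k, bang s A => bang s (subst G k A)
  | k, mu A => mu (subst G (k + 1) A)
  | k, nu A => nu (subst G (k + 1) A)

/-- All free variables are `< k`; `ClosedAt 0` means closed. -/
def ClosedAt : ℕ → Fm E → Prop
  | _, atom _ => True | _, natom _ => True
  | k, var j => j < k
  | _, one => True | _, bot => True | _, zero => True | _, top => True
  | k, tens A B => ClosedAt k A ∧ ClosedAt k B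
  | k, par A B => ClosedAt k A ∧ ClosedAt k B
  | k, plus A B => ClosedAt k A ∧ ClosedAt k B
  | k, wth A B => ClosedAt k A ∧ ClosedAt k B
  | k, quest _ A => ClosedAt k A
  | k, bang _ A => ClosedAt k A
  | k, mu A => ClosedAt (k + 1) A
  | k, nu A => ClosedAt (k + 1) A

/-- `F.IsSub G`: `F` is a subformula of `G` (used for closed `F` only). -/
inductive IsSub (F : Fm E) : Fm E → Prop
  | refl : IsSub F F
  | tensL {A B} : IsSub F A → IsSub F (tens A B)
  | tensR {A B} : IsSub F B → IsSub F (tens A B)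
  | parL {A B} : IsSub F A → IsSub F (par A B)
  | parR {A B} : IsSub F B → IsSub F (par A B)
  | plusL {A B} : IsSub F A → IsSub F (plus A B)
  | plusR {A B} : IsSub F B → IsSub F (plus A B)
  | wthL {A B} : IsSub F A → IsSub F (wth A B)
  | wthR {A B} : IsSub F B → IsSub F (wth A B)
  | quest {s A} : IsSub F A → IsSub F (quest s A)
  | bang {s A} : IsSub F A → IsSub F (bang s A)
  | mu {A} : IsSub F A → IsSub F (mu A)
  | nu {A} : IsSub F A → IsSub F (nu A)

/-- The translation of formulas: forget all signatures. -/
def tr : Fm E → Fm Unit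
  | atom a => atom a | natom a => natom a | var k => var k
  | one => one | bot => bot | zero => zero | top => top
  | tens A B => tens A.tr B.tr | par A B => par A.tr B.tr
  | plus A B => plus A.tr B.tr | wth A B => wth A.tr B.tr
  | quest _ A => quest () A.tr | bang _ A => bang () A.tr
  | mu A => mu A.tr | nu A => nu A.tr

/-- Remove an outermost `?`. -/
def unquest : Fm E → Fm E
  | quest _ A => A
  | A => A

end Fm

abbrev Seq (E : Type u) := List (Fm E)

/-- The parameters of the system: which multiplexings `?m_i` and contractions `?c_i` (`i ≥ 2`)
each signature allows, and the three relations governing the three promotions. -/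
structure Sig (E : Type u) where
  mpx : E → ℕ → Prop
  contr : E → ℕ → Prop
  leG : E → E → Prop
  leF : E → E → Prop
  leU : E → E → Prop

/-- Linear logic: one signature, with weakening `?m_0`, dereliction `?m_1`, contraction `?c_2`
and the usual promotion. -/
def LL : Sig Unit where
  mpx _ i := i = 0 ∨ i = 1
  contr _ i := i = 2
  leG _ _ := True
  leF _ _ := False
  leU _ _ := False

/-! ## Rules

Exchange is implicit: a rule acts on the formula at any position `p` of its conclusion, the
immediate subformulas replace the principal formula in place, and all other formulas keep their
order.  For `cut` and `tens` the list of Booleans tells which formulas of the conclusion go to the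
left premise.  A multicut carries its list of premises, the map `ι` (the list of the images
of the positions of the conclusion) and the cut relation `⫫` on positions of premises. -/

inductive Rule (E : Type u) : Type u
  | ax
  | cut (A : Fm E) (m : List Bool)
  | mcut (Δs : List (Seq E)) (iota : List (ℕ × ℕ)) (link : ℕ × ℕ → ℕ × ℕ → Prop)
  | one
  | top (p : ℕ)
  | bot (p : ℕ)
  | par (p : ℕ)
  | tens (p : ℕ) (m : List Bool)
  | plus (p : ℕ) (b : Bool)
  | wth (p : ℕ)
  | fix (p : ℕ)
  | mpx (p : ℕ) (i : ℕ)
  | contr (p : ℕ) (i : ℕ)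
  | promG (p : ℕ)
  | promF (p : ℕ)
  | promU (p : ℕ)

/-- A formula occurrence of a premise: the position of its immediate ancestor in the conclusion
(`none` for a cut formula), a tag telling apart the occurrences with the same ancestor, and the
formula. -/
structure Occ (E : Type u) where
  anc : Option ℕ
  tag : ℕ
  fm : Fm E

section Rules

variable {E : Type u}

/-- Replace the formula at position `p` by the list `L`. -/
def replaceAt (Γ : Seq E) (p : ℕ) (L : Seq E) : List (Occ E) :=
  Γ.zipIdx.flatMap fun x =>
    if x.2 = p then L.zipIdx.map fun y => ⟨some p, y.2, y.1⟩ else [⟨some x.2, 0, x.1⟩]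

/-- The part of `Γ` selected by `b` in the splitting `m`. -/
def side (Γ : Seq E) (m : List Bool) (b : Bool) : List (Occ E) :=
  Γ.zipIdx.filterMap fun x => if m[x.2]? = some b then some ⟨some x.2, 0, x.1⟩ else none

/-- As `side`, with the formula at position `p` replaced by `A` (with tag `t`). -/
def sideAt (Γ : Seq E) (m : List Bool) (b : Bool) (p : ℕ) (A : Fm E) (t : ℕ) : List (Occ E) :=
  Γ.zipIdx.filterMap fun x =>
    if x.2 = p then some ⟨some p, t, A⟩
    else if m[x.2]? = some b then some ⟨some x.2, 0, x.1⟩ else none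

namespace Rule

/-- Number of premises. -/
def arity : Rule E → ℕ
  | ax => 0 | one => 0 | top _ => 0
  | cut _ _ => 2 | tens _ _ => 2 | wth _ => 2
  | mcut Δs _ _ => Δs.length
  | _ => 1

/-- The premises of a rule with conclusion `Γ`. -/
def prems (Γ : Seq E) : Rule E → List (List (Occ E))
  | ax => [] | one => [] | top _ => []
  | cut A m => [⟨none, 0, A⟩ :: side Γ m true, ⟨none, 0, A.neg⟩ :: side Γ m false]
  | mcut Δs iota _ => Δs.zipIdx.map fun x =>
      x.1.zipIdx.map fun y => ⟨iota.idxOf? (x.2, y.2), 0, y.1⟩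
  | bot p => [replaceAt Γ p []]
  | par p => match Γ[p]? with
    | some (.par A B) => [replaceAt Γ p [A, B]]
    | _ => []
  | tens p m => match Γ[p]? with
    | some (.tens A B) => [sideAt Γ m true p A 0, sideAt Γ m false p B 1]
    | _ => []
  | plus p b => match Γ[p]? with
    | some (.plus A B) => [replaceAt Γ p [if b then B else A]]
    | _ => []
  | wth p => match Γ[p]? with
    | some (.wth A B) => [replaceAt Γ p [A], replaceAt Γ p [B]]
    | _ => []
  | fix p => match Γ[p]? with
    | some (.mu A) => [replaceAt Γ p [Fm.subst (.mu A) 0 A]]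
    | some (.nu A) => [replaceAt Γ p [Fm.subst (.nu A) 0 A]]
    | _ => []
  | mpx p i => match Γ[p]? with
    | some (.quest _ A) => [replaceAt Γ p (List.replicate i A)]
    | _ => []
  | contr p i => match Γ[p]? with
    | some (.quest s A) => [replaceAt Γ p (List.replicate i (.quest s A))]
    | _ => []
  | promG p => match Γ[p]? with
    | some (.bang _ A) => [replaceAt Γ p [A]]
    | _ => []
  | promF p => match Γ[p]? with
    | some (.bang _ A) => [(replaceAt Γ p [A]).map fun o =>
        if o.anc = some p then o else { o with fm := o.fm.unquest }]
    | _ => []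
  | promU p => match Γ[p]? with
    | some (.bang _ A) => [(replaceAt Γ p [A]).map fun o =>
        if o.anc = some p then o else { o with fm := o.fm.unquest }]
    | _ => []

/-- The sequent of the first premise. -/
def prem0 (Γ : Seq E) (r : Rule E) : Seq E := ((r.prems Γ)[0]?.getD []).map Occ.fm

/-- Position of the principal formula, for the rules that commute with a multicut without any
condition on the other premises and without splitting the context. -/
def localPos : Rule E → Option ℕ
  | top p => some p | bot p => some p | par p => some p | plus p _ => some p
  | wth p => some p | fix p => some p | mpx p _ => some p | contr p _ => some p
  | _ => none

/-- The same rule acting on position `q`. -/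
def setPos (q : ℕ) : Rule E → Rule E
  | top _ => top q | bot _ => bot q | par _ => par q | tens _ m => tens q m
  | plus _ b => plus q b | wth _ => wth q | fix _ => fix q
  | mpx _ i => mpx q i | contr _ i => contr q i
  | promG _ => promG q | promF _ => promF q | promU _ => promU q
  | r => r

/-- Position of the principal formula of a promotion. -/
def promPos : Rule E → Option ℕ
  | promG p => some p | promF p => some p | promU p => some p
  | _ => none

def IsProm (r : Rule E) : Prop := ∃ p, r.promPos = some p
def IsG (r : Rule E) : Prop := ∃ p, r = promG p
def IsF (r : Rule E) : Prop := ∃ p, r = promF p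
def IsU (r : Rule E) : Prop := ∃ p, r = promU p
def IsMcutRule (r : Rule E) : Prop := ∃ Δs iota link, r = mcut Δs iota link

end Rule

/-- The formula at position `x.2` of the premise number `x.1`. -/
def fmAt (Δs : List (Seq E)) (x : ℕ × ℕ) : Option (Fm E) := (Δs[x.1]?).bind (·[x.2]?)

/-- The graph on the premises of a multicut induced by the cut relation. -/
def mcutGraph (n : ℕ) (link : ℕ × ℕ → ℕ × ℕ → Prop) : SimpleGraph (Fin n) where
  Adj i i' := i ≠ i' ∧ ∃ j j', link (i, j) (i', j') ∨ link (i', j') (i, j)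
  symm := ⟨fun _ _ h => ⟨h.1.symm, by
    obtain ⟨j, j', h⟩ := h.2
    exact ⟨j', j, h.symm⟩⟩⟩
  loopless := ⟨fun _ h => h.1 rfl⟩

/-- The conditions on a multicut. Acyclicity excludes cuts inside one premise, and two cuts
between the same two premises. -/
structure McutOk (Γ : Seq E) (Δs : List (Seq E)) (iota : List (ℕ × ℕ))
    (link : ℕ × ℕ → ℕ × ℕ → Prop) : Prop where
  iota_fm : iota.map (fmAt Δs) = Γ.map some
  iota_inj : iota.Nodup
  link_dom : ∀ x y : ℕ × ℕ, link x y → (fmAt Δs x).isSome ∧ x ∉ iota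
  link_total : ∀ x, (fmAt Δs x).isSome → x ∉ iota → ∃ y, link x y
  link_symm : ∀ x y : ℕ × ℕ, link x y → link y x
  link_unique : ∀ x y y', link x y → link x y' → y = y'
  link_dual : ∀ x y : ℕ × ℕ, link x y → fmAt Δs x = (fmAt Δs y).map Fm.neg
  no_loop : ∀ x y : ℕ × ℕ, link x y → x.1 ≠ y.1
  no_double : ∀ x y x' y', link x y → link x' y' → x.1 = x'.1 → y.1 = y'.1 → x = x'
  tree : (mcutGraph Δs.length link).IsTree

/-- The side conditions of the rules. -/
def Rule.Ok (S : Sig E) (Γ : Seq E) : Rule E → Prop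
  | .ax => ∃ A, Γ = [A, A.neg]
  | .cut _ m => m.length = Γ.length
  | .mcut Δs iota link => McutOk Γ Δs iota link
  | .one => Γ = [.one]
  | .top p => Γ[p]? = some .top
  | .bot p => Γ[p]? = some .bot
  | .par p => ∃ A B, Γ[p]? = some (.par A B)
  | .tens p m => (∃ A B, Γ[p]? = some (.tens A B)) ∧ m.length = Γ.length ∧ m[p]? = some true
  | .plus p _ => ∃ A B, Γ[p]? = some (.plus A B)
  | .wth p => ∃ A B, Γ[p]? = some (.wth A B)
  | .fix p => ∃ A, Γ[p]? = some (.mu A) ∨ Γ[p]? = some (.nu A)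
  | .mpx p i => ∃ s A, Γ[p]? = some (.quest s A) ∧ S.mpx s i
  | .contr p i => 2 ≤ i ∧ ∃ s A, Γ[p]? = some (.quest s A) ∧ S.contr s i
  | .promG p => ∃ s A, Γ[p]? = some (.bang s A) ∧
      ∀ k F, k ≠ p → Γ[k]? = some F → ∃ t B, F = .quest t B ∧ S.leG s t
  | .promF p => ∃ s A, Γ[p]? = some (.bang s A) ∧
      ∀ k F, k ≠ p → Γ[k]? = some F → ∃ t B, F = .quest t B ∧ S.leF s t
  | .promU p => Γ.length = 2 ∧ ∃ s A, Γ[p]? = some (.bang s A) ∧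
      ∀ k F, k ≠ p → Γ[k]? = some F → ∃ t B, F = .quest t B ∧ S.leU s t

end Rules

/-! ## Non-wellfounded derivation trees -/

/-- The shape of derivation trees: a node is labelled by its conclusion and its rule. -/
abbrev pf (E : Type u) : PFunctor.{u, 0} := ⟨Seq E × Rule E, fun x => Fin x.2.arity⟩

/-- Possibly infinite trees of rules (coinductively). -/
abbrev Pf (E : Type u) := (pf E).M

namespace Pf

variable {E : Type u}

def concl (π : Pf E) : Seq E := (PFunctor.M.dest π).1.1

def rule (π : Pf E) : Rule E := (PFunctor.M.dest π).1.2

/-- The `k`-th immediate subtree. -/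
def child (π : Pf E) (k : ℕ) : Option (Pf E) :=
  if h : k < (PFunctor.M.dest π).1.2.arity then some ((PFunctor.M.dest π).2 ⟨k, h⟩) else none

/-- The `k`-th immediate subtree, with a dummy value if there is none. -/
def kid (π : Pf E) (k : ℕ) : Pf E := (π.child k).getD π

/-- The occurrences of the `k`-th premise. -/
def occs (π : Pf E) (k : ℕ) : List (Occ E) := (π.rule.prems π.concl)[k]?.getD []

/-- The subtree at an address. -/
def sub : Pf E → List ℕ → Option (Pf E)
  | π, [] => some π
  | π, k :: a => (π.child k).bind fun ρ => sub ρ a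

/-- The root of `π` has conclusion `Γ`, rule `r` and immediate subtrees `cs`. -/
def IsNode (π : Pf E) (Γ : Seq E) (r : Rule E) (cs : List (Pf E)) : Prop :=
  π.concl = Γ ∧ π.rule = r ∧ ∀ k, π.child k = cs[k]?

/-- The root of `π` is a correct instance of a rule, on closed formulas. -/
def LocalOk (S : Sig E) (π : Pf E) : Prop :=
  (∀ A ∈ π.concl, A.ClosedAt 0) ∧ π.rule.Ok S π.concl ∧
    ∀ k ρ, π.child k = some ρ → ρ.concl = (π.occs k).map Occ.fm

/-- Pre-proofs: every node is correct. -/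
def IsPreproof (S : Sig E) (π : Pf E) : Prop := ∀ a ρ, π.sub a = some ρ → ρ.LocalOk S

/-- `f`, `k` is an infinite branch of `π`: the successive subtrees and the premises chosen. -/
def IsBranch (π : Pf E) (f : ℕ → Pf E) (k : ℕ → ℕ) : Prop :=
  f 0 = π ∧ ∀ i, (f i).child (k i) = some (f (i + 1))

/-- The branch carries, from some point on, a thread `t` which unfolds a greatest fixed point
`νX.A` infinitely often, all formulas of the thread having `νX.A` as a subformula; since only
finitely many formulas occur on a thread, this means that the least formula occurring infinitely
often on it is a `ν`-formula. -/
def ValidBranch (f : ℕ → Pf E) (k : ℕ → ℕ) : Prop :=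
  ∃ (N : ℕ) (t : ℕ → ℕ) (A : Fm E),
    (∀ i, N ≤ i → ∃ o, ((f i).occs (k i))[t (i + 1)]? = some o ∧ o.anc = some (t i)) ∧
    (∀ i, N ≤ i → ∃ F, (f i).concl[t i]? = some F ∧ (Fm.nu A).IsSub F) ∧
    (∀ M, ∃ i, M ≤ i ∧ (f i).rule = .fix (t i) ∧ (f i).concl[t i]? = some (.nu A))

/-- Proofs: pre-proofs all of whose infinite branches are valid. -/
def IsProof (S : Sig E) (π : Pf E) : Prop :=
  π.IsPreproof S ∧ ∀ f k, π.IsBranch f k → ValidBranch f k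

/-- Pre-proofs of linear logic with fixed points: the only promotion is the usual one. -/
def IsLLPreproof (π : Pf Unit) : Prop :=
  π.IsPreproof LL ∧ ∀ a ρ, π.sub a = some ρ → ¬ ρ.rule.IsF ∧ ¬ ρ.rule.IsU

/-- Proofs of linear logic with fixed points. -/
def IsLLProof (π : Pf Unit) : Prop :=
  π.IsLLPreproof ∧ ∀ f k, π.IsBranch f k → ValidBranch f k

/-- `π'` is `π` with the subtree at address `a` rewritten along `R`. -/
inductive At (R : Pf E → Pf E → Prop) : List ℕ → Pf E → Pf E → Prop
  | here {π π'} : R π π' → At R [] π π'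
  | child {k a π π' ρ ρ'} : π'.concl = π.concl → π'.rule = π.rule →
      π.child k = some ρ → π'.child k = some ρ' →
      (∀ l, l ≠ k → π'.child l = π.child l) → At R a ρ ρ' → At R (k :: a) π π'

/-- `π` ends with the unary rules `rs` (from bottom to top) below `ρ`; its conclusion is `Γ`. -/
def Chain : Seq E → List (Rule E) → Pf E → Pf E → Prop
  | _, [], π, ρ => π = ρ
  | Γ, r :: rs, π, ρ => ∃ π', π.IsNode Γ r [π'] ∧ Chain (r.prem0 Γ) rs π' ρ

end Pf

/-- The rules `?m_1` on all formulas but the one at position `p` of a sequent of length `n`. -/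
def derelictions {E : Type u} (p n : ℕ) : List (Rule E) :=
  ((List.range n).filter (· ≠ p)).map fun k => .mpx k 1

/-! ## The translation into linear logic -/

section Translation

variable {E : Type u}

/-- The translation of a rule with conclusion `Γ`: a list of rules, from bottom to top, all unary
but possibly the last.
`?m_0` is a weakening, `?m_i` is `i - 1` contractions and `i` derelictions, `?c_i` is `i - 1`
contractions, `!_g` is a promotion, `!_f` and `!_u` are a promotion and derelictions. -/
def Rule.tr (Γ : Seq E) : Rule E → List (Rule Unit)
  | .ax => [.ax]
  | .cut A m => [.cut A.tr m]
  | .mcut Δs iota link => [.mcut (Δs.map (List.map Fm.tr)) iota link]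
  | .one => [.one]
  | .top p => [.top p]
  | .bot p => [.bot p]
  | .par p => [.par p]
  | .tens p m => [.tens p m]
  | .plus p b => [.plus p b]
  | .wth p => [.wth p]
  | .fix p => [.fix p]
  | .mpx p 0 => [.mpx p 0]
  | .mpx p (i + 1) => ((List.range i).map fun k => .contr (p + k) 2) ++
      (List.range (i + 1)).map fun k => .mpx (p + k) 1
  | .contr p 0 => [.contr p 0]
  | .contr p 1 => [.contr p 1]
  | .contr p (i + 2) => (List.range (i + 1)).map fun k => .contr (p + k) 2
  | .promG p => [.promG p]
  | .promF p => .promG p :: derelictions p Γ.length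
  | .promU p => .promG p :: derelictions p Γ.length

/-- One layer of the translation. A state consists of the conclusion of the node to be produced,
the rules still to be put on top of it (none: start with the rules translating the root of
`π`), and the tree `π` being translated. -/
def trStep (s : Seq Unit × List (Rule Unit) × Pf E) :
    (pf Unit) (Seq Unit × List (Rule Unit) × Pf E) :=
  match (if s.2.1 = [] then s.2.2.rule.tr s.2.2.concl else s.2.1) with
  | [] => ⟨(s.1, .ax), fun _ => s⟩
  | [r] => ⟨(s.1, r), fun k =>
      ((s.2.2.kid k.val).concl.map Fm.tr, [], s.2.2.kid k.val)⟩
  | r :: r' :: rs => ⟨(s.1, r), fun _ => (r.prem0 s.1, r' :: rs, s.2.2)⟩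

/-- The translation of derivation trees. -/
noncomputable def Pf.tr (π : Pf E) : Pf Unit :=
  PFunctor.M.corec trStep (π.concl.map Fm.tr, [], π)

end Translation

/-! ## Multicut reduction

The wiring of a multicut is described by naming the formula occurrences of its conclusion and of
its premises: two occurrences get the same name iff they are related by `ι` or by `⫫`.
A reduction replaces premises by their own premises or by copies; a new occurrence coming from
the occurrence named `a` is named `(some a, t)`, where `t` is its tag, so that the
wiring of the reduct is again given by equality of names. -/

section Reduction

variable {E : Type u}

/-- A premise of a multicut: its names and its proof. -/
abbrev Prem (N : Type) (E : Type u) := List N × Pf E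

abbrev Name' := Option ℕ × ℕ

/-- `π` ends with a multicut with conclusion `Γ`, named by `nc`, and with the (unordered) premises
`P`. -/
def IsMcut {N : Type} (Γ : Seq E) (nc : List N) (P : Multiset (Prem N E)) (π : Pf E) : Prop :=
  ∃ (L : List (Prem N E)) (iota : List (ℕ × ℕ)) (link : ℕ × ℕ → ℕ × ℕ → Prop),
    (L : Multiset (Prem N E)) = P ∧
    π.IsNode Γ (.mcut (L.map fun x => x.2.concl) iota link) (L.map Prod.snd) ∧
    nc.length = Γ.length ∧ (∀ x ∈ L, x.1.length = x.2.concl.length) ∧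
    (∀ (k : ℕ) (x : ℕ × ℕ), iota[k]? = some x ↔
      ∃ a, nc[k]? = some a ∧ (L[x.1]?).bind (fun y => y.1[x.2]?) = some a) ∧
    (∀ x y : ℕ × ℕ, link x y ↔ x ≠ y ∧
      ∃ a, (L[x.1]?).bind (fun z => z.1[x.2]?) = some a ∧
        (L[y.1]?).bind (fun z => z.1[y.2]?) = some a)

/-- The names of the occurrences of a premise, from the names `n` of the conclusion. -/
def up (n : List ℕ) (O : List (Occ E)) : List Name' :=
  O.map fun o => (o.anc.bind fun q => n[q]?, o.tag)

/-- An unchanged premise; `t` is the number of the copy. -/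
def keep (t : ℕ) (x : Prem ℕ E) : Prem Name' E := (x.1.map fun a => (some a, t), x.2)

/-- The `k`-th premise of the last rule of `x`. -/
def openAt (x : Prem ℕ E) (k : ℕ) : Prem Name' E := (up x.1 (x.2.occs k), x.2.kid k)

/-- The premise of the promotion ending `x`; `t` is the number of the copy. -/
def openCopy (t : ℕ) (x : Prem ℕ E) : Prem Name' E :=
  ((x.2.occs 0).map fun o => (o.anc.bind fun q => x.1[q]?, t), x.2.kid 0)

/-- `y` is the premise of the functorial promotion ending `x`, followed by rules `?m_1` on all
formulas but the principal one. -/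
def DerelictedPremise (x : Prem ℕ E) (y : Prem Name' E) : Prop :=
  ∃ p, x.2.rule = .promF p ∧ y.1 = x.1.map (fun a => (some a, 0)) ∧
    Pf.Chain (Rule.prem0 x.2.concl (.promG p)) (derelictions p x.2.concl.length) y.2 (x.2.kid 0)

/-- All the names occurring in some premises. -/
def names (P : Multiset (Prem ℕ E)) : Set ℕ := {a | ∃ x ∈ P, a ∈ x.1}

def AllProm (P : Multiset (Prem ℕ E)) : Prop := ∀ x ∈ P, x.2.rule.IsProm

/-- All `!_g`-promotions in `P` have an empty context. -/
def GEmpty (P : Multiset (Prem ℕ E)) : Prop :=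
  ∀ x ∈ P, x.2.rule.IsG → x.2.concl.length = 1

/-- The premises in `P` are cut-connected. -/
def CutConnected (P : Multiset (Prem ℕ E)) : Prop :=
  ∀ x ∈ P, ∀ y ∈ P,
    Relation.ReflTransGen (fun x y : Prem ℕ E => y ∈ P ∧ ∃ a ∈ x.1, a ∈ y.1) x y

/-- The name of the principal formula of the promotion ending `x`. -/
def promName (x : Prem ℕ E) : Option ℕ := x.2.rule.promPos.bind fun p => x.1[p]?

/-- The promotion ending `x` is cut, on its principal formula, with another element of `P`. -/
def CutInto (x : Prem ℕ E) (P : Multiset (Prem ℕ E)) : Prop :=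
  ∃ a, promName x = some a ∧ ∃ y ∈ P, y ≠ x ∧ a ∈ y.1

/-- `Duel r p ks r' q ks'`: the rules `r` on position `p` and `r'` on position `q` form a key case,
keeping the premises `ks` of `r` and `ks'` of `r'`. -/
inductive Duel : Rule E → ℕ → List ℕ → Rule E → ℕ → List ℕ → Prop
  | par_tens (p q m) : Duel (.par p) p [0] (.tens q m) q [0, 1]
  | plus_wth (p b q) : Duel (.plus p b) p [0] (.wth q) q [if b then 1 else 0]
  | fix_fix (p q) : Duel (.fix p) p [0] (.fix q) q [0]
  | one_bot (q) : Duel .one 0 [] (.bot q) q [0]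

/-- Reductions of multicuts whose conclusion `Γ` is named by `nc` and whose premises are `P`, for
the non-exponential rules, together with the commutations of `?m_i` and `?c_i` and that of `!_g`,
which have the same shape in both systems. -/
inductive BaseRed (Γ : Seq E) (nc : List ℕ) : Multiset (Prem ℕ E) → Pf E → Prop
  | ax_comm {x π'} : x.2.rule = .ax → π'.IsNode Γ .ax [] → BaseRed Γ nc {x} π'
  | one_comm {x π'} : x.2.rule = .one → π'.IsNode Γ .one [] → BaseRed Γ nc {x} π'
  | comm {x C p q a π' cs} : x.2.rule.localPos = some p → x.1[p]? = some a → nc[q]? = some a →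
      π'.IsNode Γ (x.2.rule.setPos q) cs →
      (∀ k ρ, cs[k]? = some ρ →
        IsMcut (((((x.2.rule.setPos q).prems Γ)[k]?).getD []).map Occ.fm)
          (up nc ((((x.2.rule.setPos q).prems Γ)[k]?).getD []))
          (openAt x k ::ₘ C.map (keep 0)) ρ) →
      BaseRed Γ nc (x ::ₘ C) π'
  | tens_comm {x C₁ C₂ p m q m' a π' ρ₁ ρ₂} : x.2.rule = .tens p m →
      x.1[p]? = some a → nc[q]? = some a →
      π'.IsNode Γ (.tens q m') [ρ₁, ρ₂] →
      IsMcut (((((Rule.tens q m').prems Γ)[0]?).getD []).map Occ.fm)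
        (up nc ((((Rule.tens q m').prems Γ)[0]?).getD []))
        (openAt x 0 ::ₘ C₁.map (keep 0)) ρ₁ →
      IsMcut (((((Rule.tens q m').prems Γ)[1]?).getD []).map Occ.fm)
        (up nc ((((Rule.tens q m').prems Γ)[1]?).getD []))
        (openAt x 1 ::ₘ C₂.map (keep 0)) ρ₂ →
      BaseRed Γ nc (x ::ₘ (C₁ + C₂)) π'
  | promG_comm {x C p q a π' ρ} : x.2.rule = .promG p → x.1[p]? = some a → nc[q]? = some a →
      AllProm C → π'.IsNode Γ (.promG q) [ρ] →
      IsMcut ((Rule.promG q).prem0 Γ) (nc.map fun b => (some b, 0))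
        (openAt x 0 ::ₘ C.map (keep 0)) ρ →
      BaseRed Γ nc (x ::ₘ C) π'
  | ax_princ {x C a b π'} : x.2.rule = .ax → x.1 = [a, b] → C ≠ 0 →
      IsMcut Γ (nc.map fun d => if d = a then b else d)
        (C.map fun y => (y.1.map fun d => if d = a then b else d, y.2)) π' →
      BaseRed Γ nc (x ::ₘ C) π'
  | cut_princ {x C A m π'} : x.2.rule = .cut A m →
      IsMcut Γ (nc.map fun b => ((some b, 0) : Name'))
        (openAt x 0 ::ₘ openAt x 1 ::ₘ C.map (keep 0)) π' →
      BaseRed Γ nc (x ::ₘ C) π'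
  | princ {x y C p ks q ks' a π'} : Duel x.2.rule p ks y.2.rule q ks' →
      x.1[p]? = some a → y.1[q]? = some a →
      IsMcut Γ (nc.map fun b => ((some b, 0) : Name'))
        (((ks.map (openAt x) ++ ks'.map (openAt y) : List (Prem Name' E)) : Multiset (Prem Name' E)) +
          C.map (keep 0)) π' →
      BaseRed Γ nc (x ::ₘ y ::ₘ C) π'

/-! ### Derived structural rules

Each formula of a sequent `Γ` is expanded into a block: `true` stands for the formula itself, and
`false` for the formula without its outermost `?`. -/

/-- The sequent obtained from `Γ` by expanding its formulas into the blocks `st`. -/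
def blockSeq (Γ : Seq E) (st : List (List Bool)) : Seq E :=
  (List.zipWith (fun A b => b.map fun e => if e then A else A.unquest) Γ st).flatten

/-- The structural rule acting on one element of a block, and its effect.
Weakening may only be applied to a whole block. -/
inductive BlockOp (S : Sig E) (s : E) (left right : List Bool) (p : ℕ) :
    Rule E → List Bool → Prop
  | contr {i} : 2 ≤ i → S.contr s i → BlockOp S s left right p (.contr p i) (.replicate i true)
  | mpx {i} : S.mpx s i → (i = 0 → left = [] ∧ right = []) →
      BlockOp S s left right p (.mpx p i) (.replicate i false)

/-- `StructDer S g Γ st π fin ρ`: `π` is a derivation with conclusion `blockSeq Γ st`, made of rules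
`?m_i`, `?c_i` of the system, above which stands `ρ` with conclusion `blockSeq Γ fin`.
If `g` is `false`, each block is only expanded at its last element, but for rules `?m_1`. -/
inductive StructDer (S : Sig E) (g : Bool) (Γ : Seq E) :
    List (List Bool) → Pf E → List (List Bool) → Pf E → Prop
  | refl {st ρ} : StructDer S g Γ st ρ st ρ
  | step {pre left right post s A r new π π' fin ρ} :
      Γ[pre.length]? = some (.quest s A) →
      BlockOp S s left right (pre.flatten.length + left.length) r new →
      (g = true ∨ right = [] ∨ ∃ p, r = .mpx p 1) →
      π.IsNode (blockSeq Γ (pre ++ (left ++ true :: right) :: post)) r [π'] →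
      StructDer S g Γ (pre ++ (left ++ new ++ right) :: post) π' fin ρ →
      StructDer S g Γ (pre ++ (left ++ true :: right) :: post) π fin ρ

/-- The principal reduction of `?c_i`. The premises `C`, all ending with promotions, are those
cut-connected to the contracted formula; they are duplicated. -/
def ContrPrinc (S : Sig E) (g : Bool) (Γ : Seq E) (nc : List ℕ) (P : Multiset (Prem ℕ E))
    (π' : Pf E) : Prop :=
  ∃ (x : Prem ℕ E) (D C : Multiset (Prem ℕ E)) (p i a : ℕ) (nc' : List Name')
    (fin : List (List Bool)) (ρ : Pf E),
    P = x ::ₘ (D + C) ∧ x.2.rule = .contr p i ∧ x.1[p]? = some a ∧ AllProm C ∧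
    a ∈ names C ∧ a ∉ nc ∧ (∀ b ∈ names C, b ∈ names (x ::ₘ D) → b = a) ∧
    fin.length = nc.length ∧
    (∀ (k b : ℕ), nc[k]? = some b →
      (b ∈ names C → fin[k]? = some (List.replicate i true)) ∧ (b ∉ names C → fin[k]? = some [true])) ∧
    nc' = (List.zipWith (fun b bl => (List.range (List.length bl)).map fun t => ((some b, t) : Name'))
      nc fin).flatten ∧
    StructDer S g Γ (nc.map fun _ => [true]) π' fin ρ ∧
    IsMcut (blockSeq Γ fin) nc'
      (openAt x 0 ::ₘ (D.map (keep 0) + ∑ t ∈ Finset.range i, C.map (keep t))) ρ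

/-- The principal reduction of `?m_i`. The premises cut-connected to its principal formula all end
with promotions, and form a tree. Going up from its root, `M` consists of the `!_f` and `!_u`
promotions that are reached without crossing a `!_g`, `G` of the first `!_g` met, and `T` of what is
beyond these: `M` and `G` are opened, all are duplicated. -/
def MpxPrinc (S : Sig E) (g : Bool) (i : ℕ) (Γ : Seq E) (nc : List ℕ) (P : Multiset (Prem ℕ E))
    (π' : Pf E) : Prop :=
  ∃ (x : Prem ℕ E) (D M G T : Multiset (Prem ℕ E)) (p a : ℕ) (nc' : List Name')
    (fin : List (List Bool)) (ρ : Pf E),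
    P = x ::ₘ (D + (M + G + T)) ∧ x.2.rule = .mpx p i ∧ x.1[p]? = some a ∧
    (∀ y ∈ M, y.2.rule.IsF ∨ y.2.rule.IsU) ∧ (∀ y ∈ G, y.2.rule.IsG) ∧ AllProm T ∧
    a ∈ names (M + G + T) ∧ a ∉ nc ∧
    (∀ b ∈ names (M + G + T), b ∈ names (x ::ₘ D) → b = a) ∧
    (∀ y ∈ M + G, promName y = some a ∨ CutInto y M) ∧ (∀ y ∈ T, CutInto y (G + T)) ∧
    fin.length = nc.length ∧
    (∀ (k b : ℕ), nc[k]? = some b →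
      (b ∈ names M → fin[k]? = some (List.replicate i false)) ∧
      (b ∈ names (G + T) → fin[k]? = some (List.replicate i true)) ∧
      (b ∉ names (M + G + T) → fin[k]? = some [true])) ∧
    nc' = (List.zipWith (fun b bl => (List.range (List.length bl)).map fun t => ((some b, t) : Name'))
      nc fin).flatten ∧
    StructDer S g Γ (nc.map fun _ => [true]) π' fin ρ ∧
    IsMcut (blockSeq Γ fin) nc'
      (openAt x 0 ::ₘ (D.map (keep 0) + ∑ t ∈ Finset.range i,
        ((M + G).map (openCopy t) + T.map (keep t)))) ρ

/-- The commutations of `!_f` and `!_u`. -/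
inductive PromRed (Γ : Seq E) (nc : List ℕ) : Multiset (Prem ℕ E) → Pf E → Prop
  | f1 {x C p q a π' ρ} : x.2.rule = .promF p → x.1[p]? = some a → nc[q]? = some a →
      AllProm C → GEmpty C → π'.IsNode Γ (.promF q) [ρ] →
      IsMcut ((Rule.promF q).prem0 Γ) (nc.map fun b => (some b, 0))
        ((x ::ₘ C).map (openAt · 0)) ρ →
      PromRed Γ nc (x ::ₘ C) π'
  | f2 {x y C p q a π' ρ} : x.2.rule = .promF p → x.1[p]? = some a → nc[q]? = some a →
      AllProm C → ¬ GEmpty C → π'.IsNode Γ (.promG q) [ρ] → DerelictedPremise x y →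
      IsMcut ((Rule.promG q).prem0 Γ) (nc.map fun b => (some b, 0))
        (y ::ₘ C.map (keep 0)) ρ →
      PromRed Γ nc (x ::ₘ C) π'
  | u1 {x C p q a π' ρ} : x.2.rule = .promU p → x.1[p]? = some a → nc[q]? = some a →
      (∀ z ∈ C, z.2.rule.IsU) → π'.IsNode Γ (.promU q) [ρ] →
      IsMcut ((Rule.promU q).prem0 Γ) (nc.map fun b => (some b, 0))
        ((x ::ₘ C).map (openAt · 0)) ρ →
      PromRed Γ nc (x ::ₘ C) π'
  | u2 {x C p q a π' ρ} : x.2.rule = .promU p → x.1[p]? = some a → nc[q]? = some a →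
      AllProm C → (∃ z ∈ C, z.2.rule.IsF) → GEmpty C → π'.IsNode Γ (.promF q) [ρ] →
      IsMcut ((Rule.promF q).prem0 Γ) (nc.map fun b => (some b, 0))
        ((x ::ₘ C).map (openAt · 0)) ρ →
      PromRed Γ nc (x ::ₘ C) π'
  | u3 {x C₁ z z' C₂ p q a π' ρ} : x.2.rule = .promU p → x.1[p]? = some a → nc[q]? = some a →
      (∀ w ∈ C₁, w.2.rule.IsU) → DerelictedPremise z z' → AllProm C₂ → ¬ GEmpty C₂ →
      CutConnected (x ::ₘ z ::ₘ C₁) → CutConnected (z ::ₘ C₂) →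
      π'.IsNode Γ (.promG q) [ρ] →
      IsMcut ((Rule.promG q).prem0 Γ) (nc.map fun b => (some b, 0))
        ((x ::ₘ C₁).map (openAt · 0) + z' ::ₘ C₂.map (keep 0)) ρ →
      PromRed Γ nc (x ::ₘ (C₁ + z ::ₘ C₂)) π'
  | u4 {x C₁ z C₂ p q a π' ρ} : x.2.rule = .promU p → x.1[p]? = some a → nc[q]? = some a →
      (∀ w ∈ C₁, w.2.rule.IsU) → z.2.rule.IsG → AllProm C₂ →
      CutConnected (x ::ₘ z ::ₘ C₁) → CutConnected (z ::ₘ C₂) →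
      π'.IsNode Γ (.promG q) [ρ] →
      IsMcut ((Rule.promG q).prem0 Γ) (nc.map fun b => (some b, 0))
        ((x ::ₘ z ::ₘ C₁).map (openAt · 0) + C₂.map (keep 0)) ρ →
      PromRed Γ nc (x ::ₘ (C₁ + z ::ₘ C₂)) π'

/-- One step of multicut reduction at the root, with super exponentials. -/
def SuperRed (S : Sig E) (g : Bool) (π π' : Pf E) : Prop :=
  ∃ Γ nc P, IsMcut Γ nc P π ∧
    (BaseRed Γ nc P π' ∨ PromRed Γ nc P π' ∨ ContrPrinc S g Γ nc P π' ∨ ∃ i, MpxPrinc S g i Γ nc P π')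

/-- The key case of a dereliction against a promotion. -/
def DerPrinc (Γ : Seq E) (nc : List ℕ) (P : Multiset (Prem ℕ E)) (π' : Pf E) : Prop :=
  ∃ (x y : Prem ℕ E) (C : Multiset (Prem ℕ E)) (p q a : ℕ), P = x ::ₘ y ::ₘ C ∧
    x.2.rule = .mpx p 1 ∧ y.2.rule = .promG q ∧ x.1[p]? = some a ∧ y.1[q]? = some a ∧
    IsMcut Γ (nc.map fun b => ((some b, 0) : Name'))
      (openAt x 0 ::ₘ openAt y 0 ::ₘ C.map (keep 0)) π'

/-- One step of multicut reduction at the root, in linear logic with fixed points: the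
non-exponential steps, the commutations of weakening, dereliction, contraction and promotion, and
the key cases of contraction, weakening and dereliction. -/
def LLRed (π π' : Pf Unit) : Prop :=
  ∃ Γ nc P, IsMcut Γ nc P π ∧
    (BaseRed Γ nc P π' ∨ ContrPrinc LL false Γ nc P π' ∨ MpxPrinc LL false 0 Γ nc P π' ∨
      DerPrinc Γ nc P π')

/-- One step of multicut reduction between pre-proofs, at any place. -/
def SuperStep (S : Sig E) (g : Bool) (π π' : Pf E) : Prop :=
  π.IsPreproof S ∧ π'.IsPreproof S ∧ ∃ a, Pf.At (SuperRed S g) a π π'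

def LLStep (π π' : Pf Unit) : Prop :=
  π.IsLLPreproof ∧ π'.IsLLPreproof ∧ ∃ a, Pf.At LLRed a π π'

end Reduction

/-! ## Rule permutations -/

/-- Weakening, dereliction and contraction: the position of the principal formula, and the number
of formulas which replace it. -/
def Rule.structural : Rule Unit → Option (ℕ × ℕ)
  | .mpx p 0 => some (p, 0)
  | .mpx p 1 => some (p, 1)
  | .contr p 2 => some (p, 2)
  | _ => none

/-- `Swap g r₁ r₂ r₁' r₂'`: the rules `r₁` (below) and `r₂` (above) can be permuted into `r₁'`
(below) and `r₂'` (above). Two of the rules weakening, dereliction and contraction can be permuted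
when they act on distinct formulas of the conclusion; if `g` is `true`, then also two
contractions of three occurrences of a formula can be re-associated. -/
inductive Swap (g : Bool) : Rule Unit → Rule Unit → Rule Unit → Rule Unit → Prop
  | right {r₁ r₂ p k q l} : r₁.structural = some (p, k) → r₂.structural = some (q, l) →
      p + k ≤ q → Swap g r₁ r₂ (r₂.setPos (q + 1 - k)) r₁
  | left {r₁ r₂ p k q l} : r₁.structural = some (p, k) → r₂.structural = some (q, l) →
      q < p → Swap g r₁ r₂ r₂ (r₁.setPos (p + l - 1))
  | assoc_right {p} : g = true →
      Swap g (.contr p 2) (.contr p 2) (.contr p 2) (.contr (p + 1) 2)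
  | assoc_left {p} : g = true →
      Swap g (.contr p 2) (.contr (p + 1) 2) (.contr p 2) (.contr p 2)

/-- Only weakenings, derelictions and contractions stand between the root and a multicut. -/
inductive McutAbove : Pf Unit → Prop
  | mcut {π} : π.rule.IsMcutRule → McutAbove π
  | step {π ρ} : π.rule.structural.isSome → π.child 0 = some ρ → McutAbove ρ → McutAbove π

/-- Permutation of the last two rules, which stand below a multicut. -/
def PermRoot (g : Bool) (π π' : Pf Unit) : Prop :=
  ∃ Γ r₁ r₂ r₁' r₂' ρ, Swap g r₁ r₂ r₁' r₂' ∧ Pf.Chain Γ [r₁, r₂] π ρ ∧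
    Pf.Chain Γ [r₁', r₂'] π' ρ ∧ McutAbove ρ

/-- One permutation of rules of `θ` standing in the zone which, in `π`, was occupied by a multicut or
by what is above it, and which in `θ` is below the multicuts: these are rules that
have moved below a multicut on the way from `π` to `θ`. -/
def PermMoved (g : Bool) (π θ θ' : Pf Unit) : Prop :=
  ∃ (b d : List ℕ) (μ : Pf Unit), π.sub b = some μ ∧ μ.rule.IsMcutRule ∧
    (∀ e, e <+: d → ∀ ρ, θ.sub (b ++ e) = some ρ → ¬ ρ.rule.IsMcutRule) ∧
    Pf.At (PermRoot g) (b ++ d) θ θ'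

end SuperLL

set_option linter.unusedVariables false
namespace SuperLL
universe u
open Relation

namespace Pf
variable {E : Type u}

/-- The tree with conclusion `Γ`, last rule `r` and immediate subtrees given by `f`. -/
def mkN (Γ : Seq E) (r : Rule E) (f : ℕ → Pf E) : Pf E := PFunctor.M.mk ⟨(Γ, r), fun k => f k.val⟩

theorem child_mkN (Γ : Seq E) (r : Rule E) (f : ℕ → Pf E) (k : ℕ) :
    (mkN Γ r f).child k = if k < r.arity then some (f k) else none := by
  have : PFunctor.M.dest (mkN Γ r f) = ⟨(Γ, r), fun k => f k.val⟩ := PFunctor.M.dest_mk _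
  unfold child; rw [this]
  simp only [dite_eq_ite]

theorem child_eq_none_iff {π : Pf E} {k : ℕ} : π.child k = none ↔ π.rule.arity ≤ k := by
  unfold child rule; split_ifs with h
  · simpa using h
  · simpa using h

theorem child_isSome_iff {π : Pf E} {k : ℕ} : (π.child k).isSome ↔ k < π.rule.arity := by
  rw [← not_iff_not]; simp [child_eq_none_iff]

theorem child_lt {π ρ : Pf E} {k : ℕ} (h : π.child k = some ρ) : k < π.rule.arity := by
  rw [← child_isSome_iff, h]; rfl

theorem exists_child {π : Pf E} {k : ℕ} (h : k < π.rule.arity) : ∃ ρ, π.child k = some ρ :=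
  Option.isSome_iff_exists.mp (child_isSome_iff.mpr h)

theorem ext_child {π π' : Pf E} (h1 : π.concl = π'.concl) (h2 : π.rule = π'.rule)
    (h3 : ∀ k, π.child k = π'.child k) : π = π' := by
  rw [← PFunctor.M.mk_dest π, ← PFunctor.M.mk_dest π']; congr 1
  unfold concl at h1; unfold rule at h2
  unfold child at h3; rcases hd : PFunctor.M.dest π with ⟨⟨Γ, r⟩, f⟩
  rcases hd' : PFunctor.M.dest π' with ⟨⟨Γ', r'⟩, f'⟩; rw [hd, hd'] at h1 h2 h3
  simp only at h1 h2 h3; subst h1 h2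
  congr 1; funext ⟨k, hk⟩
  have := h3 k
  have hk' : k < r.arity := hk
  simpa [hk'] using this

theorem kid_of_child {π ρ : Pf E} {k : ℕ} (h : π.child k = some ρ) : π.kid k = ρ := by simp [kid, h]

theorem child_of_lt {π : Pf E} {k : ℕ} (h : k < π.rule.arity) : π.child k = some (π.kid k) := by
  obtain ⟨ρ, hρ⟩ := exists_child h; rw [hρ, kid_of_child hρ]

theorem IsNode.unique {π π' : Pf E} {Γ r cs} (h : π.IsNode Γ r cs) (h' : π'.IsNode Γ r cs) :
    π = π' :=
  ext_child (h.1.trans h'.1.symm) (h.2.1.trans h'.2.1.symm) fun k => (h.2.2 k).trans (h'.2.2 k).symm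

theorem IsNode.length {π : Pf E} {Γ r cs} (h : π.IsNode Γ r cs) : cs.length = r.arity := by
  obtain ⟨h1, h2, h3⟩ := h
  have : ∀ k, k < cs.length ↔ k < r.arity := fun k => by rw [← h2, ← child_isSome_iff, h3]; simp
  have a := this cs.length
  have b := this r.arity
  omega

theorem IsNode.mk_of {Γ : Seq E} {r : Rule E} {cs : List (Pf E)} (h : cs.length = r.arity) :
    ∃ π : Pf E, π.IsNode Γ r cs := by
  classical
  by_cases hc : Nonempty (Pf E)
  · obtain ⟨d⟩ := hc; refine ⟨mkN Γ r fun k => cs.getD k d, rfl, rfl, fun k => ?_⟩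
    grind [child_mkN]
  · have : cs = [] := by
      cases cs with
      | nil => rfl
      | cons a l => exact absurd ⟨a⟩ hc
    subst this; refine ⟨PFunctor.M.mk ⟨(Γ, r), fun k => ?_⟩, ?_⟩
    · exact absurd (show k.val < r.arity from k.2) (by simp at h; omega)
    · exact absurd ⟨mkN Γ Rule.one fun _ => PFunctor.M.mk ⟨(Γ, r), fun k =>
        absurd (show k.val < r.arity from k.2) (by simp at h; omega)⟩⟩ hc

/-- The tree with conclusion `Γ`, last rule `r`, and `ρ` as its only immediate subtree. -/
def mk1 (Γ : Seq E) (r : Rule E) (ρ : Pf E) : Pf E := mkN Γ r fun _ => ρ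

theorem mk1_isNode {Γ : Seq E} {r : Rule E} (h : r.arity = 1) (ρ : Pf E) :
    (mk1 Γ r ρ).IsNode Γ r [ρ] := by
  refine ⟨rfl, rfl, fun k => ?_⟩
  rw [mk1, child_mkN, h]; rcases k with _ | k <;> simp

theorem IsNode.eq_mk1 {π ρ : Pf E} {Γ : Seq E} {r : Rule E} (h : π.IsNode Γ r [ρ]) :
    π = mk1 Γ r ρ :=
  h.unique (mk1_isNode h.length.symm ρ)

theorem child_mk1 {Γ : Seq E} {r : Rule E} (h : r.arity = 1) (ρ : Pf E) :
    (mk1 Γ r ρ).child 0 = some ρ := by simpa using (mk1_isNode h ρ (Γ := Γ)).2.2 0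

/-- The unary rules `rs` put below `ρ`. -/
def mkChain : Seq E → List (Rule E) → Pf E → Pf E
  | _, [], ρ => ρ
  | Γ, r :: rs, ρ => mk1 Γ r (mkChain (r.prem0 Γ) rs ρ)

theorem Chain.eq_mkChain {Γ : Seq E} {rs : List (Rule E)} {π ρ : Pf E} (h : Chain Γ rs π ρ) :
    π = mkChain Γ rs ρ := by
  induction rs generalizing Γ π with
  | nil => exact h
  | cons r rs ih =>
    obtain ⟨π', h1, h2⟩ := h; rw [h1.eq_mk1, ih h2, mkChain]

theorem Chain.unique {Γ : Seq E} {rs : List (Rule E)} {π π' ρ : Pf E} (h : Chain Γ rs π ρ)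
    (h' : Chain Γ rs π' ρ) : π = π' := h.eq_mkChain.trans h'.eq_mkChain.symm

/-- The sequent above the unary rules `rs`. -/
def topSeq : Seq E → List (Rule E) → Seq E
  | Γ, [] => Γ
  | Γ, r :: rs => topSeq (r.prem0 Γ) rs

theorem Chain.append {Γ : Seq E} {rs rs' : List (Rule E)} {π ρ σ : Pf E} (h : Chain Γ rs π ρ)
    (h' : Chain (topSeq Γ rs) rs' ρ σ) : Chain Γ (rs ++ rs') π σ := by
  induction rs generalizing Γ π with
  | nil => obtain rfl : π = ρ := h; exact h'
  | cons r rs ih =>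
    obtain ⟨π', h1, h2⟩ := h; exact ⟨π', h1, ih h2 h'⟩

theorem Chain.split {Γ : Seq E} {rs rs' : List (Rule E)} {π σ : Pf E}
    (h : Chain Γ (rs ++ rs') π σ) : ∃ ρ, Chain Γ rs π ρ ∧ Chain (topSeq Γ rs) rs' ρ σ := by
  induction rs generalizing Γ π with
  | nil => exact ⟨π, rfl, h⟩
  | cons r rs ih =>
    obtain ⟨π', h1, h2⟩ := h; obtain ⟨ρ, h3, h4⟩ := ih h2
    exact ⟨ρ, ⟨π', h1, h3⟩, h4⟩

/-! ### Hereditary characterizations -/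

theorem IsPreproof.localOk {S : Sig E} {π : Pf E} (h : π.IsPreproof S) : π.LocalOk S := h [] π rfl

theorem IsPreproof.child {S : Sig E} {π ρ : Pf E} {k : ℕ} (h : π.IsPreproof S)
    (hc : π.child k = some ρ) : ρ.IsPreproof S := fun a τ ha =>
  h (k :: a) τ (by simp [sub, hc, ha])

theorem isPreproof_of {S : Sig E} {π : Pf E} (h : π.LocalOk S)
    (hc : ∀ k ρ, π.child k = some ρ → ρ.IsPreproof S) : π.IsPreproof S := by
  rintro (_ | ⟨k, a⟩) τ ha
  · obtain rfl : π = τ := by simpa [sub] using ha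
    exact h
  · rcases hk : π.child k with _ | ρ
    · simp [sub, hk] at ha
    · exact hc k ρ hk a τ (by simpa [sub, hk] using ha)

/-- All infinite branches are valid. -/
def Val (π : Pf E) : Prop := ∀ f k, π.IsBranch f k → ValidBranch f k

theorem ValidBranch.of_tail {f : ℕ → Pf E} {k : ℕ → ℕ} (n : ℕ)
    (h : ValidBranch (fun i => f (i + n)) fun i => k (i + n)) : ValidBranch f k := by
  obtain ⟨N, t, A, h1, h2, h3⟩ := h
  refine ⟨N + n, fun i => t (i - n), A, fun i hi => ?_, fun i hi => ?_, fun M => ?_⟩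
  · have := h1 (i - n) (by omega)
    grind
  · have := h2 (i - n) (by omega)
    dsimp only at this ⊢; rwa [show i - n + n = i by omega] at this
  · obtain ⟨i, hi, h4⟩ := h3 M; exact ⟨i + n, by omega, by simpa using h4⟩

theorem ValidBranch.tail {f : ℕ → Pf E} {k : ℕ → ℕ} (n : ℕ) (h : ValidBranch f k) :
    ValidBranch (fun i => f (i + n)) fun i => k (i + n) := by
  obtain ⟨N, t, A, h1, h2, h3⟩ := h
  refine ⟨N, fun i => t (i + n), A, fun i hi => ?_, fun i hi => ?_, fun M => ?_⟩
  · have := h1 (i + n) (by omega)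
    rwa [show i + n + 1 = i + 1 + n by omega] at this
  · exact h2 (i + n) (by omega)
  · obtain ⟨i, hi, h4⟩ := h3 (M + n); refine ⟨i - n, by omega, ?_⟩
    simpa [show i - n + n = i by omega] using h4

theorem Val.child {π ρ : Pf E} {k : ℕ} (h : π.Val) (hc : π.child k = some ρ) : ρ.Val := by
  intro f l ⟨hf0, hf⟩
  refine ValidBranch.tail 1 (f := fun i => if i = 0 then π else f (i - 1))
    (k := fun i => if i = 0 then k else l (i - 1)) (h _ _ ⟨rfl, fun i => ?_⟩)
  rcases i with _ | i
  · simp [hc, hf0]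
  · simpa using hf i

theorem val_of {π : Pf E} (hc : ∀ k ρ, π.child k = some ρ → ρ.Val) : π.Val := by
  intro f l ⟨hf0, hf⟩
  refine ValidBranch.of_tail 1 (hc (l 0) (f 1) (by simpa [hf0] using hf 0) _ _ ⟨rfl, fun i => hf (i + 1)⟩)

theorem IsProof.child {S : Sig E} {π ρ : Pf E} {k : ℕ} (h : π.IsProof S)
    (hc : π.child k = some ρ) : ρ.IsProof S := ⟨h.1.child hc, Val.child h.2 hc⟩

theorem isProof_of {S : Sig E} {π : Pf E} (h : π.LocalOk S)
    (hc : ∀ k ρ, π.child k = some ρ → ρ.IsProof S) : π.IsProof S :=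
  ⟨isPreproof_of h fun k ρ hk => (hc k ρ hk).1, val_of fun k ρ hk => (hc k ρ hk).2⟩

/-- The root is a correct instance of a rule of linear logic. -/
def LLOk (π : Pf Unit) : Prop := π.LocalOk LL ∧ ¬ π.rule.IsF ∧ ¬ π.rule.IsU

theorem IsLLProof.ok {π : Pf Unit} (h : π.IsLLProof) : π.LLOk := ⟨h.1.1.localOk, h.1.2 [] π rfl⟩

theorem IsLLPreproof.child {π ρ : Pf Unit} {k : ℕ} (h : π.IsLLPreproof)
    (hc : π.child k = some ρ) : ρ.IsLLPreproof :=
  ⟨h.1.child hc, fun a τ ha => h.2 (k :: a) τ (by simp [sub, hc, ha])⟩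

theorem IsLLProof.child {π ρ : Pf Unit} {k : ℕ} (h : π.IsLLProof)
    (hc : π.child k = some ρ) : ρ.IsLLProof :=
  ⟨h.1.child hc, Val.child h.2 hc⟩

theorem isLLPreproof_of {π : Pf Unit} (h : π.LLOk)
    (hc : ∀ k ρ, π.child k = some ρ → ρ.IsLLPreproof) : π.IsLLPreproof := by
  refine ⟨isPreproof_of h.1 fun k ρ hk => (hc k ρ hk).1, ?_⟩
  rintro (_ | ⟨k, a⟩) τ ha
  · obtain rfl : π = τ := by simpa [sub] using ha
    exact h.2
  · rcases hk : π.child k with _ | ρ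
    · simp [sub, hk] at ha
    · exact (hc k ρ hk).2 a τ (by simpa [sub, hk] using ha)

theorem isLLProof_of {π : Pf Unit} (h : π.LLOk)
    (hc : ∀ k ρ, π.child k = some ρ → ρ.IsLLProof) : π.IsLLProof :=
  ⟨isLLPreproof_of h fun k ρ hk => (hc k ρ hk).1, val_of fun k ρ hk => (hc k ρ hk).2⟩

theorem IsLLProof.kid {π : Pf Unit} (h : π.IsLLProof) (k : ℕ) : (π.kid k).IsLLProof := by
  rcases hk : π.child k with _ | ρ
  · simpa [Pf.kid, hk] using h
  · rw [kid_of_child hk]; exact h.child hk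

theorem IsProof.kid {S : Sig E} {π : Pf E} (h : π.IsProof S) (k : ℕ) : (π.kid k).IsProof S := by
  rcases hk : π.child k with _ | ρ
  · simpa [Pf.kid, hk] using h
  · rw [kid_of_child hk]; exact h.child hk

/-- A coinduction principle for linear logic pre-proofs. -/
theorem isLLPreproof_coind (X : Pf Unit → Prop) (hX : ∀ π, X π → π.LLOk)
    (hc : ∀ π, X π → ∀ k ρ, π.child k = some ρ → X ρ) {π : Pf Unit} (h : X π) :
    π.IsLLPreproof := by
  have key : ∀ (a : List ℕ) (π τ : Pf Unit), X π → π.sub a = some τ → X τ := by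
    intro a
    induction a with
    | nil => grind [sub]
    | cons k a ih => grind [child, sub]
  exact ⟨fun a τ ha => (hX τ (key a π τ h ha)).1, fun a τ ha => (hX τ (key a π τ h ha)).2⟩

end Pf

/-! ### Formulas -/

namespace Fm
variable {E : Type u}

@[simp] theorem neg_neg (A : Fm E) : A.neg.neg = A := by induction A <;> simp_all [neg]

theorem tr_neg (A : Fm E) : A.neg.tr = A.tr.neg := by induction A <;> simp_all [neg, tr]

theorem tr_subst (G A : Fm E) (k : ℕ) : (subst G k A).tr = subst G.tr k A.tr := by
  induction A generalizing k <;> simp_all [subst, tr]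
  split_ifs <;> simp [tr]

theorem tr_closedAt (A : Fm E) (k : ℕ) : A.tr.ClosedAt k ↔ A.ClosedAt k := by
  induction A generalizing k <;> simp_all [ClosedAt, tr]

theorem tr_unquest (A : Fm E) (h : ∃ t B, A = quest t B) : A.unquest.tr = A.tr.unquest := by
  obtain ⟨t, B, rfl⟩ := h
  rfl

theorem IsSub.tr {F G : Fm E} (h : F.IsSub G) : F.tr.IsSub G.tr := by
  induction h with
  | refl => exact .refl
  | tensL _ ih => exact .tensL ih
  | tensR _ ih => exact .tensR ih
  | parL _ ih => exact .parL ih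
  | parR _ ih => exact .parR ih
  | plusL _ ih => exact .plusL ih
  | plusR _ ih => exact .plusR ih
  | wthL _ ih => exact .wthL ih
  | wthR _ ih => exact .wthR ih
  | quest _ ih => exact .quest ih
  | bang _ ih => exact .bang ih
  | mu _ ih => exact .mu ih
  | nu _ ih => exact .nu ih

/-- Remove an outermost exponential. -/
def strip : Fm E → Fm E
  | quest _ A => A
  | bang _ A => A
  | A => A

theorem strip_neg (A : Fm E) : A.neg.strip = A.strip.neg := by cases A <;> simp [neg, strip]

theorem ne_quest (s : E) (A : Fm E) : A ≠ quest s A := by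
  intro h
  have := congrArg sizeOf h
  simp at this

theorem ne_bang (s : E) (A : Fm E) : A ≠ bang s A := by
  intro h
  have := congrArg sizeOf h
  simp at this

end Fm

/-! ### Occurrences of premises -/

section Occurrences
variable {E : Type u}

theorem zipIdx_flatMap_single {α β : Type*} (l : List α) (n : ℕ) (P : ℕ → Prop) [DecidablePred P]
    (f : α × ℕ → List β) (h : α × ℕ → β) (hP : ∀ k, n ≤ k → k < n + l.length → ¬ P k) :
    ((l.zipIdx n).flatMap fun x => if P x.2 then f x else [h x]) = (l.zipIdx n).map h := by
  induction l generalizing n with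
  | nil => rfl
  | cons a l ih => grind

/-- The occurrences of a list of formulas which are not modified, starting at position `n`. -/
def ctxOcc (l : Seq E) (n : ℕ) : List (Occ E) := (l.zipIdx n).map fun x => ⟨some x.2, 0, x.1⟩

theorem replaceAt_split (l r : Seq E) (B : Fm E) (L : Seq E) : replaceAt (l ++ B :: r) l.length L =
      ctxOcc l 0 ++ (L.zipIdx.map fun y => ⟨some l.length, y.2, y.1⟩) ++
        ctxOcc r (l.length + 1) := by
  have e1 := zipIdx_flatMap_single l 0 (· = l.length)
    (fun _ => L.zipIdx.map fun y => (⟨some l.length, y.2, y.1⟩ : Occ E))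
    (fun x => ⟨some x.2, 0, x.1⟩) (fun k _ h => by omega)
  have e2 := zipIdx_flatMap_single r (0 + l.length + 1) (· = l.length)
    (fun _ => L.zipIdx.map fun y => (⟨some l.length, y.2, y.1⟩ : Occ E))
    (fun x => ⟨some x.2, 0, x.1⟩) (fun k h _ => by omega)
  grind [replaceAt, ctxOcc]

theorem ctxOcc_fm (l : Seq E) (n : ℕ) : (ctxOcc l n).map Occ.fm = l := by
  simp [ctxOcc, Function.comp_def]

theorem replaceAt_fm (l r : Seq E) (B : Fm E) (L : Seq E) :
    (replaceAt (l ++ B :: r) l.length L).map Occ.fm = l ++ L ++ r := by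
  rw [replaceAt_split]; simp [ctxOcc_fm, Function.comp_def]

theorem ctxOcc_length (l : Seq E) (n : ℕ) : (ctxOcc l n).length = l.length := by simp [ctxOcc]

theorem ctxOcc_get (l : Seq E) (n j : ℕ) :
    (ctxOcc l n)[j]? = l[j]?.map fun A => ⟨some (n + j), 0, A⟩ := by
  simp [ctxOcc, List.getElem?_zipIdx, Function.comp_def]

theorem exists_split {α : Type*} {l : List α} {p : ℕ} {a : α} (h : l[p]? = some a) :
    ∃ l₁ l₂, l = l₁ ++ a :: l₂ ∧ l₁.length = p := by
  obtain ⟨hp, h⟩ := List.getElem?_eq_some_iff.mp h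
  refine ⟨l.take p, l.drop (p + 1), ?_, by simp; omega⟩
  rw [← h, List.cons_getElem_drop_succ, List.take_append_drop]

theorem replaceAt_get (l r : Seq E) (B : Fm E) (L : Seq E) (j : ℕ) :
    (replaceAt (l ++ B :: r) l.length L)[j]? =
      if j < l.length then l[j]?.map fun A => ⟨some j, 0, A⟩
      else if j < l.length + L.length then
        L[j - l.length]?.map fun A => ⟨some l.length, j - l.length, A⟩
      else r[j - l.length - L.length]?.map fun A => ⟨some (j + 1 - L.length), 0, A⟩ := by
  grind [replaceAt_split, ctxOcc_length, ctxOcc_get, List.length_zipIdx]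

end Occurrences

/-! ### The translation, node by node -/

section Translation
variable {E : Type u}

/-- The translation starting from an intermediate state. -/
noncomputable def trS (s : Seq Unit × List (Rule Unit) × Pf E) : Pf Unit := PFunctor.M.corec trStep s

/-- The rules still to be put on top of the node to be produced. -/
def remRules (s : Seq Unit × List (Rule Unit) × Pf E) : List (Rule Unit) :=
  if s.2.1 = [] then s.2.2.rule.tr s.2.2.concl else s.2.1

/-- The state of the `k`-th child. -/
def nextState (s : Seq Unit × List (Rule Unit) × Pf E) (k : ℕ) :
    Seq Unit × List (Rule Unit) × Pf E :=
  match remRules s with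
  | [] => s
  | [_] => ((s.2.2.kid k).concl.map Fm.tr, [], s.2.2.kid k)
  | r :: r' :: rs => (r.prem0 s.1, r' :: rs, s.2.2)

theorem Rule.tr_ne_nil (Γ : Seq E) (r : Rule E) : r.tr Γ ≠ [] := by
  cases r with
  | mpx p i => cases i <;> simp [Rule.tr]
  | contr p i => rcases i with _ | _ | i <;> simp [Rule.tr]
  | _ => simp [Rule.tr]

theorem remRules_ne_nil (s : Seq Unit × List (Rule Unit) × Pf E) : remRules s ≠ [] := by
  grind [remRules, Rule.tr_ne_nil]

theorem trStep_eq (s : Seq Unit × List (Rule Unit) × Pf E) {r : Rule Unit} {rs : List (Rule Unit)}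
    (h : remRules s = r :: rs) : trStep s = ⟨(s.1, r), fun k => nextState s k.val⟩ := by
  unfold trStep nextState; unfold remRules at *
  rw [h]; rcases rs with _ | ⟨r', rs⟩ <;> rfl

theorem dest_trS (s : Seq Unit × List (Rule Unit) × Pf E) {r : Rule Unit} {rs : List (Rule Unit)}
    (h : remRules s = r :: rs) :
    PFunctor.M.dest (trS s) = ⟨(s.1, r), fun k => trS (nextState s k.val)⟩ := by
  unfold trS; rw [PFunctor.M.dest_corec, trStep_eq s h]
  rfl

theorem trS_eq (s : Seq Unit × List (Rule Unit) × Pf E) {r : Rule Unit} {rs : List (Rule Unit)}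
    (h : remRules s = r :: rs) : trS s = Pf.mkN s.1 r fun k => trS (nextState s k) := by
  rw [← PFunctor.M.mk_dest (trS s), dest_trS s h]
  rfl

theorem trS_rem (s : Seq Unit × List (Rule Unit) × Pf E) : trS s = trS (s.1, remRules s, s.2.2) := by
  obtain ⟨r, rs, h⟩ := List.exists_cons_of_ne_nil (remRules_ne_nil s)
  have h' : remRules (s.1, remRules s, s.2.2) = r :: rs := by
    rw [remRules]; simp [h]
  rw [trS_eq s h, trS_eq _ h']; grind [nextState]

theorem Pf.tr_eq (π : Pf E) : π.tr = trS (π.concl.map Fm.tr, [], π) := rfl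

theorem Pf.tr_eq' (π : Pf E) : π.tr = trS (π.concl.map Fm.tr, π.rule.tr π.concl, π) := by
  rw [Pf.tr_eq, trS_rem]; simp [remRules]

theorem trS_concl (s : Seq Unit × List (Rule Unit) × Pf E) : (trS s).concl = s.1 := by
  obtain ⟨r, rs, h⟩ := List.exists_cons_of_ne_nil (remRules_ne_nil s); rw [trS_eq s h]; rfl

theorem Pf.tr_concl (π : Pf E) : π.tr.concl = π.concl.map Fm.tr := trS_concl _

theorem trS_rule (s : Seq Unit × List (Rule Unit) × Pf E) {r : Rule Unit} {rs : List (Rule Unit)}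
    (h : remRules s = r :: rs) : (trS s).rule = r := by
  rw [trS_eq s h]; rfl

theorem trS_child (s : Seq Unit × List (Rule Unit) × Pf E) (k : ℕ) :
    (trS s).child k = if k < (trS s).rule.arity then some (trS (nextState s k)) else none := by
  obtain ⟨r, rs, h⟩ := List.exists_cons_of_ne_nil (remRules_ne_nil s)
  rw [trS_eq s h, Pf.child_mkN]; rfl

/-- A node translated into a single rule. -/
theorem Pf.tr_single {π : Pf E} {r : Rule Unit} (h : π.rule.tr π.concl = [r])
    (har : r.arity = π.rule.arity) :
    π.tr.concl = π.concl.map Fm.tr ∧ π.tr.rule = r ∧ ∀ k, π.tr.child k = (π.child k).map Pf.tr := by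
  have hr : remRules (π.concl.map Fm.tr, [], π) = [r] := by simp [remRules, h]
  refine ⟨Pf.tr_concl π, trS_rule _ hr, fun k => ?_⟩
  rw [Pf.tr_eq, trS_child, trS_rule _ hr, har]; split_ifs with hk
  · rw [Pf.child_of_lt hk, nextState, hr]; rfl
  · rw [Pf.child_eq_none_iff.mpr (by omega)]; rfl

theorem Pf.tr_isNode {π : Pf E} {r : Rule Unit} {Γ R cs} (hn : π.IsNode Γ R cs)
    (h : R.tr Γ = [r]) (har : r.arity = R.arity) :
    π.tr.IsNode (Γ.map Fm.tr) r (cs.map Pf.tr) := by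
  obtain ⟨rfl, rfl, h3⟩ := hn; obtain ⟨h4, h5, h6⟩ := Pf.tr_single h har
  refine ⟨h4, h5, fun k => ?_⟩
  rw [h6, h3, List.getElem?_map]

theorem trS_chain (Γ : Seq Unit) (rs : List (Rule Unit)) (hne : rs ≠ []) (π : Pf E)
    (har : ∀ r ∈ rs, r.arity = 1) : Pf.Chain Γ rs (trS (Γ, rs, π)) (π.kid 0).tr := by
  induction rs generalizing Γ with
  | nil => exact absurd rfl hne
  | cons r rs ih =>
    have hr : remRules (Γ, r :: rs, π) = r :: rs := by simp [remRules]
    have hch : (trS (Γ, r :: rs, π)).IsNode Γ r [trS (nextState (Γ, r :: rs, π) 0)] := by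
      refine ⟨trS_concl _, trS_rule _ hr, fun k => ?_⟩
      grind [trS_child, trS_rule]
    refine ⟨_, hch, ?_⟩; rcases rs with _ | ⟨r', rs⟩
    · simp only [nextState, hr]
      rfl
    grind [nextState]

/-- A node translated into a chain of unary rules. -/
theorem Pf.tr_chain {π : Pf E} (har : ∀ r ∈ π.rule.tr π.concl, r.arity = 1) :
    Pf.Chain (π.concl.map Fm.tr) (π.rule.tr π.concl) π.tr (π.kid 0).tr := by
  rw [Pf.tr_eq']; exact trS_chain _ _ (Rule.tr_ne_nil _ _) π har

/-- The rule of linear logic of the same form. -/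
def Rule.tr1 : Rule E → Rule Unit
  | .ax => .ax
  | .cut A m => .cut A.tr m
  | .mcut Δs iota link => .mcut (Δs.map (List.map Fm.tr)) iota link
  | .one => .one
  | .top p => .top p
  | .bot p => .bot p
  | .par p => .par p
  | .tens p m => .tens p m
  | .plus p b => .plus p b
  | .wth p => .wth p
  | .fix p => .fix p
  | .mpx p i => .mpx p i
  | .contr p i => .contr p i
  | .promG p => .promG p
  | .promF p => .promF p
  | .promU p => .promU p

theorem Rule.tr1_arity (r : Rule E) : r.tr1.arity = r.arity := by cases r <;> simp [Rule.tr1, Rule.arity]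

/-- The rules translated into a rule of the same form. -/
def Rule.Plain (r : Rule E) : Prop := ∀ Γ : Seq E, r.tr Γ = [r.tr1]

/-- The translation of an occurrence. -/
def Occ.tr (o : Occ E) : Occ Unit := ⟨o.anc, o.tag, o.fm.tr⟩

theorem replaceAt_tr (Γ : Seq E) (p : ℕ) (L : Seq E) :
    replaceAt (Γ.map Fm.tr) p (L.map Fm.tr) = (replaceAt Γ p L).map Occ.tr := by
  unfold replaceAt; rw [List.zipIdx_map (l := Γ), List.flatMap_map, List.map_flatMap]
  congr 1; funext x
  simp only [Prod.map_snd, id_eq]; split_ifs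
  · simp [List.zipIdx_map, Occ.tr]
  · simp [Occ.tr]

theorem side_tr (Γ : Seq E) (m : List Bool) (b : Bool) :
    side (Γ.map Fm.tr) m b = (side Γ m b).map Occ.tr := by
  unfold side; rw [List.zipIdx_map, List.filterMap_map, List.map_filterMap]
  congr 1; funext x
  simp only [Function.comp_apply, Prod.map_snd, id_eq, Prod.map_fst]; split_ifs <;> rfl

theorem sideAt_tr (Γ : Seq E) (m : List Bool) (b : Bool) (p : ℕ) (A : Fm E) (t : ℕ) :
    sideAt (Γ.map Fm.tr) m b p A.tr t = (sideAt Γ m b p A t).map Occ.tr := by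
  unfold sideAt; rw [List.zipIdx_map, List.filterMap_map, List.map_filterMap]
  congr 1; funext x
  simp only [Function.comp_apply, Prod.map_snd, id_eq, Prod.map_fst]; split_ifs <;> rfl

theorem Rule.prems_tr {S : Sig E} {Γ : Seq E} {r : Rule E} (hok : r.Ok S Γ) (hF : ¬ r.IsF)
    (hU : ¬ r.IsU) : r.tr1.prems (Γ.map Fm.tr) = (r.prems Γ).map (List.map Occ.tr) := by
  cases r with
  | ax => rfl
  | cut A m => simp [Rule.tr1, Rule.prems, side_tr, Occ.tr, Fm.tr_neg]
  | mcut Δs iota link => simp [Rule.tr1, Rule.prems, List.zipIdx_map, Occ.tr]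
  | one => rfl
  | top p => rfl
  | bot p => simpa [Rule.tr1, Rule.prems] using replaceAt_tr Γ p []
  | par p =>
    obtain ⟨A, B, h⟩ := hok; simpa [Rule.tr1, Rule.prems, h, Fm.tr] using replaceAt_tr Γ p [A, B]
  | tens p m =>
    obtain ⟨⟨A, B, h⟩, -⟩ := hok; simp [Rule.tr1, Rule.prems, h, Fm.tr, sideAt_tr]
  | plus p b =>
    obtain ⟨A, B, h⟩ := hok
    have := replaceAt_tr Γ p [if b then B else A]
    cases b <;> simpa [Rule.tr1, Rule.prems, h, Fm.tr] using this
  | wth p =>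
    obtain ⟨A, B, h⟩ := hok
    have h1 := replaceAt_tr Γ p [A]
    have h2 := replaceAt_tr Γ p [B]
    simp at h1 h2; simp [Rule.tr1, Rule.prems, h, Fm.tr, h1, h2]
  | fix p =>
    obtain ⟨A, h | h⟩ := hok
    · have h1 := replaceAt_tr Γ p [Fm.subst (.mu A) 0 A]
      grind [Fm.tr_subst, Fm.tr, Rule.tr1, Rule.prems]
    · have h1 := replaceAt_tr Γ p [Fm.subst (.nu A) 0 A]
      grind [Fm.tr_subst, Fm.tr, Rule.tr1, Rule.prems]
  | mpx p i =>
    obtain ⟨s, A, h, -⟩ := hok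
    have := replaceAt_tr Γ p (List.replicate i A)
    simpa [Rule.tr1, Rule.prems, h, Fm.tr] using this
  | contr p i =>
    obtain ⟨-, s, A, h, -⟩ := hok
    have := replaceAt_tr Γ p (List.replicate i (.quest s A))
    simpa [Rule.tr1, Rule.prems, h, Fm.tr] using this
  | promG p =>
    obtain ⟨s, A, h, -⟩ := hok
    have := replaceAt_tr Γ p [A]
    simpa [Rule.tr1, Rule.prems, h, Fm.tr] using this
  | promF p => exact absurd ⟨p, rfl⟩ hF
  | promU p => exact absurd ⟨p, rfl⟩ hU

theorem fmAt_tr (Δs : List (Seq E)) (x : ℕ × ℕ) :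
    fmAt (Δs.map (List.map Fm.tr)) x = (fmAt Δs x).map Fm.tr := by
  grind [fmAt]

theorem McutOk.tr {Γ : Seq E} {Δs : List (Seq E)} {iota : List (ℕ × ℕ)}
    {link : ℕ × ℕ → ℕ × ℕ → Prop} (h : McutOk Γ Δs iota link) :
    McutOk (Γ.map Fm.tr) (Δs.map (List.map Fm.tr)) iota link where
  iota_fm := by
    have := congrArg (List.map (Option.map Fm.tr)) h.iota_fm
    rw [show fmAt (Δs.map (List.map Fm.tr)) = fun x => (fmAt Δs x).map Fm.tr from
      funext (fmAt_tr Δs)]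
    simpa [Function.comp_def] using this
  iota_inj := h.iota_inj
  link_dom := fun x y hl => by simpa [fmAt_tr] using h.link_dom x y hl
  link_total := fun x h1 h2 => h.link_total x (by simpa [fmAt_tr] using h1) h2
  link_symm := h.link_symm
  link_unique := h.link_unique
  link_dual := fun x y hl => by
    rw [fmAt_tr, fmAt_tr, h.link_dual x y hl]; rcases fmAt Δs y with _ | A <;> simp [Fm.tr_neg]
  no_loop := h.no_loop
  no_double := h.no_double
  tree := by
    have := h.tree
    rw [List.length_map]; exact this

/-- Plain rules that are not exponential rules stay correct. -/
theorem Rule.Ok.tr1 {S : Sig E} {Γ : Seq E} {r : Rule E} (hok : r.Ok S Γ) (hF : ¬ r.IsF)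
    (hU : ¬ r.IsU) (hp : r.Plain) : r.tr1.Ok LL (Γ.map Fm.tr) := by
  cases r with
  | ax => obtain ⟨A, rfl⟩ := hok; exact ⟨A.tr, by simp [Fm.tr_neg]⟩
  | cut A m => simpa [Rule.tr1, Rule.Ok] using hok
  | mcut Δs iota link => exact McutOk.tr hok
  | one => obtain rfl : Γ = [.one] := hok; rfl
  | top p => simp [Rule.tr1, Rule.Ok] at hok ⊢; simp [hok, Fm.tr]
  | bot p => simp [Rule.tr1, Rule.Ok] at hok ⊢; simp [hok, Fm.tr]
  | par p => obtain ⟨A, B, h⟩ := hok; exact ⟨A.tr, B.tr, by simp [h, Fm.tr]⟩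
  | tens p m =>
    obtain ⟨⟨A, B, h⟩, h2, h3⟩ := hok
    exact ⟨⟨A.tr, B.tr, by simp [h, Fm.tr]⟩, by simpa using h2, h3⟩
  | plus p b => obtain ⟨A, B, h⟩ := hok; exact ⟨A.tr, B.tr, by simp [h, Fm.tr]⟩
  | wth p => obtain ⟨A, B, h⟩ := hok; exact ⟨A.tr, B.tr, by simp [h, Fm.tr]⟩
  | fix p =>
    obtain ⟨A, h | h⟩ := hok
    · exact ⟨A.tr, Or.inl (by simp [h, Fm.tr])⟩
    · exact ⟨A.tr, Or.inr (by simp [h, Fm.tr])⟩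
  | mpx p i =>
    obtain ⟨s, A, h, -⟩ := hok; refine ⟨(), A.tr, by simp [h, Fm.tr], ?_⟩
    have := hp Γ
    rcases i with _ | i
    · exact Or.inl rfl
    · have h2 := congrArg List.length this
      simp [Rule.tr] at h2
      right; omega
  | contr p i =>
    obtain ⟨hi, s, A, h, -⟩ := hok; refine ⟨hi, (), A.tr, by simp [h, Fm.tr], ?_⟩
    have := hp Γ
    rcases i with _ | _ | i
    · omega
    · omega
    · have h2 := congrArg List.length this
      simp [Rule.tr] at h2; show i + 2 = 2
      omega
  | promG p =>
    obtain ⟨s, A, h, h2⟩ := hok; refine ⟨(), A.tr, by simp [h, Fm.tr], fun k F hk hF => ?_⟩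
    rw [List.getElem?_map] at hF; rcases hG : Γ[k]? with _ | G
    · simp [hG] at hF
    · obtain ⟨t, B, rfl, -⟩ := h2 k G hk hG; simp [hG] at hF
      exact ⟨(), B.tr, by simp [← hF, Fm.tr], trivial⟩
  | promF p => exact absurd ⟨p, rfl⟩ hF
  | promU p => exact absurd ⟨p, rfl⟩ hU

end Translation

/-- A correct unary rule of linear logic, each occurrence of whose premise comes from the position
given by `d`, and is equal to its ancestor up to an outermost exponential. -/
structure AncRule (Γ : Seq Unit) (r : Rule Unit) (d : ℕ → ℕ) : Prop where
  arity : r.arity = 1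
  ok : r.Ok LL Γ
  notF : ¬ r.IsF
  notU : ¬ r.IsU
  anc : ∀ j o, ((r.prems Γ)[0]?.getD [])[j]? = some o → o.anc = some (d j) ∧
    ∃ F, Γ[d j]? = some F ∧ (F = o.fm ∨ F = .quest () o.fm ∨ F = .bang () o.fm)

/-- The composition of the ancestor maps of unary rules. -/
inductive AncChain : Seq Unit → List (Rule Unit) → (ℕ → ℕ) → Seq Unit → Prop
  | nil (Γ) : AncChain Γ [] id Γ
  | cons {Γ r rs d₁ d₂ Γ'} : AncRule Γ r d₁ → AncChain (r.prem0 Γ) rs d₂ Γ' →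
      AncChain Γ (r :: rs) (d₁ ∘ d₂) Γ'

theorem AncChain.append {Γ Γ' Γ'' : Seq Unit} {rs rs' : List (Rule Unit)} {d d' : ℕ → ℕ}
    (h : AncChain Γ rs d Γ') (h' : AncChain Γ' rs' d' Γ'') : AncChain Γ (rs ++ rs') (d ∘ d') Γ'' := by
  induction h with
  | nil => exact h'
  | cons h1 _ ih =>
    have := AncChain.cons h1 (ih h')
    exact this

theorem AncChain.arity {Γ Γ' : Seq Unit} {rs : List (Rule Unit)} {d : ℕ → ℕ}
    (h : AncChain Γ rs d Γ') : ∀ r ∈ rs, r.arity = 1 := by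
  induction h with
  | nil => simp
  | cons h1 _ ih =>
    intro r hr; rcases List.mem_cons.mp hr with rfl | hr
    · exact h1.arity
    · exact ih r hr

/-- The ancestor map of a rule replacing the formula at position `p` by `k` formulas. -/
def ancAt (p k j : ℕ) : ℕ := if j < p then j else if j < p + k then p else j + 1 - k

theorem ancRule_of_replace {l r : Seq Unit} {B C : Fm Unit} {k : ℕ} {R : Rule Unit}
    (ha : R.arity = 1) (hok : R.Ok LL (l ++ B :: r)) (hF : ¬ R.IsF) (hU : ¬ R.IsU)
    (hp : R.prems (l ++ B :: r) = [replaceAt (l ++ B :: r) l.length (List.replicate k C)])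
    (hB : B = C ∨ B = .quest () C ∨ B = .bang () C) :
    AncRule (l ++ B :: r) R (ancAt l.length k) := by
  refine ⟨ha, hok, hF, hU, fun j o ho => ?_⟩
  rw [hp] at ho
  simp only [List.length_cons, List.length_nil, Nat.zero_add, Nat.lt_add_one, getElem?_pos,
    List.getElem_cons_zero, Option.getD_some] at ho
  rw [replaceAt_get] at ho; unfold ancAt
  simp only [List.length_replicate] at ho; split_ifs at ho ⊢ with h1 h2
  · grind
  · grind
  · grind

section Structural
variable {E : Type u}

theorem prems_contr (l r : Seq E) (s : E) (A : Fm E) (i : ℕ) :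
    (Rule.contr l.length i).prems (l ++ .quest s A :: r) =
      [replaceAt (l ++ .quest s A :: r) l.length (List.replicate i (.quest s A))] := by
  simp [Rule.prems]

theorem prems_mpx (l r : Seq E) (s : E) (A : Fm E) (i : ℕ) :
    (Rule.mpx l.length i).prems (l ++ .quest s A :: r) =
      [replaceAt (l ++ .quest s A :: r) l.length (List.replicate i A)] := by
  simp [Rule.prems]

theorem prems_promG (l r : Seq E) (s : E) (A : Fm E) :
    (Rule.promG l.length).prems (l ++ .bang s A :: r) =
      [replaceAt (l ++ .bang s A :: r) l.length [A]] := by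
  simp [Rule.prems]

theorem prem0_contr (l r : Seq E) (s : E) (A : Fm E) (i : ℕ) :
    (Rule.contr l.length i).prem0 (l ++ .quest s A :: r) =
      l ++ List.replicate i (.quest s A) ++ r := by
  simp [Rule.prem0, prems_contr, replaceAt_fm]

theorem prem0_mpx (l r : Seq E) (s : E) (A : Fm E) (i : ℕ) :
    (Rule.mpx l.length i).prem0 (l ++ .quest s A :: r) = l ++ List.replicate i A ++ r := by
  simp [Rule.prem0, prems_mpx, replaceAt_fm]

theorem prem0_promG (l r : Seq E) (s : E) (A : Fm E) :
    (Rule.promG l.length).prem0 (l ++ .bang s A :: r) = l ++ A :: r := by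
  simp [Rule.prem0, prems_promG, replaceAt_fm]

end Structural

theorem ancRule_contr (l r : Seq Unit) (A : Fm Unit) :
    AncRule (l ++ .quest () A :: r) (.contr l.length 2) (ancAt l.length 2) :=
  ancRule_of_replace rfl ⟨le_rfl, (), A, by simp, rfl⟩ (by rintro ⟨p, h⟩; cases h)
    (by rintro ⟨p, h⟩; cases h) (prems_contr l r () A 2) (Or.inl rfl)

theorem ancRule_der (l r : Seq Unit) (A : Fm Unit) :
    AncRule (l ++ .quest () A :: r) (.mpx l.length 1) (ancAt l.length 1) :=
  ancRule_of_replace rfl ⟨(), A, by simp, Or.inr rfl⟩ (by rintro ⟨p, h⟩; cases h)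
    (by rintro ⟨p, h⟩; cases h) (prems_mpx l r () A 1) (Or.inr (Or.inl rfl))

theorem ancRule_promG (l r : Seq Unit) (A : Fm Unit) (hl : ∀ F ∈ l ++ r, ∃ B, F = .quest () B) :
    AncRule (l ++ .bang () A :: r) (.promG l.length) (ancAt l.length 1) := by
  refine ancRule_of_replace rfl ⟨(), A, by simp, fun k F hk hF => ?_⟩ (by rintro ⟨p, h⟩; cases h)
    (by rintro ⟨p, h⟩; cases h) (prems_promG l r () A) (Or.inr (Or.inr rfl))
  have : F ∈ l ++ r := by grind
  obtain ⟨B, rfl⟩ := hl F this; exact ⟨(), B, rfl, trivial⟩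

theorem ancAt_one (p : ℕ) : ancAt p 1 = id := by
  funext j; unfold ancAt; simp only [id]; split_ifs <;> omega

/-- The iterated binary contractions. -/
def contrs (p n : ℕ) : List (Rule Unit) := (List.range n).map fun k => .contr (p + k) 2

/-- Derelictions on `n` successive positions. -/
def ders (p n : ℕ) : List (Rule Unit) := (List.range n).map fun k => .mpx (p + k) 1

theorem contrs_succ (p n : ℕ) : contrs p (n + 1) = .contr p 2 :: contrs (p + 1) n := by
  simp only [contrs, List.range_succ_eq_map, List.map_cons, List.map_map]; congr 1
  grind [List.map_congr_left]

theorem ders_succ (p n : ℕ) : ders p (n + 1) = .mpx p 1 :: ders (p + 1) n := by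
  simp only [ders, List.range_succ_eq_map, List.map_cons, List.map_map]; congr 1
  grind [List.map_congr_left]

theorem ancChain_contrs (l r : Seq Unit) (A : Fm Unit) (n : ℕ) :
    AncChain (l ++ .quest () A :: r) (contrs l.length n) (ancAt l.length (n + 1))
      (l ++ List.replicate (n + 1) (.quest () A) ++ r) := by
  induction n generalizing l with
  | zero => simpa [contrs, ancAt_one] using AncChain.nil _
  | succ n ih =>
    rw [contrs_succ]
    have h1 := ancRule_contr l r A
    have h2 := ih (l ++ [.quest () A])
    have h3 := prem0_contr l r () A 2
    have e : ancAt l.length (n + 1 + 1) = ancAt l.length 2 ∘ ancAt (l.length + 1) (n + 1) := by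
      grind [ancAt]
    rw [e]; refine .cons h1 ?_
    rw [h3]; simpa [List.replicate_succ] using h2

theorem ancChain_ders (l r : Seq Unit) (A : Fm Unit) (n : ℕ) :
    AncChain (l ++ List.replicate n (.quest () A) ++ r) (ders l.length n) id
      (l ++ List.replicate n A ++ r) := by
  induction n generalizing l with
  | zero => simpa [ders] using AncChain.nil _
  | succ n ih =>
    rw [ders_succ]
    have h1 := ancRule_der l (List.replicate n (.quest () A) ++ r) A
    have h2 := ih (l ++ [A])
    have h3 := prem0_mpx l (List.replicate n (.quest () A) ++ r) () A 1
    rw [ancAt_one] at h1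
    have := AncChain.cons (d₂ := id) (rs := ders (l.length + 1) n)
      (Γ' := l ++ List.replicate (n + 1) A ++ r) h1 (by
        rw [h3]
        simpa [List.replicate_succ] using h2)
    simpa [List.replicate_succ] using this

/-- Remove the outermost `?` at the positions in `ks`. -/
def unqAt {E : Type u} (Γ : Seq E) (ks : List ℕ) : Seq E :=
  Γ.mapIdx fun k A => if k ∈ ks then A.unquest else A

theorem unqAt_split {E : Type u} {l r : Seq E} {A : Fm E} {s : E} {ks : List ℕ}
    (h : l.length ∉ ks) :
    unqAt (l ++ A :: r) ks = unqAt (l ++ .quest s A :: r) (l.length :: ks) := by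
  unfold unqAt; apply List.ext_getElem?
  intro k; rw [List.getElem?_mapIdx, List.getElem?_mapIdx]
  rcases lt_trichotomy k l.length with h1 | rfl | h1
  · grind
  · simp [h, Fm.unquest]
  · grind

theorem unqAt_nil {E : Type u} (Γ : Seq E) : unqAt Γ [] = Γ := by
  apply List.ext_getElem?; intro k
  simp [unqAt]

theorem ancChain_derelict (Γ : Seq Unit) (ks : List ℕ) (hn : ks.Nodup)
    (hk : ∀ k ∈ ks, ∃ A, Γ[k]? = some (.quest () A)) :
    AncChain Γ (ks.map fun k => .mpx k 1) id (unqAt Γ ks) := by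
  induction ks generalizing Γ with
  | nil => simpa [unqAt_nil] using AncChain.nil Γ
  | cons k ks ih =>
    obtain ⟨A, hA⟩ := hk k (by simp)
    obtain ⟨l, r, rfl, rfl⟩ := exists_split hA
    have h1 := ancRule_der l r A
    rw [ancAt_one] at h1; rw [List.nodup_cons] at hn
    have h3 := prem0_mpx l r () A 1
    have := AncChain.cons (d₂ := id) (rs := ks.map fun k => .mpx k 1)
      (Γ' := unqAt (l ++ .quest () A :: r) (l.length :: ks)) h1 (by
        rw [h3, ← unqAt_split hn.1]
        grind)
    simpa using this

section KeyLemma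
variable {E : Type u}

theorem derelictions_eq {E : Type u} (p n : ℕ) : (derelictions p n : List (Rule E)) =
    ((List.range n).filter (· ≠ p)).map fun k => .mpx k 1 := rfl

/-- A promotion followed by derelictions of its context. -/
theorem ancChain_prom (l r : Seq Unit) (A : Fm Unit) (hl : ∀ F ∈ l ++ r, ∃ B, F = .quest () B) :
    AncChain (l ++ .bang () A :: r)
      (.promG l.length :: derelictions l.length (l ++ .bang () A :: r).length) id
      (l.map Fm.unquest ++ A :: r.map Fm.unquest) := by
  have h1 := ancRule_promG l r A hl
  rw [ancAt_one] at h1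
  have h2 : AncChain (l ++ A :: r) (derelictions l.length (l ++ .bang () A :: r).length) id
      (unqAt (l ++ A :: r) ((List.range (l ++ .bang () A :: r).length).filter (· ≠ l.length))) := by
    rw [derelictions_eq]; refine ancChain_derelict _ _ (List.nodup_range.filter _) fun k hk => ?_
    simp only [List.length_append, List.length_cons, ne_eq, decide_not, List.mem_filter,
      List.mem_range, Bool.not_eq_eq_eq_not, Bool.not_true, decide_eq_false_iff_not] at hk
    obtain ⟨hk1, hk2⟩ := hk
    have : ∃ F, (l ++ A :: r)[k]? = some F ∧ F ∈ l ++ r := by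
      rcases lt_or_gt_of_ne hk2 with h | h
      · simp_all
      · obtain ⟨m, rfl⟩ : ∃ m, k = l.length + (m + 1) := ⟨k - l.length - 1, by omega⟩
        simp_all
    grind
  have h3 : unqAt (l ++ A :: r) ((List.range (l ++ .bang () A :: r).length).filter (· ≠ l.length)) =
      l.map Fm.unquest ++ A :: r.map Fm.unquest := by
    apply List.ext_getElem?; grind [unqAt]
  rw [h3] at h2
  have h4 := prem0_promG l r () A
  exact AncChain.cons (d₂ := id) h1 (by rw [h4]; exact h2)

theorem prems_promFU (l r : Seq E) (s : E) (A : Fm E) (R : Rule E)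
    (hR : R = .promF l.length ∨ R = .promU l.length) :
    R.prems (l ++ .bang s A :: r) = [(replaceAt (l ++ .bang s A :: r) l.length [A]).map fun o =>
        if o.anc = some l.length then o else { o with fm := o.fm.unquest }] := by
  rcases hR with rfl | rfl <;> simp [Rule.prems]

theorem ctxOcc_unquest (l : Seq E) (n p : ℕ) (h : ∀ k, n ≤ k → k < n + l.length → k ≠ p) :
    (ctxOcc l n).map (fun o => if o.anc = some p then o else { o with fm := o.fm.unquest }) =
      ctxOcc (l.map Fm.unquest) n := by
  unfold ctxOcc; rw [List.zipIdx_map, List.map_map, List.map_map]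
  grind [List.map_congr_left]

theorem prems_promFU' (l r : Seq E) (s : E) (A : Fm E) (R : Rule E)
    (hR : R = .promF l.length ∨ R = .promU l.length) :
    R.prems (l ++ .bang s A :: r) = [ctxOcc (l.map Fm.unquest) 0 ++
      ⟨some l.length, 0, A⟩ :: ctxOcc (r.map Fm.unquest) (l.length + 1)] := by
  rw [prems_promFU l r s A R hR, replaceAt_split, List.map_append, List.map_append,
    ctxOcc_unquest _ _ _ (by omega), ctxOcc_unquest _ _ _ (by omega)]
  simp

theorem prem0_promFU (l r : Seq E) (s : E) (A : Fm E) (R : Rule E)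
    (hR : R = .promF l.length ∨ R = .promU l.length) :
    R.prem0 (l ++ .bang s A :: r) = l.map Fm.unquest ++ A :: r.map Fm.unquest := by
  rw [Rule.prem0, prems_promFU' l r s A R hR]; simp [ctxOcc_fm]

/-- The context of a correct promotion. -/
theorem Rule.Ok.prom_split {S : Sig E} {Γ : Seq E} {R : Rule E} {p : ℕ} (h : R.Ok S Γ)
    (hp : R.promPos = some p) : ∃ l r s A, Γ = l ++ .bang s A :: r ∧ l.length = p ∧
      ∀ F ∈ l ++ r, ∃ t B, F = Fm.quest t B := by
  have key : ∀ (le : E → E → Prop), (∃ s A, Γ[p]? = some (.bang s A) ∧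
      ∀ k F, k ≠ p → Γ[k]? = some F → ∃ t B, F = .quest t B ∧ le s t) →
      ∃ l r s A, Γ = l ++ .bang s A :: r ∧ l.length = p ∧
      ∀ F ∈ l ++ r, ∃ t B, F = Fm.quest t B := by
    rintro le ⟨s, A, hA, h⟩; obtain ⟨l, r, rfl, rfl⟩ := exists_split hA
    refine ⟨l, r, s, A, rfl, rfl, fun F hF => ?_⟩
    rcases List.mem_append.mp hF with hF | hF
    · obtain ⟨k, hk, rfl⟩ := List.getElem_of_mem hF
      obtain ⟨t, B, h, -⟩ := h k l[k] (by omega) (by rw [List.getElem?_append_left hk]; simp)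
      exact ⟨t, B, h⟩
    · obtain ⟨k, hk, rfl⟩ := List.getElem_of_mem hF
      obtain ⟨t, B, h, -⟩ := h (l.length + (k + 1)) r[k] (by omega) (by grind)
      exact ⟨t, B, h⟩
  cases R with
  | promG q => simp [Rule.promPos] at hp; subst hp; exact key _ h
  | promF q => simp [Rule.promPos] at hp; subst hp; exact key _ h
  | promU q => simp [Rule.promPos] at hp; subst hp; exact key _ h.2
  | _ => simp [Rule.promPos] at hp

/-- A rule is translated either into a rule of the same form, or into a chain of unary rules
with the same ancestors. -/
theorem Rule.Ok.tr_cases {S : Sig E} {Γ : Seq E} {R : Rule E} (h : R.Ok S Γ) :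
    (R.Plain ∧ ¬ R.IsF ∧ ¬ R.IsU) ∨
    (R.arity = 1 ∧ ∃ d, AncChain (Γ.map Fm.tr) (R.tr Γ) d ((R.prem0 Γ).map Fm.tr) ∧
      ∀ j o, ((R.prems Γ)[0]?.getD [])[j]? = some o → o.anc = some (d j)) := by
  have hF : ∀ p, R = .promF p ∨ R = .promU p → R.arity = 1 ∧ ∃ d, AncChain (Γ.map Fm.tr) (R.tr Γ) d
      ((R.prem0 Γ).map Fm.tr) ∧
      ∀ j o, ((R.prems Γ)[0]?.getD [])[j]? = some o → o.anc = some (d j) := by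
    intro p hR
    obtain ⟨l, r, s, A, rfl, rfl, hc⟩ := h.prom_split (p := p) (by rcases hR with rfl | rfl <;> rfl)
    have hc' : ∀ F ∈ l.map Fm.tr ++ r.map Fm.tr, ∃ B, F = .quest () B := by
      rw [← List.map_append]; intro F hF
      obtain ⟨G, hG, rfl⟩ := List.mem_map.mp hF; obtain ⟨t, B, rfl⟩ := hc G hG
      exact ⟨B.tr, rfl⟩
    have := ancChain_prom (l.map Fm.tr) (r.map Fm.tr) A.tr hc'
    have htr : R.tr (l ++ .bang s A :: r) =
        .promG l.length :: derelictions l.length (l ++ .bang s A :: r).length := by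
      rcases hR with rfl | rfl <;> rfl
    have hu : ∀ l' : Seq E, (∀ F ∈ l', ∃ t B, F = Fm.quest t B) →
        (l'.map Fm.unquest).map Fm.tr = (l'.map Fm.tr).map Fm.unquest := by
      grind [List.map_congr_left, Fm.tr_unquest]
    refine ⟨by rcases hR with rfl | rfl <;> rfl, id, ?_, ?_⟩
    · rw [htr, prem0_promFU l r s A R hR]
      simp only [List.map_append, List.map_cons, Fm.tr, hu l fun F hF => hc F (by simp [hF]),
        hu r fun F hF => hc F (by simp [hF])]
      simpa using this
    · intro j o ho; rw [prems_promFU l r s A R hR] at ho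
      simp only [List.length_cons, List.length_nil, Nat.zero_add, Nat.lt_add_one, getElem?_pos,
        List.getElem_cons_zero, Option.getD_some, List.getElem?_map, replaceAt_get] at ho
      simp only [id]; split_ifs at ho with h1 h2
      · rcases h3 : l[j]? with _ | B
        · simp [h3] at ho
        · simp [h3] at ho; subst ho; split_ifs <;> rfl
      · grind
      · simp only [Option.map_map, Option.map_eq_some_iff, Function.comp_apply] at ho
        obtain ⟨B, -, rfl⟩ := ho; split_ifs <;> simp
  have hpl : ∀ R : Rule E, R.tr Γ = [R.tr1] → (∀ p, R ≠ .promF p ∧ R ≠ .promU p) →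
      ((∀ Γ : Seq E, R.tr Γ = [R.tr1]) ∧ ¬ R.IsF ∧ ¬ R.IsU) ∨
      (R.arity = 1 ∧ ∃ d, AncChain (Γ.map Fm.tr) (R.tr Γ) d ((R.prem0 Γ).map Fm.tr) ∧
      ∀ j o, ((R.prems Γ)[0]?.getD [])[j]? = some o → o.anc = some (d j)) := by
    intro R h1 h2
    refine Or.inl ⟨fun Γ' => ?_, fun ⟨p, hp⟩ => (h2 p).1 hp, fun ⟨p, hp⟩ => (h2 p).2 hp⟩
    cases R with
    | promF p => exact absurd rfl (h2 p).1
    | promU p => exact absurd rfl (h2 p).2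
    | mpx p i => cases i <;> exact h1
    | contr p i => rcases i with _ | _ | i <;> exact h1
    | _ => exact h1
  cases R with
  | promF p => exact Or.inr (hF p (Or.inl rfl))
  | promU p => exact Or.inr (hF p (Or.inr rfl))
  | mpx p i =>
    rcases i with _ | i
    · exact hpl _ rfl (by simp)
    · right; obtain ⟨s, A, hA, -⟩ := h
      obtain ⟨l, r, rfl, rfl⟩ := exists_split hA; refine ⟨rfl, ancAt l.length (i + 1), ?_, ?_⟩
      · rw [prem0_mpx]
        have h1 := ancChain_contrs (l.map Fm.tr) (r.map Fm.tr) A.tr i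
        have h2 := ancChain_ders (l.map Fm.tr) (r.map Fm.tr) A.tr (i + 1)
        have := h1.append h2
        simpa [Rule.tr, Fm.tr, contrs, ders] using this
      grind [prems_mpx, replaceAt_get, ancAt]
  | contr p i =>
    rcases i with _ | _ | i
    · exact absurd h.1 (by omega)
    · exact absurd h.1 (by omega)
    · right; obtain ⟨-, s, A, hA, -⟩ := h
      obtain ⟨l, r, rfl, rfl⟩ := exists_split hA; refine ⟨rfl, ancAt l.length (i + 2), ?_, ?_⟩
      · rw [prem0_contr]
        have h1 := ancChain_contrs (l.map Fm.tr) (r.map Fm.tr) A.tr (i + 1)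
        simpa [Rule.tr, Fm.tr, contrs] using h1
      grind [prems_contr, replaceAt_get, ancAt]
  | _ => exact hpl _ rfl (by simp)

end KeyLemma

section TrProof
variable {E : Type u} {S : Sig E}

/-- The states reached when translating a pre-proof. -/
structure GoodState (S : Sig E) (s : Seq Unit × List (Rule Unit) × Pf E) : Prop where
  pre : s.2.2.IsPreproof S
  closed : ∀ A ∈ s.1, A.ClosedAt 0
  cases : (s.2.1 = [] ∧ s.1 = s.2.2.concl.map Fm.tr) ∨
    (s.2.2.rule.arity = 1 ∧ s.2.1 ≠ [] ∧ ∃ d, AncChain s.1 s.2.1 d ((s.2.2.kid 0).concl.map Fm.tr))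

theorem Pf.LocalOk.kid_concl {π : Pf E} (h : π.LocalOk S) {k : ℕ} (hk : k < π.rule.arity) :
    (π.kid k).concl = (π.occs k).map Occ.fm := h.2.2 k _ (Pf.child_of_lt hk)

theorem goodState_head {π : Pf E} (h : π.IsPreproof S) :
    GoodState S (π.concl.map Fm.tr, [], π) := by
  refine ⟨h, fun A hA => ?_, Or.inl ⟨rfl, rfl⟩⟩
  obtain ⟨B, hB, rfl⟩ := List.mem_map.mp hA; exact (Fm.tr_closedAt _ _).mpr (h.localOk.1 B hB)

theorem GoodState.cases' {s : Seq Unit × List (Rule Unit) × Pf E} (h : GoodState S s) :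
    (s.1 = s.2.2.concl.map Fm.tr ∧ s.2.2.rule.Plain ∧ ¬ s.2.2.rule.IsF ∧ ¬ s.2.2.rule.IsU ∧
      remRules s = [s.2.2.rule.tr1]) ∨
    (s.2.2.rule.arity = 1 ∧ ∃ d, AncChain s.1 (remRules s) d ((s.2.2.kid 0).concl.map Fm.tr)) := by
  rcases h.cases with ⟨h1, h2⟩ | ⟨h0, h1, d, hd⟩
  · have hok := h.pre.localOk
    rcases hok.2.1.tr_cases with ⟨h3, h4, h5⟩ | ⟨h3, d, hd, -⟩
    · exact Or.inl ⟨h2, h3, h4, h5, by simp [remRules, h1, h3 _]⟩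
    · refine Or.inr ⟨h3, d, ?_⟩; rw [hok.kid_concl (by omega)]
      simp only [remRules, h1, h2, if_true]; exact hd
  · exact Or.inr ⟨h0, d, by simpa [remRules, h1] using hd⟩

theorem AncRule.prem0_closed {Γ : Seq Unit} {r : Rule Unit} {d : ℕ → ℕ} (h : AncRule Γ r d)
    (hc : ∀ A ∈ Γ, A.ClosedAt 0) : ∀ A ∈ r.prem0 Γ, A.ClosedAt 0 := by
  intro A hA; obtain ⟨o, ho, rfl⟩ := List.mem_map.mp hA
  obtain ⟨j, hj, rfl⟩ := List.getElem_of_mem ho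
  obtain ⟨-, F, hF, h1⟩ := h.anc j _ (List.getElem?_eq_getElem hj)
  have := hc F (List.mem_of_getElem? hF)
  rcases h1 with rfl | rfl | rfl <;> exact this

theorem GoodState.next {s : Seq Unit × List (Rule Unit) × Pf E} (h : GoodState S s) {k : ℕ}
    (hk : k < (trS s).rule.arity) : GoodState S (nextState s k) ∧
      (trS (nextState s k)).concl = ((trS s).occs k).map Occ.fm := by
  rcases h.cases' with ⟨h1, h2, h3, h4, h5⟩ | ⟨h1, d, hd⟩
  · have hn : nextState s k = ((s.2.2.kid k).concl.map Fm.tr, [], s.2.2.kid k) := by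
      rw [nextState, h5]
    have hok := h.pre.localOk
    rw [trS_rule s h5, Rule.tr1_arity] at hk; rw [hn]
    refine ⟨goodState_head (h.pre.child (Pf.child_of_lt hk)), ?_⟩
    rw [trS_concl, hok.kid_concl hk, Pf.occs, Pf.occs, trS_rule s h5, trS_concl, h1, Rule.prems_tr hok.2.1 h3 h4,
      List.getElem?_map]
    rcases (Rule.prems s.2.2.concl s.2.2.rule)[k]? with _ | O
    · rfl
    · simp [Function.comp_def, Occ.tr]
  · rcases hr : remRules s with _ | ⟨r, rs⟩
    · exact absurd hr (remRules_ne_nil s)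
    rw [hr] at hd; rcases hd with _ | ⟨ha, hd⟩
    have hk0 : k = 0 := by
      rw [trS_rule s hr, ha.arity] at hk; omega
    subst hk0
    have hocc : ((trS s).occs 0).map Occ.fm = r.prem0 s.1 := by
      rw [Pf.occs, trS_rule s hr, trS_concl]; rfl
    rw [hocc]; rcases rs with _ | ⟨r', rs⟩
    · have hn : nextState s 0 = ((s.2.2.kid 0).concl.map Fm.tr, [], s.2.2.kid 0) := by
        rw [nextState, hr]
      rw [hn]; refine ⟨goodState_head (h.pre.child (Pf.child_of_lt (by omega))), ?_⟩
      rw [trS_concl]; generalize hg : (s.2.2.kid 0).concl.map Fm.tr = Γ' at hd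
      cases hd
      rfl
    · have hn : nextState s 0 = (r.prem0 s.1, r' :: rs, s.2.2) := by rw [nextState, hr]
      rw [hn]; exact ⟨⟨h.pre, ha.prem0_closed h.closed, Or.inr ⟨h1, by simp, _, hd⟩⟩, trS_concl _⟩

theorem GoodState.llOk {s : Seq Unit × List (Rule Unit) × Pf E} (h : GoodState S s) :
    (trS s).LLOk := by
  have hch : ∀ k ρ, (trS s).child k = some ρ → ρ.concl = ((trS s).occs k).map Occ.fm := by
    intro k ρ hρ
    have hk := Pf.child_lt hρ
    rw [trS_child, if_pos hk] at hρ; rw [← Option.some.inj hρ]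
    exact (h.next hk).2
  rcases h.cases' with ⟨h1, h2, h3, h4, h5⟩ | ⟨h1, d, hd⟩
  · have hok := h.pre.localOk
    have hr : (trS s).rule = s.2.2.rule.tr1 := trS_rule s h5
    refine ⟨⟨by rw [trS_concl]; exact h.closed, ?_, hch⟩, ?_, ?_⟩
    · rw [trS_concl, hr, h1]; exact hok.2.1.tr1 h3 h4 h2
    · rw [hr]; rintro ⟨p, hp⟩
      apply h3; revert hp
      cases s.2.2.rule <;> simp [Rule.tr1, Rule.IsF]
    · rw [hr]; rintro ⟨p, hp⟩
      apply h4; revert hp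
      cases s.2.2.rule <;> simp [Rule.tr1, Rule.IsU]
  · rcases hr : remRules s with _ | ⟨r, rs⟩
    · exact absurd hr (remRules_ne_nil s)
    rw [hr] at hd; rcases hd with _ | ⟨ha, hd⟩
    have hr' : (trS s).rule = r := trS_rule s hr
    refine ⟨⟨by rw [trS_concl]; exact h.closed, ?_, hch⟩, ?_, ?_⟩
    · rw [trS_concl, hr']; exact ha.ok
    · rw [hr']; exact ha.notF
    · rw [hr']; exact ha.notU

theorem GoodState.isLLPreproof {s : Seq Unit × List (Rule Unit) × Pf E} (h : GoodState S s) :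
    (trS s).IsLLPreproof := by
  refine Pf.isLLPreproof_coind (fun π => ∃ s, GoodState S s ∧ π = trS s) ?_ ?_ ⟨s, h, rfl⟩
  · rintro _ ⟨s, hs, rfl⟩; exact hs.llOk
  · rintro _ ⟨s, hs, rfl⟩ k ρ hk
    have hlt := Pf.child_lt hk
    rw [trS_child, if_pos hlt] at hk; exact ⟨_, (hs.next hlt).1, (Option.some.inj hk).symm⟩

/-! ### Validity of the translation -/

/-- The ancestor of the `j`-th occurrence. -/
def ancOf (O : List (Occ Unit)) (j : ℕ) : ℕ := (O[j]?.bind Occ.anc).getD 0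

/-- The ancestor, below the rules `rs`, of the position `j` of the `k`-th premise of the last of
these rules, all others being unary. -/
def down : Seq Unit → List (Rule Unit) → ℕ → ℕ → ℕ
  | _, [], _, j => j
  | Γ, [r], k, j => ancOf ((r.prems Γ)[k]?.getD []) j
  | Γ, r :: r' :: rs, k, j => ancOf ((r.prems Γ)[0]?.getD []) (down (r.prem0 Γ) (r' :: rs) k j)

theorem AncRule.ancOf_eq {Γ : Seq Unit} {r : Rule Unit} {d : ℕ → ℕ} (h : AncRule Γ r d) {j : ℕ}
    {G : Fm Unit} (hj : (r.prem0 Γ)[j]? = some G) :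
    ancOf ((r.prems Γ)[0]?.getD []) j = d j ∧
      (∃ o, ((r.prems Γ)[0]?.getD [])[j]? = some o ∧ o.anc = some (d j)) ∧
      ∃ F, Γ[d j]? = some F ∧ ∀ B : Fm Unit, B.IsSub G → B.IsSub F := by
  rw [Rule.prem0, List.getElem?_map, Option.map_eq_some_iff] at hj; obtain ⟨o, ho, rfl⟩ := hj
  obtain ⟨h1, F, hF, h2⟩ := h.anc j o ho
  refine ⟨by simp [ancOf, ho, h1], ⟨o, ho, h1⟩, F, hF, fun B hB => ?_⟩
  rcases h2 with rfl | rfl | rfl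
  · exact hB
  · exact .quest hB
  · exact .bang hB

theorem AncChain.down_eq {Γ Γ' : Seq Unit} {rs : List (Rule Unit)} {d : ℕ → ℕ}
    (h : AncChain Γ rs d Γ') {j : ℕ} {G : Fm Unit} (hj : Γ'[j]? = some G) :
    down Γ rs 0 j = d j ∧ ∃ F, Γ[d j]? = some F ∧ ∀ B : Fm Unit, B.IsSub G → B.IsSub F := by
  induction h with
  | nil => exact ⟨rfl, G, hj, fun B hB => hB⟩
  | @cons Γ r rs d₁ d₂ Γ' ha hd ih =>
    obtain ⟨h1, F, hF, h2⟩ := ih hj; obtain ⟨h3, -, F', hF', h4⟩ := ha.ancOf_eq hF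
    refine ⟨?_, F', hF', fun B hB => h4 B (h2 B hB)⟩
    rcases rs with _ | ⟨r', rs⟩
    all_goals grind [down]

theorem trS_valid {π : Pf E} (h : π.IsProof S) : π.tr.Val := by
  intro f k ⟨hf0, hf⟩
  -- the states along the branch
  obtain ⟨s, hs0, hs⟩ : ∃ s : ℕ → Seq Unit × List (Rule Unit) × Pf E,
      s 0 = (π.concl.map Fm.tr, [], π) ∧ ∀ i, s (i + 1) = nextState (s i) (k i) :=
    ⟨fun i => Nat.rec (π.concl.map Fm.tr, [], π) (fun i s => nextState s (k i)) i, rfl, fun _ => rfl⟩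
  have hfs : ∀ i, f i = trS (s i) := by
    intro i
    induction i with
    | zero => rw [hf0, hs0]; rfl
    | succ i ih => grind [trS_child]
  have hkl : ∀ i, k i < (trS (s i)).rule.arity := fun i => by
    have := Pf.child_lt (hf i)
    rwa [hfs] at this
  have hg : ∀ i, GoodState S (s i) := by
    intro i
    induction i with
    | zero => rw [hs0]; exact goodState_head h.1
    | succ i ih => rw [hs]; exact (ih.next (hkl i)).1
  obtain ⟨R, hR⟩ : ∃ R : ℕ → List (Rule Unit), ∀ i, R i = remRules (s i) := ⟨_, fun _ => rfl⟩
  have hRne : ∀ i, 0 < (R i).length := fun i => by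
    rw [hR]; exact List.length_pos_of_ne_nil (remRules_ne_nil _)
  have hstep : ∀ i r r' rs, R i = r :: r' :: rs →
      s (i + 1) = (r.prem0 (s i).1, r' :: rs, (s i).2.2) ∧ R (i + 1) = r' :: rs := by
    grind [nextState, remRules]
  have hlast : ∀ i, (R i).length = 1 →
      s (i + 1) = (((s i).2.2.kid (k i)).concl.map Fm.tr, [], (s i).2.2.kid (k i)) := by
    grind [nextState]
  -- the starting times of the translations of the nodes
  obtain ⟨T, hT0, hT⟩ : ∃ T : ℕ → ℕ, T 0 = 0 ∧ ∀ j, T (j + 1) = T j + (R (T j)).length :=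
    ⟨fun j => Nat.rec 0 (fun _ t => t + (R t).length) j, rfl, fun _ => rfl⟩
  have hin : ∀ j m, m < (R (T j)).length →
      (s (T j + m)).2.2 = (s (T j)).2.2 ∧ R (T j + m) = (R (T j)).drop m := by
    intro j m
    induction m with
    | zero => intro _; simp
    | succ m ih =>
      intro hm; obtain ⟨h1, h2⟩ := ih (by omega)
      rcases hd : (R (T j)).drop m with _ | ⟨r, _ | ⟨r', rs⟩⟩
      all_goals grind [List.tail_drop]
  have hend : ∀ j, (R (T j + ((R (T j)).length - 1))).length = 1 := by
    intro j
    have := hRne (T j)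
    rw [(hin j _ (by omega)).2, List.length_drop]
    omega
  obtain ⟨g, hgd⟩ : ∃ g : ℕ → Pf E, ∀ j, g j = (s (T j)).2.2 := ⟨_, fun _ => rfl⟩
  obtain ⟨κ, hκ⟩ : ∃ κ : ℕ → ℕ, ∀ j, κ j = k (T j + ((R (T j)).length - 1)) := ⟨_, fun _ => rfl⟩
  have hhead : ∀ j, s (T j) = ((g j).concl.map Fm.tr, [], g j) := by
    intro j; rcases j with _ | j
    · rw [hgd, hT0, hs0]
    · have h1 := hlast _ (hend j)
      have h2 := hRne (T j)
      rw [show T j + ((R (T j)).length - 1) + 1 = T (j + 1) by rw [hT]; omega] at h1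
      rw [hgd, h1]
  have hnext : ∀ j, g (j + 1) = (g j).kid (κ j) := by
    intro j
    have h1 := hlast _ (hend j)
    have h2 := hRne (T j)
    rw [show T j + ((R (T j)).length - 1) + 1 = T (j + 1) by rw [hT]; omega] at h1
    rw [hgd (j + 1), h1, (hin j _ (by omega)).1, ← hgd, ← hκ]
  -- the two kinds of blocks
  have hkind : ∀ j, ((g j).rule.Plain ∧ ¬ (g j).rule.IsF ∧ ¬ (g j).rule.IsU ∧
        R (T j) = [(g j).rule.tr1]) ∨
      ((g j).rule.arity = 1 ∧ κ j = 0 ∧ ∀ m, m < (R (T j)).length → k (T j + m) = 0) := by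
    intro j; rcases (hg (T j)).cases' with ⟨-, h1, h2, h3, h4⟩ | ⟨h1, d, hd⟩
    · rw [← hgd, ← hR] at *; exact Or.inl ⟨h1, h2, h3, h4⟩
    · right
      have key : ∀ m, m < (R (T j)).length → k (T j + m) = 0 := by
        intro m hm
        have h5 := hkl (T j + m)
        rcases hd' : R (T j + m) with _ | ⟨r, rs⟩
        · have := hRne (T j + m); simp [hd'] at this
        · rw [trS_rule _ ((hR _).symm.trans hd')] at h5
          have h6 : r ∈ R (T j) := by grind [List.mem_cons_self]
          rw [hR] at h6; rw [hd.arity r h6] at h5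
          omega
      refine ⟨by rw [hgd]; exact h1, ?_, key⟩
      rw [hκ]; exact key _ (by have := hRne (T j); omega)
  have hκl : ∀ j, κ j < (g j).rule.arity := by
    intro j; rcases hkind j with ⟨h1, h2, h3, h4⟩ | ⟨h1, h2, -⟩
    · have h5 := hkl (T j)
      rw [trS_rule _ ((hR _).symm.trans h4), Rule.tr1_arity] at h5; rw [hκ, h4]
      exact h5
    · omega
  obtain ⟨N, t, A, ht1, ht2, ht3⟩ := h.2 g κ ⟨by rw [hgd, hT0, hs0], fun j => by
    rw [hnext, Pf.child_of_lt (hκl j)]⟩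
  -- the current block
  obtain ⟨J, hJ0, hJ⟩ : ∃ J : ℕ → ℕ, J 0 = 0 ∧
      ∀ i, J (i + 1) = if (R i).length = 1 then J i + 1 else J i :=
    ⟨fun i => Nat.rec 0 (fun i j => if (R i).length = 1 then j + 1 else j) i, rfl, fun _ => rfl⟩
  have hJT : ∀ i, ∃ m, i = T (J i) + m ∧ m < (R (T (J i))).length := by
    intro i
    induction i with
    | zero => exact ⟨0, by rw [hJ0, hT0], hRne _⟩
    | succ i ih =>
      obtain ⟨m, hm1, hm2⟩ := ih
      have h1 := (hin _ _ hm2).2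
      rw [← hm1] at h1
      have h2 := congrArg List.length h1
      rw [List.length_drop] at h2; rw [hJ]
      split_ifs with h3
      · exact ⟨0, by rw [hT]; omega, hRne _⟩
      · exact ⟨m + 1, by omega, by omega⟩
  have hTmono : ∀ a b, a < b → T a + (R (T a)).length ≤ T b := by
    intro a b hab
    induction b with
    | zero => omega
    | succ b ih =>
      rcases Nat.lt_succ_iff_lt_or_eq.mp hab with h1 | rfl
      · have := ih h1
        rw [hT]; omega
      · rw [hT]
  have hJu : ∀ i j m, i = T j + m → m < (R (T j)).length → J i = j := by
    intro i j m h1 h2; obtain ⟨m', h3, h4⟩ := hJT i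
    rcases lt_trichotomy (J i) j with h5 | h5 | h5
    · have := hTmono _ _ h5; omega
    · exact h5
    · have := hTmono _ _ h5; omega
  have hgj : ∀ j, (g j).IsPreproof S := fun j => by rw [hgd]; exact (hg _).pre
  -- the thread
  obtain ⟨u, hu⟩ : ∃ u : ℕ → ℕ, ∀ i, u i = down (s i).1 (R i) (κ (J i)) (t (J i + 1)) :=
    ⟨_, fun _ => rfl⟩
  have hform : ∀ j, N ≤ j → ∃ F, ((g j).concl.map Fm.tr)[t j]? = some F ∧ (Fm.nu A.tr).IsSub F := by
    intro j hj; obtain ⟨F, hF, hs⟩ := ht2 j hj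
    exact ⟨F.tr, by simp [hF], hs.tr⟩
  have hchain : ∀ i, (g (J i)).rule.arity = 1 → κ (J i) = 0 →
      (∃ d, AncChain (s (T (J i))).1 (R (T (J i))) d (((g (J i)).kid 0).concl.map Fm.tr)) →
      ∃ d, AncChain (s i).1 (R i) d ((g (J i + 1)).concl.map Fm.tr) := by
    intro i h1 h2 ⟨d0, hd0⟩; obtain ⟨m, hm1, hm2⟩ := hJT i
    rw [hnext, h2]; generalize hj : J i = j at *
    have key : ∀ m, m < (R (T j)).length →
        ∃ d, AncChain (s (T j + m)).1 (R (T j + m)) d (((g j).kid 0).concl.map Fm.tr) := by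
      intro m
      induction m with
      | zero => exact fun _ => ⟨d0, hd0⟩
      | succ m ih =>
        intro hm; obtain ⟨d, hd⟩ := ih (by omega)
        rcases hd' : R (T j + m) with _ | ⟨r, _ | ⟨r', rs⟩⟩
        · have := hRne (T j + m); simp [hd'] at this
        · have := congrArg List.length ((hin j m (by omega)).2)
          rw [hd'] at this; simp at this; omega
        · obtain ⟨h3, h4⟩ := hstep _ r r' rs hd'; rw [hd'] at hd
          rcases hd with _ | ⟨ha, hd⟩; rw [← Nat.add_assoc, h3, h4]
          exact ⟨_, hd⟩
    rw [hm1]; exact key m hm2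
  have hheadpos : ∀ j, N ≤ j → u (T j) = t j := by
    intro j hj
    have hJj : J (T j) = j := hJu _ j 0 rfl (hRne _)
    rw [hu, hJj, hhead]; obtain ⟨o, ho, ha⟩ := ht1 j hj
    have hok := (hgj j).localOk
    rcases hok.2.1.tr_cases with ⟨h1, h2, h3⟩ | ⟨h1, d, hd, hd'⟩
    · have hRj : R (T j) = [(g j).rule.tr1] := by rw [hR, hhead]; simp [remRules, h1 _]
      rw [hRj, down, Rule.prems_tr hok.2.1 h2 h3, ancOf]; rw [Pf.occs] at ho
      rw [List.getElem?_map]; rcases hO : ((g j).rule.prems (g j).concl)[κ j]? with _ | O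
      · simp [hO] at ho
      · simp [hO] at ho; simp [ho, Occ.tr, ha]
    · have hRj : R (T j) = (g j).rule.tr (g j).concl := by rw [hR, hhead]; simp [remRules]
      have hk0 : κ j = 0 := by have := hκl j; omega
      obtain ⟨F, hF, -⟩ := hform (j + 1) (by omega)
      rw [hnext, hk0, hok.kid_concl (by omega)] at hF
      rw [hk0, hRj, (hd.down_eq hF).1]; rw [hk0] at ho
      have := hd' _ _ ho
      rw [ha] at this; exact (Option.some.inj this).symm
  have hlater : ∀ i, N ≤ i → N ≤ J (i + T N) := by
    intro i hi; obtain ⟨m, h1, h2⟩ := hJT (i + T N)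
    by_contra hlt
    have := hTmono _ _ (not_le.mp hlt)
    omega
  -- one step of the thread, and the formulas on it
  have hmain : ∀ i, N ≤ J i → (∃ o, ((f i).occs (k i))[u (i + 1)]? = some o ∧ o.anc = some (u i)) ∧
      ∃ F, (f i).concl[u i]? = some F ∧ (Fm.nu A.tr).IsSub F := by
    intro i hi; obtain ⟨m, hm1, hm2⟩ := hJT i
    have hend' : (R i).length = 1 → J (i + 1) = J i + 1 ∧ u (i + 1) = t (J i + 1) := by
      intro h1
      have h2 : J (i + 1) = J i + 1 := by rw [hJ, if_pos h1]
      have h3 : i + 1 = T (J i + 1) := by grind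
      exact ⟨h2, by rw [h3, hheadpos _ (by omega)]⟩
    rcases (hg (T (J i))).cases' with ⟨-, h1, h2, h3, h4⟩ | ⟨h1, d, hd⟩
    · rw [← hR] at h4; rw [← hgd] at h1 h2 h3 h4
      have hm0 : m = 0 := by rw [h4] at hm2; simpa using hm2
      have hiT : i = T (J i) := by omega
      obtain ⟨o, ho, ha⟩ := ht1 (J i) hi; obtain ⟨F, hF, hFs⟩ := hform (J i) hi
      have hok := (hgj (J i)).localOk
      have hlen : (R i).length = 1 := by rw [hiT, h4]; rfl
      have hui : u i = t (J i) := by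
        have := hheadpos (J i) hi
        rwa [← hiT] at this
      have hκi : κ (J i) = k i := by rw [hκ, h4]; simp [← hiT]
      have hsi : s i = ((g (J i)).concl.map Fm.tr, [], g (J i)) := by
        have := hhead (J i)
        rwa [← hiT] at this
      have hRi : remRules (s i) = [(g (J i)).rule.tr1] := by rw [← hR, ← h4, ← hiT]
      refine ⟨⟨o.tr, ?_, ?_⟩, F, ?_, hFs⟩
      · rw [hfs, Pf.occs, trS_rule _ hRi, trS_concl, hsi, Rule.prems_tr hok.2.1 h2 h3, (hend' hlen).2,
          List.getElem?_map]
        rw [Pf.occs, hκi] at ho; rcases hO : ((g (J i)).rule.prems (g (J i)).concl)[k i]? with _ | O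
        · simp [hO] at ho
        · simp [hO] at ho; simp [ho]
      · rw [hui]; exact ha
      · rw [hfs, trS_concl, hsi, hui]; exact hF
    · rw [← hR, ← hgd] at hd
      have hk0 : κ (J i) = 0 := by
        have h5 := hκl (J i)
        rw [← hgd] at h1; omega
      obtain ⟨d', hd'⟩ := hchain i (by rw [hgd]; exact h1) hk0 ⟨d, hd⟩
      obtain ⟨G, hG, hGs⟩ := hform (J i + 1) (by omega)
      rcases hRi : R i with _ | ⟨r, rs⟩
      · have := hRne i; simp [hRi] at this
      rw [hRi] at hd'
      have hall := hd'.down_eq hG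
      rcases hd' with _ | ⟨ha, hd''⟩
      rename_i d₁ d₂
      obtain ⟨h6, F₁, hF₁, hsub₁⟩ := hd''.down_eq hG
      obtain ⟨h7, ⟨o, ho, hoa⟩, F₂, hF₂, hsub₂⟩ := ha.ancOf_eq hF₁
      have hki : k i = 0 := by
        have h5 := hkl i
        rw [trS_rule _ ((hR _).symm.trans hRi), ha.arity] at h5; omega
      have hui : u i = d₁ (d₂ (t (J i + 1))) := by rw [hu, hk0, hRi, hall.1]; rfl
      have hui1 : u (i + 1) = d₂ (t (J i + 1)) := by
        rcases rs with _ | ⟨r', rs⟩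
        · rw [(hend' (by rw [hRi]; rfl)).2, ← h6]; rfl
        · obtain ⟨h8, h9⟩ := hstep _ r r' rs hRi
          have h10 : J (i + 1) = J i := by rw [hJ, hRi]; simp
          rw [hu, h10, h9, h8, hk0]; exact h6
      refine ⟨⟨o, ?_, ?_⟩, F₂, ?_, hsub₂ _ (hsub₁ _ hGs)⟩
      · rw [hfs, Pf.occs, trS_rule _ ((hR _).symm.trans hRi), trS_concl, hki, hui1]; exact ho
      · rw [hui]; exact hoa
      · rw [hfs, trS_concl, hui]; exact hF₂
  have hNJ : ∀ i, T N ≤ i → N ≤ J i := by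
    intro i hi; obtain ⟨m, h1, h2⟩ := hJT i
    by_contra hlt
    have := hTmono _ _ (not_le.mp hlt)
    omega
  refine ⟨T N, u, A.tr, fun i hi => (hmain i (hNJ i hi)).1, fun i hi => (hmain i (hNJ i hi)).2,
    fun M => ?_⟩
  obtain ⟨j, hj, h1, h2⟩ := ht3 (M + N)
  have hjT : ∀ j, j ≤ T j := by
    intro j
    induction j with
    | zero => omega
    | succ j ih => rw [hT]; have := hRne (T j); omega
  refine ⟨T j, by have := hjT j; omega, ?_, ?_⟩
  · have : remRules (s (T j)) = [.fix (t j)] := by rw [hhead]; simp [remRules, h1, Rule.tr]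
    rw [hfs, trS_rule _ this, hheadpos j (by omega)]
  · rw [hfs, trS_concl, hhead, hheadpos j (by omega)]
    simp [h2, Fm.tr]

theorem Pf.IsProof.tr {π : Pf E} (h : π.IsProof S) : π.tr.IsLLProof :=
  ⟨(goodState_head h.1).isLLPreproof, trS_valid h⟩

end TrProof

/-- `C` puts its argument at the address `b` of a fixed tree. -/
structure IsCtx (b : List ℕ) (C : Pf Unit → Pf Unit) : Prop where
  concl : b ≠ [] → ∀ τ τ', (C τ).concl = (C τ').concl
  sub : ∀ τ e, (C τ).sub (b ++ e) = τ.sub e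
  at_ : ∀ Q τ τ' e, Pf.At Q e τ τ' → Pf.At Q (b ++ e) (C τ) (C τ')
  proof : ∀ τ τ', τ.concl = τ'.concl → (C τ).IsLLProof → τ'.IsLLProof → (C τ').IsLLProof
  arg : ∀ τ, (C τ).IsLLProof → τ.IsLLProof

theorem IsCtx.id : IsCtx [] id where
  concl h := absurd rfl h
  sub _ _ := rfl
  at_ _ _ _ _ h := h
  proof _ _ _ _ h := h
  arg _ h := h

/-- One node, with a hole instead of its `k`-th immediate subtree. -/
def layer (Γ : Seq Unit) (r : Rule Unit) (f : ℕ → Pf Unit) (k : ℕ) (τ : Pf Unit) : Pf Unit :=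
  Pf.mkN Γ r fun l => if l = k then τ else f l

theorem layer_child {Γ : Seq Unit} {r : Rule Unit} {f : ℕ → Pf Unit} {k : ℕ} (hk : k < r.arity)
    (τ : Pf Unit) : (layer Γ r f k τ).child k = some τ := by
  rw [layer, Pf.child_mkN, if_pos hk, if_pos rfl]

theorem layer_child_ne {Γ : Seq Unit} {r : Rule Unit} {f : ℕ → Pf Unit} {k l : ℕ} (hl : l ≠ k)
    (τ : Pf Unit) : (layer Γ r f k τ).child l = if l < r.arity then some (f l) else none := by
  rw [layer, Pf.child_mkN, if_neg hl]

theorem IsCtx.comp_layer {Γ : Seq Unit} {r : Rule Unit} {f : ℕ → Pf Unit} {k : ℕ}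
    (hk : k < r.arity) {b : List ℕ} {C : Pf Unit → Pf Unit} (h : IsCtx b C) :
    IsCtx (k :: b) (fun τ => layer Γ r f k (C τ)) where
  concl _ τ τ' := rfl
  sub τ e := by
    rw [List.cons_append, Pf.sub, layer_child hk]; exact h.sub τ e
  at_ Q τ τ' e ha := by
    refine .child rfl rfl (layer_child hk _) (layer_child hk _) (fun l hl => ?_) (h.at_ Q τ τ' e ha)
    rw [layer_child_ne hl, layer_child_ne hl]
  proof τ τ' hc h1 h2 := by
    have h3 := h.proof τ τ' hc (h1.child (layer_child hk _)) h2
    have h5 : (C τ').concl = (C τ).concl := by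
      by_cases hb : b = []
      · subst hb
        have e : ∀ σ, C σ = σ := fun σ => by simpa [Pf.sub] using h.sub σ []
        rw [e, e, hc]
      · exact h.concl hb _ _
    have hch : ∀ l ρ, (layer Γ r f k (C τ')).child l = some ρ →
        ∃ ρ', (layer Γ r f k (C τ)).child l = some ρ' ∧ ρ.concl = ρ'.concl ∧ ρ.IsLLProof := by
      intro l ρ hρ; by_cases hl : l = k
      · grind [layer_child]
      · rw [layer_child_ne hl] at hρ
        have h4 : (layer Γ r f k (C τ)).child l = some ρ := by rw [layer_child_ne hl]; exact hρ
        exact ⟨ρ, h4, rfl, h1.child h4⟩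
    refine Pf.isLLProof_of ⟨⟨h1.ok.1.1, h1.ok.1.2.1, fun l ρ hρ => ?_⟩, h1.ok.2⟩ fun l ρ hρ => ?_
    · obtain ⟨ρ', h6, h7, -⟩ := hch l ρ hρ; rw [h7]
      exact h1.ok.1.2.2 l ρ' h6
    · obtain ⟨-, -, -, h8⟩ := hch l ρ hρ; exact h8
  arg τ h1 := h.arg τ (h1.child (layer_child hk _))

theorem layer_zero_unary {Γ : Seq Unit} {r : Rule Unit} (hr : r.arity = 1) (f : ℕ → Pf Unit)
    (ρ : Pf Unit) : layer Γ r f 0 ρ = Pf.mk1 Γ r ρ := by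
  refine Pf.ext_child rfl rfl fun k => ?_
  grind [layer_child, layer_child_ne, Pf.mk1, Pf.child_mkN]

theorem IsCtx.comp_mk1 {Γ : Seq Unit} {r : Rule Unit} (hr : r.arity = 1) {b : List ℕ}
    {C : Pf Unit → Pf Unit} (h : IsCtx b C) : IsCtx (0 :: b) (fun τ => Pf.mk1 Γ r (C τ)) := by
  have := IsCtx.comp_layer (Γ := Γ) (r := r) 
    (f := fun _ => PFunctor.M.corec (fun x : Unit => ⟨([], .one), fun _ => x⟩) ()) (k := 0)
    (by omega) h
  simpa only [layer_zero_unary hr] using this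

theorem IsCtx.comp_mkChain {Γ : Seq Unit} {rs : List (Rule Unit)} (hr : ∀ r ∈ rs, r.arity = 1)
    {b : List ℕ} {C : Pf Unit → Pf Unit} (h : IsCtx b C) :
    IsCtx (List.replicate rs.length 0 ++ b) (fun τ => Pf.mkChain Γ rs (C τ)) := by
  induction rs generalizing Γ with
  | nil => exact h
  | cons r rs ih => exact IsCtx.comp_mk1 (hr r (by simp)) (ih fun r' h' => hr r' (by simp [h']))

section
variable {E : Type u} {S : Sig E}

/-- The translation of a rewriting at some address. -/
theorem at_tr {Q : Pf E → Pf E → Prop} {a : List ℕ} {π π' : Pf E} (h : Pf.At Q a π π')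
    (hp : π.IsProof S) (hp' : π'.IsPreproof S) :
    ∃ b C σ σ', Q σ σ' ∧ IsCtx b C ∧ π.tr = C σ.tr ∧ π'.tr = C σ'.tr ∧ σ.IsProof S ∧
      σ'.IsPreproof S := by
  induction h with
  | here h => exact ⟨[], id, _, _, h, IsCtx.id, rfl, rfl, hp, hp'⟩
  | @child k a π π' ρ ρ' h1 h2 h3 h4 h5 h6 ih =>
    obtain ⟨b, C, σ, σ', i1, i2, i3, i4, i5, i6⟩ := ih (hp.child h3) (hp'.child h4)
    have hk := Pf.child_lt h3
    rcases hp.1.localOk.2.1.tr_cases with ⟨e1, e2, e3⟩ | ⟨e1, d, hd, -⟩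
    · refine ⟨k :: b, fun τ => layer (π.concl.map Fm.tr) π.rule.tr1 (fun l => (π.kid l).tr) k (C τ),
        σ, σ', i1, i2.comp_layer (by rw [Rule.tr1_arity]; exact hk), ?_, ?_, i5, i6⟩
      · obtain ⟨t1, t2, t3⟩ := Pf.tr_single (e1 π.concl) (Rule.tr1_arity _)
        refine Pf.ext_child t1 t2 fun l => ?_
        rw [t3]; dsimp only
        rw [← i3]; by_cases hl : l = k
        · grind [layer_child, Rule.tr1_arity]
        · rw [layer_child_ne hl, Rule.tr1_arity]; split_ifs with h7
          · rw [Pf.child_of_lt h7]; rfl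
          · rw [Pf.child_eq_none_iff.mpr (by omega)]; rfl
      · obtain ⟨t1, t2, t3⟩ := Pf.tr_single (π := π') (r := π.rule.tr1)
          (by rw [h1, h2]; exact e1 π.concl) (by rw [h2, Rule.tr1_arity])
        refine Pf.ext_child (by rw [t1, h1]; rfl) t2 fun l => ?_
        rw [t3]; dsimp only
        rw [← i4]; by_cases hl : l = k
        · grind [layer_child, Rule.tr1_arity]
        · rw [layer_child_ne hl, Rule.tr1_arity, h5 l hl]; split_ifs with h7
          · rw [Pf.child_of_lt h7]; rfl
          · rw [Pf.child_eq_none_iff.mpr (by omega)]; rfl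
    · have hk0 : k = 0 := by omega
      subst hk0
      have har := hd.arity
      refine ⟨_, fun τ => Pf.mkChain (π.concl.map Fm.tr) (π.rule.tr π.concl) (C τ), σ, σ', i1,
        i2.comp_mkChain har, ?_, ?_, i5, i6⟩
      · have := (Pf.tr_chain har).eq_mkChain
        rw [Pf.kid_of_child h3, i3] at this; exact this
      · have := (Pf.tr_chain (π := π') (by rw [h1, h2]; exact har)).eq_mkChain
        rw [Pf.kid_of_child h4, i4, h1, h2] at this; exact this

end

/-- A step between proofs of linear logic. -/
def PStep (θ θ' : Pf Unit) : Prop :=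
  θ.IsLLProof ∧ θ'.IsLLProof ∧ θ.concl = θ'.concl ∧ ∃ a, Pf.At LLRed a θ θ'

/-- A permutation of two rules standing below all multicuts. -/
def PermZone (g : Bool) (θ θ' : Pf Unit) : Prop :=
  ∃ d : List ℕ, (∀ e, e <+: d → ∀ ρ, θ.sub e = some ρ → ¬ ρ.rule.IsMcutRule) ∧
    Pf.At (PermRoot g) d θ θ'

theorem IsCtx.pStep {b : List ℕ} {C : Pf Unit → Pf Unit} (hC : IsCtx b C) {τ τ' : Pf Unit}
    (h0 : (C τ).IsLLProof) (h : PStep τ τ') : PStep (C τ) (C τ') := by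
  obtain ⟨h1, h2, h3, a, h4⟩ := h; refine ⟨h0, hC.proof τ τ' h3 h0 h2, ?_, _, hC.at_ _ _ _ _ h4⟩
  by_cases hb : b = []
  · subst hb
    have e : ∀ σ, C σ = σ := fun σ => by simpa [Pf.sub] using hC.sub σ []
    rw [e, e, h3]
  · exact hC.concl hb _ _

theorem IsCtx.pSteps {b : List ℕ} {C : Pf Unit → Pf Unit} (hC : IsCtx b C) {τ τ' : Pf Unit}
    (h0 : (C τ).IsLLProof) (h : ReflTransGen PStep τ τ') : ReflTransGen PStep (C τ) (C τ') := by
  induction h with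
  | refl => exact .refl
  | @tail x y h1 h2 ih =>
    refine ih.tail (hC.pStep ?_ h2); rcases ReflTransGen.cases_tail ih with h | ⟨z, -, h⟩
    · rw [h]; exact h0
    · exact h.2.1

theorem reflTransGen_seq {α : Type*} {R : α → α → Prop} {x y : α} (h : ReflTransGen R x y) :
    ∃ (n : ℕ) (θ : ℕ → α), θ 0 = x ∧ θ n = y ∧ ∀ i < n, R (θ i) (θ (i + 1)) := by
  induction h with
  | refl => exact ⟨0, fun _ => x, rfl, rfl, by simp⟩
  | @tail b c _ hbc ih =>
    obtain ⟨n, θ, h0, hn, hs⟩ := ih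
    refine ⟨n + 1, fun i => if i ≤ n then θ i else c, by simp [h0], by simp, fun i hi => ?_⟩
    grind

/-- From a simulation at the root to the main theorem. -/
theorem simulation_of_local {E : Type u} (S : Sig E) (g : Bool)
    (hloc : ∀ σ σ' : Pf E, σ.IsProof S → σ'.IsPreproof S → SuperRed S g σ σ' →
      σ.tr.rule.IsMcutRule ∧
      ∃ θ, ReflTransGen PStep σ.tr θ ∧ ReflTransGen (PermZone g) θ σ'.tr)
    (π₀ π₁ : Pf E) (h₀ : π₀.IsProof S) (h₁ : SuperStep S g π₀ π₁) :
    ∃ (n : ℕ) (θ : ℕ → Pf Unit), θ 0 = π₀.tr ∧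
      (∀ i ≤ n, (θ i).IsLLProof) ∧ (∀ i < n, LLStep (θ i) (θ (i + 1))) ∧
      Relation.ReflTransGen (PermMoved g π₀.tr) (θ n) π₁.tr := by
  obtain ⟨-, hp', a, hat⟩ := h₁; obtain ⟨b, C, σ, σ', hred, hC, e0, e1, hσ, hσ'⟩ := at_tr hat h₀ hp'
  obtain ⟨hm, θ, hs, hperm⟩ := hloc σ σ' hσ hσ' hred
  have hpr : (C σ.tr).IsLLProof := by rw [← e0]; exact h₀.tr
  obtain ⟨n, f, hf0, hfn, hf⟩ := reflTransGen_seq (hC.pSteps hpr hs)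
  refine ⟨n, f, by rw [hf0, e0], fun i hi => ?_, fun i hi => ?_, ?_⟩
  · rcases i with _ | i
    · rw [hf0]; exact hpr
    · exact (hf i (by omega)).2.1
  · obtain ⟨h1, h2, -, h4⟩ := hf i hi; exact ⟨h1.1, h2.1, h4⟩
  · rw [hfn, e1, e0]; clear hfn hf0 hf hs e1
    generalize σ'.tr = τ at hperm
    induction hperm with
    | refl => exact .refl
    | tail _ h ih =>
      refine ih.tail ?_; obtain ⟨d, h1, h2⟩ := h
      refine ⟨b, d, σ.tr, ?_, hm, fun e he ρ hρ => h1 e he ρ ?_, hC.at_ _ _ _ _ h2⟩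
      · simpa [Pf.sub] using hC.sub σ.tr []
      · rw [← hC.sub]; exact hρ

section Wiring
variable {N : Type} {E : Type u}

/-- The sequents of the premises of a multicut, with the names of their formulas. -/
abbrev Skel (N : Type) (E : Type u) := Multiset (List (N × Fm E))

open Classical in
/-- The formulas named `a`. -/
noncomputable def fil (a : N) (M : Multiset (N × Fm E)) : Multiset (Fm E) :=
  (M.filter (·.1 = a)).map Prod.snd

/-- All named formulas of the premises. -/
def occM (X : Skel N E) : Multiset (N × Fm E) := X.bind fun l => (l : Multiset (N × Fm E))

/-- The name `a` occurs in some premise. -/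
def HasName (a : N) (X : Skel N E) : Prop := ∃ l ∈ X, a ∈ l.map Prod.fst

/-- The premises cannot be partitioned into two parts without a common name. -/
def ConnM (X : Skel N E) : Prop :=
  X ≠ 0 ∧ ∀ X₁ X₂, X = X₁ + X₂ → X₁ ≠ 0 → X₂ ≠ 0 → ∃ a, HasName a X₁ ∧ HasName a X₂

/-- The names of a correct multicut: a name occurs once in the conclusion and once in the premises,
or twice in the premises, with dual formulas. -/
def Wired (cc : List (N × Fm E)) (X : Skel N E) : Prop :=
  ∀ a, (fil a (cc : Multiset (N × Fm E)) = 0 ∧ fil a (occM X) = 0) ∨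
    (∃ A, fil a (cc : Multiset (N × Fm E)) = {A} ∧ fil a (occM X) = {A}) ∨
    (∃ A, fil a (cc : Multiset (N × Fm E)) = 0 ∧ fil a (occM X) = {A, A.neg})

/-- The correctness of a named multicut, its premises being unordered. -/
structure MOk (cc : List (N × Fm E)) (X : Skel N E) : Prop where
  wired : Wired cc X
  conn : ConnM X
  bal : (occM X).card + 2 = cc.length + 2 * X.card

theorem fil_add (a : N) (M M' : Multiset (N × Fm E)) : fil a (M + M') = fil a M + fil a M' := by
  simp [fil]

theorem fil_cons_self (a : N) (A : Fm E) (M : Multiset (N × Fm E)) :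
    fil a ((a, A) ::ₘ M) = A ::ₘ fil a M := by
  simp [fil]

theorem fil_cons_ne {a b : N} (h : b ≠ a) (A : Fm E) (M : Multiset (N × Fm E)) :
    fil a ((b, A) ::ₘ M) = fil a M := by
  simp [fil, h]

theorem mem_fil {a : N} {A : Fm E} {M : Multiset (N × Fm E)} : A ∈ fil a M ↔ (a, A) ∈ M := by
  unfold fil; simp

theorem fil_eq_zero {a : N} {M : Multiset (N × Fm E)} : fil a M = 0 ↔ ∀ A, (a, A) ∉ M := by
  rw [Multiset.eq_zero_iff_forall_notMem]; simp only [mem_fil]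

theorem occM_zero : occM (0 : Skel N E) = 0 := rfl

theorem occM_cons (l : List (N × Fm E)) (X : Skel N E) : occM (l ::ₘ X) = ↑l + occM X := by
  simp [occM]

theorem occM_add (X Y : Skel N E) : occM (X + Y) = occM X + occM Y := by simp [occM]

theorem mem_occM {p : N × Fm E} {X : Skel N E} : p ∈ occM X ↔ ∃ l ∈ X, p ∈ l := by simp [occM]

theorem hasName_iff {a : N} {X : Skel N E} : HasName a X ↔ ∃ A, (a, A) ∈ occM X := by
  constructor
  · rintro ⟨l, hl, h⟩; obtain ⟨⟨b, A⟩, hp, rfl⟩ := List.mem_map.mp h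
    exact ⟨A, mem_occM.mpr ⟨l, hl, hp⟩⟩
  · rintro ⟨A, h⟩; obtain ⟨l, hl, hp⟩ := mem_occM.mp h
    exact ⟨l, hl, List.mem_map.mpr ⟨_, hp, rfl⟩⟩

theorem hasName_iff_fil {a : N} {X : Skel N E} : HasName a X ↔ fil a (occM X) ≠ 0 := by
  rw [hasName_iff, Ne, fil_eq_zero]; push Not
  rfl

theorem HasName.add_left {a : N} {X Y : Skel N E} (h : HasName a X) : HasName a (X + Y) := by
  obtain ⟨l, hl, h⟩ := h; exact ⟨l, Multiset.mem_add.mpr (Or.inl hl), h⟩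

theorem HasName.add_right {a : N} {X Y : Skel N E} (h : HasName a Y) : HasName a (X + Y) := by
  obtain ⟨l, hl, h⟩ := h; exact ⟨l, Multiset.mem_add.mpr (Or.inr hl), h⟩

theorem hasName_add {a : N} {X Y : Skel N E} : HasName a (X + Y) ↔ HasName a X ∨ HasName a Y := by
  constructor
  · rintro ⟨l, hl, h⟩; rcases Multiset.mem_add.mp hl with hl | hl
    · exact Or.inl ⟨l, hl, h⟩
    · exact Or.inr ⟨l, hl, h⟩
  · rintro (h | h)
    · exact h.add_left
    · exact h.add_right

/-! ### Positions -/

/-- The named formula at a position. -/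
def entry (LL : List (List (N × Fm E))) (x : ℕ × ℕ) : Option (N × Fm E) := LL[x.1]?.bind (·[x.2]?)

/-- All positions. -/
def posns (LL : List (List (N × Fm E))) : Finset (ℕ × ℕ) :=
  (Finset.range LL.length).biUnion fun i =>
    (Finset.range ((LL[i]?.getD []).length)).image fun j => (i, j)

theorem mem_posns {LL : List (List (N × Fm E))} {x : ℕ × ℕ} :
    x ∈ posns LL ↔ ∃ p, entry LL x = some p := by
  obtain ⟨i, j⟩ := x
  simp only [posns, Finset.mem_biUnion, Finset.mem_range, Finset.mem_image, Prod.mk.injEq, entry]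
  constructor
  · rintro ⟨i', hi, j', hj, rfl, rfl⟩; simp_all
  · rintro ⟨p, hp⟩; rcases h : LL[i]? with _ | l
    · simp [h] at hp
    · simp only [h, Option.bind_some] at hp
      exact ⟨i, (List.getElem?_eq_some_iff.mp h).1, j, by
        simpa [h] using (List.getElem?_eq_some_iff.mp hp).1, rfl, rfl⟩

theorem list_sum_eq_range {α M : Type*} [AddCommMonoid M] (l : List α) (G : α → M) :
    (l.map G).sum = ∑ j ∈ Finset.range l.length, (l[j]?.elim 0 G) := by
  induction l with
  | nil => simp
  | cons a l ih => grind [Finset.sum_range_succ']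

theorem sum_occM {M : Type*} [AddCommMonoid M] (LL : List (List (N × Fm E)))
    (G : N × Fm E → M) : ((occM (LL : Skel N E)).map G).sum =
      ∑ x ∈ posns LL, (entry LL x).elim 0 G := by
  have h1 : ((occM (LL : Skel N E)).map G).sum = (LL.map fun l => (l.map G).sum).sum := by
    induction LL with
    | nil => rfl
    | cons l LL ih =>
      rw [← Multiset.cons_coe, occM_cons, Multiset.map_add, Multiset.sum_add, ih]; simp
  rw [h1, list_sum_eq_range, Finset.sum_finset_product (posns LL) (Finset.range LL.length)
    (fun i => Finset.range ((LL[i]?.getD []).length))]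
  all_goals grind [Finset.sum_congr, list_sum_eq_range, entry, posns]

/-- The name at a position. -/
def nmx (LL : List (List (N × Fm E))) (x : ℕ × ℕ) : Option N := (entry LL x).map Prod.fst

/-- The formula at a position. -/
def fmx (LL : List (List (N × Fm E))) (x : ℕ × ℕ) : Fm E := ((entry LL x).map Prod.snd).getD .one

open Classical in
/-- The positions named `a`. -/
noncomputable def posA (LL : List (List (N × Fm E))) (a : N) : Finset (ℕ × ℕ) :=
  (posns LL).filter fun x => nmx LL x = some a

theorem mem_posA {LL : List (List (N × Fm E))} {a : N} {x : ℕ × ℕ} :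
    x ∈ posA LL a ↔ nmx LL x = some a := by
  grind [posA, mem_posns, nmx, Option.map_eq_some_iff]

theorem fil_eq_sum (a : N) (M : Multiset (N × Fm E)) [DecidableEq N] :
    fil a M = (M.map fun p => if p.1 = a then ({p.2} : Multiset (Fm E)) else 0).sum := by
  induction M using Multiset.induction_on with
  | empty => rfl
  | cons p M ih =>
    obtain ⟨b, A⟩ := p; by_cases h : b = a
    all_goals simp_all [fil_cons_self, fil_cons_ne]

theorem fil_occM (LL : List (List (N × Fm E))) (a : N) :
    fil a (occM (LL : Skel N E)) = (posA LL a).val.map (fmx LL) := by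
  classical
  rw [fil_eq_sum, sum_occM, ← Multiset.sum_map_singleton ((posA LL a).val.map (fmx LL)),
    Multiset.map_map]
  change _ = ∑ x ∈ posA LL a, {fmx LL x}
  have e : posA LL a = (posns LL).filter fun x => nmx LL x = some a := by ext x; simp [posA]
  grind [Finset.sum_filter, nmx, fmx, entry]

theorem card_occM (LL : List (List (N × Fm E))) : (occM (LL : Skel N E)).card = (posns LL).card := by
  have := sum_occM LL (fun _ => (1 : ℕ))
  rw [Multiset.map_const', Multiset.sum_replicate, smul_eq_mul, mul_one] at this
  rw [this, Finset.card_eq_sum_ones]; refine Finset.sum_congr rfl fun x hx => ?_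
  obtain ⟨p, hp⟩ := mem_posns.mp hx; simp [hp]

/-! ### From multicuts to named multicuts and back -/

/-- The wiring of a multicut, given by names. -/
structure WOk (cc : List (N × Fm E)) (LL : List (List (N × Fm E))) (iota : List (ℕ × ℕ))
    (link : ℕ × ℕ → ℕ × ℕ → Prop) : Prop where
  iota_iff : ∀ (k : ℕ) (x : ℕ × ℕ), iota[k]? = some x ↔
      ∃ a, (cc[k]?).map Prod.fst = some a ∧ nmx LL x = some a
  link_iff : ∀ x y : ℕ × ℕ, link x y ↔ x ≠ y ∧ ∃ a, nmx LL x = some a ∧ nmx LL y = some a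

theorem fmAt_entry (LL : List (List (N × Fm E))) (x : ℕ × ℕ) :
    fmAt (LL.map (List.map Prod.snd)) x = (entry LL x).map Prod.snd := by
  grind [fmAt, entry]

theorem fmAt_of_nmx {LL : List (List (N × Fm E))} {x : ℕ × ℕ} {a : N} (h : nmx LL x = some a) :
    fmAt (LL.map (List.map Prod.snd)) x = some (fmx LL x) := by
  grind [fmAt_entry, nmx, fmx, entry]

theorem exists_nmx {LL : List (List (N × Fm E))} {x : ℕ × ℕ}
    (h : (fmAt (LL.map (List.map Prod.snd)) x).isSome) : ∃ a, nmx LL x = some a := by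
  rw [fmAt_entry] at h; unfold nmx
  rcases he : entry LL x with _ | p
  · simp [he] at h
  · exact ⟨p.1, by simp⟩

theorem fil_list_single {cc : List (N × Fm E)} {k : ℕ} {a : N} {A : Fm E} (h : cc[k]? = some (a, A))
    (hu : ∀ k', (cc[k']?).map Prod.fst = some a → k' = k) :
    fil a (cc : Multiset (N × Fm E)) = {A} := by
  obtain ⟨l, r, rfl, rfl⟩ := exists_split h
  have h1 : fil a (l : Multiset (N × Fm E)) = 0 := by
    rw [fil_eq_zero]; intro B hB
    obtain ⟨j, hj, hj'⟩ := List.getElem_of_mem (Multiset.mem_coe.mp hB)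
    have := hu j (by rw [List.getElem?_append_left hj, List.getElem?_eq_getElem hj, hj']; rfl)
    omega
  have h2 : fil a (r : Multiset (N × Fm E)) = 0 := by
    rw [fil_eq_zero]; intro B hB
    obtain ⟨j, hj, hj'⟩ := List.getElem_of_mem (Multiset.mem_coe.mp hB)
    have := hu (l.length + (j + 1)) (by grind)
    omega
  rw [← Multiset.coe_add, ← Multiset.cons_coe, fil_add, fil_cons_self, h1, h2]
  rfl

open Classical in
theorem adj_card {n : ℕ} (G : SimpleGraph (Fin n)) :
    ((Finset.univ : Finset (Fin n × Fin n)).filter fun p => G.Adj p.1 p.2).card =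
      2 * Nat.card G.edgeSet := by
  have h1 := G.dart_card_eq_twice_card_edges
  have h2 : Nat.card G.edgeSet = G.edgeFinset.card := by
    rw [Nat.card_eq_fintype_card, SimpleGraph.edgeFinset_card]
  rw [h2, ← h1, ← Fintype.card_subtype]
  exact Fintype.card_congr ⟨fun p => ⟨p.1, p.2⟩, fun d => ⟨d.toProd, d.adj⟩, fun _ => rfl, fun _ => rfl⟩

theorem split_indices {α : Type*} (L : List α) (X₁ X₂ : Multiset α) (h : (L : Multiset α) = X₁ + X₂) :
    ∃ I : Set ℕ, (∀ l ∈ X₁, ∃ i ∈ I, L[i]? = some l) ∧ (∀ l ∈ X₂, ∃ i, i ∉ I ∧ L[i]? = some l) ∧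
      ∀ i l, L[i]? = some l → (i ∈ I → l ∈ X₁) ∧ (i ∉ I → l ∈ X₂) := by
  classical
  induction L generalizing X₁ X₂ with
  | nil =>
    have h0 : X₁ + X₂ = 0 := h.symm
    obtain ⟨rfl, rfl⟩ := add_eq_zero.mp h0; exact ⟨∅, by simp, by simp, by simp⟩
  | cons a L ih =>
    have ha : a ∈ X₁ + X₂ := by rw [← h]; simp
    rcases Multiset.mem_add.mp ha with ha | ha
    · obtain ⟨Y, rfl⟩ := Multiset.exists_cons_of_mem ha
      rw [← Multiset.cons_coe, Multiset.cons_add, Multiset.cons_inj_right] at h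
      obtain ⟨I, h1, h2, h3⟩ := ih Y X₂ h
      refine ⟨insert 0 (Nat.succ '' I), fun l hl => ?_, fun l hl => ?_, fun i l hi => ?_⟩
      · rcases Multiset.mem_cons.mp hl with rfl | hl
        · exact ⟨0, by simp, rfl⟩
        · obtain ⟨i, hi, hi'⟩ := h1 l hl; exact ⟨i + 1, Or.inr ⟨i, hi, rfl⟩, hi'⟩
      · obtain ⟨i, hi, hi'⟩ := h2 l hl; exact ⟨i + 1, by simpa using hi, hi'⟩
      grind
    · obtain ⟨Y, rfl⟩ := Multiset.exists_cons_of_mem ha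
      rw [← Multiset.cons_coe, Multiset.add_cons, Multiset.cons_inj_right] at h
      obtain ⟨I, h1, h2, h3⟩ := ih X₁ Y h
      refine ⟨Nat.succ '' I, fun l hl => ?_, fun l hl => ?_, fun i l hi => ?_⟩
      · obtain ⟨i, hi, hi'⟩ := h1 l hl; exact ⟨i + 1, ⟨i, hi, rfl⟩, hi'⟩
      · rcases Multiset.mem_cons.mp hl with rfl | hl
        · exact ⟨0, by simp, rfl⟩
        · obtain ⟨i, hi, hi'⟩ := h2 l hl; exact ⟨i + 1, by simpa using hi, hi'⟩
      grind

theorem hasName_of_nmx {LL : List (List (N × Fm E))} {i j : ℕ} {a : N}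
    (h : nmx LL (i, j) = some a) : ∃ l, LL[i]? = some l ∧ a ∈ l.map Prod.fst := by
  unfold nmx entry at h; grind

theorem nmx_of_mem {LL : List (List (N × Fm E))} {i : ℕ} {a : N} {l : List (N × Fm E)}
    (h : LL[i]? = some l) (ha : a ∈ l.map Prod.fst) : ∃ j, nmx LL (i, j) = some a := by
  obtain ⟨j, hj, hj'⟩ := List.getElem_of_mem ha; refine ⟨j, ?_⟩
  grind [nmx, entry]

theorem nmx_lt {LL : List (List (N × Fm E))} {x : ℕ × ℕ} {a : N} (h : nmx LL x = some a) :
    x.1 < LL.length := by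
  obtain ⟨l, hl, -⟩ := hasName_of_nmx (i := x.1) (j := x.2) h
  exact (List.getElem?_eq_some_iff.mp hl).1

variable {cc : List (N × Fm E)} {LL : List (List (N × Fm E))} {iota : List (ℕ × ℕ)}
  {link : ℕ × ℕ → ℕ × ℕ → Prop}

/-- The pairs of adjacent premises. -/
noncomputable def adjPairs (n : ℕ) (link : ℕ × ℕ → ℕ × ℕ → Prop) : Finset (ℕ × ℕ) :=
  open Classical in
  ((Finset.univ : Finset (Fin n × Fin n)).filter fun p => (mcutGraph n link).Adj p.1 p.2).image
    fun p => (p.1.val, p.2.val)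

theorem card_adjPairs (n : ℕ) (link : ℕ × ℕ → ℕ × ℕ → Prop) :
    (adjPairs n link).card = 2 * Nat.card (mcutGraph n link).edgeSet := by
  classical
  unfold adjPairs; rw [Finset.card_image_of_injective]
  · convert adj_card (mcutGraph n link)
  · rintro ⟨a, b⟩ ⟨a', b'⟩ h; grind

theorem mem_adjPairs {n : ℕ} {p : ℕ × ℕ} (hs : ∀ x y : ℕ × ℕ, link x y → link y x) :
    p ∈ adjPairs n link ↔ p.1 < n ∧ p.2 < n ∧ p.1 ≠ p.2 ∧ ∃ j j', link (p.1, j) (p.2, j') := by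
  obtain ⟨a, b⟩ := p
  have e : ∀ p : Fin n × Fin n, (mcutGraph n link).Adj p.1 p.2 ↔
      p.1 ≠ p.2 ∧ ∃ j j', link (p.1, j) (p.2, j') ∨ link (p.2, j') (p.1, j) := fun _ => Iff.rfl
  unfold adjPairs; rw [Finset.mem_image]
  simp only [Finset.mem_filter, Finset.mem_univ, true_and, Prod.exists, Prod.mk.injEq]; constructor
  · rintro ⟨i, i', ⟨h1, j, j', h2⟩, rfl, rfl⟩; grind
  · rintro ⟨h1, h2, h3, j, j', h4⟩
    exact ⟨⟨a, h1⟩, ⟨b, h2⟩, ⟨fun h => h3 (congrArg Fin.val h), j, j', Or.inl h4⟩, rfl, rfl⟩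

theorem McutOk.mok (h : McutOk (cc.map Prod.snd) (LL.map (List.map Prod.snd)) iota link)
    (hw : WOk cc LL iota link) : MOk cc (LL : Skel N E) := by
  classical
  have hlen : iota.length = cc.length := by
    have := congrArg List.length h.iota_fm
    simpa using this
  have hcu : ∀ (k k' : ℕ) (a : N), (cc[k]?).map Prod.fst = some a → (cc[k']?).map Prod.fst = some a → k' = k := by
    intro k k' a h1 h2
    have hk : k < iota.length := by grind
    have hx := (hw.iota_iff k iota[k]).mp (List.getElem?_eq_getElem hk)
    obtain ⟨b, h3, h4⟩ := hx; rw [h1] at h3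
    obtain rfl := Option.some.inj h3
    have h5 := (hw.iota_iff k' iota[k]).mpr ⟨a, h2, h4⟩
    obtain ⟨hk', h6⟩ := List.getElem?_eq_some_iff.mp h5
    exact (List.Nodup.getElem_inj_iff h.iota_inj).mp h6
  have hin : ∀ x a, nmx LL x = some a → (∃ A, (a, A) ∈ cc) → x ∈ iota := by
    rintro x a hx ⟨A, hA⟩; obtain ⟨k, hk, hk'⟩ := List.getElem_of_mem hA
    exact List.mem_of_getElem? ((hw.iota_iff k x).mpr ⟨a, by simp [List.getElem?_eq_getElem hk, hk'], hx⟩)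
  have hnotin : ∀ x a, nmx LL x = some a → x ∈ iota → ∃ A, (a, A) ∈ cc := by
    intro x a hx hi; obtain ⟨k, hk, hk'⟩ := List.getElem_of_mem hi
    obtain ⟨b, h1, h2⟩ := (hw.iota_iff k x).mp (by rw [List.getElem?_eq_getElem hk, hk'])
    grind
  refine ⟨fun a => ?_, ⟨?_, fun X₁ X₂ hX h1 h2 => ?_⟩, ?_⟩
  · by_cases ha : ∃ A, (a, A) ∈ cc
    · obtain ⟨A, hA⟩ := ha; obtain ⟨k, hk, hk'⟩ := List.getElem_of_mem hA
      have hck : cc[k]? = some (a, A) := by rw [List.getElem?_eq_getElem hk, hk']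
      have hki : k < iota.length := by omega
      obtain ⟨b, h3, h4⟩ := (hw.iota_iff k iota[k]).mp (List.getElem?_eq_getElem hki)
      rw [hck] at h3; obtain rfl : a = b := Option.some.inj h3
      refine Or.inr (Or.inl ⟨A, fil_list_single hck fun k' h' => hcu k k' a (by simp [hck]) h', ?_⟩)
      have hpos : posA LL a = {iota[k]} := by
        ext y; rw [mem_posA, Finset.mem_singleton]
        constructor
        · intro hy; by_contra hne
          exact (h.link_dom _ _ ((hw.link_iff y iota[k]).mpr ⟨hne, a, hy, h4⟩)).2 (hin y a hy ⟨A, hA⟩)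
        · rintro rfl; exact h4
      have hfm : fmx LL iota[k] = A := by
        have h5 := congrArg (fun l => l[k]?) h.iota_fm
        grind [fmAt_of_nmx]
      rw [fil_occM, hpos]; simp [hfm]
    · have h0 : fil a (cc : Multiset (N × Fm E)) = 0 := by
        rw [fil_eq_zero]; intro A hA
        exact ha ⟨A, Multiset.mem_coe.mp hA⟩
      by_cases hp : ∃ x, nmx LL x = some a
      · obtain ⟨x, hx⟩ := hp
        have hxi : x ∉ iota := fun hi => ha (hnotin x a hx hi)
        obtain ⟨y, hy⟩ := h.link_total x (by rw [fmAt_of_nmx hx]; rfl) hxi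
        obtain ⟨hne, b, h3, h4⟩ := (hw.link_iff x y).mp hy; rw [hx] at h3
        obtain rfl := Option.some.inj h3
        have hpos : posA LL a = {x, y} := by
          ext z; rw [mem_posA, Finset.mem_insert, Finset.mem_singleton]
          constructor
          · intro hz; by_cases hzx : z = x
            · exact Or.inl hzx
            · exact Or.inr (h.link_unique x z y ((hw.link_iff x z).mpr ⟨Ne.symm hzx, a, hx, hz⟩) hy)
          grind
        have hd := h.link_dual x y hy
        rw [fmAt_of_nmx hx, fmAt_of_nmx h4] at hd
        simp only [Option.map_some, Option.some.injEq] at hd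
        refine Or.inr (Or.inr ⟨fmx LL x, h0, ?_⟩)
        rw [fil_occM, hpos, Finset.insert_val_of_notMem (by simpa using hne)]
        simp [hd]
      · refine Or.inl ⟨h0, ?_⟩
        have hpos : posA LL a = ∅ := by grind [mem_posA]
        rw [fil_occM, hpos]
        rfl
  · intro h0
    have := h.tree.connected.nonempty
    rw [List.length_map, show LL = [] from by simpa using h0] at this
    exact this.some.elim0
  · obtain ⟨I, i1, i2, i3⟩ := split_indices LL X₁ X₂ hX
    obtain ⟨l, hl⟩ := Multiset.exists_mem_of_ne_zero h1
    obtain ⟨l', hl'⟩ := Multiset.exists_mem_of_ne_zero h2; obtain ⟨i, hi, hil⟩ := i1 l hl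
    obtain ⟨i', hi', hil'⟩ := i2 l' hl'
    have hlt := (List.getElem?_eq_some_iff.mp hil).1
    have hlt' := (List.getElem?_eq_some_iff.mp hil').1
    have hconn := h.tree.connected
    rw [List.length_map] at hconn; obtain ⟨w⟩ := hconn.preconnected ⟨i, hlt⟩ ⟨i', hlt'⟩
    obtain ⟨d, -, hd1, hd2⟩ := w.exists_boundary_dart {j | j.val ∈ I} hi hi'
    obtain ⟨-, j, j', hjj⟩ := d.adj
    have : ∃ a, nmx LL (d.fst.val, j) = some a ∧ nmx LL (d.snd.val, j') = some a := by
      rcases hjj with hjj | hjj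
      · exact ((hw.link_iff _ _).mp hjj).2
      · obtain ⟨-, a, h3, h4⟩ := (hw.link_iff _ _).mp hjj; exact ⟨a, h4, h3⟩
    obtain ⟨a, h3, h4⟩ := this; obtain ⟨m, hm, hma⟩ := hasName_of_nmx h3
    obtain ⟨m', hm', hma'⟩ := hasName_of_nmx h4
    exact ⟨a, ⟨m, (i3 _ m hm).1 hd1, hma⟩, ⟨m', (i3 _ m' hm').2 hd2, hma'⟩⟩
  · rw [card_occM, Multiset.coe_card]
    have hsplit : posns LL = iota.toFinset ∪ (posns LL).filter (· ∉ iota) := by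
      ext x; simp only [Finset.mem_union, List.mem_toFinset, Finset.mem_filter]
      constructor
      · grind
      · rintro (hi | hx)
        · obtain ⟨k, hk, hk'⟩ := List.getElem_of_mem hi
          obtain ⟨b, h1, h2⟩ := (hw.iota_iff k x).mp (by rw [List.getElem?_eq_getElem hk, hk'])
          exact (Finset.mem_filter.mp (mem_posA.mpr h2)).1
        · exact hx.1
    have hcard : (posns LL).card = cc.length + ((posns LL).filter (· ∉ iota)).card := by
      conv_lhs => rw [hsplit]
      rw [Finset.card_union_of_disjoint, List.toFinset_card_of_nodup h.iota_inj, hlen]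
      rw [Finset.disjoint_left]; intro x hx hx'
      exact (Finset.mem_filter.mp hx').2 (List.mem_toFinset.mp hx)
    have htree := (SimpleGraph.isTree_iff_connected_and_card.mp h.tree).2
    rw [List.length_map, Nat.card_eq_fintype_card (α := Fin LL.length), Fintype.card_fin] at htree
    have hφ : ∀ x ∈ (posns LL).filter (· ∉ iota), ∃ y, link x y := by
      intro x hx; obtain ⟨h1, h2⟩ := Finset.mem_filter.mp hx
      obtain ⟨p, hp⟩ := mem_posns.mp h1; exact h.link_total x (by rw [fmAt_entry, hp]; rfl) h2
    choose! φ hφ using hφ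
    have hbij : ((posns LL).filter (· ∉ iota)).card = (adjPairs LL.length link).card := by
      refine Finset.card_bij (fun x _ => (x.1, (φ x).1)) ?_ ?_ ?_
      · intro x hx
        have h1 := hφ x hx
        obtain ⟨-, a, h2, h3⟩ := (hw.link_iff _ _).mp h1; rw [mem_adjPairs h.link_symm]
        exact ⟨nmx_lt (x := x) h2, nmx_lt (x := φ x) h3, h.no_loop x (φ x) h1, x.2, (φ x).2, h1⟩
      · intro x hx y hy hxy; simp only [Prod.mk.injEq] at hxy
        exact h.no_double x (φ x) y (φ y) (hφ x hx) (hφ y hy) hxy.1 hxy.2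
      · rintro ⟨i, i'⟩ hp; rw [mem_adjPairs h.link_symm] at hp
        obtain ⟨h1, h2, h3, j, j', h4⟩ := hp; obtain ⟨-, a, h5, h6⟩ := (hw.link_iff _ _).mp h4
        have hm : (i, j) ∈ (posns LL).filter (· ∉ iota) := Finset.mem_filter.mpr
          ⟨(Finset.mem_filter.mp (mem_posA.mpr h5)).1, (h.link_dom _ _ h4).2⟩
        refine ⟨(i, j), hm, ?_⟩; rw [h.link_unique _ _ _ (hφ _ hm) h4]
    rw [hcard, hbij, card_adjPairs]; omega

end Wiring

section Wiring
variable {N : Type} {E : Type u}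
variable {cc : List (N × Fm E)} {LL : List (List (N × Fm E))} {iota : List (ℕ × ℕ)}
  {link : ℕ × ℕ → ℕ × ℕ → Prop}

theorem Wired.nodup {X : Skel N E} (h : Wired cc X) : (cc.map Prod.fst).Nodup := by
  classical
  rw [List.nodup_iff_count_le_one]; intro a
  have e : ∀ l : List (N × Fm E), (l.map Prod.fst).count a = (fil a (l : Multiset (N × Fm E))).card := by
    intro l
    induction l with
    | nil => rfl
    | cons p l ih =>
      obtain ⟨b, A⟩ := p; rw [← Multiset.cons_coe]
      grind [fil_cons_self, Multiset.card_cons, fil_cons_ne]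
  rw [e]; rcases h a with ⟨h1, -⟩ | ⟨A, h1, -⟩ | ⟨A, h1, -⟩ <;> simp [h1]

theorem Wired.cc_unique {X : Skel N E} (h : Wired cc X) {k k' : ℕ} {a : N}
    (h1 : (cc[k]?).map Prod.fst = some a) (h2 : (cc[k']?).map Prod.fst = some a) : k = k' := by
  have hn := h.nodup
  rw [← List.getElem?_map] at h1 h2; obtain ⟨i1, j1⟩ := List.getElem?_eq_some_iff.mp h1
  obtain ⟨i2, j2⟩ := List.getElem?_eq_some_iff.mp h2
  exact (hn.getElem_inj_iff).mp (j1.trans j2.symm)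

theorem Wired.posA_concl (h : Wired cc (LL : Skel N E)) {k : ℕ} {a : N} {A : Fm E}
    (hk : cc[k]? = some (a, A)) : ∃ x, posA LL a = {x} ∧ fmx LL x = A := by
  classical
  have hm : A ∈ fil a (cc : Multiset (N × Fm E)) := mem_fil.mpr (by
    exact Multiset.mem_coe.mpr (List.mem_of_getElem? hk))
  rcases h a with ⟨h1, -⟩ | ⟨B, h1, h2⟩ | ⟨B, h1, -⟩
  · simp [h1] at hm
  · rw [h1, Multiset.mem_singleton] at hm; subst hm
    rw [fil_occM] at h2
    have h3 := congrArg Multiset.card h2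
    simp only [Multiset.card_map, Finset.card_val, Multiset.card_singleton] at h3
    obtain ⟨x, hx⟩ := Finset.card_eq_one.mp h3; refine ⟨x, hx, ?_⟩
    rw [hx] at h2; simpa using h2
  · simp [h1] at hm

theorem MOk.mcutOk (h : MOk cc (LL : Skel N E)) (hw : WOk cc LL iota link) :
    McutOk (cc.map Prod.snd) (LL.map (List.map Prod.snd)) iota link := by
  classical
  have hC := fun (k : ℕ) (a : N) (A : Fm E) => h.wired.posA_concl (k := k) (a := a) (A := A)
  -- two occurrences in the premises
  have hP : ∀ (x y : ℕ × ℕ) (a : N), x ≠ y → nmx LL x = some a → nmx LL y = some a →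
      (∀ k : ℕ, (cc[k]?).map Prod.fst ≠ some a) ∧ posA LL a = {x, y} ∧ fmx LL x = (fmx LL y).neg := by
    intro x y a hne hx hy
    have hx' := mem_posA.mpr hx
    have hy' := mem_posA.mpr hy
    have hc2 : 2 ≤ (posA LL a).card := by
      have : ({x, y} : Finset (ℕ × ℕ)) ⊆ posA LL a := by grind
      have h2 := Finset.card_le_card this
      rwa [Finset.card_pair hne] at h2
    rcases h.wired a with ⟨-, h2⟩ | ⟨B, -, h2⟩ | ⟨B, h1, h2⟩
    · rw [fil_occM] at h2
      have h3 := congrArg Multiset.card h2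
      simp at h3; simp [h3] at hc2
    · grind [fil_occM, Multiset.card_map, Finset.card_val, Multiset.card_singleton]
    · rw [fil_occM] at h2
      have h3 := congrArg Multiset.card h2
      simp only [Multiset.card_map, Finset.card_val, Multiset.insert_eq_cons, Multiset.card_cons,
        Multiset.card_singleton] at h3
      have h4 : posA LL a = {x, y} := by
        symm; apply Finset.eq_of_subset_of_card_le
        all_goals grind
      refine ⟨fun k hk => ?_, h4, ?_⟩
      · grind
      · rw [h4, Finset.insert_val_of_notMem (by simpa using hne)] at h2
        simp only [Finset.singleton_val, Multiset.map_cons, Multiset.map_singleton,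
          Multiset.insert_eq_cons] at h2
        have h5 : fmx LL x ∈ B ::ₘ {B.neg} := by rw [← h2]; simp
        rw [Multiset.mem_cons, Multiset.mem_singleton] at h5; rcases h5 with h5 | h5
        · rw [h5, Multiset.cons_inj_right, Multiset.singleton_inj] at h2; rw [h5, h2, Fm.neg_neg]
        · rw [h5, ← Multiset.cons_zero B.neg, Multiset.cons_swap, Multiset.cons_inj_right,
            Multiset.cons_zero, Multiset.singleton_inj] at h2
          rw [h5, h2]
  have hlen : iota.length = cc.length := by
    have key : ∀ k, k < iota.length ↔ k < cc.length := by
      intro k; constructor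
      · intro hk; obtain ⟨a, h1, -⟩ := (hw.iota_iff k iota[k]).mp (List.getElem?_eq_getElem hk)
        grind
      · intro hk; obtain ⟨x, hx, -⟩ := hC k cc[k].1 cc[k].2 (List.getElem?_eq_getElem hk)
        have hx' : nmx LL x = some cc[k].1 := mem_posA.mp (by rw [hx]; simp)
        have := (hw.iota_iff k x).mpr ⟨cc[k].1, by simp [List.getElem?_eq_getElem hk], hx'⟩
        exact (List.getElem?_eq_some_iff.mp this).1
    have a1 := key cc.length
    have a2 := key iota.length
    omega
  have hnot : ∀ (x : ℕ × ℕ) (a : N), nmx LL x = some a → (∀ k : ℕ, (cc[k]?).map Prod.fst ≠ some a) → x ∉ iota := by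
    intro x a hx hk hi; obtain ⟨k, hk', hk''⟩ := List.getElem_of_mem hi
    obtain ⟨b, h1, h2⟩ := (hw.iota_iff k x).mp (by rw [List.getElem?_eq_getElem hk', hk''])
    rw [hx] at h2; obtain rfl := Option.some.inj h2
    exact hk k h1
  have hsymm : ∀ x y : ℕ × ℕ, link x y → link y x := by
    intro x y hl; obtain ⟨h1, a, h2, h3⟩ := (hw.link_iff x y).mp hl
    exact (hw.link_iff y x).mpr ⟨h1.symm, a, h3, h2⟩
  have hdom : ∀ x y : ℕ × ℕ, link x y → (fmAt (LL.map (List.map Prod.snd)) x).isSome ∧ x ∉ iota := by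
    intro x y hl; obtain ⟨h1, a, h2, h3⟩ := (hw.link_iff x y).mp hl
    exact ⟨by rw [fmAt_of_nmx h2]; rfl, hnot x a h2 (hP x y a h1 h2 h3).1⟩
  have htot : ∀ x, (fmAt (LL.map (List.map Prod.snd)) x).isSome → x ∉ iota → ∃ y, link x y := by
    intro x hx hi; obtain ⟨a, ha⟩ := exists_nmx hx
    have hxA := mem_posA.mpr ha
    rcases h.wired a with ⟨-, h2⟩ | ⟨B, h1, h2⟩ | ⟨B, h1, h2⟩
    · rw [fil_occM] at h2
      have h3 := congrArg Multiset.card h2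
      simp at h3; simp [h3] at hxA
    · have hB : B ∈ fil a (cc : Multiset (N × Fm E)) := by rw [h1]; simp
      obtain ⟨k, hk, hk'⟩ := List.getElem_of_mem (Multiset.mem_coe.mp (mem_fil.mp hB))
      exact absurd (List.mem_of_getElem? ((hw.iota_iff k x).mpr
        ⟨a, by simp [List.getElem?_eq_getElem hk, hk'], ha⟩)) hi
    · rw [fil_occM] at h2
      have h3 := congrArg Multiset.card h2
      simp only [Multiset.card_map, Finset.card_val, Multiset.insert_eq_cons, Multiset.card_cons,
        Multiset.card_singleton] at h3
      obtain ⟨y, hy, hne⟩ := Finset.exists_mem_ne (by omega : 1 < (posA LL a).card) x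
      exact ⟨y, (hw.link_iff x y).mpr ⟨hne.symm, a, ha, mem_posA.mp hy⟩⟩
  have huniq : ∀ x y y', link x y → link x y' → y = y' := by
    intro x y y' h1 h2; obtain ⟨h1, a, h3, h4⟩ := (hw.link_iff x y).mp h1
    obtain ⟨h2, b, h5, h6⟩ := (hw.link_iff x y').mp h2; rw [h3] at h5
    obtain rfl := Option.some.inj h5
    have h7 := (hP x y a h1 h3 h4).2.1
    have h8 : y' ∈ posA LL a := mem_posA.mpr h6
    grind
  have hnodup : iota.Nodup := by
    rw [List.nodup_iff_injective_getElem]; rintro ⟨k, hk⟩ ⟨k', hk'⟩ hkk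
    dsimp only at hkk; obtain ⟨a, h1, h2⟩ := (hw.iota_iff k _).mp (List.getElem?_eq_getElem hk)
    obtain ⟨b, h3, h4⟩ := (hw.iota_iff k' _).mp (List.getElem?_eq_getElem hk'); rw [hkk, h4] at h2
    obtain rfl := Option.some.inj h2; exact Fin.ext (h.wired.cc_unique h1 h3)
  -- the graph
  have hne : 0 < LL.length := by
    by_contra h0; exact h.conn.1 (by simpa using h0)
  have : NeZero LL.length := ⟨hne.ne'⟩
  have hconn : (mcutGraph LL.length link).Connected := by
    have : Nonempty (Fin LL.length) := ⟨⟨0, hne⟩⟩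
    refine SimpleGraph.Connected.mk ?_; intro v w
    by_contra hvw
    let I : Set ℕ := {i | ∃ hi : i < LL.length, (mcutGraph LL.length link).Reachable v ⟨i, hi⟩}
    have hsum : (LL : Skel N E) =
        ((LL.zipIdx.filter fun p => decide (p.2 ∈ I)).map Prod.fst : List (List (N × Fm E))) +
        ((LL.zipIdx.filter fun p => ! decide (p.2 ∈ I)).map Prod.fst : List (List (N × Fm E))) := by
      rw [Multiset.coe_add, ← List.map_append]
      conv_lhs => rw [← List.zipIdx_map_fst 0 LL]
      exact Multiset.coe_eq_coe.mpr ((List.filter_append_perm _ _).symm.map _)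
    have hI : ∀ i l, LL[i]? = some l → (l, i) ∈ LL.zipIdx := by
      intro i l hi; rw [List.mem_zipIdx_iff_getElem?]
      exact hi
    have hvI : v.1 ∈ I := ⟨v.2, .refl _⟩
    have hwI : w.1 ∉ I := fun ⟨_, hr⟩ => hvw hr
    obtain ⟨a, ⟨l, hl, ha⟩, l', hl', ha'⟩ := h.conn.2 _ _ hsum (by
        intro h0
        have h3 : (LL[v.1], v.1) ∈ LL.zipIdx.filter fun p => decide (p.2 ∈ I) :=
          List.mem_filter.mpr ⟨hI _ _ (List.getElem?_eq_getElem v.2), decide_eq_true hvI⟩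
        rw [Multiset.coe_eq_zero, List.map_eq_nil_iff] at h0; rw [h0] at h3
        exact List.not_mem_nil h3) (by
        intro h0
        have h3 : (LL[w.1], w.1) ∈ LL.zipIdx.filter fun p => ! decide (p.2 ∈ I) :=
          List.mem_filter.mpr ⟨hI _ _ (List.getElem?_eq_getElem w.2), by
            rw [decide_eq_false hwI]; rfl⟩
        rw [Multiset.coe_eq_zero, List.map_eq_nil_iff] at h0; rw [h0] at h3
        exact List.not_mem_nil h3)
    obtain ⟨⟨_, i⟩, hi, rfl⟩ := List.mem_map.mp (Multiset.mem_coe.mp hl)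
    obtain ⟨⟨_, i'⟩, hi', rfl⟩ := List.mem_map.mp (Multiset.mem_coe.mp hl')
    rw [List.mem_filter, List.mem_zipIdx_iff_getElem?] at hi hi'; obtain ⟨hi1, hi2⟩ := hi
    obtain ⟨hi1', hi2'⟩ := hi'; obtain ⟨hv, hr⟩ : i ∈ I := of_decide_eq_true hi2
    have hr' : i' ∉ I := of_decide_eq_false (by simpa only [Bool.not_eq_true'] using hi2')
    obtain ⟨j, hj⟩ := nmx_of_mem hi1 ha; obtain ⟨j', hj'⟩ := nmx_of_mem hi1' ha'
    have hlt' : i' < LL.length := (List.getElem?_eq_some_iff.mp hi1').1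
    have hii : i ≠ i' := by rintro rfl; exact hr' ⟨hv, hr⟩
    refine hr' ⟨hlt', hr.trans (SimpleGraph.Adj.reachable ?_)⟩
    refine ⟨fun h => hii (congrArg Fin.val h), j, j', Or.inl ?_⟩
    exact (hw.link_iff _ _).mpr ⟨fun h => hii (congrArg Prod.fst h), a, hj, hj'⟩
  have hcardE := hconn.card_vert_le_card_edgeSet_add_one
  rw [Nat.card_eq_fintype_card (α := Fin LL.length), Fintype.card_fin] at hcardE
  -- counting the links
  have hsplit : posns LL = iota.toFinset ∪ (posns LL).filter (· ∉ iota) := by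
    ext x; simp only [Finset.mem_union, List.mem_toFinset, Finset.mem_filter]
    constructor
    · grind
    · rintro (hi | hx)
      · obtain ⟨k, hk, hk'⟩ := List.getElem_of_mem hi
        obtain ⟨b, h1, h2⟩ := (hw.iota_iff k x).mp (by rw [List.getElem?_eq_getElem hk, hk'])
        exact (Finset.mem_filter.mp (mem_posA.mpr h2)).1
      · exact hx.1
  have hcard : (posns LL).card = cc.length + ((posns LL).filter (· ∉ iota)).card := by
    conv_lhs => rw [hsplit]
    rw [Finset.card_union_of_disjoint, List.toFinset_card_of_nodup hnodup, hlen]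
    rw [Finset.disjoint_left]; intro x hx hx'
    exact (Finset.mem_filter.mp hx').2 (List.mem_toFinset.mp hx)
  have hbal := h.bal
  rw [card_occM, Multiset.coe_card] at hbal
  have hφ : ∀ x ∈ (posns LL).filter (· ∉ iota), ∃ y, link x y := by
    intro x hx; obtain ⟨h1, h2⟩ := Finset.mem_filter.mp hx
    obtain ⟨p, hp⟩ := mem_posns.mp h1; exact htot x (by rw [fmAt_entry, hp]; rfl) h2
  choose! φ hφ using hφ
  have hlinkmem : ∀ x y, link x y → x ∈ (posns LL).filter (· ∉ iota) := by
    intro x y hl; obtain ⟨-, a, h5, -⟩ := (hw.link_iff _ _).mp hl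
    exact Finset.mem_filter.mpr ⟨(Finset.mem_filter.mp (mem_posA.mpr h5)).1, (hdom _ _ hl).2⟩
  have hsub : adjPairs LL.length link ⊆
      ((posns LL).filter (· ∉ iota)).image fun x => (x.1, (φ x).1) := by
    rintro ⟨i, i'⟩ hp; rw [mem_adjPairs hsymm] at hp
    grind
  have hle1 := Finset.card_le_card hsub
  have hle2 : (((posns LL).filter (· ∉ iota)).image fun x => (x.1, (φ x).1)).card ≤
    ((posns LL).filter (· ∉ iota)).card := Finset.card_image_le
  have hadj := card_adjPairs LL.length link
  have himg := Finset.eq_of_subset_of_card_le hsub (by omega)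
  have hinj : Set.InjOn (fun x => (x.1, (φ x).1)) ((posns LL).filter (· ∉ iota)) :=
    Finset.card_image_iff.mp (by omega)
  refine ⟨?_, hnodup, hdom, htot, hsymm, huniq, ?_, ?_, ?_, ?_⟩
  · apply List.ext_getElem?; intro k
    rw [List.getElem?_map, List.getElem?_map, List.getElem?_map]
    rcases lt_or_ge k iota.length with hk | hk
    · have hkc : k < cc.length := by omega
      obtain ⟨a, h1, h2⟩ := (hw.iota_iff k _).mp (List.getElem?_eq_getElem hk)
      obtain ⟨x, hx, hx'⟩ := hC k cc[k].1 cc[k].2 (List.getElem?_eq_getElem hkc)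
      rw [List.getElem?_eq_getElem hkc] at h1; obtain rfl := Option.some.inj h1
      grind [posA, fmAt_of_nmx]
    grind
  · intro x y hl; obtain ⟨h1, a, h2, h3⟩ := (hw.link_iff x y).mp hl
    rw [fmAt_of_nmx h2, fmAt_of_nmx h3, (hP x y a h1 h2 h3).2.2]
    rfl
  · intro x y hl hxy
    have hm := hlinkmem _ _ hl
    have h1 : (x.1, (φ x).1) ∈ adjPairs LL.length link := by
      rw [himg]; exact Finset.mem_image.mpr ⟨x, hm, rfl⟩
    grind [mem_adjPairs]
  · intro x y x' y' h1 h2 h3 h4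
    have hm := hlinkmem _ _ h1
    have hm' := hlinkmem _ _ h2
    refine hinj hm hm' ?_; grind
  · rw [List.length_map, SimpleGraph.isTree_iff_connected_and_card, Nat.card_eq_fintype_card (α := Fin LL.length),
      Fintype.card_fin]
    exact ⟨hconn, by omega⟩

end Wiring

section Named
variable {N N' : Type} {E : Type u}

/-- The named sequents of some premises. -/
def sk (P : Multiset (Prem N E)) : Skel N E := P.map fun x => x.1.zip x.2.concl

/-- The names of each premise match its conclusion. -/
def Fits (P : Multiset (Prem N E)) : Prop := ∀ x ∈ P, x.1.length = x.2.concl.length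

theorem zip_getElem? {α β : Type*} {l : List α} {r : List β} (h : l.length = r.length) (k : ℕ) :
    ((l.zip r)[k]?).map Prod.fst = l[k]? := by
  rw [← List.getElem?_map, List.map_fst_zip h.le]

theorem nmx_zip {L : List (Prem N E)} (h : ∀ x ∈ L, x.1.length = x.2.concl.length) (x : ℕ × ℕ) :
    nmx (L.map fun x => x.1.zip x.2.concl) x = (L[x.1]?).bind fun y => y.1[x.2]? := by
  grind [nmx, entry]

theorem map_snd_zip {L : List (Prem N E)} (h : ∀ x ∈ L, x.1.length = x.2.concl.length) :
    (L.map fun x => x.1.zip x.2.concl).map (List.map Prod.snd) = L.map fun x => x.2.concl := by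
  grind [List.map_congr_left, List.map_snd_zip]

theorem isMcut_wOk {Γ : Seq E} {nc : List N} {L : List (Prem N E)} {iota : List (ℕ × ℕ)}
    {link : ℕ × ℕ → ℕ × ℕ → Prop} (hn : nc.length = Γ.length)
    (hL : ∀ x ∈ L, x.1.length = x.2.concl.length)
    (h1 : ∀ (k : ℕ) (x : ℕ × ℕ), iota[k]? = some x ↔
      ∃ a, nc[k]? = some a ∧ (L[x.1]?).bind (fun y => y.1[x.2]?) = some a)
    (h2 : ∀ x y : ℕ × ℕ, link x y ↔ x ≠ y ∧ ∃ a, (L[x.1]?).bind (fun z => z.1[x.2]?) = some a ∧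
        (L[y.1]?).bind (fun z => z.1[y.2]?) = some a) :
    WOk (nc.zip Γ) (L.map fun x => x.1.zip x.2.concl) iota link where
  iota_iff k x := by rw [h1, zip_getElem? hn, nmx_zip hL]
  link_iff x y := by rw [h2, nmx_zip hL, nmx_zip hL]

theorem IsMcut.fits {Γ : Seq E} {nc : List N} {P : Multiset (Prem N E)} {π : Pf E}
    (h : IsMcut Γ nc P π) : nc.length = Γ.length ∧ Fits P := by
  obtain ⟨L, iota, link, rfl, -, h1, h2, -⟩ := h; exact ⟨h1, h2⟩

theorem IsMcut.concl {Γ : Seq E} {nc : List N} {P : Multiset (Prem N E)} {π : Pf E}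
    (h : IsMcut Γ nc P π) : π.concl = Γ := by
  obtain ⟨L, iota, link, rfl, h, -⟩ := h; exact h.1

theorem IsMcut.isMcutRule {Γ : Seq E} {nc : List N} {P : Multiset (Prem N E)} {π : Pf E}
    (h : IsMcut Γ nc P π) : π.rule.IsMcutRule := by
  obtain ⟨L, iota, link, rfl, h, -⟩ := h; exact ⟨_, _, _, h.2.1⟩

theorem IsMcut.mok {S : Sig E} {Γ : Seq E} {nc : List N} {P : Multiset (Prem N E)} {π : Pf E}
    (h : IsMcut Γ nc P π) (hok : π.LocalOk S) : MOk (nc.zip Γ) (sk P) := by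
  obtain ⟨L, iota, link, rfl, hnode, hn, hL, h1, h2⟩ := h
  have hm := hok.2.1
  rw [hnode.2.1, hnode.1] at hm
  have hm : McutOk Γ (L.map fun x => x.2.concl) iota link := hm
  rw [← map_snd_zip hL, ← List.map_snd_zip hn.ge] at hm; exact hm.mok (isMcut_wOk hn hL h1 h2)

theorem IsMcut.mem_child {Γ : Seq E} {nc : List N} {P : Multiset (Prem N E)} {π : Pf E}
    (h : IsMcut Γ nc P π) {x : Prem N E} (hx : x ∈ P) : ∃ k, π.child k = some x.2 := by
  obtain ⟨L, iota, link, rfl, hnode, -⟩ := h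
  obtain ⟨k, hk, hk'⟩ := List.getElem_of_mem (Multiset.mem_coe.mp hx); refine ⟨k, ?_⟩
  rw [hnode.2.2, List.getElem?_map, List.getElem?_eq_getElem hk, hk']
  rfl

/-- The premises and names of a correct multicut between proofs of linear logic. -/
structure Good (Γ : Seq Unit) (nc : List N) (P : Multiset (Prem N Unit)) : Prop where
  len : nc.length = Γ.length
  fits : Fits P
  mok : MOk (nc.zip Γ) (sk P)
  prf : ∀ x ∈ P, x.2.IsLLProof

theorem IsMcut.good {Γ : Seq Unit} {nc : List N} {P : Multiset (Prem N Unit)} {π : Pf Unit}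
    (h : IsMcut Γ nc P π) (hp : π.IsLLProof) : Good Γ nc P where
  len := h.fits.1
  fits := h.fits.2
  mok := h.mok hp.ok.1
  prf x hx := by
    obtain ⟨k, hk⟩ := h.mem_child hx; exact hp.child hk

theorem Good.mcutOk {Γ : Seq Unit} {nc : List N} {L : List (Prem N Unit)}
    (h : Good Γ nc (L : Multiset (Prem N Unit))) {iota : List (ℕ × ℕ)}
    {link : ℕ × ℕ → ℕ × ℕ → Prop}
    (h1 : ∀ (k : ℕ) (x : ℕ × ℕ), iota[k]? = some x ↔
      ∃ a, nc[k]? = some a ∧ (L[x.1]?).bind (fun y => y.1[x.2]?) = some a)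
    (h2 : ∀ x y : ℕ × ℕ, link x y ↔ x ≠ y ∧ ∃ a, (L[x.1]?).bind (fun z => z.1[x.2]?) = some a ∧
        (L[y.1]?).bind (fun z => z.1[y.2]?) = some a) :
    McutOk Γ (L.map fun x => x.2.concl) iota link := by
  have hL : ∀ x ∈ L, x.1.length = x.2.concl.length := h.fits
  have := MOk.mcutOk (LL := L.map fun x => x.1.zip x.2.concl) h.mok (isMcut_wOk h.len hL h1 h2)
  rwa [map_snd_zip hL, List.map_snd_zip h.len.ge] at this

theorem Good.closed {Γ : Seq Unit} {nc : List N} {P : Multiset (Prem N Unit)} (h : Good Γ nc P) :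
    ∀ A ∈ Γ, A.ClosedAt 0 := by
  intro A hA; obtain ⟨k, hk, rfl⟩ := List.getElem_of_mem hA
  have hz : (nc.zip Γ)[k]? = some (nc[k]'(by rw [h.len]; exact hk), Γ[k]) := by
    rw [List.getElem?_eq_getElem (by simp [h.len, hk])]
    simp
  have hm : Γ[k] ∈ fil (nc[k]'(by rw [h.len]; exact hk)) (nc.zip Γ : Multiset (N × Fm Unit)) :=
    mem_fil.mpr (Multiset.mem_coe.mpr (List.mem_of_getElem? hz))
  have : Γ[k] ∈ fil (nc[k]'(by rw [h.len]; exact hk)) (occM (sk P)) := by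
    rcases h.mok.wired (nc[k]'(by rw [h.len]; exact hk)) with ⟨h1, -⟩ | ⟨B, h1, h2⟩ | ⟨B, h1, -⟩
    all_goals grind
  obtain ⟨l, hl, hl'⟩ := mem_occM.mp (mem_fil.mp this)
  obtain ⟨x, hx, rfl⟩ := Multiset.mem_map.mp hl; exact (h.prf x hx).ok.1.1 _ (List.of_mem_zip hl').2

theorem Good.isLLProof {Γ : Seq Unit} {nc : List N} {P : Multiset (Prem N Unit)} (h : Good Γ nc P)
    {ρ : Pf Unit} (hρ : IsMcut Γ nc P ρ) : ρ.IsLLProof := by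
  obtain ⟨L, iota, link, rfl, hnode, hn, hL, h1, h2⟩ := hρ
  have hok := h.mcutOk h1 h2
  refine Pf.isLLProof_of ⟨⟨?_, ?_, ?_⟩, ?_, ?_⟩ ?_
  · rw [hnode.1]; exact h.closed
  · rw [hnode.1, hnode.2.1]; exact hok
  · intro k σ hσ; rw [hnode.2.2, List.getElem?_map] at hσ
    rcases hk : L[k]? with _ | x
    · simp [hk] at hσ
    · simp only [hk, Option.map_some, Option.some.injEq] at hσ; subst hσ
      unfold Pf.occs; rw [hnode.1, hnode.2.1]
      simp [Rule.prems, hk, Function.comp_def]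
  · rw [hnode.2.1]; rintro ⟨p, hp⟩; cases hp
  · rw [hnode.2.1]; rintro ⟨p, hp⟩; cases hp
  · intro k σ hσ; rw [hnode.2.2, List.getElem?_map] at hσ
    rcases hk : L[k]? with _ | x
    · simp [hk] at hσ
    · simp only [hk, Option.map_some, Option.some.injEq] at hσ; subst hσ
      exact h.prf x (List.mem_of_getElem? hk)

theorem Good.exists {Γ : Seq Unit} {nc : List N} {P : Multiset (Prem N Unit)} (h : Good Γ nc P) :
    ∃ ρ, IsMcut Γ nc P ρ ∧ ρ.IsLLProof := by
  classical
  obtain ⟨L, rfl⟩ := Quot.exists_rep P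
  have hL : ∀ x ∈ L, x.1.length = x.2.concl.length := h.fits
  have hw : Wired (nc.zip Γ) ((L.map fun x => x.1.zip x.2.concl : List _) : Skel N Unit) := h.mok.wired
  have hex : ∀ a ∈ nc, ∃ x : ℕ × ℕ, ∀ y : ℕ × ℕ,
      (L[y.1]?).bind (fun z => z.1[y.2]?) = some a ↔ y = x := by
    intro a ha; obtain ⟨k, hk, rfl⟩ := List.getElem_of_mem ha
    have hz : (nc.zip Γ)[k]? = some (nc[k], Γ[k]'(by rw [← h.len]; exact hk)) := by
      rw [List.getElem?_eq_getElem (by simp [← h.len, hk])]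
      simp
    obtain ⟨x, hx, -⟩ := hw.posA_concl hz; refine ⟨x, fun y => ?_⟩
    rw [← nmx_zip hL, ← mem_posA, hx, Finset.mem_singleton]
  let f : N → ℕ × ℕ := fun a => if ha : a ∈ nc then (hex a ha).choose else (0, 0)
  have hf : ∀ a ∈ nc, ∀ y : ℕ × ℕ, (L[y.1]?).bind (fun z => z.1[y.2]?) = some a ↔ y = f a := by
    intro a ha
    have := (hex a ha).choose_spec
    simpa only [f, dif_pos ha] using this
  obtain ⟨ρ, hρ⟩ := Pf.IsNode.mk_of (Γ := Γ) (r := .mcut (L.map fun x => x.2.concl) (nc.map f)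
    fun x y => x ≠ y ∧ ∃ a, (L[x.1]?).bind (fun z => z.1[x.2]?) = some a ∧
        (L[y.1]?).bind (fun z => z.1[y.2]?) = some a) (cs := L.map Prod.snd)
    (by simp [Rule.arity])
  have hm : IsMcut Γ nc (L : Multiset (Prem N Unit)) ρ := by
    refine ⟨L, _, _, rfl, hρ, h.len, hL, fun k x => ?_, fun x y => Iff.rfl⟩
    grind
  exact ⟨ρ, hm, h.isLLProof hm⟩

/-- Renaming in a premise. -/
def ren (f : N → N') (x : Prem N E) : Prem N' E := (x.1.map f, x.2)

theorem IsMcut.rename {Γ : Seq E} {nc : List N} {P : Multiset (Prem N E)} {π : Pf E}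
    (h : IsMcut Γ nc P π) (f : N → N') (hf : Set.InjOn f {a | a ∈ nc ∨ ∃ x ∈ P, a ∈ x.1}) :
    IsMcut Γ (nc.map f) (P.map (ren f)) π := by
  obtain ⟨L, iota, link, rfl, hnode, hn, hL, h1, h2⟩ := h
  have e : ∀ x : ℕ × ℕ, ((L.map (ren f))[x.1]?).bind (fun y => y.1[x.2]?) =
      ((L[x.1]?).bind fun y => y.1[x.2]?).map f := by
    grind [ren]
  have hin : ∀ (x : ℕ × ℕ) (a : N), (L[x.1]?).bind (fun y => y.1[x.2]?) = some a →
      a ∈ {a | a ∈ nc ∨ ∃ x ∈ (L : Multiset (Prem N E)), a ∈ x.1} := by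
    intro x a hx; rcases hk : L[x.1]? with _ | y
    · simp [hk] at hx
    · simp only [hk, Option.bind_some] at hx
      exact Or.inr ⟨y, Multiset.mem_coe.mpr (List.mem_of_getElem? hk), List.mem_of_getElem? hx⟩
  refine ⟨L.map (ren f), iota, link, rfl, ?_, by simpa using hn, ?_, fun k x => ?_, fun x y => ?_⟩
  · simpa [ren, Function.comp_def] using hnode
  · grind [ren]
  · rw [h1, e, List.getElem?_map]; constructor
    · grind
    · rintro ⟨b, hb, hb'⟩; obtain ⟨a, ha, rfl⟩ := Option.map_eq_some_iff.mp hb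
      obtain ⟨a', ha', hab⟩ := Option.map_eq_some_iff.mp hb'
      have := hf (hin x a' ha') (Or.inl (List.mem_of_getElem? ha)) hab
      subst this; exact ⟨a', ha, ha'⟩
  · rw [h2, e, e]; refine and_congr_right fun _ => ?_
    constructor
    · grind
    · rintro ⟨b, hb, hb'⟩; obtain ⟨a, ha, rfl⟩ := Option.map_eq_some_iff.mp hb
      obtain ⟨a', ha', hab⟩ := Option.map_eq_some_iff.mp hb'
      have := hf (hin y a' ha') (hin x a ha) hab
      subst this; exact ⟨a', ha, ha'⟩

theorem isMcut_rename_iff [Nonempty N] {Γ : Seq E} {nc : List N} {P : Multiset (Prem N E)} {π : Pf E}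
    (f : N → N') (hf : Set.InjOn f {a | a ∈ nc ∨ ∃ x ∈ P, a ∈ x.1}) :
    IsMcut Γ (nc.map f) (P.map (ren f)) π ↔ IsMcut Γ nc P π := by
  refine ⟨fun h => ?_, fun h => h.rename f hf⟩
  · let g := Function.invFunOn f {a | a ∈ nc ∨ ∃ x ∈ P, a ∈ x.1}
    have hg : ∀ a, (a ∈ nc ∨ ∃ x ∈ P, a ∈ x.1) → g (f a) = a := fun a ha => hf.leftInvOn_invFunOn ha
    have e1 : (nc.map f).map g = nc := by
      rw [List.map_map]; simp_all [List.map_congr_left]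
    have e2 : (P.map (ren f)).map (ren g) = P := by
      rw [Multiset.map_map]
      conv_rhs => rw [← Multiset.map_id P]
      refine Multiset.map_congr rfl fun x hx => ?_
      refine Prod.ext ?_ rfl; change (x.1.map f).map g = x.1
      rw [List.map_map]
      conv_rhs => rw [← List.map_id x.1]
      exact List.map_congr_left fun a ha => hg a (Or.inr ⟨x, hx, ha⟩)
    have := h.rename g (by
      have key : ∀ b, (b ∈ nc.map f ∨ ∃ x ∈ P.map (ren f), b ∈ x.1) →
          ∃ a, (a ∈ nc ∨ ∃ x ∈ P, a ∈ x.1) ∧ f a = b := by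
        rintro b (hb | ⟨x, hx, hb⟩)
        · obtain ⟨a, ha, rfl⟩ := List.mem_map.mp hb; exact ⟨a, Or.inl ha, rfl⟩
        · obtain ⟨y, hy, rfl⟩ := Multiset.mem_map.mp hx; obtain ⟨a, ha, rfl⟩ := List.mem_map.mp hb
          exact ⟨a, Or.inr ⟨y, hy, ha⟩, rfl⟩
      intro b hb b' hb' hbb; obtain ⟨a, ha, rfl⟩ := key b hb
      obtain ⟨a', ha', rfl⟩ := key b' hb'; rw [hg a ha, hg a' ha'] at hbb
      rw [hbb])
    rwa [e1, e2] at this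

/-- The translation of a premise. -/
noncomputable def trP (x : Prem N E) : Prem N Unit := (x.1, x.2.tr)

theorem IsMcut.tr {Γ : Seq E} {nc : List N} {P : Multiset (Prem N E)} {π : Pf E}
    (h : IsMcut Γ nc P π) : IsMcut (Γ.map Fm.tr) nc (P.map trP) π.tr := by
  obtain ⟨L, iota, link, rfl, hnode, hn, hL, h1, h2⟩ := h
  have e : ∀ x : ℕ × ℕ, ((L.map trP)[x.1]?).bind (fun y => y.1[x.2]?) =
      (L[x.1]?).bind fun y => y.1[x.2]? := by
    intro x; rw [List.getElem?_map]
    rcases L[x.1]? with _ | y <;> rfl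
  refine ⟨L.map trP, iota, link, rfl, ?_, by simpa using hn, ?_, fun k x => ?_, fun x y => ?_⟩
  · have := Pf.tr_isNode (r := .mcut ((L.map trP).map fun x => x.2.concl) iota link) hnode
      (by simp [Rule.tr, trP, Pf.tr_concl, Function.comp_def]) (by simp [Rule.arity])
    simpa [trP, Function.comp_def] using this
  all_goals grind [trP, Pf.tr_concl]

end Named

section Counting
variable {N N' : Type} {E : Type u}

open Classical in
/-- The names occurring in some premises. -/
noncomputable def nmF (X : Skel N E) : Finset N := ((occM X).map Prod.fst).toFinset

theorem mem_nmF {X : Skel N E} {a : N} : a ∈ nmF X ↔ HasName a X := by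
  grind [nmF, Multiset.mem_map, hasName_iff]

theorem card_eq_sum_fil (M : Multiset (N × Fm E)) (s : Finset N) (h : ∀ p ∈ M, p.1 ∈ s) :
    M.card = ∑ a ∈ s, (fil a M).card := by
  classical
  induction M using Multiset.induction_on with
  | empty => simp [fil]
  | cons p M ih =>
    obtain ⟨b, A⟩ := p; rw [Multiset.card_cons, ih fun p hp => h p (Multiset.mem_cons_of_mem hp)]
    have hb : b ∈ s := h (b, A) (Multiset.mem_cons_self _ _)
    rw [← Finset.add_sum_erase _ _ hb, ← Finset.add_sum_erase _ (fun a => (fil a ((b, A) ::ₘ M)).card) hb,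
      fil_cons_self, Multiset.card_cons]
    grind [fil_cons_ne, Finset.sum_congr]

theorem nmF_card_cons (y : List (N × Fm E)) (K : Skel N E) {a : N} (ha : a ∈ y.map Prod.fst)
    (hK : HasName a K) : (nmF (y ::ₘ K)).card + 1 ≤ (nmF K).card + y.length := by
  classical
  have e : nmF (y ::ₘ K) = nmF K ∪ (y.map Prod.fst).toFinset := by
    ext b; rw [Finset.mem_union, mem_nmF, mem_nmF, List.mem_toFinset]
    constructor
    · rintro ⟨l, hl, hb⟩; rcases Multiset.mem_cons.mp hl with rfl | hl
      · exact Or.inr hb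
      · exact Or.inl ⟨l, hl, hb⟩
    · rintro (⟨l, hl, hb⟩ | hb)
      · exact ⟨l, Multiset.mem_cons_of_mem hl, hb⟩
      · exact ⟨y, Multiset.mem_cons_self _ _, hb⟩
  have h1 := Finset.card_union_add_card_inter (nmF K) (y.map Prod.fst).toFinset
  have h2 : 0 < (nmF K ∩ (y.map Prod.fst).toFinset).card :=
    Finset.card_pos.mpr ⟨a, Finset.mem_inter.mpr ⟨mem_nmF.mpr hK, List.mem_toFinset.mpr ha⟩⟩
  have h3 : (y.map Prod.fst).toFinset.card ≤ y.length := by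
    simpa using (y.map Prod.fst).toFinset_card_le
  rw [e]; omega

theorem ConnM.grow (R : Skel N E) : ∀ K : Skel N E, ConnM (K + R) → K ≠ 0 →
    (occM K).card + (nmF (K + R)).card + (K + R).card ≤
      (occM (K + R)).card + (nmF K).card + K.card := by
  induction h : R.card generalizing R with
  | zero =>
    intro K _ _; obtain rfl := Multiset.card_eq_zero.mp h
    simp
  | succ n ih =>
    intro K hc hK
    have hR : R ≠ 0 := by rintro rfl; simp at h
    obtain ⟨a, h1, y, hy, hya⟩ := hc.2 K R rfl hK hR
    obtain ⟨R', rfl⟩ := Multiset.exists_cons_of_mem hy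
    have e : K + y ::ₘ R' = (y ::ₘ K) + R' := by rw [Multiset.add_cons, Multiset.cons_add]
    rw [e] at hc ⊢
    have h2 := ih R' (by simpa using h) (y ::ₘ K) hc (by simp)
    have h3 := nmF_card_cons y K hya h1
    rw [occM_cons, Multiset.card_add, Multiset.coe_card, Multiset.card_cons y K] at h2; omega

theorem Wired.card_two {cc : List (N × Fm E)} {X : Skel N E} (h : Wired cc X) {a : N}
    (ha : HasName a X) : (fil a (cc : Multiset (N × Fm E))).card + (fil a (occM X)).card = 2 := by
  rw [hasName_iff_fil] at ha; rcases h a with ⟨-, h2⟩ | ⟨A, h1, h2⟩ | ⟨A, h1, h2⟩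
  · exact absurd h2 ha
  · simp [h1, h2]
  · simp [h1, h2]

theorem Wired.hasName_of_cc {cc : List (N × Fm E)} {X : Skel N E} (h : Wired cc X) {p : N × Fm E}
    (hp : p ∈ cc) : HasName p.1 X := by
  rw [hasName_iff_fil]
  have hm : p.2 ∈ fil p.1 (cc : Multiset (N × Fm E)) := mem_fil.mpr hp
  rcases h p.1 with ⟨h1, -⟩ | ⟨A, h1, h2⟩ | ⟨A, h1, h2⟩
  · simp [h1] at hm
  · simp [h2]
  · simp [h1] at hm

theorem MOk.count {cc : List (N × Fm E)} {X : Skel N E} (h : MOk cc X) :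
    (occM X).card + cc.length = 2 * (nmF X).card := by
  rw [card_eq_sum_fil (occM X) (nmF X) fun p hp => mem_nmF.mpr (hasName_iff.mpr ⟨p.2, hp⟩),
    ← Multiset.coe_card, card_eq_sum_fil (cc : Multiset _) (nmF X) fun p hp =>
      mem_nmF.mpr (h.wired.hasName_of_cc (Multiset.mem_coe.mp hp)), ← Finset.sum_add_distrib,
    Finset.sum_congr rfl fun a ha => (add_comm _ _).trans (h.wired.card_two (mem_nmF.mp ha))]
  simp [mul_comm]

/-- Some premises of a correct multicut share few names. -/
theorem MOk.forest {cc : List (N × Fm E)} {K R : Skel N E} (h : MOk cc (K + R)) (hK : K ≠ 0) :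
    (occM K).card + 1 ≤ (nmF K).card + K.card := by
  have h1 := ConnM.grow R K h.conn hK
  have h2 := h.count
  have h3 := h.bal
  omega

/-- Connected premises share many names. -/
theorem ConnM.count {K : Skel N E} (h : ConnM K) : (nmF K).card + K.card ≤ (occM K).card + 1 := by
  classical
  obtain ⟨y, hy⟩ := Multiset.exists_mem_of_ne_zero h.1
  obtain ⟨K', rfl⟩ := Multiset.exists_cons_of_mem hy
  have e : y ::ₘ K' = {y} + K' := by rw [Multiset.singleton_add]
  rw [e] at h ⊢
  have h1 := ConnM.grow K' {y} h (by simp)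
  have h2 : (nmF ({y} : Skel N E)).card ≤ (occM ({y} : Skel N E)).card := by
    unfold nmF; exact (Multiset.toFinset_card_le _).trans (by simp)
  rw [Multiset.card_singleton] at h1; omega

/-- A connected part, when it is separated from the others by one name. -/
theorem ConnM.part {Y C : Skel N E} (h : ConnM (Y + C)) (hY : Y ≠ 0) (hC : C ≠ 0) (a : N)
    (hsep : ∀ b, HasName b C → HasName b Y → b = a) : ConnM C := by
  refine ⟨hC, fun C₁ C₂ e h1 h2 => ?_⟩
  by_contra hno; subst e
  by_cases ha : HasName a C₁
  · have ha2 : ¬ HasName a C₂ := fun h => hno ⟨a, ha, h⟩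
    obtain ⟨b, hb, hb'⟩ := h.2 (Y + C₁) C₂ (by rw [add_assoc]) (by simp [hY]) h2
    rcases hasName_add.mp hb with hb | hb
    · exact ha2 (hsep b hb'.add_right hb ▸ hb')
    · exact hno ⟨b, hb, hb'⟩
  · obtain ⟨b, hb, hb'⟩ := h.2 (Y + C₂) C₁ (by rw [add_assoc, add_comm C₂]) (by simp [hY]) h1
    rcases hasName_add.mp hb with hb | hb
    · exact ha (hsep b hb'.add_left hb ▸ hb')
    · exact hno ⟨b, hb', hb⟩

theorem exists_of_map_eq_add {α β : Type*} (g : α → β) (X : Multiset α) (Y₁ Y₂ : Multiset β)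
    (h : X.map g = Y₁ + Y₂) : ∃ X₁ X₂, X = X₁ + X₂ ∧ X₁.map g = Y₁ ∧ X₂.map g = Y₂ := by
  classical
  induction X using Multiset.induction_on generalizing Y₁ Y₂ with
  | empty =>
    rw [Multiset.map_zero] at h; obtain ⟨rfl, rfl⟩ := add_eq_zero.mp h.symm
    exact ⟨0, 0, rfl, rfl, rfl⟩
  | cons x X ih =>
    rw [Multiset.map_cons] at h
    have hx : g x ∈ Y₁ + Y₂ := by rw [← h]; simp
    rcases Multiset.mem_add.mp hx with hx | hx
    · obtain ⟨Z, rfl⟩ := Multiset.exists_cons_of_mem hx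
      rw [Multiset.cons_add, Multiset.cons_inj_right] at h
      obtain ⟨X₁, X₂, rfl, rfl, rfl⟩ := ih _ _ h; exact ⟨x ::ₘ X₁, X₂, by simp, by simp, rfl⟩
    · obtain ⟨Z, rfl⟩ := Multiset.exists_cons_of_mem hx
      rw [Multiset.add_cons, Multiset.cons_inj_right] at h
      obtain ⟨X₁, X₂, rfl, rfl, rfl⟩ := ih _ _ h; exact ⟨X₁, x ::ₘ X₂, by simp, rfl, by simp⟩

theorem ConnM.map {X : Skel N E} {E' : Type*} (h : ConnM X)
    (g : List (N × Fm E) → List (N' × Fm E')) (φ : N → N')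
    (hg : ∀ l ∈ X, ∀ a ∈ l.map Prod.fst, φ a ∈ (g l).map Prod.fst) : ConnM (X.map g) := by
  refine ⟨by simpa using h.1, fun Y₁ Y₂ e h1 h2 => ?_⟩
  obtain ⟨X₁, X₂, rfl, rfl, rfl⟩ := exists_of_map_eq_add g X Y₁ Y₂ e
  obtain ⟨a, ⟨l, hl, ha⟩, l', hl', ha'⟩ := h.2 X₁ X₂ rfl (by simpa using h1) (by simpa using h2)
  exact ⟨φ a, ⟨g l, Multiset.mem_map_of_mem _ hl, hg l (Multiset.mem_add.mpr (Or.inl hl)) a ha⟩,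
    g l', Multiset.mem_map_of_mem _ hl', hg l' (Multiset.mem_add.mpr (Or.inr hl')) a ha'⟩

theorem riesz_multiset {α : Type*} {X Y Z₁ Z₂ : Multiset α} (h : X + Y = Z₁ + Z₂) :
    ∃ X₁ X₂ Y₁ Y₂, X = X₁ + X₂ ∧ Y = Y₁ + Y₂ ∧ Z₁ = X₁ + Y₁ ∧ Z₂ = X₂ + Y₂ := by
  classical
  induction X using Multiset.induction_on generalizing Z₁ Z₂ with
  | empty => exact ⟨0, 0, Z₁, Z₂, by simp, by simpa using h, by simp, by simp⟩
  | cons x X ih =>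
    have hx : x ∈ Z₁ + Z₂ := by rw [← h]; simp
    rcases Multiset.mem_add.mp hx with hx | hx
    · obtain ⟨Z, rfl⟩ := Multiset.exists_cons_of_mem hx
      rw [Multiset.cons_add, Multiset.cons_add, Multiset.cons_inj_right] at h
      obtain ⟨X₁, X₂, Y₁, Y₂, rfl, rfl, rfl, rfl⟩ := ih h
      exact ⟨x ::ₘ X₁, X₂, Y₁, Y₂, by simp, rfl, by simp, rfl⟩
    · obtain ⟨Z, rfl⟩ := Multiset.exists_cons_of_mem hx
      rw [Multiset.cons_add, Multiset.add_cons, Multiset.cons_inj_right] at h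
      obtain ⟨X₁, X₂, Y₁, Y₂, rfl, rfl, rfl, rfl⟩ := ih h
      exact ⟨X₁, x ::ₘ X₂, Y₁, Y₂, by simp, rfl, rfl, by simp⟩

theorem ConnM.union {X Y : Skel N E} (hX : ConnM X) (hY : ConnM Y) {a : N} (h1 : HasName a X)
    (h2 : HasName a Y) : ConnM (X + Y) := by
  refine ⟨by simp [hX.1], fun Z₁ Z₂ e hz1 hz2 => ?_⟩
  obtain ⟨X₁, X₂, Y₁, Y₂, rfl, rfl, rfl, rfl⟩ := riesz_multiset e; by_cases hx1 : X₁ = 0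
  · subst hx1; by_cases hy2 : Y₂ = 0
    · subst hy2; exact ⟨a, by simpa using h2, by simpa using h1⟩
    · obtain ⟨b, hb, hb'⟩ := hY.2 Y₁ Y₂ rfl (by simpa using hz1) hy2
      exact ⟨b, hb.add_right, hb'.add_right⟩
  · by_cases hx2 : X₂ = 0
    · subst hx2; by_cases hy1 : Y₁ = 0
      · subst hy1; exact ⟨a, by simpa using h1, by simpa using h2⟩
      · obtain ⟨b, hb, hb'⟩ := hY.2 Y₁ Y₂ rfl hy1 (by simpa using hz2)
        exact ⟨b, hb.add_right, hb'.add_right⟩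
    · obtain ⟨b, hb, hb'⟩ := hX.2 X₁ X₂ rfl hx1 hx2; exact ⟨b, hb.add_left, hb'.add_left⟩

/-! ### Maps -/

/-- Rename by `φ` and change the formula named `a` by `h a`. -/
def nmap {E' : Type u} (φ : N → N') (h : N → Fm E → Fm E') (p : N × Fm E) : N' × Fm E' :=
  (φ p.1, h p.1 p.2)

theorem fil_nmap {E' : Type u} {φ : N → N'} (hφ : Function.Injective φ) (h : N → Fm E → Fm E')
    (a : N) (M : Multiset (N × Fm E)) : fil (φ a) (M.map (nmap φ h)) = (fil a M).map (h a) := by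
  induction M using Multiset.induction_on with
  | empty => rfl
  | cons p M ih =>
    obtain ⟨b, A⟩ := p; rw [Multiset.map_cons, nmap]
    by_cases hb : b = a
    all_goals grind [fil_cons_self, Multiset.map_cons, fil_cons_ne]

theorem fil_nmap_notin {E' : Type u} {φ : N → N'} (h : N → Fm E → Fm E') {a : N'}
    (ha : ∀ b, φ b ≠ a) (M : Multiset (N × Fm E)) : fil a (M.map (nmap φ h)) = 0 := by
  rw [fil_eq_zero]; intro A hA
  obtain ⟨p, -, hp⟩ := Multiset.mem_map.mp hA; exact ha p.1 (congrArg Prod.fst hp)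

theorem occM_map {E' : Type u} (f : N × Fm E → N' × Fm E') (X : Skel N E) :
    occM (X.map (List.map f)) = (occM X).map f := by
  induction X using Multiset.induction_on with
  | empty => rfl
  | cons l X ih => rw [Multiset.map_cons, occM_cons, occM_cons, ih, Multiset.map_add]; rfl

theorem MOk.map {E' : Type u} {cc : List (N × Fm E)} {X : Skel N E} (hm : MOk cc X) {φ : N → N'}
    (hφ : Function.Injective φ) (h : N → Fm E → Fm E') (hneg : ∀ a A, h a A.neg = (h a A).neg) :
    MOk (cc.map (nmap φ h)) (X.map (List.map (nmap φ h))) where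
  wired := by
    intro a; rw [occM_map, ← Multiset.map_coe]
    by_cases ha : ∃ b, φ b = a
    · obtain ⟨b, rfl⟩ := ha; rw [fil_nmap hφ, fil_nmap hφ]
      rcases hm.wired b with ⟨h1, h2⟩ | ⟨A, h1, h2⟩ | ⟨A, h1, h2⟩
      · exact Or.inl (by simp [h1, h2])
      · exact Or.inr (Or.inl ⟨h b A, by simp [h1, h2]⟩)
      · exact Or.inr (Or.inr ⟨h b A, by simp [h1, h2, hneg]⟩)
    grind [fil_nmap_notin]
  conn := hm.conn.map _ φ fun l _ a ha => by
    obtain ⟨p, hp, rfl⟩ := List.mem_map.mp ha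
    exact List.mem_map.mpr ⟨_, List.mem_map.mpr ⟨p, hp, rfl⟩, rfl⟩
  bal := by
    rw [occM_map, Multiset.card_map, List.length_map, Multiset.card_map]; exact hm.bal

/-! ### Duplication -/

/-- The copy number `t`. -/
def tagp (t : ℕ) (p : ℕ × Fm E) : Name' × Fm E := ((some p.1, t), p.2)

theorem tagp_eq (t : ℕ) : (tagp t : ℕ × Fm E → Name' × Fm E) =
    nmap (fun a => ((some a, t) : Name')) fun _ A => A := rfl

theorem fil_tagp (t : ℕ) (b : ℕ) (M : Multiset (ℕ × Fm E)) :
    fil ((some b, t) : Name') (M.map (tagp t)) = fil b M := by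
  rw [tagp_eq, fil_nmap (φ := fun a => ((some a, t) : Name')) (fun a b h => by simpa using h)]
  simp

theorem fil_tagp_ne {t : ℕ} {o : Name'} (h : ∀ b, o ≠ (some b, t)) (M : Multiset (ℕ × Fm E)) :
    fil o (M.map (tagp t)) = 0 := by
  rw [tagp_eq]; exact fil_nmap_notin _ (fun b h' => h b h'.symm) M

open Classical in
/-- The conclusion after the duplication of some premises. -/
noncomputable def dupC (Q : ℕ → Prop) (cc : List (ℕ × Fm E)) : List (Name' × Fm E) :=
  cc.flatMap fun p => if Q p.1 then [tagp 0 p, tagp 1 p] else [tagp 0 p]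

open Classical in
theorem dupC_coe (Q : ℕ → Prop) (cc : List (ℕ × Fm E)) : (dupC Q cc : Multiset (Name' × Fm E)) =
    (cc : Multiset _).map (tagp 0) + ((cc : Multiset (ℕ × Fm E)).filter fun p => Q p.1).map (tagp 1) := by
  induction cc with
  | nil => rfl
  | cons p cc ih =>
    have e : dupC Q (p :: cc) = (if Q p.1 then [tagp 0 p, tagp 1 p] else [tagp 0 p]) ++ dupC Q cc := rfl
    rw [e, ← Multiset.coe_add, ih, ← Multiset.cons_coe, Multiset.map_cons]; by_cases h : Q p.1
    · rw [if_pos h, Multiset.filter_cons_of_pos (p := fun p : ℕ × Fm E => Q p.1) _ h, Multiset.map_cons, Multiset.cons_add,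
        Multiset.add_cons, ← Multiset.cons_coe, ← Multiset.cons_coe, Multiset.coe_nil,
        Multiset.cons_add, Multiset.cons_add, Multiset.zero_add]
    simp_all

open Classical in
theorem fil_filter (Q : N → Prop) (b : N) (M : Multiset (N × Fm E)) :
    fil b (M.filter fun p => Q p.1) = if Q b then fil b M else 0 := by
  induction M using Multiset.induction_on with
  | empty => simp [fil]
  | cons p M ih =>
    obtain ⟨c', A⟩ := p; by_cases hc : c' = b
    · grind [Multiset.filter_cons_of_pos, fil_cons_self, Multiset.filter_cons_of_neg]
    · rw [fil_cons_ne hc, ← ih]; by_cases hQ : Q c'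
      all_goals grind [Multiset.filter_cons_of_pos, fil_cons_ne, Multiset.filter_cons_of_neg]

theorem MOk.dup {cc : List (ℕ × Fm E)} {pre post : List (ℕ × Fm E)} {a : ℕ} {F : Fm E}
    {D C : Skel ℕ E} (h : MOk cc ((pre ++ (a, F) :: post) ::ₘ (D + C)))
    (hsep : ∀ b, HasName b C → HasName b ((pre ++ (a, F) :: post) ::ₘ D) → b = a)
    (hC : C = 0 ∧ a ∈ cc.map Prod.fst ∨ a ∉ cc.map Prod.fst ∧ HasName a C) :
    MOk (dupC (fun b => b = a ∨ HasName b C) cc)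
      ((pre.map (tagp 0) ++ tagp 0 (a, F) :: tagp 1 (a, F) :: post.map (tagp 0)) ::ₘ
        (D.map (List.map (tagp 0)) + (C.map (List.map (tagp 0)) + C.map (List.map (tagp 1))))) := by
  classical
  generalize hQd : (fun b => b = a ∨ HasName b C) = Q
  have hQi : ∀ b, Q b ↔ b = a ∨ HasName b C := fun b => by rw [← hQd]
  set l := pre ++ (a, F) :: post with hl
  have hla : HasName a (l ::ₘ D) := ⟨l, by simp, by simp [hl]⟩
  have hocc : occM ((pre.map (tagp 0) ++ tagp 0 (a, F) :: tagp 1 (a, F) :: post.map (tagp 0)) ::ₘ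
        (D.map (List.map (tagp 0)) + (C.map (List.map (tagp 0)) + C.map (List.map (tagp 1))))) =
      (occM (l ::ₘ (D + C))).map (tagp 0) + ((a, F) ::ₘ occM C).map (tagp 1) := by
    rw [occM_cons, occM_cons, occM_add, occM_add, occM_add, occM_map, occM_map, occM_map, hl]
    simp only [← Multiset.coe_add, ← Multiset.cons_coe, Multiset.map_add, Multiset.map_cons,
      ← Multiset.map_coe]
    simp only [← Multiset.singleton_add]
    abel
  have hsplit : ∀ b, fil b (occM (l ::ₘ (D + C))) = fil b (occM (l ::ₘ D)) + fil b (occM C) := by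
    intro b; rw [← fil_add, ← occM_add, Multiset.cons_add]
  have hFl : F ∈ fil a (occM (l ::ₘ D)) := mem_fil.mpr (mem_occM.mpr ⟨l, by simp, by simp [hl]⟩)
  have hcca : ∀ b, b ∉ cc.map Prod.fst → fil b (cc : Multiset (ℕ × Fm E)) = 0 := by
    simp [fil_eq_zero]
  have hcard : ∀ b, HasName b C → (fil b (occM C)).card +
      (fil b ((cc : Multiset (ℕ × Fm E)).filter fun p => Q p.1)).card +
      (if b = a then 1 else 0) = 2 := by
    intro b hb
    have h2 := h.wired.card_two (X := l ::ₘ (D + C)) (a := b) (by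
      rw [← Multiset.cons_add]; exact hb.add_right)
    rw [fil_filter Q, if_pos ((hQi b).mpr (Or.inr hb))]; rw [hsplit, Multiset.card_add] at h2
    by_cases hba : b = a
    · subst hba; rw [if_pos rfl]
      rcases hC with ⟨rfl, -⟩ | ⟨h3, -⟩
      · obtain ⟨l, hl, -⟩ := hb; simp at hl
      · rw [hcca _ h3] at h2 ⊢
        have h4 : 0 < (fil b (occM C)).card := Multiset.card_pos.mpr (hasName_iff_fil.mp hb)
        have h5 : 0 < (fil b (occM (l ::ₘ D))).card := Multiset.card_pos_iff_exists_mem.mpr ⟨F, hFl⟩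
        simp only [Multiset.card_zero] at h2 ⊢; omega
    · rw [if_neg hba]
      have : fil b (occM (l ::ₘ D)) = 0 := by
        by_contra h0; exact hba (hsep b hb (hasName_iff_fil.mpr h0))
      rw [this, Multiset.card_zero] at h2; omega
  have hQ : ∀ b, b = a ∨ HasName b C →
      fil b ((a, F) ::ₘ occM C) = fil b (occM (l ::ₘ (D + C))) := by
    intro b hb; by_cases hba : b = a
    · subst hba; rw [fil_cons_self, hsplit]
      obtain ⟨M, hM⟩ := Multiset.exists_cons_of_mem hFl
      have h2 := h.wired.card_two (X := l ::ₘ (D + C)) (a := b) (by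
        rw [← Multiset.cons_add]; exact hla.add_left)
      rw [hsplit, hM, Multiset.cons_add, Multiset.card_cons, Multiset.card_add] at h2; rw [hM]
      have hM0 : M.card = 0 := by
        rcases hC with ⟨rfl, h3⟩ | ⟨-, h3⟩
        · obtain ⟨⟨b', A⟩, h3, hb'⟩ := List.mem_map.mp h3; simp only at hb'
          rw [hb'] at h3
          have : 0 < (fil b (cc : Multiset (ℕ × Fm E))).card :=
            Multiset.card_pos_iff_exists_mem.mpr ⟨A, mem_fil.mpr (Multiset.mem_coe.mpr h3)⟩
          omega
        · have h4 : 0 < (fil b (occM C)).card := Multiset.card_pos.mpr (hasName_iff_fil.mp h3)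
          omega
      simp_all
    · rw [fil_cons_ne (Ne.symm hba), hsplit]
      have hb' := hb.resolve_left hba
      have : fil b (occM (l ::ₘ D)) = 0 := by
        by_contra h0; exact hba (hsep b hb' (hasName_iff_fil.mpr h0))
      rw [this, Multiset.zero_add]
  refine ⟨?_, ?_, ?_⟩
  · intro o; rw [hocc, dupC_coe, fil_add, fil_add]
    by_cases h0 : ∃ b, o = (some b, 0)
    · obtain ⟨b, rfl⟩ := h0
      rw [fil_tagp, fil_tagp, fil_tagp_ne (by simp), fil_tagp_ne (by simp), Multiset.add_zero,
        Multiset.add_zero]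
      exact h.wired b
    · push Not at h0; rw [fil_tagp_ne h0, fil_tagp_ne h0, Multiset.zero_add, Multiset.zero_add]
      by_cases h1 : ∃ b, o = (some b, 1)
      · obtain ⟨b, rfl⟩ := h1; rw [fil_tagp, fil_tagp, fil_filter Q]
        by_cases hb : Q b
        · rw [if_pos hb, hQ b ((hQi b).mp hb)]; exact h.wired b
        · rw [if_neg hb]; rw [hQi] at hb
          push Not at hb; refine Or.inl ⟨rfl, ?_⟩
          rw [fil_cons_ne (Ne.symm hb.1)]; by_contra h0
          exact hb.2 (hasName_iff_fil.mpr h0)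
      grind [fil_tagp_ne]
  · have hmapn : ∀ (t : ℕ) (l : List (ℕ × Fm E)), ∀ b ∈ l.map Prod.fst,
        ((some b, t) : Name') ∈ (l.map (tagp t)).map Prod.fst := by
      intro t l b hb; obtain ⟨p, hp, rfl⟩ := List.mem_map.mp hb
      exact List.mem_map.mpr ⟨_, List.mem_map.mpr ⟨p, hp, rfl⟩, rfl⟩
    let g : List (ℕ × Fm E) → List (Name' × Fm E) := fun l' =>
      if l' = l then pre.map (tagp 0) ++ tagp 0 (a, F) :: tagp 1 (a, F) :: post.map (tagp 0)
      else l'.map (tagp 0)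
    have hg : ∀ l', ∀ b ∈ l'.map Prod.fst, ((some b, 0) : Name') ∈ (g l').map Prod.fst := by grind
    -- connectedness of the part which is not copied
    have hD : ConnM (l ::ₘ D) := by
      by_cases hC0 : C = 0
      · subst hC0; simpa using h.conn
      · refine ConnM.part (Y := C) (a := a) ?_ hC0 (by simp) fun b h1 h2 => hsep b h2 h1
        rw [add_comm, Multiset.cons_add]; exact h.conn
    have hD' : ConnM ((pre.map (tagp 0) ++ tagp 0 (a, F) :: tagp 1 (a, F) :: post.map (tagp 0)) ::ₘ
        D.map (List.map (tagp 0))) := by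
      refine ⟨by simp, fun Y₁ Y₂ e h1 h2 => ?_⟩
      have e' : (none ::ₘ D.map some).map (fun o : Option (List (ℕ × Fm E)) => o.elim
          (pre.map (tagp 0) ++ tagp 0 (a, F) :: tagp 1 (a, F) :: post.map (tagp 0))
          (List.map (tagp 0))) = Y₁ + Y₂ := by
        rw [← e, Multiset.map_cons, Multiset.map_map]
        rfl
      obtain ⟨X₁, X₂, e1, rfl, rfl⟩ := exists_of_map_eq_add _ _ _ _ e'
      obtain ⟨b, ⟨l1, hl1, hb1⟩, l2, hl2, hb2⟩ := hD.2 (X₁.map fun o => o.getD l)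
        (X₂.map fun o => o.getD l) (by
          rw [← Multiset.map_add, ← e1, Multiset.map_cons, Multiset.map_map]
          simp) (by simpa using h1) (by simpa using h2)
      have key : ∀ (X : Multiset (Option (List (ℕ × Fm E)))) (l1 : List (ℕ × Fm E)),
          l1 ∈ X.map (fun o => o.getD l) → b ∈ l1.map Prod.fst →
          HasName ((some b, 0) : Name') (X.map fun o : Option (List (ℕ × Fm E)) => o.elim
          (pre.map (tagp 0) ++ tagp 0 (a, F) :: tagp 1 (a, F) :: post.map (tagp 0))
          (List.map (tagp 0))) := by
        intro X l1 hl1 hb1; obtain ⟨o, ho, rfl⟩ := Multiset.mem_map.mp hl1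
        refine ⟨_, Multiset.mem_map_of_mem _ ho, ?_⟩; rcases o with _ | l'
        · grind
        · exact hmapn 0 l' b hb1
      exact ⟨_, key X₁ l1 hl1 hb1, key X₂ l2 hl2 hb2⟩
    by_cases hC0 : C = 0
    · subst hC0; simpa using hD'
    · have hCc : ConnM C := ConnM.part (Y := l ::ₘ D) (by rw [Multiset.cons_add]; exact h.conn)
        (by simp) hC0 a hsep
      have hCt : ∀ t, ConnM (C.map (List.map (tagp t))) := fun t =>
        hCc.map _ (fun b => ((some b, t) : Name')) fun l' _ b hb => hmapn t l' b hb
      have haC : HasName a C := by grind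
      have haCt : ∀ t, HasName ((some a, t) : Name') (C.map (List.map (tagp t))) := by
        intro t; obtain ⟨l', h1, h2⟩ := haC
        exact ⟨_, Multiset.mem_map_of_mem _ h1, hmapn t l' a h2⟩
      have h1 := hD'.union (hCt 0) (a := (some a, 0)) ⟨_, Multiset.mem_cons_self _ _, by simp [tagp]⟩
        (haCt 0)
      have h2 := h1.union (hCt 1) (a := (some a, 1))
        ⟨_, Multiset.mem_add.mpr (Or.inl (Multiset.mem_cons_self _ _)), by simp [tagp]⟩ (haCt 1)
      rwa [Multiset.cons_add, Multiset.cons_add, add_assoc] at h2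
  · rw [hocc, ← Multiset.coe_card, dupC_coe]
    simp only [Multiset.card_add, Multiset.card_map, Multiset.card_cons, Multiset.coe_card]
    have hb := h.bal
    simp only [Multiset.card_add, Multiset.card_cons] at hb
    suffices hs : (occM C).card + 1 =
        ((cc : Multiset (ℕ × Fm E)).filter fun p => Q p.1).card + 2 * C.card by omega
    by_cases hC0 : C = 0
    · subst hC0
      have e : ((cc : Multiset (ℕ × Fm E)).filter fun p => Q p.1) =
          (cc : Multiset _).filter fun p => p.1 = a := by
        refine Multiset.filter_congr fun p _ => (hQi _).trans ⟨fun h => h.resolve_right ?_, Or.inl⟩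
        rintro ⟨l, hl, -⟩; simp at hl
      have h2 := h.wired.card_two (X := l ::ₘ (D + 0)) (a := a) (by simpa using hla)
      have h3 : 0 < (fil a (cc : Multiset (ℕ × Fm E))).card := by
        rcases hC with ⟨-, h3⟩ | ⟨-, l, hl, -⟩
        · obtain ⟨⟨b', A⟩, h3, hb'⟩ := List.mem_map.mp h3; simp only at hb'
          rw [hb'] at h3
          exact Multiset.card_pos_iff_exists_mem.mpr ⟨A, mem_fil.mpr (Multiset.mem_coe.mpr h3)⟩
        · simp at hl
      have h4 : 0 < (fil a (occM (l ::ₘ (D + 0)))).card := by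
        rw [add_zero]; exact Multiset.card_pos_iff_exists_mem.mpr ⟨F, hFl⟩
      grind [occM_zero, fil, Multiset.card_map, Multiset.card_zero]
    · have hCc : ConnM C := ConnM.part (Y := l ::ₘ D) (by rw [Multiset.cons_add]; exact h.conn)
        (by simp) hC0 a hsep
      have h1 := hCc.count
      have h2 := MOk.forest (K := C) (R := l ::ₘ D) (cc := cc) (by
        rw [add_comm, Multiset.cons_add]; exact h) hC0
      have haC : a ∈ nmF C := by
        rcases hC with ⟨h1, -⟩ | ⟨-, h1⟩
        · exact absurd h1 hC0
        · exact mem_nmF.mpr h1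
      have e1 := card_eq_sum_fil (occM C) (nmF C) fun p hp => mem_nmF.mpr (hasName_iff.mpr ⟨p.2, hp⟩)
      have e2 := card_eq_sum_fil ((cc : Multiset (ℕ × Fm E)).filter fun p => Q p.1) (nmF C)
        fun p hp => by
          rcases (hQi _).mp (Multiset.mem_filter.mp hp).2 with h3 | h3
          · rw [h3]; exact haC
          · exact mem_nmF.mpr h3
      have e3 : ∑ b ∈ nmF C, (if b = a then 1 else 0) = 1 := by simp [haC]
      have e4 := Finset.sum_congr rfl fun b hb => hcard b (mem_nmF.mp hb)
      rw [Finset.sum_add_distrib, Finset.sum_add_distrib, ← e1, ← e2, e3] at e4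
      simp only [Finset.sum_const, smul_eq_mul] at e4; omega

end Counting

/-! ### Structural trees

A structural tree describes the weakenings, derelictions and contractions performed on a formula and
on its copies; `leaf` is a formula which is left unchanged, the Boolean telling whether it still
carries its `?`. -/

inductive STree
  | leaf (b : Bool) | weak | der | con (l r : STree)

namespace STree

/-- The number of rules. -/
def size : STree → ℕ
  | leaf _ => 0 | weak => 1 | der => 1 | con l r => l.size + r.size + 1

/-- The block produced by the rules. -/
def outs : STree → List Bool
  | leaf b => [b] | weak => [] | der => [false] | con l r => l.outs ++ r.outs

/-- The tree can be applied to the formula `A`. -/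
def Wf (A : Fm Unit) : STree → Prop
  | leaf _ => True | weak => ∃ B, A = .quest () B | der => ∃ B, A = .quest () B
  | con l r => (∃ B, A = .quest () B) ∧ l.Wf A ∧ r.Wf A

def IsLeaf (t : STree) : Prop := ∃ b, t = leaf b

/-- One element of a block. -/
def el : Bool → STree
  | true => leaf true | false => der

/-- Right combs. -/
def conc : List STree → STree
  | [] => weak | [t] => t | t :: t' :: ts => con t (conc (t' :: ts))

/-- The right comb producing a block. -/
def comb (bs : List Bool) : STree := conc (bs.map el)

theorem conc_cons (t : STree) {ts : List STree} (h : ts ≠ []) : conc (t :: ts) = con t (conc ts) := by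
  cases ts with
  | nil => exact absurd rfl h
  | cons => rfl

theorem outs_el (b : Bool) : (el b).outs = [b] := by cases b <;> rfl

theorem outs_conc (ts : List STree) : (conc ts).outs = ts.flatMap outs := by
  induction ts with
  | nil => rfl
  | cons t ts ih =>
    by_cases h : ts = []
    all_goals grind [conc, conc_cons, outs]

theorem outs_comb (bs : List Bool) : (comb bs).outs = bs := by
  rw [comb, outs_conc, List.flatMap_map]; simp [outs_el, List.flatMap_singleton']

theorem wf_conc {B : Fm Unit} {ts : List STree} (h : ∀ t ∈ ts, t.Wf (.quest () B)) :
    (conc ts).Wf (.quest () B) := by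
  induction ts with
  | nil => exact ⟨B, rfl⟩
  | cons t ts ih =>
    by_cases hts : ts = []
    · subst hts; exact h t (by simp)
    · rw [conc_cons t hts]; exact ⟨⟨B, rfl⟩, h t (by simp), ih fun t' ht' => h t' (by simp [ht'])⟩

theorem wf_comb (B : Fm Unit) (bs : List Bool) : (comb bs).Wf (.quest () B) := by
  refine wf_conc fun t ht => ?_
  obtain ⟨b, -, rfl⟩ := List.mem_map.mp ht; cases b
  · exact ⟨B, rfl⟩
  · trivial

theorem conc_append (ts us : List STree) (h : us ≠ []) : conc (ts ++ [conc us]) = conc (ts ++ us) := by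
  induction ts with
  | nil => rfl
  | cons t ts ih => simp_all [conc_cons]

end STree

abbrev Item := Fm Unit × STree

/-- The rule expanding a tree, and its effect. -/
inductive Exp : Item → (ℕ → Rule Unit) → List Item → Prop
  | weak {A} : Exp (.quest () A, .weak) (fun p => .mpx p 0) []
  | der {A} : Exp (.quest () A, .der) (fun p => .mpx p 1) [(A, .leaf false)]
  | con {A l r} : Exp (.quest () A, .con l r) (fun p => .contr p 2)
      [(.quest () A, l), (.quest () A, r)]

/-- `FRun F rs F'`: the rules `rs` expand the trees `F` into `F'`. -/
inductive FRun : List Item → List (Rule Unit) → List Item → Prop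
  | nil {F} : FRun F [] F
  | step {l t R ks r rs F'} : Exp t R ks → FRun (l ++ (ks ++ r)) rs F' →
      FRun (l ++ t :: r) (R l.length :: rs) F'

def Leaves (F : List Item) : Prop := ∀ x ∈ F, x.2.IsLeaf
def WfF (F : List Item) : Prop := ∀ x ∈ F, x.2.Wf x.1
def sizeF (F : List Item) : ℕ := (F.map fun x => x.2.size).sum

section Exp
variable {t : Item} {R : ℕ → Rule Unit} {ks : List Item}

theorem Exp.structural (h : Exp t R ks) (p : ℕ) : (R p).structural = some (p, ks.length) := by
  cases h <;> rfl

theorem Exp.setPos (h : Exp t R ks) (p q : ℕ) : (R p).setPos q = R q := by cases h <;> rfl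

theorem Exp.arity (h : Exp t R ks) (p : ℕ) : (R p).arity = 1 := by cases h <;> rfl

theorem Exp.prem0 (h : Exp t R ks) (l r : Seq Unit) :
    (R l.length).prem0 (l ++ t.1 :: r) = l ++ (ks.map Prod.fst ++ r) := by
  cases h
  all_goals grind [prem0_mpx, prem0_contr]

theorem Exp.ok (h : Exp t R ks) (l r : Seq Unit) : (R l.length).Ok LL (l ++ t.1 :: r) := by
  cases h
  · exact ⟨(), _, by rw [List.getElem?_append_right le_rfl, Nat.sub_self]; rfl, Or.inl rfl⟩
  · exact ⟨(), _, by rw [List.getElem?_append_right le_rfl, Nat.sub_self]; rfl, Or.inr rfl⟩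
  · exact ⟨le_rfl, (), _, by rw [List.getElem?_append_right le_rfl, Nat.sub_self]; rfl, rfl⟩

theorem Exp.closed (h : Exp t R ks) (ht : t.1.ClosedAt 0) : ∀ x ∈ ks, x.1.ClosedAt 0 := by
  cases h
  · simp
  · simpa [Fm.ClosedAt] using ht
  · simpa using ht

theorem Exp.size (h : Exp t R ks) : t.2.size = sizeF ks + 1 := by
  cases h <;> simp [STree.size, sizeF]

theorem Exp.wf (h : Exp t R ks) (hw : t.2.Wf t.1) : WfF ks := by
  cases h
  · simp [WfF]
  · simp [WfF, STree.Wf]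
  · simpa [WfF] using hw.2

theorem Exp.not_leaf (h : Exp t R ks) : ¬ t.2.IsLeaf := by cases h <;> rintro ⟨b, hb⟩ <;> cases hb

theorem Exp.unique {R' : ℕ → Rule Unit} {ks' : List Item} (h : Exp t R ks) (h' : Exp t R' ks') :
    R = R' ∧ ks = ks' := by
  cases h <;> cases h' <;> exact ⟨rfl, rfl⟩

theorem exists_exp {A : Fm Unit} {t : STree} (hw : t.Wf A) (hl : ¬ t.IsLeaf) :
    ∃ R ks, Exp (A, t) R ks := by
  cases t with
  | leaf b => exact absurd ⟨b, rfl⟩ hl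
  | weak => obtain ⟨B, rfl⟩ := hw; exact ⟨_, _, .weak⟩
  | der => obtain ⟨B, rfl⟩ := hw; exact ⟨_, _, .der⟩
  | con l r => obtain ⟨⟨B, rfl⟩, -⟩ := hw; exact ⟨_, _, .con⟩

end Exp

theorem FRun.trans {F F' F'' : List Item} {rs rs' : List (Rule Unit)} (h : FRun F rs F')
    (h' : FRun F' rs' F'') : FRun F (rs ++ rs') F'' := by
  induction h with
  | nil => exact h'
  | step h1 _ ih => exact .step h1 (ih h')

theorem FRun.structural {F F' : List Item} {rs : List (Rule Unit)} (h : FRun F rs F') :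
    ∀ r ∈ rs, r.structural.isSome ∧ r.arity = 1 := by
  induction h with
  | nil => simp
  | step h1 _ ih =>
    intro r hr; rcases List.mem_cons.mp hr with rfl | hr
    · rw [h1.structural]; exact ⟨rfl, h1.arity _⟩
    · exact ih r hr

theorem FRun.topSeq {F F' : List Item} {rs : List (Rule Unit)} (h : FRun F rs F') :
    Pf.topSeq (F.map Prod.fst) rs = F'.map Prod.fst := by
  induction h with
  | nil => rfl
  | @step l t R ks r rs F' h1 _ ih =>
    have := h1.prem0 (l.map Prod.fst) (r.map Prod.fst)
    grind [Pf.topSeq]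

theorem FRun.wf {F F' : List Item} {rs : List (Rule Unit)} (h : FRun F rs F') (hF : WfF F) :
    WfF F' := by
  induction h with
  | nil => exact hF
  | @step l t R ks r rs F' h1 _ ih =>
    refine ih fun x hx => ?_
    rcases List.mem_append.mp hx with hx | hx
    · exact hF x (by simp [hx])
    · rcases List.mem_append.mp hx with hx | hx
      · exact h1.wf (hF t (by simp)) x hx
      · exact hF x (by simp [hx])

theorem sizeF_append (F G : List Item) : sizeF (F ++ G) = sizeF F + sizeF G := by simp [sizeF]

theorem sizeF_cons (t : Item) (G : List Item) : sizeF (t :: G) = t.2.size + sizeF G := by simp [sizeF]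

theorem exists_nonleaf {F : List Item} (h : ¬ Leaves F) : ∃ l t r, F = l ++ t :: r ∧ ¬ t.2.IsLeaf := by
  unfold Leaves at h; push Not at h
  obtain ⟨t, ht, ht'⟩ := h; obtain ⟨l, r, rfl⟩ := List.append_of_mem ht
  exact ⟨l, t, r, rfl, ht'⟩

theorem exists_run (F : List Item) (hF : WfF F) : ∃ rs G, FRun F rs G ∧ Leaves G := by
  induction h : sizeF F using Nat.strong_induction_on generalizing F with
  | _ n ih =>
    by_cases hl : Leaves F
    · exact ⟨[], F, .nil, hl⟩
    · obtain ⟨l, t, r, rfl, ht⟩ := exists_nonleaf hl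
      obtain ⟨R, ks, he⟩ := exists_exp (hF t (by simp)) ht
      have hw : WfF (l ++ (ks ++ r)) := (FRun.step he .nil).wf hF
      obtain ⟨rs, G, h1, h2⟩ := ih (sizeF (l ++ (ks ++ r))) (by
        have := he.size
        simp only [sizeF_append, sizeF_cons] at h this ⊢
        omega) _ hw rfl
      exact ⟨_, G, .step he h1, h2⟩

theorem FRun.leaves_nil {F F' : List Item} {rs : List (Rule Unit)} (h : FRun F rs F')
    (hF : Leaves F) : rs = [] := by
  cases h with
  | nil => rfl
  | step h1 _ => exact absurd (hF _ (by simp)) h1.not_leaf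

theorem mkChain_isLLProof {F F' : List Item} {rs : List (Rule Unit)} (h : FRun F rs F')
    (hc : ∀ A ∈ F.map Prod.fst, A.ClosedAt 0) {ρ : Pf Unit} (hρ : ρ.IsLLProof)
    (hρ' : ρ.concl = F'.map Prod.fst) :
    (Pf.mkChain (F.map Prod.fst) rs ρ).IsLLProof ∧
      (Pf.mkChain (F.map Prod.fst) rs ρ).concl = F.map Prod.fst := by
  induction h with
  | nil => exact ⟨hρ, hρ'⟩
  | @step l t R ks r rs F' h1 _ ih =>
    have hp := h1.prem0 (l.map Prod.fst) (r.map Prod.fst)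
    have hok := h1.ok (l.map Prod.fst) (r.map Prod.fst)
    rw [List.length_map] at hp hok
    have e : (l ++ t :: r).map Prod.fst = l.map Prod.fst ++ t.1 :: r.map Prod.fst := by simp
    have e' : (l ++ (ks ++ r)).map Prod.fst = l.map Prod.fst ++ (ks.map Prod.fst ++ r.map Prod.fst) := by
      simp
    obtain ⟨i1, i2⟩ := ih (by
      rw [e]at hc; rw [e']
      intro A hA; rcases List.mem_append.mp hA with hA | hA
      · exact hc A (by rw [List.mem_append]; exact Or.inl hA)
      · rcases List.mem_append.mp hA with hA | hA
        · obtain ⟨x, hx, rfl⟩ := List.mem_map.mp hA; exact h1.closed (hc t.1 (by simp)) x hx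
        · exact hc A (by rw [List.mem_append, List.mem_cons]; exact Or.inr (Or.inr hA))) hρ'
    rw [e', ← hp, ← e] at i1 i2; refine ⟨?_, rfl⟩
    rw [Pf.mkChain]
    obtain ⟨n1, n2, n3⟩ := Pf.mk1_isNode (Γ := (l ++ t :: r).map Prod.fst) (h1.arity l.length)
      (Pf.mkChain (Rule.prem0 ((l ++ t :: r).map Prod.fst) (R l.length)) rs ρ)
    refine Pf.isLLProof_of ⟨⟨?_, ?_, ?_⟩, ?_, ?_⟩ ?_
    · rw [n1]; exact hc
    · rw [n1, n2, e]; exact hok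
    · intro k σ hσ
      have hk := Pf.child_lt hσ
      rw [n2, h1.arity] at hk; obtain rfl : k = 0 := by omega
      rw [Pf.child_mk1 (h1.arity _)] at hσ; obtain rfl := Option.some.inj hσ
      rw [i2, Pf.occs, n1, n2]
      rfl
    · rw [n2]; cases h1 <;> rintro ⟨p, hp⟩ <;> cases hp
    · rw [n2]; cases h1 <;> rintro ⟨p, hp⟩ <;> cases hp
    grind

/-! ### Permutations -/

/-- The rules `rs` can be permuted into `rs'` below any multicut. -/
def Perm (g : Bool) (Γ : Seq Unit) (rs rs' : List (Rule Unit)) : Prop :=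
  ∀ ρ : Pf Unit, ρ.rule.IsMcutRule →
    ReflTransGen (PermZone g) (Pf.mkChain Γ rs ρ) (Pf.mkChain Γ rs' ρ)

theorem Perm.refl (g : Bool) (Γ : Seq Unit) (rs : List (Rule Unit)) : Perm g Γ rs rs := fun _ _ => .refl

theorem Perm.trans {g : Bool} {Γ : Seq Unit} {rs rs' rs'' : List (Rule Unit)} (h : Perm g Γ rs rs')
    (h' : Perm g Γ rs' rs'') : Perm g Γ rs rs'' := fun ρ hρ => (h ρ hρ).trans (h' ρ hρ)

theorem PermZone.mk1 {g : Bool} {Γ : Seq Unit} {r : Rule Unit} (hr : r.arity = 1)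
    (hm : ¬ r.IsMcutRule) {θ θ' : Pf Unit} (h : PermZone g θ θ') :
    PermZone g (Pf.mk1 Γ r θ) (Pf.mk1 Γ r θ') := by
  obtain ⟨d, h1, h2⟩ := h
  refine ⟨0 :: d, fun e he ρ hρ => ?_, .child rfl rfl (Pf.child_mk1 hr _) (Pf.child_mk1 hr _)
    (fun l hl => ?_) h2⟩
  · rcases e with _ | ⟨k, e⟩
    · obtain rfl := Option.some.inj hρ; exact hm
    grind [Pf.sub, Pf.child_mk1]
  grind [Pf.mk1, Pf.child_mkN]

theorem structural_not_mcut {r : Rule Unit} (h : r.structural.isSome) : ¬ r.IsMcutRule := by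
  rintro ⟨_, _, _, rfl⟩; simp [Rule.structural] at h

theorem Perm.cons {g : Bool} {Γ : Seq Unit} {r : Rule Unit} {rs rs' : List (Rule Unit)}
    (hr : r.arity = 1) (hm : ¬ r.IsMcutRule) (h : Perm g (r.prem0 Γ) rs rs') :
    Perm g Γ (r :: rs) (r :: rs') := by
  intro ρ hρ
  have := h ρ hρ
  rw [Pf.mkChain, Pf.mkChain]; generalize Pf.mkChain (r.prem0 Γ) rs' ρ = θ' at this
  induction this with
  | refl => exact .refl
  | tail _ h ih => exact ih.tail (PermZone.mk1 hr hm h)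

theorem mcutAbove_mkChain {Γ : Seq Unit} {rs : List (Rule Unit)} {ρ : Pf Unit}
    (hs : ∀ r ∈ rs, r.structural.isSome ∧ r.arity = 1) (h : ρ.rule.IsMcutRule) :
    McutAbove (Pf.mkChain Γ rs ρ) := by
  induction rs generalizing Γ with
  | nil => exact .mcut h
  | cons r rs ih =>
    rw [Pf.mkChain]
    exact .step (hs r (by simp)).1 (Pf.child_mk1 (hs r (by simp)).2 _)
      (ih fun r' hr' => hs r' (by simp [hr']))

theorem Perm.swap {g : Bool} {Γ Γ' : Seq Unit} {r₁ r₂ r₁' r₂' : Rule Unit} {rs : List (Rule Unit)}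
    (h : Swap g r₁ r₂ r₁' r₂') (h1 : r₁.arity = 1) (h2 : r₂.arity = 1) (h1' : r₁'.arity = 1)
    (h2' : r₂'.arity = 1) (hm : ¬ r₁.IsMcutRule) (e : r₂.prem0 (r₁.prem0 Γ) = Γ')
    (e' : r₂'.prem0 (r₁'.prem0 Γ) = Γ')
    (hs : ∀ r ∈ rs, r.structural.isSome ∧ r.arity = 1) :
    Perm g Γ (r₁ :: r₂ :: rs) (r₁' :: r₂' :: rs) := by
  intro ρ hρ
  refine .single ⟨[], fun d hd τ hτ => ?_, .here ⟨Γ, r₁, r₂, r₁', r₂', Pf.mkChain Γ' rs ρ, h, ?_, ?_,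
    mcutAbove_mkChain hs hρ⟩⟩
  · obtain rfl := List.prefix_nil.mp hd; obtain rfl := Option.some.inj hτ
    exact hm
  · refine ⟨_, Pf.mk1_isNode h1 _, _, Pf.mk1_isNode h2 _, ?_⟩; rw [e]; rfl
  · refine ⟨_, Pf.mk1_isNode h1' _, _, Pf.mk1_isNode h2' _, ?_⟩; rw [e']; rfl

theorem Exp.prem0_items {t : Item} {R : ℕ → Rule Unit} {ks : List Item} (h : Exp t R ks)
    (l r : List Item) :
    (R l.length).prem0 ((l ++ t :: r).map Prod.fst) = (l ++ (ks ++ r)).map Prod.fst := by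
  have := h.prem0 (l.map Prod.fst) (r.map Prod.fst)
  rw [List.length_map] at this; simpa using this

theorem Exp.not_mcut {t : Item} {R : ℕ → Rule Unit} {ks : List Item} (h : Exp t R ks) (p : ℕ) :
    ¬ (R p).IsMcutRule := structural_not_mcut (by rw [h.structural]; rfl)

/-- Two complete runs of the same trees differ by permutations. -/
theorem FRun.perm (g : Bool) {F G G' : List Item} {rs rs' : List (Rule Unit)} (hF : WfF F)
    (h : FRun F rs G) (hG : Leaves G) (h' : FRun F rs' G') (hG' : Leaves G') :
    Perm g (F.map Prod.fst) rs rs' := by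
  induction hn : sizeF F using Nat.strong_induction_on generalizing F G G' rs rs' with
  | _ n ih =>
    subst hn; cases h with
    | nil => rw [h'.leaves_nil hG]; exact Perm.refl _ _ _
    | @step l t R ks r rs _ h1 h2 =>
      generalize hE : l ++ t :: r = F at h' hF ih; cases h' with
      | nil => exact absurd (hG' t (by rw [← hE]; simp)) h1.not_leaf
      | @step l' t' R' ks' r' rs' _ h1' h2' =>
        rcases List.append_eq_append_iff.mp hE with ⟨m, e1, e2⟩ | ⟨m, e1, e2⟩
        · rcases m with _ | ⟨x, m⟩
          · simp only [List.append_nil, List.nil_append, List.cons.injEq] at e1 e2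
            obtain ⟨rfl, rfl⟩ := e2; subst e1
            obtain ⟨rfl, rfl⟩ := h1.unique h1'; refine Perm.cons (h1.arity _) (h1.not_mcut _) ?_
            rw [h1.prem0_items]; refine ih _ ?_ ((FRun.step h1 .nil).wf hF) h2 hG h2' hG' rfl
            have := h1.size
            simp only [sizeF_append, sizeF_cons]; omega
          · simp only [List.cons_append, List.cons.injEq] at e2; obtain ⟨rfl, rfl⟩ := e2
            subst e1
            -- the second run acts further to the right
            have hs1 := h1.size
            have hs2 := h1'.size
            have hw1 : WfF (l ++ (ks ++ (m ++ t' :: r'))) := (FRun.step h1 .nil).wf (by rwa [hE])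
            have hw2 : WfF ((l ++ t :: m) ++ (ks' ++ r')) := (FRun.step h1' .nil).wf hF
            have hw0 : WfF (l ++ (ks ++ (m ++ (ks' ++ r')))) := by
              have := (FRun.step (l := l ++ (ks ++ m)) h1' .nil (r := r')).wf (by simpa using hw1)
              simpa using this
            obtain ⟨rs0, G0, h0, hG0⟩ := exists_run _ hw0
            have c1 : FRun (l ++ (ks ++ (m ++ t' :: r'))) (R' (l ++ (ks ++ m)).length :: rs0) G0 := by
              have := FRun.step (l := l ++ (ks ++ m)) h1' (r := r') (rs := rs0) (F' := G0)
                (by simpa using h0)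
              simpa using this
            have c2 : FRun ((l ++ t :: m) ++ (ks' ++ r')) (R l.length :: rs0) G0 := by
              have := FRun.step (l := l) h1 (r := m ++ (ks' ++ r')) (rs := rs0) (F' := G0) h0
              simpa using this
            have p1 := ih _ (by simp only [sizeF_append, sizeF_cons]; omega) hw1 h2 hG c1 hG0 rfl
            have p2 := ih _ (by simp only [sizeF_append, sizeF_cons]; omega) hw2 c2 hG0 h2' hG' rfl
            have p1' : Perm g (((l ++ t :: m) ++ t' :: r').map Prod.fst) (R l.length :: rs)
                (R l.length :: R' (l ++ (ks ++ m)).length :: rs0) := by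
              refine Perm.cons (h1.arity _) (h1.not_mcut _) ?_; rw [← hE, h1.prem0_items]
              exact p1
            have p2' : Perm g (((l ++ t :: m) ++ t' :: r').map Prod.fst)
                (R' (l ++ t :: m).length :: R l.length :: rs0)
                (R' (l ++ t :: m).length :: rs') := by
              refine Perm.cons (h1'.arity _) (h1'.not_mcut _) ?_; rw [h1'.prem0_items]
              exact p2
            refine p1'.trans (Perm.trans ?_ p2')
            have hsw := Swap.right (g := g) (h1.structural l.length)
              (h1'.structural (l ++ (ks ++ m)).length) (by simp)
            rw [h1'.setPos] at hsw
            have e3 : (l ++ (ks ++ m)).length + 1 - ks.length = (l ++ t :: m).length := by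
              simp; omega
            rw [e3] at hsw
            refine Perm.swap (Γ' := (l ++ (ks ++ (m ++ (ks' ++ r')))).map Prod.fst) hsw (h1.arity _)
              (h1'.arity _) (h1'.arity _) (h1.arity _) (h1.not_mcut _) ?_ ?_ h0.structural
            · rw [← hE, h1.prem0_items]
              have := h1'.prem0_items (l ++ (ks ++ m)) r'
              simpa using this
            · rw [h1'.prem0_items]
              have := h1.prem0_items l (m ++ (ks' ++ r'))
              simpa using this
        · rcases m with _ | ⟨x, m⟩
          · simp only [List.append_nil, List.nil_append, List.cons.injEq] at e1 e2
            obtain ⟨rfl, rfl⟩ := e2; subst e1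
            obtain ⟨rfl, rfl⟩ := h1.unique h1'; refine Perm.cons (h1.arity _) (h1.not_mcut _) ?_
            rw [h1.prem0_items]; refine ih _ ?_ ((FRun.step h1 .nil).wf hF) h2 hG h2' hG' rfl
            have := h1.size
            simp only [sizeF_append, sizeF_cons]; omega
          · simp only [List.cons_append, List.cons.injEq] at e2; obtain ⟨rfl, rfl⟩ := e2
            subst e1
            -- the second run acts further to the left
            have hs1 := h1.size
            have hs2 := h1'.size
            have hw1 : WfF ((l' ++ t' :: m) ++ (ks ++ r)) := (FRun.step h1 .nil).wf (by rwa [hE])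
            have hw2 : WfF (l' ++ (ks' ++ (m ++ t :: r))) := (FRun.step h1' .nil).wf hF
            have hw0 : WfF (l' ++ (ks' ++ (m ++ (ks ++ r)))) := by
              have := (FRun.step (l := l' ++ (ks' ++ m)) h1 .nil (r := r)).wf (by simpa using hw2)
              simpa using this
            obtain ⟨rs0, G0, h0, hG0⟩ := exists_run _ hw0
            have c2 : FRun (l' ++ (ks' ++ (m ++ t :: r))) (R (l' ++ (ks' ++ m)).length :: rs0) G0 := by
              have := FRun.step (l := l' ++ (ks' ++ m)) h1 (r := r) (rs := rs0) (F' := G0)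
                (by simpa using h0)
              simpa using this
            have c1 : FRun ((l' ++ t' :: m) ++ (ks ++ r)) (R' l'.length :: rs0) G0 := by
              have := FRun.step (l := l') h1' (r := m ++ (ks ++ r)) (rs := rs0) (F' := G0) h0
              simpa using this
            have p1 := ih _ (by simp only [sizeF_append, sizeF_cons]; omega) hw1 h2 hG c1 hG0 rfl
            have p2 := ih _ (by simp only [sizeF_append, sizeF_cons]; omega) hw2 c2 hG0 h2' hG' rfl
            have p1' : Perm g ((l' ++ t' :: (m ++ t :: r)).map Prod.fst)
                (R (l' ++ t' :: m).length :: rs)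
                (R (l' ++ t' :: m).length :: R' l'.length :: rs0) := by
              refine Perm.cons (h1.arity _) (h1.not_mcut _) ?_; rw [← hE, h1.prem0_items]
              exact p1
            have p2' : Perm g ((l' ++ t' :: (m ++ t :: r)).map Prod.fst)
                (R' l'.length :: R (l' ++ (ks' ++ m)).length :: rs0)
                (R' l'.length :: rs') := by
              refine Perm.cons (h1'.arity _) (h1'.not_mcut _) ?_; rw [h1'.prem0_items]
              exact p2
            refine p1'.trans (Perm.trans ?_ p2')
            have hsw := Swap.left (g := g) (h1.structural (l' ++ t' :: m).length)
              (h1'.structural l'.length) (by simp)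
            rw [h1.setPos] at hsw
            have e3 : (l' ++ t' :: m).length + ks'.length - 1 = (l' ++ (ks' ++ m)).length := by
              simp; omega
            rw [e3] at hsw
            refine Perm.swap (Γ' := (l' ++ (ks' ++ (m ++ (ks ++ r)))).map Prod.fst) hsw (h1.arity _)
              (h1'.arity _) (h1'.arity _) (h1.arity _) (h1.not_mcut _) ?_ ?_ h0.structural
            · rw [← hE, h1.prem0_items]
              have := h1'.prem0_items l' (m ++ (ks ++ r))
              simpa using this
            · rw [h1'.prem0_items]
              have := h1.prem0_items (l' ++ (ks' ++ m)) r
              simpa using this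

open STree

/-! ### Re-association -/

namespace STree

/-- Trees without weakenings, to be applied to a formula carrying its `?`. -/
def NW : STree → Prop
  | leaf b => b = true | weak => False | der => True | con l r => l.NW ∧ r.NW

/-- The comb with the same effect. -/
def norm : STree → STree
  | leaf b => leaf b | weak => weak | der => der | con l r => comb (con l r).outs

theorem norm_eq {t : STree} (h : t.NW ∨ t = weak) : t.norm = comb t.outs := by
  cases t with
  | leaf b =>
    obtain rfl : b = true := by rcases h with h | h; exact h; cases h
    rfl
  | weak => rfl
  | der => rfl
  | con l r => rfl

theorem NW.outs_ne {t : STree} (h : t.NW) : t.outs ≠ [] := by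
  induction t with
  | leaf b => simp [outs]
  | weak => exact absurd h id
  | der => simp [outs]
  | con l r ih _ => simp [outs, ih h.1]

end STree

theorem perm_contr_contr {l r : List Item} {B : Fm Unit} {t₁ t₂ t₃ : STree}
    {rs : List (Rule Unit)} {G : List Item} {p : ℕ} (hp : p = l.length)
    (h : FRun (l ++ (.quest () B, t₁) :: (.quest () B, t₂) :: (.quest () B, t₃) :: r) rs G) :
    Perm true ((l ++ (.quest () B, con t₁ (con t₂ t₃)) :: r).map Prod.fst)
      (.contr p 2 :: .contr (p + 1) 2 :: rs) (.contr p 2 :: .contr p 2 :: rs) := by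
  subst hp
  refine Perm.swap (Γ' := (l ++ (.quest () B, t₁) :: (.quest () B, t₂) :: (.quest () B, t₃) :: r).map
    Prod.fst) (Swap.assoc_left rfl) rfl rfl rfl rfl (by rintro ⟨_, _, _, h⟩; cases h) ?_ ?_ h.structural
  · rw [(Exp.con (A := B) (l := t₁) (r := con t₂ t₃)).prem0_items l r]
    have := (Exp.con (A := B) (l := t₂) (r := t₃)).prem0_items (l ++ [(.quest () B, t₁)]) r
    simpa using this
  · have h1 := (Exp.con (A := B) (l := con t₁ t₂) (r := t₃)).prem0_items l r
    have h2 := (Exp.con (A := B) (l := t₁) (r := t₂)).prem0_items l ((.quest () B, t₃) :: r)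
    grind

theorem perm_assoc_comb {r : List Item} {B : Fm Unit} (x y : List Bool) (hx : x ≠ []) (hy : y ≠ [])
    {l : List Item} (hl : WfF l) (hr : WfF r) {rs rs' : List (Rule Unit)} {G G' : List Item}
    (h : FRun (l ++ (.quest () B, comb (x ++ y)) :: r) rs G) (hG : Leaves G)
    (h' : FRun (l ++ (.quest () B, con (comb x) (comb y)) :: r) rs' G') (hG' : Leaves G') :
    Perm true ((l ++ (.quest () B, comb (x ++ y)) :: r).map Prod.fst) rs rs' := by
  have wf1 : ∀ t : STree, t.Wf (.quest () B) → ∀ l' : List Item, WfF l' → WfF (l' ++ (.quest () B, t) :: r) := by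
    intro t ht l' hl' z hz; rcases List.mem_append.mp hz with hz | hz
    · exact hl' z hz
    · rcases List.mem_cons.mp hz with rfl | hz
      · exact ht
      · exact hr z hz
  induction x generalizing l rs rs' G G' with
  | nil => exact absurd rfl hx
  | cons b x ih =>
    rcases x with _ | ⟨b', x⟩
    · obtain ⟨c, y', rfl⟩ := List.exists_cons_of_ne_nil hy
      exact FRun.perm true (wf1 _ (wf_comb B _) l hl) h hG h' hG'
    · have hwe : (el b).Wf (.quest () B) := by cases b; exacts [⟨B, rfl⟩, trivial]
      have hwl : WfF (l ++ [(.quest () B, el b)]) := by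
        intro z hz; rcases List.mem_append.mp hz with hz | hz
        · exact hl z hz
        · obtain rfl := List.mem_singleton.mp hz; exact hwe
      obtain ⟨rs0, G0, h0, hG0⟩ := exists_run
        ((l ++ [(.quest () B, el b)]) ++ (.quest () B, comb (b' :: x)) :: (.quest () B, comb y) :: r) (by
          intro z hz; rcases List.mem_append.mp hz with hz | hz
          · exact hwl z hz
          · rcases List.mem_cons.mp hz with rfl | hz
            · exact wf_comb _ _
            · rcases List.mem_cons.mp hz with rfl | hz
              · exact wf_comb _ _
              · exact hr z hz)
      obtain ⟨rs1, G1, h1, hG1⟩ := exists_run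
        ((l ++ [(.quest () B, el b)]) ++ (.quest () B, comb (b' :: x ++ y)) :: r)
        (wf1 _ (wf_comb B _) _ hwl)
      -- the run of the comb
      have a1 : FRun (l ++ (.quest () B, comb (b :: b' :: x ++ y)) :: r) (.contr l.length 2 :: rs1) G1 := by
        have := FRun.step (l := l) (r := r) (rs := rs1) (F' := G1)
          (Exp.con (A := B) (l := el b) (r := comb (b' :: x ++ y))) (by simpa using h1)
        exact this
      have a2 : FRun ((l ++ [(.quest () B, el b)]) ++ (.quest () B, con (comb (b' :: x)) (comb y)) :: r)
          (.contr (l.length + 1) 2 :: rs0) G0 := by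
        have := FRun.step (l := l ++ [(.quest () B, el b)]) (r := r) (rs := rs0) (F' := G0)
          (Exp.con (A := B) (l := comb (b' :: x)) (r := comb y)) (by simpa using h0)
        simpa using this
      have a3 : FRun (l ++ (.quest () B, con (comb (b :: b' :: x)) (comb y)) :: r)
          (.contr l.length 2 :: .contr l.length 2 :: rs0) G0 := by
        refine FRun.step (l := l) (Exp.con (A := B)) ?_
        refine FRun.step (l := l) (r := (.quest () B, comb y) :: r)
          (Exp.con (A := B) (l := el b) (r := comb (b' :: x))) ?_
        simpa using h0
      have e0 : (l ++ (.quest () B, comb (b :: b' :: x ++ y)) :: r).map Prod.fst =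
          (l ++ (.quest () B, con (comb (b :: b' :: x)) (comb y)) :: r).map Prod.fst := by simp
      have p1 := FRun.perm true (wf1 _ (wf_comb B _) l hl) h hG a1 hG1
      have p2 : Perm true ((l ++ (.quest () B, comb (b :: b' :: x ++ y)) :: r).map Prod.fst)
          (.contr l.length 2 :: rs1) (.contr l.length 2 :: .contr (l.length + 1) 2 :: rs0) := by
        refine Perm.cons rfl (by rintro ⟨_, _, _, h⟩; cases h) ?_
        have := (Exp.con (A := B) (l := el b) (r := comb (b' :: x ++ y))).prem0_items l r
        grind
      have p3 := perm_contr_contr (l := l) (r := r) (t₁ := el b) (t₂ := comb (b' :: x)) (t₃ := comb y)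
        (B := B) (rs := rs0) (G := G0) rfl (by simpa using h0)
      have p4 := FRun.perm true (wf1 (con (comb (b :: b' :: x)) (comb y))
        ⟨⟨B, rfl⟩, wf_comb B (b :: b' :: x), wf_comb B y⟩ l hl)
        a3 hG0 h' hG'
      grind [Perm.trans]

/-- Any trees can be re-associated into combs. -/
theorem perm_norm {F : List Item} (hF : WfF F) (hN : ∀ x ∈ F, x.2.NW ∨ x.2 = weak ∨ x.2 = leaf false)
    {rs rs' : List (Rule Unit)} {G G' : List Item}
    (h : FRun (F.map fun x => (x.1, x.2.norm)) rs G) (hG : Leaves G)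
    (h' : FRun F rs' G') (hG' : Leaves G') : Perm true (F.map Prod.fst) rs rs' := by
  have hwn : ∀ F : List Item, WfF F → WfF (F.map fun x => (x.1, x.2.norm)) := by
    intro F hF z hz; obtain ⟨⟨A, t⟩, hx, rfl⟩ := List.mem_map.mp hz
    have := hF _ hx
    cases t with
    | leaf b => trivial
    | weak => exact this
    | der => exact this
    | con l r =>
      obtain ⟨⟨B, rfl⟩, -⟩ := this; exact wf_comb B _
  induction hn : sizeF F using Nat.strong_induction_on generalizing F rs rs' G G' with
  | _ n ih =>
    subst hn; by_cases hl : Leaves F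
    · have e : F.map (fun x => (x.1, x.2.norm)) = F := by
        conv_rhs => rw [← List.map_id F]
        refine List.map_congr_left fun x hx => ?_
        obtain ⟨b, hb⟩ := hl x hx; obtain ⟨A, t⟩ := x
        simp only at hb; rw [hb]
        rfl
      rw [e] at h; rw [h.leaves_nil hl, h'.leaves_nil hl]
      exact Perm.refl _ _ _
    · obtain ⟨l, ⟨A, t⟩, r, rfl, ht⟩ := exists_nonleaf hl
      obtain ⟨R, ks, he⟩ := exists_exp (hF (A, t) (by simp)) ht
      have hw1 : WfF (l ++ (ks ++ r)) := (FRun.step he .nil).wf hF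
      have hs := he.size
      have hN1 : ∀ x ∈ l ++ (ks ++ r), x.2.NW ∨ x.2 = weak ∨ x.2 = leaf false := by
        intro x hx; rcases List.mem_append.mp hx with hx | hx
        · exact hN x (by simp [hx])
        · rcases List.mem_append.mp hx with hx | hx
          · have := hN (A, t) (by simp)
            cases he with
            | weak => simp at hx
            | der => simp only [List.mem_singleton] at hx; subst hx; exact Or.inr (Or.inr rfl)
            | @con B t1 t2 =>
              have : NW t1 ∧ NW t2 := by simpa [NW] using this
              rcases List.mem_cons.mp hx with rfl | hx
              all_goals grind
          · exact hN x (by simp [hx])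
      obtain ⟨rs1, G1, h1, hG1⟩ := exists_run _ hw1
      obtain ⟨rs0, G0, h0, hG0⟩ := exists_run _ (hwn _ hw1)
      have p := ih _ (by simp only [sizeF_append, sizeF_cons] at hs ⊢; omega) hw1 hN1 h0 hG0 h1 hG1 rfl
      have a1 := FRun.step he h1
      have p1 := FRun.perm true hF a1 hG1 h' hG'
      have p2 : Perm true ((l ++ (A, t) :: r).map Prod.fst) (R l.length :: rs0) (R l.length :: rs1) := by
        refine Perm.cons (he.arity _) (he.not_mcut _) ?_; rw [he.prem0_items]
        exact p
      refine Perm.trans ?_ (p2.trans p1)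
      have e1 : ((l ++ (A, t) :: r).map fun x => ((x.1, x.2.norm) : Item)).map Prod.fst =
          (l ++ (A, t) :: r).map Prod.fst := by rw [List.map_map]; rfl
      cases he with
      | @weak B =>
        rw [← e1]; refine FRun.perm true (hwn _ hF) h hG (G' := G0) ?_ hG0
        have := FRun.step (l := l.map fun x => ((x.1, x.2.norm) : Item)) (.weak (A := B))
          (r := r.map fun x => ((x.1, x.2.norm) : Item)) (rs := rs0) (F' := G0) (by simpa using h0)
        simpa [STree.norm] using this
      | @der B =>
        rw [← e1]; refine FRun.perm true (hwn _ hF) h hG (G' := G0) ?_ hG0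
        have := FRun.step (l := l.map fun x => ((x.1, x.2.norm) : Item)) (.der (A := B))
          (r := r.map fun x => ((x.1, x.2.norm) : Item)) (rs := rs0) (F' := G0) (by simpa [STree.norm] using h0)
        simpa [STree.norm] using this
      | @con B t1 t2 =>
        have ht12 : NW t1 ∧ NW t2 := by
          have := hN (Fm.quest () B, con t1 t2) (by simp)
          simpa [NW] using this
        have a0 : FRun ((l.map fun x => ((x.1, x.2.norm) : Item)) ++
            (.quest () B, con (comb t1.outs) (comb t2.outs)) ::
            r.map fun x => ((x.1, x.2.norm) : Item)) (.contr l.length 2 :: rs0) G0 := by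
          have := FRun.step (l := l.map fun x => ((x.1, x.2.norm) : Item))
            (.con (A := B) (l := comb t1.outs) (r := comb t2.outs))
            (r := r.map fun x => ((x.1, x.2.norm) : Item)) (rs := rs0) (F' := G0) (by
              simpa [norm_eq (Or.inl ht12.1), norm_eq (Or.inl ht12.2)] using h0)
          simpa using this
        have := perm_assoc_comb (B := B) t1.outs t2.outs ht12.1.outs_ne ht12.2.outs_ne
          (l := l.map fun x => ((x.1, x.2.norm) : Item)) (r := r.map fun x => ((x.1, x.2.norm) : Item))
          (hwn l fun x hx => hF x (by simp [hx])) (hwn r fun x hx => hF x (by simp [hx]))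
          (rs := rs) (G := G) (by simpa [STree.norm, outs] using h) hG a0 hG0
        simpa [Function.comp_def] using this

theorem frun_contrs (B : Fm Unit) (ts : List STree) (hts : ts ≠ []) (l r : List Item) :
    FRun (l ++ (.quest () B, conc ts) :: r) (contrs l.length (ts.length - 1))
      (l ++ (ts.map (fun t => ((Fm.quest () B, t) : Item)) ++ r)) := by
  induction ts generalizing l with
  | nil => exact absurd rfl hts
  | cons t ts ih =>
    rcases ts with _ | ⟨t', ts⟩
    · exact .nil
    · have h1 := ih (by simp) (l ++ [(.quest () B, t)])
      have e : (t :: t' :: ts).length - 1 = ((t' :: ts).length - 1) + 1 := by simp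
      rw [e, contrs_succ]; refine FRun.step (.con (A := B)) ?_
      simpa using h1

theorem frun_ders (B : Fm Unit) (n : ℕ) (l r : List Item) :
    FRun (l ++ (List.replicate n (.quest () B, der) ++ r)) (ders l.length n)
      (l ++ (List.replicate n (B, leaf false) ++ r)) := by
  induction n generalizing l with
  | zero => exact .nil
  | succ n ih =>
    rw [ders_succ]
    have h1 := ih (l ++ [(B, leaf false)])
    refine FRun.step (l := l) (r := List.replicate n (.quest () B, der) ++ r) (.der (A := B)) ?_
    simpa [List.replicate_succ] using h1

theorem Rule.tr_contr {E : Type u} (Γ : Seq E) (p i : ℕ) (hi : 2 ≤ i) :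
    (Rule.contr p i).tr Γ = contrs p (i - 1) := by
  obtain ⟨j, rfl⟩ : ∃ j, i = j + 2 := ⟨i - 2, by omega⟩
  rfl

theorem Rule.tr_mpx {E : Type u} (Γ : Seq E) (p i : ℕ) :
    (Rule.mpx p (i + 1)).tr Γ = contrs p i ++ ders p (i + 1) := rfl

section
variable {E : Type u} {S : Sig E}

/-- Blocks with the trees which are still to be expanded. -/
abbrev Blocks := List (List (Bool × STree))

/-- The translation of blocks. -/
def blockItem (A : Fm E) (e : Bool × STree) : Item := ((if e.1 then A else A.unquest).tr, e.2)

def blockItems (Γ : Seq E) (BT : Blocks) : List Item :=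
  (List.zipWith (fun A b => b.map (blockItem A)) Γ BT).flatten

theorem blockItems_fst (Γ : Seq E) (BT : Blocks) :
    (blockItems Γ BT).map Prod.fst = (blockSeq Γ (BT.map (List.map Prod.fst))).map Fm.tr := by
  induction Γ generalizing BT with
  | nil => rfl
  | cons A Γ ih =>
    rcases BT with _ | ⟨b, BT⟩
    · rfl
    · have := ih BT
      simp only [blockItems, blockSeq, List.map_cons, List.zipWith_cons_cons, List.flatten_cons,
        List.map_append, List.map_map] at this ⊢
      rw [this]
      rfl

theorem blockItems_append (Γ Γ' : Seq E) (BT BT' : Blocks) (h : Γ.length = BT.length) :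
    blockItems (Γ ++ Γ') (BT ++ BT') = blockItems Γ BT ++ blockItems Γ' BT' := by
  unfold blockItems; rw [List.zipWith_append h, List.flatten_append]

theorem blockItems_length (Γ : Seq E) (BT : Blocks) (h : Γ.length = BT.length) :
    (blockItems Γ BT).length = (BT.map (List.map Prod.fst)).flatten.length := by
  induction Γ generalizing BT with
  | nil =>
    obtain rfl : BT = [] := by simpa using h.symm
    rfl
  | cons A Γ ih =>
    rcases BT with _ | ⟨b, BT⟩
    all_goals grind [blockItems, List.zipWith_cons_cons]

structure BlkOk (g : Bool) (b : List (Bool × STree)) : Prop where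
  unq : ∀ e ∈ b, e.1 = false → e.2 = leaf false
  nw : ∀ e ∈ b, e.1 = true → e.2.NW ∨ b = [(true, weak)]
  lin : g = false → ∀ init last, b = init ++ [last] →
    (∀ e ∈ init, e.2 = leaf false ∨ ∃ c, e.2 = el c) ∧ (last.2 = leaf false ∨ ∃ bs, last.2 = comb bs)

theorem nw_conc {ts : List STree} (h : ts ≠ []) (ht : ∀ t ∈ ts, t.NW) : (conc ts).NW := by
  induction ts with
  | nil => exact absurd rfl h
  | cons t ts ih =>
    by_cases hts : ts = []
    · subst hts; exact ht t (by simp)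
    · rw [conc_cons t hts]; exact ⟨ht t (by simp), ih hts fun t' ht' => ht t' (by simp [ht'])⟩

theorem conc_els (init : List STree) (bs : List Bool) (hi : ∀ t ∈ init, ∃ b, t = el b) (hb : bs ≠ []) :
    ∃ cs, conc (init ++ [comb bs]) = comb cs := by
  have : ∃ cs : List Bool, init = cs.map el := by
    induction init with
    | nil => exact ⟨[], rfl⟩
    | cons t init ih =>
      obtain ⟨b, rfl⟩ := hi t (by simp)
      obtain ⟨cs, rfl⟩ := ih fun t ht => hi t (by simp [ht])
      exact ⟨b :: cs, rfl⟩
  obtain ⟨cs, rfl⟩ := this; refine ⟨cs ++ bs, ?_⟩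
  unfold comb; rw [conc_append _ _ (by simpa using hb), List.map_append]

/-- The tree expanding one element of a block, with its run. -/
theorem BlockOp.tree {s : E} {left right : List Bool} {p : ℕ} {r : Rule E} {new : List Bool}
    (h : BlockOp S s left right p r new) (g : Bool) (A : Fm E)
    (hg : g = true ∨ right = [] ∨ ∃ p, r = .mpx p 1)
    {LB NB RB : List (Bool × STree)} (hL : LB.map Prod.fst = left) (hN : NB.map Prod.fst = new)
    (hR : RB.map Prod.fst = right) (hok : BlkOk g (LB ++ NB ++ RB)) :
    ∃ t : STree, t.outs = NB.flatMap (fun e => e.2.outs) ∧ BlkOk g (LB ++ (true, t) :: RB) ∧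
      ((∀ e ∈ NB, e.2.Wf (.quest () A.tr)) → t.Wf (.quest () A.tr)) ∧
      ∀ (Γ : Seq E) (l rr : List Item), l.length = p → (∀ q ∈ r.tr Γ, q.arity = 1) ∧
        FRun (l ++ (.quest () A.tr, t) :: rr) (r.tr Γ)
          (l ++ (NB.map (blockItem (.quest s A)) ++ rr)) := by
  -- the other elements of the block
  have hunq : ∀ t : STree, ∀ e ∈ LB ++ (true, t) :: RB, e.1 = false → e.2 = leaf false := by
    intro t e he h1; rcases List.mem_append.mp he with he | he
    · exact hok.unq e (by simp [he]) h1
    · rcases List.mem_cons.mp he with rfl | he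
      · simp at h1
      · exact hok.unq e (by simp [he]) h1
  cases h with
  | @contr i hi hs =>
    have hlen : NB.length = i := by simpa using congrArg List.length hN
    have htrue : ∀ e ∈ NB, e.1 = true := by
      intro e he
      have : e.1 ∈ NB.map Prod.fst := List.mem_map.mpr ⟨e, he, rfl⟩
      rw [hN] at this; exact List.eq_of_mem_replicate this
    have hne : LB ++ NB ++ RB ≠ [(true, weak)] := by grind [List.length_cons]
    have hnw : ∀ e ∈ NB, e.2.NW := fun e he =>
      (hok.nw e (by simp [he]) (htrue e he)).resolve_right hne
    have hNne : NB.map Prod.snd ≠ [] := by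
      intro h0
      have := congrArg List.length h0
      simp at this; simp [this] at hlen; omega
    refine ⟨conc (NB.map Prod.snd), by rw [outs_conc, List.flatMap_map], ⟨hunq _, ?_, ?_⟩, ?_, ?_⟩
    · intro e he h1; refine Or.inl ?_
      rcases List.mem_append.mp he with he | he
      · exact (hok.nw e (by simp [he]) h1).resolve_right hne
      · rcases List.mem_cons.mp he with rfl | he
        · grind [nw_conc]
        · exact (hok.nw e (by simp [he]) h1).resolve_right hne
    · intro hgf init last hb; rcases hg with hg | hg | ⟨q, hg⟩
      · rw [hgf] at hg; cases hg
      · obtain rfl : RB = [] := by simpa [hg] using hR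
        obtain ⟨NI, NL, rfl⟩ : ∃ NI NL, NB = NI ++ [NL] := by
          rcases List.eq_nil_or_concat NB with h0 | ⟨NI, NL, h0⟩
          all_goals grind
        obtain ⟨h1, h2⟩ := hok.lin hgf (LB ++ NI) NL (by simp)
        obtain ⟨rfl, rfl⟩ : init = LB ∧ last = (true, conc ((NI ++ [NL]).map Prod.snd)) := by
          grind [List.append_inj']
        refine ⟨fun e he => h1 e (by simp [he]), Or.inr ?_⟩
        have hNL : NL.2.NW := hnw NL (by simp)
        obtain ⟨bs, hbs⟩ := h2.resolve_left (by rintro h0; rw [h0] at hNL; cases hNL)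
        have hbs' : bs ≠ [] := by
          rintro rfl; rw [hbs] at hNL
          exact hNL
        simp only [List.map_append, List.map_cons, List.map_nil]; rw [hbs]
        refine conc_els _ _ (fun t ht => ?_) hbs'
        obtain ⟨e, he, rfl⟩ := List.mem_map.mp ht
        refine (h1 e (by simp [he])).resolve_left fun h0 => ?_
        have := hnw e (by simp [he])
        rw [h0] at this; cases this
      · cases hg
    · grind [wf_conc]
    · intro Γ l rr hl; rw [Rule.tr_contr Γ p i hi]
      refine ⟨?_, ?_⟩
      · intro q hq; obtain ⟨k, -, rfl⟩ := List.mem_map.mp hq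
        rfl
      grind [frun_contrs, List.map_congr_left, blockItem, Fm.tr]
  | @mpx i hs h0 =>
    have hlen : NB.length = i := by simpa using congrArg List.length hN
    have hfalse : ∀ e ∈ NB, e.1 = false := by
      intro e he
      have : e.1 ∈ NB.map Prod.fst := List.mem_map.mpr ⟨e, he, rfl⟩
      rw [hN] at this; exact List.eq_of_mem_replicate this
    have hNB : NB = List.replicate i (false, leaf false) := by
      rw [← hlen, List.eq_replicate_iff]; refine ⟨rfl, fun e he => ?_⟩
      have h1 := hfalse e he
      have h2 := hok.unq e (by simp [he]) h1
      exact Prod.ext h1 h2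
    rcases i with _ | i
    · obtain ⟨h1, h2⟩ := h0 rfl; obtain rfl : LB = [] := by simpa [h1] using hL
      obtain rfl : RB = [] := by simpa [h2] using hR
      obtain rfl : NB = [] := by simpa using hlen
      refine ⟨weak, rfl, ⟨hunq _, fun e he h1 => Or.inr rfl, fun hgf init last hb => ?_⟩,
        fun _ => ⟨_, rfl⟩, fun Γ l rr hl => ⟨?_, ?_⟩⟩
      · obtain ⟨rfl, rfl⟩ : init = [] ∧ last = (true, weak) := by grind [List.append_inj']
        exact ⟨by simp, Or.inr ⟨[], rfl⟩⟩
      · intro q hq; obtain rfl := List.mem_singleton.mp hq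
        rfl
      · subst hl; exact FRun.step .weak .nil
    · have hcomb : comb (List.replicate (i + 1) false) = conc (List.replicate (i + 1) der) := by
        simp [comb, el]
      refine ⟨comb (List.replicate (i + 1) false), ?_, ⟨hunq _, ?_, ?_⟩, fun _ => wf_comb _ _, ?_⟩
      · rw [outs_comb, hNB, List.flatMap_replicate]; simp [outs]
      · intro e he h1; refine Or.inl ?_
        have hne : LB ++ NB ++ RB ≠ [(true, weak)] := by
          intro h0
          have h2 : (false, leaf false) ∈ LB ++ NB ++ RB := by rw [hNB]; simp
          rw [h0] at h2; simp at h2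
        rcases List.mem_append.mp he with he | he
        · exact (hok.nw e (by simp [he]) h1).resolve_right hne
        · rcases List.mem_cons.mp he with rfl | he
          · rw [hcomb]; refine nw_conc (by simp) fun t ht => ?_
            rw [List.eq_of_mem_replicate ht]
            trivial
          · exact (hok.nw e (by simp [he]) h1).resolve_right hne
      · intro hgf init last hb; rcases List.eq_nil_or_concat RB with hRB | ⟨RI, RL, hRB⟩
        · subst hRB
          obtain ⟨rfl, rfl⟩ : init = LB ∧ last = (true, comb (List.replicate (i + 1) false)) := by
            grind [List.append_inj']
          have h1 := (hok.lin hgf (init ++ List.replicate i (false, leaf false)) (false, leaf false)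
            (by rw [hNB, List.replicate_succ']; simp)).1
          exact ⟨fun e he => h1 e (by simp [he]), Or.inr ⟨_, rfl⟩⟩
        · rw [List.concat_eq_append] at hRB; subst hRB
          obtain ⟨h1, h2⟩ := hok.lin hgf (LB ++ NB ++ RI) RL (by simp)
          obtain ⟨rfl, rfl⟩ : init = LB ++ (true, comb (List.replicate (i + 1) false)) :: RI ∧
              last = RL := by
            have := List.append_inj' (s₁ := LB ++ (true, comb (List.replicate (i + 1) false)) :: RI)
              (t₁ := [RL]) (s₂ := init) (t₂ := [last]) (by rw [← hb]; simp) rfl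
            exact ⟨this.1.symm, by simpa using this.2.symm⟩
          refine ⟨fun e he => ?_, h2⟩
          rcases List.mem_append.mp he with he | he
          · exact h1 e (by simp [he])
          · rcases List.mem_cons.mp he with rfl | he
            · rcases hg with hg | hg | ⟨q, hg⟩
              · rw [hgf] at hg; cases hg
              · rw [hg] at hR; simp at hR
              · obtain ⟨-, rfl⟩ : p = q ∧ i = 0 := by simpa using hg
                exact Or.inr ⟨false, rfl⟩
            · exact h1 e (by simp [he])
      · intro Γ l rr hl; rw [Rule.tr_mpx Γ p i]
        refine ⟨?_, ?_⟩
        · intro q hq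
          rcases List.mem_append.mp hq with hq | hq <;> obtain ⟨k, -, rfl⟩ := List.mem_map.mp hq <;> rfl
        · have h1 := frun_contrs A.tr (List.replicate (i + 1) der) (by simp) l rr
          have h2 := frun_ders A.tr (i + 1) l rr
          rw [List.map_replicate, List.length_replicate, Nat.add_sub_cancel, ← hcomb, hl] at h1
          rw [hl] at h2
          have h3 := h1.trans h2
          rw [hNB, List.map_replicate]; exact h3

theorem StructDer.blocks {g : Bool} {Γ : Seq E} {st fin : List (List Bool)} {π ρ : Pf E}
    (h : StructDer S g Γ st π fin ρ) (hΓ : st.length = Γ.length) :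
    ∃ BT : Blocks, BT.map (List.map Prod.fst) = st ∧ (∀ b ∈ BT, BlkOk g b) ∧
      BT.map (List.flatMap fun e => e.2.outs) = fin ∧ WfF (blockItems Γ BT) ∧
      ∃ rs G, FRun (blockItems Γ BT) rs G ∧ Leaves G ∧
        Pf.Chain ((blockSeq Γ st).map Fm.tr) rs π.tr ρ.tr := by
  induction h with
  | @refl st ρ =>
    refine ⟨st.map (List.map fun b => (b, leaf b)), ?_, ?_, ?_, ?_, [], _, .nil, ?_, rfl⟩
    · simp [Function.comp_def]
    · intro b hb; obtain ⟨b, -, rfl⟩ := List.mem_map.mp hb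
      have hm : ∀ e ∈ b.map (fun c => (c, leaf c)), e.2 = leaf e.1 := by simp
      refine ⟨fun e he h1 => by rw [hm e he, h1], fun e he h1 => Or.inl (by rw [hm e he, h1]; rfl), ?_⟩
      intro _ init last hb
      have hm' : ∀ e ∈ init ++ [last], e.2 = leaf e.1 := by rw [← hb]; exact hm
      refine ⟨fun e he => ?_, ?_⟩
      · rcases hc : e.1 with _ | _
        · exact Or.inl (by rw [hm' e (by simp [he]), hc])
        · exact Or.inr ⟨true, by rw [hm' e (by simp [he]), hc]; rfl⟩
      · rcases hc : last.1 with _ | _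
        · exact Or.inl (by rw [hm' last (by simp), hc])
        · exact Or.inr ⟨[true], by rw [hm' last (by simp), hc]; rfl⟩
    · simp [List.map_congr_left, List.flatMap_map, outs]
    · intro x hx; obtain ⟨b, hb, hx⟩ := List.mem_flatten.mp hx
      obtain ⟨i, hi, rfl⟩ := List.getElem_of_mem hb
      simp only [List.getElem_zipWith, List.getElem_map, List.map_map] at hx
      obtain ⟨c, -, rfl⟩ := List.mem_map.mp hx
      trivial
    · intro x hx; obtain ⟨b, hb, hx⟩ := List.mem_flatten.mp hx
      obtain ⟨i, hi, rfl⟩ := List.getElem_of_mem hb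
      simp only [List.getElem_zipWith, List.getElem_map, List.map_map] at hx
      obtain ⟨c, -, rfl⟩ := List.mem_map.mp hx; exact ⟨c, rfl⟩
  | @step pre left right post s A r new π π' fin ρ hA hop hg hnode hder ih =>
    obtain ⟨BT, h1, h2, h3, h4, rs, G, h5, h6, h7⟩ := ih (by simpa using hΓ)
    obtain ⟨preB, BT', rfl, e1, h1⟩ := List.map_eq_append_iff.mp h1
    obtain ⟨blk, postB, rfl, e2, e3⟩ := List.map_eq_cons_iff.mp h1
    obtain ⟨LN, RB, rfl, e4, e5⟩ := List.map_eq_append_iff.mp e2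
    obtain ⟨LB, NB, rfl, e6, e7⟩ := List.map_eq_append_iff.mp e4
    obtain ⟨t, t1, t2, t3, t4⟩ := hop.tree g A hg e6 e7 e5 (h2 _ (by simp))
    obtain ⟨Γ₁, Γ₂, rfl, hlen⟩ := exists_split hA
    have hlB : Γ₁.length = preB.length := by rw [hlen, ← e1, List.length_map]
    have it : ∀ b, blockItems (Γ₁ ++ .quest s A :: Γ₂) (preB ++ b :: postB) =
        blockItems Γ₁ preB ++ (b.map (blockItem (.quest s A)) ++ blockItems Γ₂ postB) := by
      intro b; rw [blockItems_append _ _ _ _ hlB]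
      rfl
    have hbt : blockItem (.quest s A) (true, t) = (.quest () A.tr, t) := rfl
    have it1 : blockItems (Γ₁ ++ .quest s A :: Γ₂) (preB ++ (LB ++ (true, t) :: RB) :: postB) =
        (blockItems Γ₁ preB ++ LB.map (blockItem (.quest s A))) ++ (.quest () A.tr, t) ::
          (RB.map (blockItem (.quest s A)) ++ blockItems Γ₂ postB) := by
      rw [it, ← hbt]; simp
    have it2 : blockItems (Γ₁ ++ .quest s A :: Γ₂) (preB ++ (LB ++ NB ++ RB) :: postB) =
        (blockItems Γ₁ preB ++ LB.map (blockItem (.quest s A))) ++ (NB.map (blockItem (.quest s A)) ++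
          (RB.map (blockItem (.quest s A)) ++ blockItems Γ₂ postB)) := by
      rw [it]; simp
    have hpos : (blockItems Γ₁ preB ++ LB.map (blockItem (.quest s A))).length =
        pre.flatten.length + left.length := by
      grind [blockItems_length]
    obtain ⟨u1, u2⟩ := t4 (blockSeq (Γ₁ ++ .quest s A :: Γ₂) (pre ++ (left ++ true :: right) :: post)) _
      (RB.map (blockItem (.quest s A)) ++ blockItems Γ₂ postB) hpos
    rw [← it1, ← it2] at u2
    have hst : (preB ++ (LB ++ (true, t) :: RB) :: postB).map (List.map Prod.fst) =
        pre ++ (left ++ true :: right) :: post := by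
      simp [e1, e3, e5, e6]
    refine ⟨preB ++ (LB ++ (true, t) :: RB) :: postB, hst, ?_, ?_, ?_, _, G, u2.trans h5, h6, ?_⟩
    · grind
    · rw [← h3]; simp [t1]
    · rw [it1]; rw [it2] at h4
      intro x hx; rcases List.mem_append.mp hx with hx | hx
      · exact h4 x (List.mem_append.mpr (Or.inl hx))
      · rcases List.mem_cons.mp hx with rfl | hx
        · refine t3 fun e he => ?_
          have hm : blockItem (.quest s A) e ∈ NB.map (blockItem (.quest s A)) :=
            List.mem_map.mpr ⟨e, he, rfl⟩
          have h8 := h4 _ (List.mem_append.mpr (Or.inr (List.mem_append.mpr (Or.inl hm))))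
          rcases hc : e.1 with _ | _
          · rw [(h2 (LB ++ NB ++ RB) (by simp)).unq e (by simp [he]) hc]
            trivial
          · simpa [blockItem, hc, Fm.tr] using h8
        · exact h4 x (List.mem_append.mpr (Or.inr (List.mem_append.mpr (Or.inr hx))))
    · have hch := Pf.tr_chain (π := π) (by rw [hnode.2.1, hnode.1]; exact u1)
      rw [hnode.2.1, hnode.1, Pf.kid_of_child (hnode.2.2 0)] at hch; refine hch.append ?_
      have := u2.topSeq
      grind [blockItems_fst]

/-- The translation of a derived structural rule, up to permutations. -/
theorem StructDer.perm {g : Bool} {Γ : Seq E} {fin : List (List Bool)} {π ρ : Pf E}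
    (h : StructDer S g Γ (Γ.map fun _ => [true]) π fin ρ) (hρ : ρ.tr.rule.IsMcutRule) :
    fin.length = Γ.length ∧
    ∀ (rs : List (Rule Unit)) (G : List Item),
      FRun (List.zipWith (fun A b => ((A.tr, comb b) : Item)) Γ fin) rs G → Leaves G →
      ReflTransGen (PermZone g) (Pf.mkChain (Γ.map Fm.tr) rs ρ.tr) π.tr := by
  obtain ⟨BT, h1, h2, h3, h4, rs', G', h5, h6, h7⟩ := h.blocks (by simp)
  have hlen : BT.length = Γ.length := by simpa using congrArg List.length h1
  refine ⟨by rw [← h3, List.length_map, hlen], fun rs G hr hG => ?_⟩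
  have hsing : ∃ ts : List STree, BT = ts.map fun t => [(true, t)] := by
    refine ⟨BT.map fun b => ((b[0]?).map Prod.snd).getD weak, ?_⟩
    rw [List.map_map]
    conv_lhs => rw [← List.map_id BT]
    refine List.map_congr_left fun b hb => ?_
    have : b.map Prod.fst ∈ BT.map (List.map Prod.fst) := List.mem_map.mpr ⟨b, hb, rfl⟩
    rw [h1] at this; obtain ⟨A, -, hA⟩ := List.mem_map.mp this
    obtain ⟨e, rfl, he⟩ := List.map_eq_singleton_iff.mp hA.symm; grind
  obtain ⟨ts, rfl⟩ := hsing
  have hts : ∀ t ∈ ts, t.NW ∨ t = weak := by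
    intro t ht
    have := (h2 [(true, t)] (List.mem_map.mpr ⟨t, ht, rfl⟩)).nw (true, t) (by simp) rfl
    simpa using this
  have hit : blockItems Γ (ts.map fun t => [(true, t)]) = List.zipWith (fun A t => ((A.tr, t) : Item)) Γ ts := by
    clear h h1 h2 h3 h4 h5 h7 hr hts
    induction Γ generalizing ts with
    | nil => rfl
    | cons A Γ ih =>
      rcases ts with _ | ⟨t, ts⟩
      · rfl
      · have := ih ts (by simpa using hlen)
        simp only [blockItems, List.map_cons, List.zipWith_cons_cons, List.flatten_cons] at this ⊢
        rw [this]
        rfl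
  have hnorm : List.zipWith (fun A b => ((A.tr, comb b) : Item)) Γ fin =
      (List.zipWith (fun A t => ((A.tr, t) : Item)) Γ ts).map fun x => (x.1, x.2.norm) := by
    rw [← h3, List.map_map, List.map_zipWith]; rw [List.zipWith_map_right]
    clear h h1 h2 h3 h4 h5 h7 hr hit
    induction Γ generalizing ts with
    | nil => rfl
    | cons A Γ ih =>
      rcases ts with _ | ⟨t, ts⟩
      all_goals grind [List.zipWith_cons_cons, norm_eq]
  have hblk : (blockSeq Γ (Γ.map fun _ => [true])).map Fm.tr = Γ.map Fm.tr := by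
    rw [← h1, ← blockItems_fst, hit]; rw [List.map_zipWith]
    clear h h1 h2 h3 h4 h5 h7 hr hit hnorm hts
    induction Γ generalizing ts with
    | nil => rfl
    | cons A Γ ih =>
      rcases ts with _ | ⟨t, ts⟩
      all_goals grind [List.zipWith_cons_cons]
  have hfst := blockItems_fst Γ (ts.map fun t => [(true, t)])
  rw [h1, hblk] at hfst; rw [hblk] at h7
  rw [h7.eq_mkChain]; rw [hit] at h4 h5 hfst
  cases g with
  | true =>
    have := perm_norm h4 (fun x hx => by
      obtain ⟨i, hi, rfl⟩ := List.getElem_of_mem hx; rw [List.getElem_zipWith]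
      have hi' : i < ts.length := by
        rw [List.length_zipWith] at hi; omega
      rcases hts ts[i] (List.getElem_mem hi') with h | h
      · exact Or.inl h
      · exact Or.inr (Or.inl h)) (by rw [← hnorm]; exact hr) hG h5 h6
    rw [hfst] at this; exact this ρ.tr hρ
  | false =>
    have hcomb : ∀ t ∈ ts, t.norm = t := by
      intro t ht
      have hb := h2 [(true, t)] (List.mem_map.mpr ⟨t, ht, rfl⟩)
      have h8 := (hb.lin rfl [] (true, t) rfl).2
      have h9 : t ≠ leaf false := by
        rintro rfl; rcases hts _ ht with h | h
        · cases h
        · cases h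
      grind [norm_eq, outs_comb]
    have e : (List.zipWith (fun A t => ((A.tr, t) : Item)) Γ ts).map (fun x => ((x.1, x.2.norm) : Item)) =
        List.zipWith (fun A t => ((A.tr, t) : Item)) Γ ts := by
      conv_rhs => rw [← List.map_id (List.zipWith (fun A t => ((A.tr, t) : Item)) Γ ts)]
      refine List.map_congr_left fun x hx => ?_
      grind [List.getElem_of_mem]
    rw [hnorm, e] at hr
    have := FRun.perm false h4 hr hG h5 h6
    rw [hfst] at this; exact this ρ.tr hρ

end

/-! ### Simulations -/

section Sim
variable {N N' N'' : Type}

theorem mkChain_append {E : Type u} (Γ : Seq E) (rs rs' : List (Rule E)) (ρ : Pf E) :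
    Pf.mkChain Γ (rs ++ rs') ρ = Pf.mkChain Γ rs (Pf.mkChain (Pf.topSeq Γ rs) rs' ρ) := by
  induction rs generalizing Γ with
  | nil => rfl
  | cons r rs ih => rw [List.cons_append, Pf.mkChain, ih]; rfl

/-- Every multicut of the first kind reduces to every multicut of the second kind below which the
rules expanding `F` into `F'` are put. -/
def SimS (F : List Item) (nc : List N) (P : Multiset (Prem N Unit)) (F' : List Item) (nc' : List N')
    (P' : Multiset (Prem N' Unit)) : Prop :=
  ∃ rs, FRun F rs F' ∧ ∀ ρ, IsMcut (F.map Prod.fst) nc P ρ → ρ.IsLLProof →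
    ∀ ρ', IsMcut (F'.map Prod.fst) nc' P' ρ' → ρ'.IsLLProof →
      ReflTransGen PStep ρ (Pf.mkChain (F.map Prod.fst) rs ρ')

/-- As `SimS`, for some multicut of the first kind. -/
def SimW (F : List Item) (nc : List N) (P : Multiset (Prem N Unit)) (F' : List Item) (nc' : List N')
    (P' : Multiset (Prem N' Unit)) : Prop :=
  ∃ rs, FRun F rs F' ∧ ∀ ρ', IsMcut (F'.map Prod.fst) nc' P' ρ' → ρ'.IsLLProof →
    ∃ ρ, IsMcut (F.map Prod.fst) nc P ρ ∧ ρ.IsLLProof ∧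
      ReflTransGen PStep ρ (Pf.mkChain (F.map Prod.fst) rs ρ')

variable {F F' F'' : List Item} {nc : List N} {nc' : List N'} {nc'' : List N''}
  {P : Multiset (Prem N Unit)} {P' : Multiset (Prem N' Unit)} {P'' : Multiset (Prem N'' Unit)}

theorem SimS.simW (h : SimS F nc P F' nc' P') (hg : Good (F.map Prod.fst) nc P) :
    SimW F nc P F' nc' P' := by
  obtain ⟨rs, h1, h2⟩ := h; obtain ⟨ρ, h3, h4⟩ := hg.exists
  exact ⟨rs, h1, fun ρ' h5 h6 => ⟨ρ, h3, h4, h2 ρ h3 h4 ρ' h5 h6⟩⟩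

theorem steps_mkChain {rs rs' : List (Rule Unit)} {ρ ρ₁ ρ₂ : Pf Unit} {Γ Γ₁ : Seq Unit}
    (e : Pf.topSeq Γ rs = Γ₁) (hr : ∀ r ∈ rs, r.arity = 1) (hρ : ρ.IsLLProof)
    (h : ReflTransGen PStep ρ (Pf.mkChain Γ rs ρ₁))
    (h' : ReflTransGen PStep ρ₁ (Pf.mkChain Γ₁ rs' ρ₂)) :
    ReflTransGen PStep ρ (Pf.mkChain Γ (rs ++ rs') ρ₂) := by
  rw [mkChain_append, e]; refine h.trans ((IsCtx.id.comp_mkChain hr).pSteps ?_ h')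
  rcases ReflTransGen.cases_tail h with h | ⟨z, -, h⟩
  · exact h ▸ hρ
  · exact h.2.1

theorem SimS.trans (h : SimS F nc P F' nc' P') (h' : SimW F' nc' P' F'' nc'' P'') :
    SimS F nc P F'' nc'' P'' := by
  obtain ⟨rs, h1, h2⟩ := h; obtain ⟨rs', h3, h4⟩ := h'
  refine ⟨rs ++ rs', h1.trans h3, fun ρ hρ hρ' ρ₂ hρ₂ hρ₂' => ?_⟩
  obtain ⟨ρ₁, h5, h6, h7⟩ := h4 ρ₂ hρ₂ hρ₂'
  exact steps_mkChain h1.topSeq (fun r hr => (h1.structural r hr).2) hρ' (h2 ρ hρ hρ' ρ₁ h5 h6) h7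

theorem SimW.trans (h : SimW F nc P F' nc' P') (h' : SimW F' nc' P' F'' nc'' P'') :
    SimW F nc P F'' nc'' P'' := by
  obtain ⟨rs, h1, h2⟩ := h; obtain ⟨rs', h3, h4⟩ := h'
  refine ⟨rs ++ rs', h1.trans h3, fun ρ₂ hρ₂ hρ₂' => ?_⟩
  obtain ⟨ρ₁, h5, h6, h7⟩ := h4 ρ₂ hρ₂ hρ₂'; obtain ⟨ρ, h8, h9, h10⟩ := h2 ρ₁ h5 h6
  exact ⟨ρ, h8, h9, steps_mkChain h1.topSeq (fun r hr => (h1.structural r hr).2) h9 h10 h7⟩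

theorem SimW.of_imp (h : ∀ ρ, IsMcut (F.map Prod.fst) nc' P' ρ → IsMcut (F.map Prod.fst) nc P ρ) :
    SimW F nc P F nc' P' := ⟨[], .nil, fun ρ' h1 h2 => ⟨ρ', h ρ' h1, h2, .refl⟩⟩

theorem SimW.refl : SimW F nc P F nc P := .of_imp fun _ h => h

theorem SimS.of_step {rs : List (Rule Unit)} (hr : FRun F rs F')
    (h : ∀ ρ ρ', IsMcut (F.map Prod.fst) nc P ρ → IsMcut (F'.map Prod.fst) nc' P' ρ' →
      LLRed ρ (Pf.mkChain (F.map Prod.fst) rs ρ')) : SimS F nc P F' nc' P' := by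
  refine ⟨rs, hr, fun ρ h1 h2 ρ' h3 h4 => .single ?_⟩
  obtain ⟨h5, h6⟩ := mkChain_isLLProof hr (by rw [← h1.concl]; exact h2.ok.1.1) h4 h3.concl
  exact ⟨h2, h5, by rw [h6, h1.concl], [], .here (h ρ ρ' h1 h3)⟩

end Sim

/-! ### Names of the premises of unary rules -/

/-- The standard renaming. -/
def nm0 (b : ℕ) : Name' := (some b, 0)

theorem nm0_inj : Function.Injective nm0 := fun a b h => by simpa [nm0] using h

theorem keep_zero {E : Type u} : (keep 0 : Prem ℕ E → Prem Name' E) = ren nm0 := rfl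

theorem up_replace {E : Type u} (n₁ n₂ : List ℕ) (a : ℕ) (l r : Seq E) (B : Fm E) (L : Seq E)
    (h1 : n₁.length = l.length) (h2 : n₂.length = r.length) :
    up (n₁ ++ a :: n₂) (replaceAt (l ++ B :: r) l.length L) =
      n₁.map nm0 ++ ((List.range L.length).map (fun t => ((some a, t) : Name')) ++ n₂.map nm0) := by
  rw [replaceAt_split]; unfold up ctxOcc
  simp only [List.map_append, List.map_map, List.append_assoc]; congr 1
  · apply List.ext_getElem
    · simp [h1]
    · intro i hi hi'
      have hi2 : i < n₁.length := by simpa [h1] using hi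
      simp [nm0, List.getElem?_append_left hi2, List.getElem?_eq_getElem hi2]
  congr 1
  · apply List.ext_getElem
    · simp
    · intro i hi hi'; simp [← h1]
  · apply List.ext_getElem
    · simp [h2]
    · intro i hi hi'
      have hi2 : i < n₂.length := by simpa [h2] using hi
      simp only [List.getElem_map, Function.comp, List.getElem_zipIdx, Option.bind_some, nm0]; grind

theorem up_replace_one {E : Type u} {n : List ℕ} {Γ : Seq E} (h : n.length = Γ.length) {p : ℕ}
    {A : Fm E} (hp : Γ[p]? = some A) (B : Fm E) : up n (replaceAt Γ p [B]) = n.map nm0 := by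
  obtain ⟨l, r, rfl, rfl⟩ := exists_split hp
  obtain ⟨n₁, n₂', rfl, hn₁⟩ : ∃ n₁ n₂, n = n₁ ++ n₂ ∧ n₁.length = l.length :=
    ⟨n.take l.length, n.drop l.length, by simp, by simp at h ⊢; omega⟩
  rcases n₂' with _ | ⟨a, n₂⟩
  · simp at h; omega
  · rw [up_replace n₁ n₂ a l r A [B] hn₁ (by simp at h; omega)]
    simp [nm0]

theorem replaceAt_fm_set {E : Type u} {Γ : Seq E} {p : ℕ} {A : Fm E} (hp : Γ[p]? = some A) (B : Fm E) :
    (replaceAt Γ p [B]).map Occ.fm = Γ.set p B := by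
  obtain ⟨l, r, rfl, rfl⟩ := exists_split hp; rw [replaceAt_fm]
  simp

/-- `π` ends with a dereliction or a promotion opening its formula number `p`. -/
structure Opens (π : Pf Unit) (p : ℕ) (A B : Fm Unit) : Prop where
  get : π.concl[p]? = some A
  strip : A.strip = B
  occs : π.occs 0 = replaceAt π.concl p [B]
  kid : (π.kid 0).concl = π.concl.set p B

theorem opens_der {π : Pf Unit} (h : π.IsLLProof) {p : ℕ} (hr : π.rule = .mpx p 1) :
    ∃ B, Opens π p (.quest () B) B := by
  obtain ⟨⟨-, h1, h2⟩, -⟩ := h.ok; rw [hr] at h1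
  obtain ⟨⟨⟩, B, h3, -⟩ := h1
  have h4 : π.occs 0 = replaceAt π.concl p [B] := by
    unfold Pf.occs; rw [hr]
    simp [Rule.prems, h3]
  have h5 : π.child 0 = some (π.kid 0) := Pf.child_of_lt (by rw [hr]; exact Nat.one_pos)
  refine ⟨B, h3, rfl, h4, ?_⟩; rw [h2 0 _ h5, h4, replaceAt_fm_set h3]

theorem opens_prom {π : Pf Unit} (h : π.IsLLProof) {p : ℕ} (hr : π.rule = .promG p) :
    (∃ B, Opens π p (.bang () B) B) ∧
      ∀ k F, k ≠ p → π.concl[k]? = some F → ∃ B, F = .quest () B := by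
  obtain ⟨⟨-, h1, h2⟩, -⟩ := h.ok; rw [hr] at h1
  obtain ⟨⟨⟩, B, h3, h6⟩ := h1
  have h4 : π.occs 0 = replaceAt π.concl p [B] := by
    unfold Pf.occs; rw [hr]
    simp [Rule.prems, h3]
  have h5 : π.child 0 = some (π.kid 0) := Pf.child_of_lt (by rw [hr]; exact Nat.one_pos)
  refine ⟨⟨B, h3, rfl, h4, ?_⟩, fun k F hk hF => ?_⟩
  all_goals grind [replaceAt_fm_set]

theorem Opens.openAt {π : Pf Unit} {p : ℕ} {A B : Fm Unit} (h : Opens π p A B) {n : List ℕ}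
    (hn : n.length = π.concl.length) : openAt (n, π) 0 = ren nm0 (n, π.kid 0) := by
  unfold SuperLL.openAt ren; rw [h.occs]
  dsimp only; rw [up_replace_one hn h.get]

/-! ### Opening the formula with a given name -/

section Strip
variable {N : Type} {E : Type u}

open Classical in
/-- Strip the formula named `a`. -/
noncomputable def stripAt (a b : N) (A : Fm E) : Fm E := if b = a then A.strip else A

theorem map_strip_notin {a : N} {n : List N} (ha : a ∉ n) (Γ : Seq E) :
    (n.zip Γ).map (nmap id (stripAt a)) = n.zip Γ := by
  conv_rhs => rw [← List.map_id (n.zip Γ)]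
  refine List.map_congr_left fun p hp => ?_
  have : p.1 ≠ a := by rintro rfl; exact ha (List.of_mem_zip hp).1
  simp [nmap, stripAt, this]

theorem map_strip_single {a : N} {n : List N} (hn : n.Nodup) {Γ : Seq E} {p : ℕ} {A : Fm E}
    (ha : n[p]? = some a) (hA : Γ[p]? = some A) :
    (n.zip Γ).map (nmap id (stripAt a)) = n.zip (Γ.set p A.strip) := by
  obtain ⟨n₁, n₂, rfl, rfl⟩ := exists_split ha; obtain ⟨l, r, rfl, hl⟩ := exists_split hA
  have h1 : a ∉ n₁ := by grind
  have h2 : a ∉ n₂ := by grind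
  simp_all [List.zip_append, map_strip_notin, nmap, stripAt]

theorem MOk.stripName {cc : List (N × Fm E)} {X : Skel N E} (h : MOk cc X) (a : N) :
    MOk (cc.map (nmap id (stripAt a))) (X.map (List.map (nmap id (stripAt a)))) := by
  refine h.map Function.injective_id _ fun b A => ?_
  unfold stripAt; split_ifs
  · exact Fm.strip_neg A
  · rfl

theorem MOk.names_nodup {cc : List (N × Fm E)} {X : Skel N E} (h : MOk cc X) {l : List (N × Fm E)}
    (hl : l ∈ X) : (l.map Prod.fst).Nodup := by
  classical
  obtain ⟨R, rfl⟩ := Multiset.exists_cons_of_mem hl; rw [← Multiset.singleton_add] at h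
  have h1 := h.forest (by simp)
  have e : occM ({l} : Skel N E) = (l : Multiset _) := by simp [occM]
  rw [e, Multiset.card_singleton, Multiset.coe_card] at h1
  have e2 : nmF ({l} : Skel N E) = (l.map Prod.fst).toFinset := by
    ext b; rw [mem_nmF, List.mem_toFinset]
    constructor
    · rintro ⟨l', hl', hb⟩; rw [Multiset.mem_singleton] at hl'
      exact hl' ▸ hb
    · exact fun hb => ⟨l, by simp, hb⟩
  grind [List.dedup_eq_self, List.dedup_sublist, List.card_toFinset]

end Strip

section Dual
variable {N : Type} {E : Type u}

theorem fil_mono {M M' : Multiset (N × Fm E)} (h : M ≤ M') (a : N) : fil a M ≤ fil a M' := by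
  classical
  exact Multiset.map_le_map (Multiset.filter_le_filter _ h)

theorem Wired.dual {cc : List (N × Fm E)} {X : Skel N E} (h : Wired cc X) {l₁ l₂ : List (N × Fm E)}
    (hX : l₁ ::ₘ {l₂} ≤ X) {a : N} {A₁ A₂ : Fm E} (h1 : (a, A₁) ∈ l₁) (h2 : (a, A₂) ∈ l₂) :
    A₂ = A₁.neg ∧ fil a (cc : Multiset (N × Fm E)) = 0 ∧ fil a (occM X) = {A₁, A₂} := by
  obtain ⟨Y, rfl⟩ := Multiset.le_iff_exists_add.mp hX
  have e : fil a (occM (l₁ ::ₘ {l₂} + Y)) = fil a (l₁ : Multiset _) + (fil a (l₂ : Multiset _) + fil a (occM Y)) := by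
    simp [occM_cons, fil_add]
  obtain ⟨M₁, hM₁⟩ := Multiset.exists_cons_of_mem (mem_fil.mpr (Multiset.mem_coe.mpr h1))
  obtain ⟨M₂, hM₂⟩ := Multiset.exists_cons_of_mem (mem_fil.mpr (Multiset.mem_coe.mpr h2))
  rw [hM₁, hM₂] at e; rw [e]
  have h3 := h a
  rw [e] at h3; rcases h3 with ⟨-, h3⟩ | ⟨A, -, h3⟩ | ⟨A, h4, h3⟩
  · simp at h3
  · have := congrArg Multiset.card h3
    simp at this
  · have h5 := congrArg Multiset.card h3
    simp only [Multiset.card_add, Multiset.card_cons, Multiset.insert_eq_cons, Multiset.card_singleton] at h5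
    obtain rfl : M₁ = 0 := Multiset.card_eq_zero.mp (by omega)
    obtain rfl : M₂ = 0 := Multiset.card_eq_zero.mp (by omega)
    have h6 : fil a (occM Y) = 0 := Multiset.card_eq_zero.mp (by omega)
    rw [h6] at h3 ⊢
    have h7 : A₁ ::ₘ {A₂} = A ::ₘ {A.neg} := by simpa using h3
    refine ⟨?_, h4, by simp⟩
    have h8 : A₁ ∈ A ::ₘ {A.neg} := by rw [← h7]; simp
    rcases Multiset.mem_cons.mp h8 with rfl | h8
    · simpa using h7
    · obtain rfl := Multiset.mem_singleton.mp h8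
      grind [Multiset.cons_zero, Multiset.cons_swap, Multiset.cons_inj_right, Multiset.singleton_inj, Fm.neg_neg]

theorem Wired.concl_eq {cc : List (N × Fm E)} {X : Skel N E} (h : Wired cc X) {a : N} {A B : Fm E}
    (h1 : (a, A) ∈ cc) (h2 : (a, B) ∈ occM X) : A = B ∧ fil a (occM X) = {A} := by
  have h1 := mem_fil.mpr (Multiset.mem_coe.mpr h1)
  have h2 := mem_fil.mpr h2
  rcases h a with ⟨h3, -⟩ | ⟨C, h3, h4⟩ | ⟨C, h3, -⟩
  all_goals grind [Multiset.mem_singleton]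

theorem mem_zip_get {n : List N} {Γ : Seq E} {a : N} {A : Fm E} :
    (a, A) ∈ n.zip Γ ↔ ∃ p : ℕ, n[p]? = some a ∧ Γ[p]? = some A := by
  simp [List.mem_iff_getElem?, List.getElem?_zip_eq_some]

theorem mem_occM_sk {P : Multiset (Prem N E)} {a : N} {A : Fm E} :
    (a, A) ∈ occM (sk P) ↔ ∃ x ∈ P, ∃ p : ℕ, x.1[p]? = some a ∧ x.2.concl[p]? = some A := by
  rw [mem_occM]; constructor
  · rintro ⟨l, hl, h⟩; obtain ⟨x, hx, rfl⟩ := Multiset.mem_map.mp hl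
    exact ⟨x, hx, mem_zip_get.mp h⟩
  · rintro ⟨x, hx, h⟩; exact ⟨_, Multiset.mem_map_of_mem _ hx, mem_zip_get.mpr h⟩

theorem fil_zip_single {n : List N} (hn : n.Nodup) {Γ : Seq E} {p : ℕ} {a : N} {A : Fm E}
    (h1 : n[p]? = some a) (h2 : Γ[p]? = some A) : fil a (n.zip Γ : Multiset (N × Fm E)) = {A} := by
  refine fil_list_single (k := p) (List.getElem?_zip_eq_some.mpr ⟨h1, h2⟩) fun k' hk' => ?_
  obtain ⟨⟨b, B⟩, h3, rfl⟩ := Option.map_eq_some_iff.mp hk'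
  obtain ⟨h4, -⟩ := List.getElem?_zip_eq_some.mp h3
  obtain ⟨i1, j1⟩ := List.getElem?_eq_some_iff.mp h1
  obtain ⟨i2, j2⟩ := List.getElem?_eq_some_iff.mp h4
  exact (hn.getElem_inj_iff).mp (j2.trans j1.symm)

theorem map_strip_sk {P : Multiset (Prem N E)} (hP : Fits P) {a : N} (h : fil a (occM (sk P)) = 0) :
    (sk P).map (List.map (nmap id (stripAt a))) = sk P := by
  unfold sk; rw [Multiset.map_map]
  refine Multiset.map_congr rfl fun x hx => ?_
  refine map_strip_notin (fun ha => ?_) _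
  obtain ⟨p, hp, hp'⟩ := List.getElem_of_mem ha
  have hp2 : p < x.2.concl.length := by rw [← hP x hx]; exact hp
  have := fil_eq_zero.mp h x.2.concl[p]
  rw [mem_occM_sk] at this
  exact this ⟨x, hx, p, by rw [List.getElem?_eq_getElem hp, hp'], List.getElem?_eq_getElem hp2⟩

end Dual

/-- A premise, followed upwards by derelictions. -/
structure Act where
  names : List ℕ
  cur : Pf Unit
  ps : List ℕ
  base : Pf Unit

namespace Act

def prem (x : Act) : Prem ℕ Unit := (x.names, x.cur)
def fin (x : Act) : Prem ℕ Unit := (x.names, x.base)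
/-- Open the last rule. -/
def pop (x : Act) (ps : List ℕ) : Act := ⟨x.names, x.cur.kid 0, ps, x.base⟩

/-- The premise ends with derelictions. -/
def Open (x : Act) : Prop :=
  x.ps.Nodup ∧ Pf.Chain x.cur.concl (x.ps.map fun p => .mpx p 1) x.cur x.base

/-- The premise ends with derelictions and a promotion whose principal formula is cut. -/
def Closed (nc : List ℕ) (x : Act) : Prop :=
  ∃ q, x.cur.rule = .promG q ∧ q ∉ x.ps ∧ (x.pop x.ps).Open ∧ ∀ a, x.names[q]? = some a → a ∉ nc

end Act

theorem chain_kid {Γ : Seq Unit} {r : Rule Unit} {rs : List (Rule Unit)} {π ρ : Pf Unit} (hπ : π.IsLLProof)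
    (h : Pf.Chain Γ (r :: rs) π ρ) : π.rule = r ∧ Pf.Chain (π.kid 0).concl rs (π.kid 0) ρ := by
  obtain ⟨π', ⟨h1, h2, h3⟩, h4⟩ := h
  have h5 : π.child 0 = some π' := h3 0
  rw [Pf.kid_of_child h5]; refine ⟨h2, ?_⟩
  have := hπ.ok.1.2.2 0 π' h5
  unfold Pf.occs at this; rw [h2, h1] at this
  rw [this]; exact h4

theorem chain_ders {ps : List ℕ} (hn : ps.Nodup) {cur base : Pf Unit} (hp : cur.IsLLProof)
    (h : Pf.Chain cur.concl (ps.map fun p => .mpx p 1) cur base) :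
    base.IsLLProof ∧ base.concl.length = cur.concl.length ∧
      (∀ k, k ∉ ps → base.concl[k]? = cur.concl[k]?) ∧
      ∀ k ∈ ps, ∃ B, cur.concl[k]? = some (.quest () B) ∧ base.concl[k]? = some B := by
  induction ps generalizing cur with
  | nil =>
    obtain rfl : cur = base := h; exact ⟨hp, rfl, fun _ _ => rfl, by simp⟩
  | cons p ps ih =>
    obtain ⟨h1, h2⟩ := chain_kid hp h; obtain ⟨B, ho⟩ := opens_der hp h1
    obtain ⟨hp1, hp2⟩ := List.nodup_cons.mp hn; obtain ⟨i0, i1, i2, i3⟩ := ih hp2 (hp.kid 0) h2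
    rw [ho.kid] at i1 i2 i3; refine ⟨i0, by simpa using i1, fun k hk => ?_, fun k hk => ?_⟩
    · grind
    · rcases List.mem_cons.mp hk with rfl | hk
      · refine ⟨B, ho.get, ?_⟩
        rw [i2 _ hp1, List.getElem?_set_self (List.getElem?_eq_some_iff.mp ho.get).1]
      grind

/-- The trees leading to the formulas `Γf`: derelictions or nothing. -/
def Compat (F : List Item) (Γf : Seq Unit) : Prop :=
  List.Forall₂ (fun x B => (x.1 = B ∧ x.2.IsLeaf) ∨ (x.1 ≠ B ∧ x.2 = der)) F Γf

open Classical in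
/-- Bangs. -/
noncomputable def bangs {N : Type} (M : Multiset (N × Fm Unit)) : Multiset (N × Fm Unit) :=
  M.filter fun p => ∃ B, p.2 = .bang () B

/-- If every premise of `K` has a bang, and all bangs in `K` are cut with formulas of `K`, then `K`
is empty. -/
theorem MOk.no_cycle {N : Type} {cc : List (N × Fm Unit)} {K R : Skel N Unit} (h : MOk cc (K + R))
    (h1 : ∀ l ∈ K, ∃ a B, (a, Fm.bang () B) ∈ l)
    (h2 : ∀ a B, (a, Fm.bang () B) ∈ occM K → fil a (occM K) = {.bang () B, .quest () B.neg}) :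
    K = 0 := by
  classical
  by_contra hK
  have hf := h.forest hK
  have hb : K.card ≤ (bangs (occM K)).card := by
    clear hf hK h2 h
    induction K using Multiset.induction_on with
    | empty => simp
    | cons l K ih =>
      rw [occM_cons, bangs, Multiset.filter_add, Multiset.card_add, Multiset.card_cons]
      have := ih fun l hl => h1 l (by simp [hl])
      obtain ⟨a, B, hm⟩ := h1 l (by simp)
      have h3 : 0 < ((l : Multiset (N × Fm Unit)).filter fun p => ∃ B, p.2 = .bang () B).card :=
        Multiset.card_pos_iff_exists_mem.mpr ⟨_, Multiset.mem_filter.mpr ⟨hm, B, rfl⟩⟩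
      rw [bangs] at this; omega
  have e1 := card_eq_sum_fil (occM K) (nmF K) fun p hp => mem_nmF.mpr (hasName_iff.mpr ⟨p.2, hp⟩)
  have e2 := card_eq_sum_fil (bangs (occM K)) (nmF K) fun p hp =>
    mem_nmF.mpr (hasName_iff.mpr ⟨p.2, (Multiset.mem_filter.mp hp).1⟩)
  have e3 : ∀ a ∈ nmF K, (fil a (bangs (occM K))).card + 1 ≤ (fil a (occM K)).card := by
    intro a ha
    have ha' := Multiset.card_pos.mpr (hasName_iff_fil.mp (mem_nmF.mp ha))
    by_cases h0 : fil a (bangs (occM K)) = 0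
    · rw [h0, Multiset.card_zero]; omega
    · obtain ⟨A, hA⟩ := Multiset.exists_mem_of_ne_zero h0
      obtain ⟨h3, B, h4⟩ := Multiset.mem_filter.mp (mem_fil.mp hA); simp only at h4
      subst h4
      have h5 := h2 a B h3
      have h6 : fil a (bangs (occM K)) ≤ {.bang () B, .quest () B.neg} := by
        rw [← h5]; exact fil_mono (Multiset.filter_le _ _) a
      have h7 : fil a (bangs (occM K)) ≠ {.bang () B, .quest () B.neg} := by
        intro h7
        have : Fm.quest () B.neg ∈ fil a (bangs (occM K)) := by rw [h7]; simp
        obtain ⟨-, C, hC⟩ := Multiset.mem_filter.mp (mem_fil.mp this); cases hC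
      have h8 := Multiset.card_lt_card (lt_of_le_of_ne h6 h7)
      rw [h5]; omega
  have e4 := Finset.sum_le_sum e3
  rw [Finset.sum_add_distrib, ← e1, ← e2] at e4
  simp only [Finset.sum_const, smul_eq_mul, mul_one] at e4; omega

/-- Total number of derelictions. -/
def pend (A : Multiset Act) : ℕ := (A.map fun x => x.ps.length).sum

theorem zip_set_snd {N : Type} {n : List N} {Γ Γ' : Seq Unit} (h : n.length = Γ.length)
    (h' : n.length = Γ'.length) {X : Skel N Unit} (hw : Wired (n.zip Γ) X) (hw' : Wired (n.zip Γ') X) :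
    Γ = Γ' := by
  apply List.ext_getElem (by omega)
  intro k hk hk'
  have hkn : k < n.length := by omega
  have m1 : (n[k], Γ[k]) ∈ n.zip Γ := mem_zip_get.mpr
    ⟨k, List.getElem?_eq_getElem hkn, List.getElem?_eq_getElem hk⟩
  have m2 : (n[k], Γ'[k]) ∈ n.zip Γ' := mem_zip_get.mpr
    ⟨k, List.getElem?_eq_getElem hkn, List.getElem?_eq_getElem hk'⟩
  obtain ⟨C, hC⟩ := hasName_iff.mp (hw.hasName_of_cc m1)
  rw [(hw.concl_eq m1 hC).1, (hw'.concl_eq m2 hC).1]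

theorem le_sk_of_mem {N : Type} {E : Type u} {x y : Prem N E} {P Q : Multiset (Prem N E)}
    (hP : P = x ::ₘ Q) (hy : y ∈ Q) :
    x.1.zip x.2.concl ::ₘ {y.1.zip y.2.concl} ≤ sk P := by
  subst hP; unfold sk
  rw [Multiset.map_cons]
  exact Multiset.cons_le_cons _ (Multiset.singleton_le.mpr (Multiset.mem_map_of_mem (fun x : Prem N E => x.1.zip x.2.concl) hy))

section

section Wired
variable {N : Type} {E : Type u}

theorem Wired.pair {cc : List (N × Fm E)} {X : Skel N E} (h : Wired cc X) {a : N} {A : Fm E}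
    (h0 : fil a (cc : Multiset (N × Fm E)) = 0) (h1 : (a, A) ∈ occM X) : fil a (occM X) = {A, A.neg} := by
  have h1 := mem_fil.mpr h1
  rcases h a with ⟨-, h3⟩ | ⟨C, h3, h4⟩ | ⟨C, -, h3⟩
  · simp [h3] at h1
  · simp [h0] at h3
  · rw [h3] at h1 ⊢; rcases Multiset.mem_cons.mp h1 with rfl | h1
    all_goals grind [Multiset.mem_singleton, Fm.neg_neg, Multiset.pair_comm]

theorem Wired.name_unique {n : List N} {Γ : Seq E} {X : Skel N E} (h : Wired (n.zip Γ) X)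
    {a : N} (h1 : a ∉ n) : fil a (n.zip Γ : Multiset (N × Fm E)) = 0 :=
  fil_eq_zero.mpr fun A hA => h1 (List.of_mem_zip (Multiset.mem_coe.mp hA)).1

theorem sk_add {P Q : Multiset (Prem N E)} : sk (P + Q) = sk P + sk Q := Multiset.map_add _ _ _

theorem sk_cons {x : Prem N E} {P : Multiset (Prem N E)} :
    sk (x ::ₘ P) = x.1.zip x.2.concl ::ₘ sk P := Multiset.map_cons _ _ _

theorem Good.names_nodup {Γ : Seq Unit} {nc : List N} {P : Multiset (Prem N Unit)} (h : Good Γ nc P)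
    {x : Prem N Unit} (hx : x ∈ P) : x.1.Nodup := by
  have := h.mok.names_nodup (Multiset.mem_map_of_mem (fun x : Prem N Unit => x.1.zip x.2.concl) hx)
  rwa [List.map_fst_zip (h.fits x hx).le] at this

theorem Good.nc_nodup {Γ : Seq Unit} {nc : List N} {P : Multiset (Prem N Unit)} (h : Good Γ nc P) :
    nc.Nodup := by
  have := h.mok.wired.nodup
  rwa [List.map_fst_zip h.len.le] at this

end Wired

/-- All the premises of a dereliction phase. -/
def Act.all (A K : Multiset Act) (I : Multiset (Prem ℕ Unit)) : Multiset (Prem ℕ Unit) :=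
  A.map Act.prem + K.map Act.prem + I

/-- The premises when the dereliction phase is finished. -/
def Act.allFin (A K : Multiset Act) (I : Multiset (Prem ℕ Unit)) : Multiset (Prem ℕ Unit) :=
  A.map Act.fin + K.map Act.fin + I

/-- The premises `A` end with derelictions to be performed, the premises `K` with promotions to be
opened; `Γf` is the conclusion after this. -/
structure DerPhase (A K : Multiset Act) (I : Multiset (Prem ℕ Unit)) (F : List Item) (nc : List ℕ)
    (Γf : Seq Unit) : Prop where
  open_ : ∀ x ∈ A, x.Open
  closed : ∀ x ∈ K, x.Closed nc
  good : Good (F.map Prod.fst) nc (Act.all A K I)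
  len : nc.length = Γf.length
  mok : MOk (nc.zip Γf) (sk (Act.allFin A K I))
  compat : Compat F Γf

theorem Act.Open.fin_get {x : Act} (h : x.Open) (hp : x.cur.IsLLProof) {k : ℕ} {A : Fm Unit}
    (hk : x.cur.concl[k]? = some A) (hA : ∀ B, A ≠ .quest () B) : x.base.concl[k]? = some A := by
  obtain ⟨-, -, h1, h2⟩ := chain_ders h.1 hp h.2; grind

/-- The principal formula of a promotion to be opened. -/
theorem Act.Closed.principal {nc : List ℕ} {x : Act} (h : x.Closed nc) (hp : x.cur.IsLLProof) :
    ∃ q B, x.cur.rule = .promG q ∧ Opens x.cur q (.bang () B) B ∧ (x.pop x.ps).Open ∧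
      x.base.concl[q]? = some B ∧ (∀ a, x.names[q]? = some a → a ∉ nc) ∧
      ∀ k C, x.cur.concl[k]? = some (.bang () C) → k = q := by
  obtain ⟨q, h1, h2, h3, h4⟩ := h; obtain ⟨⟨B, h5⟩, h6⟩ := opens_prom hp h1
  refine ⟨q, B, h1, h5, h3, ?_, h4, fun k C hk => ?_⟩
  · obtain ⟨-, -, h7, -⟩ := chain_ders h3.1 (hp.kid 0) h3.2
    have := h7 q h2
    rw [show x.base = (x.pop x.ps).base from rfl, this]
    change (x.cur.kid 0).concl[q]? = _
    rw [h5.kid, List.getElem?_set_self (List.getElem?_eq_some_iff.mp h5.get).1]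
  · by_contra hne; obtain ⟨D, hD⟩ := h6 k _ hne hk
    cases hD

namespace DerPhase
variable {A K : Multiset Act} {I : Multiset (Prem ℕ Unit)} {F : List Item} {nc : List ℕ} {Γf : Seq Unit}

theorem prfA (h : DerPhase A K I F nc Γf) {x : Act} (hx : x ∈ A) : x.cur.IsLLProof :=
  h.good.prf x.prem (by grind [Act.all, Multiset.mem_map_of_mem])

theorem prfK (h : DerPhase A K I F nc Γf) {x : Act} (hx : x ∈ K) : x.cur.IsLLProof :=
  h.good.prf x.prem (by grind [Act.all, Multiset.mem_map_of_mem])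

/-- When there is no dereliction left, all the promotions are open. -/
theorem closed_eq_zero (h : DerPhase A K I F nc Γf) (h0 : ∀ x ∈ A, x.ps = []) : K = 0 := by
  have hfin : A.map Act.prem = A.map Act.fin := by
    refine Multiset.map_congr rfl fun x hx => ?_
    have := (h.open_ x hx).2
    rw [h0 x hx] at this
    have : x.cur = x.base := this
    unfold Act.prem Act.fin; rw [this]
  have e1 : sk (Act.all A K I) = sk (K.map Act.prem) + sk (A.map Act.fin + I) := by
    unfold Act.all; rw [← sk_add, hfin]
    congr 1
    abel
  have e2 : sk (Act.allFin A K I) = sk (K.map Act.fin) + sk (A.map Act.fin + I) := by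
    unfold Act.allFin; rw [← sk_add]
    congr 1
    abel
  have hm := h.good.mok
  rw [e1] at hm
  have hK := hm.no_cycle (fun l hl => ?_) (fun a B ha => ?_)
  · have := congrArg Multiset.card hK
    simp only [sk, Multiset.card_map, Multiset.card_zero] at this
    exact Multiset.card_eq_zero.mp this
  · obtain ⟨y, hy, rfl⟩ := Multiset.mem_map.mp hl; obtain ⟨x, hx, rfl⟩ := Multiset.mem_map.mp hy
    obtain ⟨q, B, -, h2, -⟩ := (h.closed x hx).principal (h.prfK hx)
    have hl : x.names.length = x.cur.concl.length := h.good.fits x.prem (by grind [Act.all])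
    have hq := (List.getElem?_eq_some_iff.mp h2.get).1
    exact ⟨x.names[q], B, mem_zip_get.mpr ⟨q, List.getElem?_eq_getElem (show q < x.names.length by omega), h2.get⟩⟩
  · obtain ⟨y, hy, p, h1, h2⟩ := mem_occM_sk.mp ha; obtain ⟨x, hx, rfl⟩ := Multiset.mem_map.mp hy
    obtain ⟨q, B', -, h3, -, h4, h5, h6⟩ := (h.closed x hx).principal (h.prfK hx)
    have h2 : x.cur.concl[p]? = some (.bang () B) := h2
    obtain rfl := h6 p B h2; obtain rfl : B = B' := by simpa [h3.get] using h2.symm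
    have h7 := hm.wired.pair (hm.wired.name_unique (h5 a h1)) (by
      rw [occM_add]; exact Multiset.mem_add.mpr (Or.inl ha))
    rw [occM_add, fil_add] at h7; by_cases h8 : fil a (occM (sk (A.map Act.fin + I))) = 0
    · rw [h8, add_zero] at h7; exact h7
    · exfalso; obtain ⟨C, hC⟩ := Multiset.exists_mem_of_ne_zero h8
      obtain ⟨l, hl, hl'⟩ := mem_occM.mp (mem_fil.mp hC)
      have hx1 : x.names.zip x.cur.concl ∈ sk (K.map Act.prem) :=
        Multiset.mem_map_of_mem (fun x : Prem ℕ Unit => x.1.zip x.2.concl) (Multiset.mem_map_of_mem Act.prem hx)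
      have hx2 : x.names.zip x.base.concl ∈ sk (K.map Act.fin) :=
        Multiset.mem_map_of_mem (fun x : Prem ℕ Unit => x.1.zip x.2.concl) (Multiset.mem_map_of_mem Act.fin hx)
      have le : ∀ {l₁ : List (ℕ × Fm Unit)} {X Y : Skel ℕ Unit}, l₁ ∈ X → l ∈ Y → l₁ ::ₘ {l} ≤ X + Y := by
        intro l₁ X Y h1 h2; rw [← Multiset.singleton_add]
        exact add_le_add (Multiset.singleton_le.mpr h1) (Multiset.singleton_le.mpr h2)
      have hf := h.mok
      rw [e2] at hf
      have h9 := (hm.wired.dual (le hx1 hl) (mem_zip_get.mpr ⟨p, h1, h3.get⟩) hl').1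
      have h10 := (hf.wired.dual (le hx2 hl) (mem_zip_get.mpr ⟨p, h1, h4⟩) hl').1
      exact Fm.ne_quest () B.neg (h10.symm.trans h9)

theorem mcut_ren {Γ : Seq Unit} {nc : List ℕ} {P : Multiset (Prem ℕ Unit)} {ρ : Pf Unit}
    (h : IsMcut Γ nc P ρ) : IsMcut Γ (nc.map nm0) (P.map (ren nm0)) ρ :=
  h.rename nm0 (nm0_inj.injOn)

/-- A step of the dereliction phase. -/
theorem step {x : Act} {p : ℕ} {ps : List ℕ} (h : DerPhase (x ::ₘ A) K I F nc Γf)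
    (hps : x.ps = p :: ps) :
    (∃ F', DerPhase (x.pop ps ::ₘ A) K I F' nc Γf ∧
      SimS F nc (Act.all (x ::ₘ A) K I) F' nc (Act.all (x.pop ps ::ₘ A) K I)) ∨
    ∃ y K', K = y ::ₘ K' ∧ DerPhase (x.pop ps ::ₘ y.pop y.ps ::ₘ A) K' I F nc Γf ∧
      SimS F nc (Act.all (x ::ₘ A) K I) F nc (Act.all (x.pop ps ::ₘ y.pop y.ps ::ₘ A) K' I) := by
  classical
  have hxo := h.open_ x (by simp)
  have hpx := h.prfA (x := x) (by simp)
  have hch := hxo.2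
  rw [hps, List.map_cons] at hch; obtain ⟨hr, hch⟩ := chain_kid hpx hch
  obtain ⟨B, ho⟩ := opens_der hpx hr
  have hnd := hxo.1
  rw [hps, List.nodup_cons] at hnd
  have hxo' : (x.pop ps).Open := ⟨hnd.2, hch⟩
  have hbase : x.base.concl[p]? = some B := by
    obtain ⟨-, -, h1, -⟩ := chain_ders hnd.2 (hpx.kid 0) hch
    rw [h1 p hnd.1, ho.kid, List.getElem?_set_self (List.getElem?_eq_some_iff.mp ho.get).1]
  obtain ⟨Ot, hOt⟩ : ∃ Ot, Ot = Act.all A K I := ⟨_, rfl⟩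
  have eall : ∀ z : Act, Act.all (z ::ₘ A) K I = z.prem ::ₘ Ot := by simp_all [Act.all]
  have efin : ∀ z : Act, Act.allFin (z ::ₘ A) K I = z.fin ::ₘ Act.allFin A K I := by
    simp [Act.allFin]
  have hg := h.good
  have hmf := h.mok
  rw [eall] at hg ⊢; rw [efin] at hmf
  have hlx : x.names.length = x.cur.concl.length := hg.fits x.prem (by simp)
  have hpl := (List.getElem?_eq_some_iff.mp ho.get).1
  obtain ⟨a, ha⟩ : ∃ a, x.names[p]? = some a := ⟨_, List.getElem?_eq_getElem (hlx ▸ hpl)⟩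
  have hxn : x.names.Nodup := hg.names_nodup (x := x.prem) (by simp)
  have hfx : fil a (x.names.zip x.cur.concl : Multiset (ℕ × Fm Unit)) = {.quest () B} :=
    fil_zip_single hxn ha ho.get
  have hma : (a, Fm.quest () B) ∈ occM (sk (x.prem ::ₘ Ot)) :=
    mem_occM_sk.mpr ⟨x.prem, by simp, p, ha, ho.get⟩
  have hmaf : (a, B) ∈ occM (sk (x.fin ::ₘ Act.allFin A K I)) :=
    mem_occM_sk.mpr ⟨x.fin, by simp, p, ha, hbase⟩
  have hsk : sk (x.prem ::ₘ Ot) = x.names.zip x.cur.concl ::ₘ sk Ot := sk_cons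
  have hstx : (x.names.zip x.cur.concl).map (nmap id (stripAt a)) =
      x.names.zip (x.cur.kid 0).concl := by
    rw [map_strip_single hxn ha ho.get, ho.strip, ho.kid]
  have hw := hg.mok.wired
  have hst := hg.mok.stripName a
  have hOtfits : Fits Ot := fun z hz => hg.fits z (by simp [hz])
  have hkid : (x.pop ps).prem = (x.names, x.cur.kid 0) := rfl
  have hoa : openAt x.prem 0 = ren nm0 (x.pop ps).prem := ho.openAt hlx
  have hlen : (x.pop ps).prem.1.length = (x.pop ps).prem.2.concl.length := by
    change x.names.length = (x.cur.kid 0).concl.length; rw [ho.kid, List.length_set, hlx]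
  by_cases hanc : a ∈ nc
  · left; obtain ⟨q, hq, hqa⟩ := List.getElem_of_mem hanc
    have hq1 : nc[q]? = some a := by rw [List.getElem?_eq_getElem hq, hqa]
    have hqF : q < (F.map Prod.fst).length := by rw [← hg.len]; exact hq
    have hqf : q < Γf.length := by rw [← h.len]; exact hq
    obtain ⟨e1, e2⟩ := hw.concl_eq (mem_zip_get.mpr ⟨q, hq1, List.getElem?_eq_getElem hqF⟩) hma
    obtain ⟨e3, -⟩ := hmf.wired.concl_eq (mem_zip_get.mpr ⟨q, hq1, List.getElem?_eq_getElem hqf⟩) hmaf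
    rw [e1, hsk, occM_cons, fil_add, hfx] at e2
    have e4 : fil a (occM (sk Ot)) = 0 := by
      have := congrArg Multiset.card e2
      simp only [Multiset.card_add, Multiset.card_singleton] at this
      exact Multiset.card_eq_zero.mp (by omega)
    have hqF' : q < F.length := by simpa using hqF
    have hget : (F[q]'hqF').1 = .quest () B := by rw [← e1, List.getElem_map]
    have htree : (F[q]'hqF').2 = der := by
      have := (List.forall₂_iff_get.mp h.compat).2 q hqF' hqf
      grind [Fm.ne_quest]
    have hFq : F[q]? = some (.quest () B, der) := by grind
    obtain ⟨l, r, rfl, hl⟩ := exists_split hFq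
    have hFset : (l ++ (B, leaf false) :: r).map Prod.fst =
        ((l ++ (Fm.quest () B, der) :: r).map Prod.fst).set q B := by
      subst hl; simp
    have hΓq : ((l ++ (Fm.quest () B, der) :: r).map Prod.fst)[q]? = some (.quest () B) := by
      rw [List.getElem?_map, hFq]; rfl
    have hncn := hg.nc_nodup
    refine ⟨l ++ (B, leaf false) :: r, ⟨?_, h.closed, ⟨?_, ?_, ?_, ?_⟩, h.len, ?_, ?_⟩, ?_⟩
    · intro z hz; rcases Multiset.mem_cons.mp hz with rfl | hz
      · exact hxo'
      · exact h.open_ z (by simp [hz])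
    · rw [hFset, List.length_set, hg.len]
    · rw [eall]; intro z hz
      rcases Multiset.mem_cons.mp hz with rfl | hz
      · exact hlen
      · exact hOtfits z hz
    · rw [eall, sk_cons]
      rw [hsk, Multiset.map_cons, map_strip_sk hOtfits e4, hstx, map_strip_single hncn hq1 hΓq] at hst
      rw [hFset]; exact hst
    · rw [eall]; intro z hz
      rcases Multiset.mem_cons.mp hz with rfl | hz
      · exact hpx.kid 0
      · exact hg.prf z (by simp [hz])
    · rw [efin]; exact hmf
    · have := h.compat
      refine List.forall₂_iff_get.mpr ⟨by have := this.length_eq; simpa using this, fun i h1 h2 => ?_⟩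
      have h3 := (List.forall₂_iff_get.mp this).2 i (by simpa using h1) h2
      grind [IsLeaf]
    · rw [eall]
      have hrun : FRun (l ++ (Fm.quest () B, der) :: r) [Rule.mpx l.length 1] (l ++ (B, leaf false) :: r) :=
        .step (.der) .nil
      rw [hl] at hrun; refine .of_step hrun fun ρ ρ' h1 h2 => ⟨_, _, _, h1, .inl ?_⟩
      have hpr : (Rule.mpx q 1).prems ((l ++ (Fm.quest () B, der) :: r).map Prod.fst) =
          [replaceAt ((l ++ (Fm.quest () B, der) :: r).map Prod.fst) q [B]] := by
        simp only [Rule.prems, hΓq]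
        rfl
      refine .comm (x := x.prem) (p := p) (q := q) (a := a) (cs := [ρ']) (by
        change x.cur.rule.localPos = _
        rw [hr]; rfl) ha hq1 ?_ fun k σ hk => ?_
      · change Pf.IsNode _ _ (Rule.setPos q x.cur.rule) _; rw [hr]
        exact Pf.mk1_isNode rfl ρ'
      · rcases k with _ | k
        · obtain rfl : ρ' = σ := by simpa using hk
          change IsMcut (((((Rule.setPos q x.cur.rule).prems _)[0]?).getD []).map Occ.fm)
            (up nc ((((Rule.setPos q x.cur.rule).prems _)[0]?).getD [])) _ _
          rw [hr]; change IsMcut (((((Rule.mpx q 1).prems _)[0]?).getD []).map Occ.fm)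
            (up nc ((((Rule.mpx q 1).prems _)[0]?).getD [])) _ _
          rw [hpr]; simp only [List.getElem?_cons_zero, Option.getD_some]
          rw [replaceAt_fm_set hΓq, up_replace_one hg.len hΓq, hoa, keep_zero, ← Multiset.map_cons,
            ← hFset]
          exact mcut_ren h2
        · simp at hk
  · right
    have e0 := hw.name_unique hanc
    have e1 := hw.pair e0 hma
    have e0f := hmf.wired.name_unique hanc
    rw [hsk, occM_cons, fil_add, hfx] at e1
    have e2 : fil a (occM (sk Ot)) = {.bang () B.neg} := by
      rw [Multiset.insert_eq_cons, ← Multiset.singleton_add] at e1; exact add_left_cancel e1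
    have e3 : (a, Fm.bang () B.neg) ∈ occM (sk Ot) := mem_fil.mp (by rw [e2]; simp)
    obtain ⟨z, hz, r, hr1, hr2⟩ := mem_occM_sk.mp e3
    have hfinal : ∀ l ∈ sk (Act.allFin A K I), (a, Fm.bang () B.neg) ∉ l := by
      intro l hl hl'
      have hle : x.names.zip x.base.concl ::ₘ {l} ≤ sk (x.fin ::ₘ Act.allFin A K I) := by
        rw [sk_cons]; exact Multiset.cons_le_cons _ (Multiset.singleton_le.mpr hl)
      exact Fm.ne_bang () B.neg (hmf.wired.dual hle (mem_zip_get.mpr ⟨p, ha, hbase⟩) hl').1.symm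
    rw [hOt] at hz; unfold Act.all at hz
    rw [Multiset.mem_add, Multiset.mem_add] at hz; rcases hz with (hz | hz) | hz
    · exfalso; obtain ⟨w, hw1, rfl⟩ := Multiset.mem_map.mp hz
      refine hfinal (w.names.zip w.base.concl) ?_ (mem_zip_get.mpr ⟨r, hr1, ?_⟩)
      · refine Multiset.mem_map_of_mem (fun x : Prem ℕ Unit => x.1.zip x.2.concl) (a := w.fin) ?_
        grind [Act.allFin, Multiset.mem_map_of_mem]
      · exact (h.open_ w (by simp [hw1])).fin_get (h.prfA (by simp [hw1])) hr2 (by simp)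
    · obtain ⟨y, hy, rfl⟩ := Multiset.mem_map.mp hz
      obtain ⟨K', rfl⟩ := Multiset.exists_cons_of_mem hy
      have hpy := h.prfK hy
      obtain ⟨q, C, h1, h2, h3, h4, h5, h6⟩ := (h.closed y hy).principal hpy
      have hr2 : y.cur.concl[r]? = some (.bang () B.neg) := hr2
      obtain rfl := h6 r _ hr2; obtain rfl : B.neg = C := by simpa [h2.get] using hr2.symm
      obtain ⟨Re, hRe⟩ : ∃ Re, Re = Act.all A K' I := ⟨_, rfl⟩
      have hOt2 : Ot = y.prem ::ₘ Re := by
        rw [hOt, hRe]; simp [Act.all]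
      have eall2 : Act.all (x.pop ps ::ₘ y.pop y.ps ::ₘ A) K' I =
          (x.pop ps).prem ::ₘ (y.pop y.ps).prem ::ₘ Re := by
        rw [hRe]; unfold Act.all
        simp
      have efin2 : Act.allFin (x.pop ps ::ₘ y.pop y.ps ::ₘ A) K' I = x.fin ::ₘ Act.allFin A (y ::ₘ K') I := by
        unfold Act.allFin; simp only [Multiset.map_cons, Multiset.add_cons, Multiset.cons_add]
        rfl
      have hyn : y.names.Nodup := hg.names_nodup (x := y.prem) (by simp [hOt2])
      have hly : y.names.length = y.cur.concl.length := hg.fits y.prem (by simp [hOt2])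
      have hr1 : y.names[r]? = some a := hr1
      have hfy : fil a (y.names.zip y.cur.concl : Multiset (ℕ × Fm Unit)) = {.bang () B.neg} :=
        fil_zip_single hyn hr1 h2.get
      have hsk2 : sk Ot = y.names.zip y.cur.concl ::ₘ sk Re := by rw [hOt2]; exact sk_cons
      have e4 : fil a (occM (sk Re)) = 0 := by
        rw [hsk2, occM_cons, fil_add, hfy] at e2
        have := congrArg Multiset.card e2
        simp only [Multiset.card_add, Multiset.card_singleton] at this
        exact Multiset.card_eq_zero.mp (by omega)
      have hsty : (y.names.zip y.cur.concl).map (nmap id (stripAt a)) =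
          y.names.zip (y.cur.kid 0).concl := by
        rw [map_strip_single hyn hr1 h2.get, h2.strip, h2.kid]
      have hRefits : Fits Re := fun z hz => hOtfits z (by simp [hOt2, hz])
      have hlen2 : (y.pop y.ps).prem.1.length = (y.pop y.ps).prem.2.concl.length := by
        change y.names.length = (y.cur.kid 0).concl.length; rw [h2.kid, List.length_set, hly]
      refine ⟨y, K', rfl, ⟨?_, fun z hz => h.closed z (by simp [hz]), ⟨hg.len, ?_, ?_, ?_⟩, h.len, ?_,
        h.compat⟩, ?_⟩
      · intro z hz; rcases Multiset.mem_cons.mp hz with rfl | hz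
        · exact hxo'
        rcases Multiset.mem_cons.mp hz with rfl | hz
        · exact h3
        · exact h.open_ z (by simp [hz])
      · rw [eall2]; intro z hz
        rcases Multiset.mem_cons.mp hz with rfl | hz
        · exact hlen
        rcases Multiset.mem_cons.mp hz with rfl | hz
        · exact hlen2
        · exact hRefits z hz
      · rw [eall2, sk_cons, sk_cons]
        rw [hsk, hsk2, Multiset.map_cons, Multiset.map_cons, map_strip_sk hRefits e4, hstx, hsty,
          map_strip_notin hanc] at hst
        exact hst
      · rw [eall2]; intro z hz
        rcases Multiset.mem_cons.mp hz with rfl | hz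
        · exact hpx.kid 0
        rcases Multiset.mem_cons.mp hz with rfl | hz
        · exact hpy.kid 0
        · exact hg.prf z (by simp [hOt2, hz])
      · rw [efin2]; exact hmf
      · rw [eall2, hOt2]
        refine .of_step .nil fun ρ ρ' i1 i2 => ⟨_, _, _, i1, .inr (.inr (.inr ?_))⟩
        refine ⟨x.prem, y.prem, Re, p, r, a, rfl, hr, h1, ha, hr1, ?_⟩
        have hob : openAt y.prem 0 = ren nm0 (y.pop y.ps).prem := h2.openAt hly
        rw [hoa, hob, keep_zero, ← Multiset.map_cons, ← Multiset.map_cons]; exact mcut_ren i2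
    · exfalso; refine hfinal (z.1.zip z.2.concl) ?_ (mem_zip_get.mpr ⟨r, hr1, hr2⟩)
      refine Multiset.mem_map_of_mem (fun x : Prem ℕ Unit => x.1.zip x.2.concl) (a := z) ?_
      unfold Act.allFin; rw [Multiset.mem_add]
      exact Or.inr hz

theorem finish (h : DerPhase A K I F nc Γf) (h0 : ∀ x ∈ A, x.ps = []) :
    K = 0 ∧ Leaves F ∧ F.map Prod.fst = Γf ∧ Act.all A K I = Act.allFin A K I := by
  have hK := h.closed_eq_zero h0
  subst hK
  have hfin : Act.all A 0 I = Act.allFin A 0 I := by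
    unfold Act.all Act.allFin; congr 2
    refine Multiset.map_congr rfl fun x hx => ?_
    have := (h.open_ x hx).2
    rw [h0 x hx] at this
    have : x.cur = x.base := this
    unfold Act.prem Act.fin; rw [this]
  have hm := h.mok
  rw [← hfin] at hm
  have hΓ := zip_set_snd h.good.len h.len h.good.mok.wired hm.wired
  refine ⟨rfl, ?_, hΓ, hfin⟩; intro t ht
  obtain ⟨i, hi, rfl⟩ := List.getElem_of_mem ht
  have hi2 : i < Γf.length := by rw [← hΓ]; simpa using hi
  have h3 := (List.forall₂_iff_get.mp h.compat).2 i hi hi2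
  grind

/-- The dereliction phase. -/
theorem run (m : ℕ) : ∀ {A K : Multiset Act} {F : List Item}, pend A + pend K = m →
    DerPhase A K I F nc Γf →
    ∃ F', Leaves F' ∧ F'.map Prod.fst = Γf ∧
      ((∃ x ∈ A, x.ps ≠ []) → SimS F nc (Act.all A K I) F' nc (Act.allFin A K I)) ∧
      SimW F nc (Act.all A K I) F' nc (Act.allFin A K I) := by
  induction m with
  | zero =>
    intro A K F hm h
    have h0 : ∀ x ∈ A, x.ps = [] := by
      intro x hx; obtain ⟨A', rfl⟩ := Multiset.exists_cons_of_mem hx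
      simp_all [pend]
    obtain ⟨rfl, h1, h2, h3⟩ := h.finish h0; grind [SimW.refl]
  | succ m ih =>
    intro A K F hm h; by_cases h0 : ∀ x ∈ A, x.ps = []
    · obtain ⟨rfl, h1, h2, h3⟩ := h.finish h0; grind [SimW.refl]
    · push Not at h0; obtain ⟨x, hx, hx'⟩ := h0
      obtain ⟨A, rfl⟩ := Multiset.exists_cons_of_mem hx
      obtain ⟨p, ps, hps⟩ := List.exists_cons_of_ne_nil hx'
      rcases h.step hps with ⟨F₁, h1, h2⟩ | ⟨y, K', rfl, h1, h2⟩
      · obtain ⟨F', h3, h4, -, h5⟩ := ih (A := x.pop ps ::ₘ A) (K := K) (by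
          unfold pend at hm ⊢; rw [Multiset.map_cons, Multiset.sum_cons] at hm ⊢
          rw [hps, List.length_cons] at hm; change ps.length + _ + _ = m
          omega) h1
        have : Act.allFin (x.pop ps ::ₘ A) K I = Act.allFin (x ::ₘ A) K I := by
          unfold Act.allFin; rw [Multiset.map_cons, Multiset.map_cons]
          rfl
        rw [this] at h5
        have h6 := h2.trans h5
        exact ⟨F', h3, h4, fun _ => h6, h6.simW h.good⟩
      · obtain ⟨F', h3, h4, -, h5⟩ := ih (A := x.pop ps ::ₘ y.pop y.ps ::ₘ A) (K := K') (by
          unfold pend at hm ⊢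
          rw [Multiset.map_cons, Multiset.sum_cons, Multiset.map_cons, Multiset.sum_cons] at hm ⊢
          rw [hps, List.length_cons] at hm; change ps.length + (y.ps.length + _) + _ = m
          omega) h1
        have : Act.allFin (x.pop ps ::ₘ y.pop y.ps ::ₘ A) K' I = Act.allFin (x ::ₘ A) (y ::ₘ K') I := by
          unfold Act.allFin; simp only [Multiset.map_cons, Multiset.add_cons, Multiset.cons_add]
          rw [Multiset.cons_swap]
          rfl
        rw [this] at h5
        have h6 := h2.trans h5
        exact ⟨F', h3, h4, fun _ => h6, h6.simW h.good⟩

end DerPhase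

end

/-! ### One pass of structural rules -/

/-- At most one rule, not a dereliction, is applied to the root of a tree. -/
inductive Shot : Item → List Bool → List Item → Prop
  | keep {t} : Shot t [true] [t]
  | weak {A} : Shot (.quest () A, .weak) [] []
  | dup {A l r} : Shot (.quest () A, .con l r) [true, true] [(.quest () A, l), (.quest () A, r)]

theorem Shot.len {t : Item} {b : List Bool} {ks : List Item} (h : Shot t b ks) : b.length = ks.length := by
  cases h <;> rfl

theorem Shot.blk {t : Item} {b : List Bool} {ks : List Item} (h : Shot t b ks) :
    (b.map fun e => if e then t.1 else t.1.unquest) = ks.map Prod.fst := by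
  cases h <;> rfl

abbrev Shots := List (Item × List Bool × List Item)

theorem blockSeq_append {E : Type u} (Γ Γ' : Seq E) (st st' : List (List Bool)) (h : Γ.length = st.length) :
    blockSeq (Γ ++ Γ') (st ++ st') = blockSeq Γ st ++ blockSeq Γ' st' := by
  unfold blockSeq; rw [List.zipWith_append h, List.flatten_append]

theorem blockSeq_shots (T : Shots) (h : ∀ s ∈ T, Shot s.1 s.2.1 s.2.2) :
    blockSeq (T.map fun s => s.1.1) (T.map fun s => s.2.1) = (T.flatMap fun s => s.2.2).map Prod.fst := by
  induction T with
  | nil => rfl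
  | cons s T ih =>
    have := ih fun s hs => h s (by simp [hs])
    unfold blockSeq at this ⊢
    rw [List.map_cons, List.map_cons, List.zipWith_cons_cons, List.flatten_cons, this, List.flatMap_cons,
      List.map_append, (h s (by simp)).blk]

theorem blockSeq_trues {E : Type u} (Γ : Seq E) : blockSeq Γ (Γ.map fun _ => [true]) = Γ := by
  induction Γ with
  | nil => rfl
  | cons A Γ ih => grind [blockSeq, List.zipWith_cons_cons]

theorem shots_run (T₂ : Shots) : ∀ T₁ : Shots, (∀ s ∈ T₁, Shot s.1 s.2.1 s.2.2) →
    (∀ s ∈ T₂, Shot s.1 s.2.1 s.2.2) →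
    ∃ rs, FRun ((T₁.flatMap fun s => s.2.2) ++ T₂.map fun s => s.1) rs
        ((T₁.flatMap fun s => s.2.2) ++ T₂.flatMap fun s => s.2.2) ∧
      ∀ ρ, StructDer LL false ((T₁ ++ T₂).map fun s => s.1.1)
        ((T₁.map fun s => s.2.1) ++ T₂.map fun _ => [true])
        (Pf.mkChain (((T₁.flatMap fun s => s.2.2) ++ T₂.map fun s => s.1).map Prod.fst) rs ρ)
        ((T₁ ++ T₂).map fun s => s.2.1) ρ := by
  induction T₂ with
  | nil =>
    intro T₁ h1 h2
    exact ⟨[], .nil, fun ρ => by simp only [List.append_nil, List.map_nil, Pf.mkChain]; exact .refl⟩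
  | cons s T₂ ih =>
    intro T₁ h1 h2
    have hs := h2 s (by simp)
    obtain ⟨rs, h3, h4⟩ := ih (T₁ ++ [s]) (fun t ht => by
      rcases List.mem_append.mp ht with ht | ht
      · exact h1 t ht
      · rw [List.mem_singleton.mp ht]; exact hs) fun t ht => h2 t (by simp [ht])
    have hflat : (T₁.map fun s => s.2.1).flatten.length = (T₁.flatMap fun s => s.2.2).length := by
      rw [List.length_flatten, List.length_flatMap, List.map_map]; congr 1
      exact List.map_congr_left fun t ht => (h1 t ht).len
    have hblk : blockSeq ((T₁ ++ s :: T₂).map fun s => s.1.1)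
        ((T₁.map fun s => s.2.1) ++ [true] :: T₂.map fun _ => [true]) =
        ((T₁.flatMap fun s => s.2.2) ++ s.1 :: T₂.map fun s => s.1).map Prod.fst := by
      have := blockSeq_trues ((s :: T₂).map fun s => s.1.1)
      rw [List.map_append, blockSeq_append _ _ _ _ (by simp), blockSeq_shots T₁ h1, List.map_append]
      grind [Function.comp_def]
    have hget : ((T₁ ++ s :: T₂).map fun s => s.1.1)[(T₁.map fun s => s.2.1).length]? = some s.1.1 := by
      simp
    have main : ∀ (r : ℕ → Rule Unit) (A : Fm Unit) (new : List Bool) , s.1.1 = .quest () A → s.2.1 = new →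
        (∀ p, BlockOp LL () [] [] p (r p) new) → Exp s.1 r s.2.2 →
        ∃ rs, FRun ((T₁.flatMap fun s => s.2.2) ++ (s :: T₂).map fun s => s.1) rs
        ((T₁.flatMap fun s => s.2.2) ++ (s :: T₂).flatMap fun s => s.2.2) ∧
      ∀ ρ, StructDer LL false ((T₁ ++ s :: T₂).map fun s => s.1.1)
        ((T₁.map fun s => s.2.1) ++ (s :: T₂).map fun _ => [true])
        (Pf.mkChain (((T₁.flatMap fun s => s.2.2) ++ (s :: T₂).map fun s => s.1).map Prod.fst) rs ρ)
        ((T₁ ++ s :: T₂).map fun s => s.2.1) ρ := by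
      intro r A new hA hnew hop hexp
      refine ⟨r (T₁.flatMap fun s => s.2.2).length :: rs, .step hexp ?_, fun ρ => ?_⟩
      · simpa using h3
      · rw [List.map_cons (l := T₂) (f := fun _ => [true]), List.map_cons]
        refine .step (left := []) (right := []) (new := new) (s := ()) (A := A)
          (π' := Pf.mkChain ((((T₁ ++ [s]).flatMap fun s => s.2.2) ++ T₂.map fun s => s.1).map Prod.fst) rs ρ)
          (by rw [hget, hA]) (hop _) (Or.inr (Or.inl rfl)) ?_ ?_
        · rw [hflat]; simp only [List.length_nil, Nat.add_zero, List.nil_append]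
          rw [hblk, Pf.mkChain]
          have := hexp.prem0 ((T₁.flatMap fun s => s.2.2).map Prod.fst) ((T₂.map fun s => s.1).map Prod.fst)
          rw [List.length_map] at this; rw [List.map_append, List.map_cons, this]
          convert Pf.mk1_isNode (hexp.arity _) _ using 3
          simp
        · have := h4 ρ
          simpa [hnew] using this
    obtain ⟨t, b, ks⟩ := s; simp only at hs
    rcases hs with _ | _ | _
    · grind
    · exact main (fun p => .mpx p 0) _ _ rfl rfl (fun p => .mpx (i := 0) (Or.inl rfl) fun _ => ⟨rfl, rfl⟩) .weak
    · exact main (fun p => .contr p 2) _ _ rfl rfl (fun p => .contr (i := 2) le_rfl rfl) .con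

/-! ### Repeated duplication -/

/-- A formula of the conclusion, its name, and the trees of its copies. -/
structure Col where
  name : ℕ
  fm : Fm Unit
  ts : List STree

namespace Col

/-- The formulas before duplication. -/
def items (cols : List Col) : List Item := cols.map fun k => (k.fm, conc k.ts)
def ncs (cols : List Col) : List ℕ := cols.map Col.name
/-- The formulas after duplication. -/
def items' (cols : List Col) : List Item := cols.flatMap fun k => k.ts.map fun t => (k.fm, t)
def ncs' (cols : List Col) : List Name' :=
  cols.flatMap fun k => (List.range k.ts.length).map fun t => (some k.name, t)

/-- Names are encoded as numbers. -/
noncomputable def enc (n : Name') : ℕ := Encodable.encode n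

theorem enc_inj : Function.Injective enc := Encodable.encode_injective

open Classical in
/-- One duplication. -/
noncomputable def split (Q : ℕ → Prop) (k : Col) : List Col :=
  if Q k.name then [⟨enc (some k.name, 0), k.fm, k.ts.take 1⟩, ⟨enc (some k.name, 1), k.fm, k.ts.tail⟩]
  else [⟨enc (some k.name, 0), k.fm, k.ts⟩]

noncomputable def splits (Q : ℕ → Prop) (cols : List Col) : List Col := cols.flatMap (split Q)

/-- The names after one duplication. -/
noncomputable def ncs1 (Q : ℕ → Prop) (cols : List Col) : List Name' := by
  classical
  exact cols.flatMap fun k => if Q k.name then [(some k.name, 0), (some k.name, 1)] else [(some k.name, 0)]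

theorem ncs_splits (Q : ℕ → Prop) (cols : List Col) : ncs (splits Q cols) = (ncs1 Q cols).map enc := by
  grind [ncs, splits, ncs1, List.map_flatMap, split]

theorem items'_splits (Q : ℕ → Prop) (cols : List Col) (h : ∀ k ∈ cols, k.ts ≠ []) :
    items' (splits Q cols) = items' cols := by
  unfold items' splits; rw [List.flatMap_assoc]
  refine List.flatMap_congr fun k hk => ?_
  unfold split; split_ifs
  · obtain ⟨t, ts, hts⟩ := List.exists_cons_of_ne_nil (h k hk); simp [hts]
  · simp

theorem zip_items (cols : List Col) : (ncs cols).zip ((items cols).map Prod.fst) = cols.map fun k => (k.name, k.fm) := by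
  unfold ncs items; rw [List.map_map, List.zip_map']
  rfl

theorem zip_ncs1 (Q : ℕ → Prop) (cols : List Col) :
    (ncs1 Q cols).zip ((items (splits Q cols)).map Prod.fst) = dupC Q (cols.map fun k => (k.name, k.fm)) := by
  induction cols with
  | nil => rfl
  | cons k cols ih => grind [ncs1, items, splits, split, dupC, tagp]

end Col

theorem hasName_sk {N : Type} {E : Type u} {P : Multiset (Prem N E)} (h : Fits P) {a : N} :
    HasName a (sk P) ↔ ∃ x ∈ P, a ∈ x.1 := by
  constructor
  · rintro ⟨l, hl, ha⟩; obtain ⟨x, hx, rfl⟩ := Multiset.mem_map.mp hl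
    rw [List.map_fst_zip (h x hx).le] at ha; exact ⟨x, hx, ha⟩
  · rintro ⟨x, hx, ha⟩; refine ⟨_, Multiset.mem_map_of_mem _ hx, ?_⟩
    rw [List.map_fst_zip (h x hx).le]; exact ha

theorem sk_keep {E : Type u} (t : ℕ) (P : Multiset (Prem ℕ E)) :
    sk (P.map (keep t)) = (sk P).map (List.map (tagp t)) := by
  unfold sk; rw [Multiset.map_map, Multiset.map_map]
  refine Multiset.map_congr rfl fun x hx => ?_
  change (x.1.map fun a => ((some a, t) : Name')).zip x.2.concl = (x.1.zip x.2.concl).map (tagp t)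
  rw [List.zip_map_left]
  rfl

theorem chain_kid_contr {l r : Seq Unit} {A : Fm Unit} {rs : List (Rule Unit)} {π ρ : Pf Unit}
    (hπ : π.IsLLProof) (hc : π.concl = l ++ .quest () A :: r)
    (h : Pf.Chain π.concl (.contr l.length 2 :: rs) π ρ) :
    π.rule = .contr l.length 2 ∧
      π.occs 0 = replaceAt (l ++ .quest () A :: r) l.length [.quest () A, .quest () A] ∧
      (π.kid 0).concl = (l ++ [.quest () A]) ++ .quest () A :: r ∧
      Pf.Chain (π.kid 0).concl rs (π.kid 0) ρ := by
  obtain ⟨π', ⟨h1, h2, h3⟩, h4⟩ := h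
  have h5 : π.child 0 = some π' := h3 0
  rw [Pf.kid_of_child h5]
  have h6 : π.occs 0 = replaceAt (l ++ .quest () A :: r) l.length [.quest () A, .quest () A] := by
    unfold Pf.occs; rw [h2, hc]
    simp [Rule.prems]
  have h7 := hπ.ok.1.2.2 0 π' h5
  grind [replaceAt_fm, Rule.prem0, Pf.occs]

/-- The premise `(n₁ ++ a :: n₂, cur)` ends with `j` contractions of its formula named `a`, and the
premises `C` are to be duplicated `j` times. -/
structure DupPhase (j : ℕ) (n₁ n₂ : List ℕ) (a : ℕ) (l r : Seq Unit) (A : Fm Unit) (cur base : Pf Unit)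
    (D C : Multiset (Prem ℕ Unit)) (cols : List Col) : Prop where
  len : n₁.length = l.length
  concl : cur.concl = l ++ .quest () A :: r
  chain : Pf.Chain cur.concl (contrs l.length j) cur base
  prom : AllProm C
  sep : ∀ b ∈ names C, b ∈ names ((n₁ ++ a :: n₂, cur) ::ₘ D) → b = a
  cut : C = 0 ∧ a ∈ Col.ncs cols ∨ a ∉ Col.ncs cols ∧ a ∈ names C
  good : Good ((Col.items cols).map Prod.fst) (Col.ncs cols) ((n₁ ++ a :: n₂, cur) ::ₘ (D + C))
  dup : ∀ k ∈ cols, k.name ∈ names C ∨ k.name = a → k.ts.length = j + 1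
  single : ∀ k ∈ cols, ¬ (k.name ∈ names C ∨ k.name = a) → k.ts.length = 1
  quest : ∀ k ∈ cols, k.ts.length ≠ 1 → ∃ B, k.fm = .quest () B

/-- The premises after the duplications. -/
def dupPrems (j : ℕ) (n₁ n₂ : List ℕ) (a : ℕ) (base : Pf Unit) (D C : Multiset (Prem ℕ Unit)) :
    Multiset (Prem Name' Unit) :=
  (n₁.map nm0 ++ ((List.range (j + 1)).map (fun t => ((some a, t) : Name')) ++ n₂.map nm0), base) ::ₘ
    (D.map (keep 0) + ∑ t ∈ Finset.range (j + 1), C.map (keep t))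

namespace DupPhase
variable {j : ℕ} {n₁ n₂ : List ℕ} {a : ℕ} {l r : Seq Unit} {A : Fm Unit} {cur base : Pf Unit}
  {D C : Multiset (Prem ℕ Unit)} {cols : List Col}

/-- The names to be duplicated. -/
def Q (a : ℕ) (C : Multiset (Prem ℕ Unit)) (b : ℕ) : Prop := b = a ∨ HasName b (sk C)

theorem fitsC (h : DupPhase j n₁ n₂ a l r A cur base D C cols) : Fits C :=
  fun x hx => h.good.fits x (by simp [hx])

theorem Q_iff (h : DupPhase j n₁ n₂ a l r A cur base D C cols) {b : ℕ} :
    Q a C b ↔ b ∈ names C ∨ b = a := by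
  unfold Q; rw [hasName_sk h.fitsC, or_comm]
  rfl

theorem ts_ne (h : DupPhase j n₁ n₂ a l r A cur base D C cols) : ∀ k ∈ cols, k.ts ≠ [] := by
  intro k hk h0; by_cases h1 : k.name ∈ names C ∨ k.name = a
  · have := h.dup k hk h1; simp [h0] at this
  · have := h.single k hk h1; simp [h0] at this

theorem len₂ (h : DupPhase j n₁ n₂ a l r A cur base D C cols) : n₂.length = r.length := by
  have h1 : (n₁ ++ a :: n₂).length = cur.concl.length := h.good.fits (n₁ ++ a :: n₂, cur) (by simp)
  rw [h.concl] at h1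
  have := h.len
  simp at h1; omega

/-- The premises after one duplication. -/
def prems1 (n₁ n₂ : List ℕ) (a : ℕ) (cur : Pf Unit) (D C : Multiset (Prem ℕ Unit)) :
    Multiset (Prem Name' Unit) :=
  (n₁.map nm0 ++ ((some a, 0) :: (some a, 1) :: n₂.map nm0), cur.kid 0) ::ₘ
    (D.map (keep 0) + (C.map (keep 0) + C.map (keep 1)))

theorem kid (h : DupPhase (j + 1) n₁ n₂ a l r A cur base D C cols) : cur.rule = .contr l.length 2 ∧
      cur.occs 0 = replaceAt (l ++ .quest () A :: r) l.length [.quest () A, .quest () A] ∧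
      (cur.kid 0).concl = (l ++ [.quest () A]) ++ .quest () A :: r ∧
      Pf.Chain (cur.kid 0).concl (contrs (l.length + 1) j) (cur.kid 0) base := by
  have := h.chain
  rw [contrs_succ] at this
  exact chain_kid_contr (h.good.prf (n₁ ++ a :: n₂, cur) (by simp)) h.concl this

theorem good1 (h : DupPhase (j + 1) n₁ n₂ a l r A cur base D C cols) :
    Good ((Col.items (Col.splits (Q a C) cols)).map Prod.fst) (Col.ncs1 (Q a C) cols)
      (prems1 n₁ n₂ a cur D C) := by
  obtain ⟨-, -, hk, -⟩ := h.kid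
  have hl2 := h.len₂
  have hz := Col.zip_ncs1 (Q a C) cols
  have hprf := h.good.prf
  have hfits := h.good.fits
  refine ⟨?_, ?_, ?_, ?_⟩
  · have := Col.ncs_splits (Q a C) cols
    have := congrArg List.length this
    unfold Col.ncs at this; unfold Col.items
    simpa using this.symm
  · intro x hx; unfold prems1 at hx
    simp only [Multiset.mem_cons, Multiset.mem_add, Multiset.mem_map] at hx
    rcases hx with rfl | ⟨y, hy, rfl⟩ | ⟨y, hy, rfl⟩ | ⟨y, hy, rfl⟩
    · simp [hk, h.len, hl2]
    all_goals
      have := hfits y (by simp [hy])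
      simpa [keep] using this
  · have hm := h.good.mok
    rw [Col.zip_items, sk_cons, sk_add] at hm
    have hzip : (n₁ ++ a :: n₂).zip cur.concl = n₁.zip l ++ (a, .quest () A) :: n₂.zip r := by
      rw [h.concl, List.zip_append h.len, List.zip_cons_cons]
    rw [show ((n₁ ++ a :: n₂, cur) : Prem ℕ Unit).1.zip ((n₁ ++ a :: n₂, cur) : Prem ℕ Unit).2.concl =
      n₁.zip l ++ (a, .quest () A) :: n₂.zip r from hzip] at hm
    have hd := hm.dup (fun b hb hb' => ?_) ?_
    · rw [hz]; unfold prems1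
      rw [sk_cons, sk_add, sk_add, sk_keep, sk_keep, sk_keep]
      have e : (n₁.map nm0 ++ ((some a, 0) :: (some a, 1) :: n₂.map nm0)).zip (cur.kid 0).concl =
          (n₁.zip l).map (tagp 0) ++ tagp 0 (a, .quest () A) :: tagp 1 (a, .quest () A) ::
            (n₂.zip r).map (tagp 0) := by
        rw [hk, List.append_assoc, List.zip_append (by simp [h.len]), List.singleton_append,
          List.zip_cons_cons, List.zip_cons_cons, List.zip_map_left, List.zip_map_left]
        rfl
      change MOk _ ((n₁.map nm0 ++ ((some a, 0) :: (some a, 1) :: n₂.map nm0)).zip (cur.kid 0).concl ::ₘ _)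
      rw [e]; exact hd
    · rw [← hzip] at hb'; refine h.sep b ((hasName_sk h.fitsC).mp hb) ?_
      have hf : Fits ((n₁ ++ a :: n₂, cur) ::ₘ D) := fun x hx => hfits x (by grind)
      refine (hasName_sk hf).mp ?_; rw [sk_cons]
      exact hb'
    · have e : (cols.map fun k => (k.name, k.fm)).map Prod.fst = Col.ncs cols := by
        rw [List.map_map]; rfl
      rw [e]; rcases h.cut with ⟨rfl, h1⟩ | ⟨h1, h2⟩
      · exact Or.inl ⟨rfl, h1⟩
      · exact Or.inr ⟨h1, (hasName_sk h.fitsC).mpr h2⟩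
  · intro x hx; unfold prems1 at hx
    simp only [Multiset.mem_cons, Multiset.mem_add, Multiset.mem_map] at hx
    rcases hx with rfl | ⟨y, hy, rfl⟩ | ⟨y, hy, rfl⟩ | ⟨y, hy, rfl⟩
    · exact (hprf (n₁ ++ a :: n₂, cur) (by simp)).kid 0
    all_goals exact hprf y (by simp [hy])

theorem openAt_eq (h : DupPhase (j + 1) n₁ n₂ a l r A cur base D C cols) :
    openAt (n₁ ++ a :: n₂, cur) 0 =
      (n₁.map nm0 ++ ((some a, 0) :: (some a, 1) :: n₂.map nm0), cur.kid 0) := by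
  obtain ⟨-, ho, -, -⟩ := h.kid; unfold openAt
  rw [ho, up_replace _ _ _ _ _ _ _ h.len h.len₂]
  rfl

end DupPhase

namespace DupPhase
variable {j : ℕ} {n₁ n₂ : List ℕ} {a : ℕ} {l r : Seq Unit} {A : Fm Unit} {cur base : Pf Unit}
  {D C : Multiset (Prem ℕ Unit)} {cols : List Col}

open Classical in
/-- The rules of one duplication. -/
noncomputable def shots (a : ℕ) (C : Multiset (Prem ℕ Unit)) (cols : List Col) : Shots :=
  cols.map fun k => ((k.fm, conc k.ts), if Q a C k.name then [true, true] else [true],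
    Col.items (Col.split (Q a C) k))

theorem two (h : DupPhase (j + 1) n₁ n₂ a l r A cur base D C cols) {k : Col} (hk : k ∈ cols)
    (hQ : Q a C k.name) : ∃ B t t' ts, k.fm = .quest () B ∧ k.ts = t :: t' :: ts := by
  have h1 := h.dup k hk (h.Q_iff.mp hQ)
  obtain ⟨B, hB⟩ := h.quest k hk (by omega)
  rcases hts : k.ts with _ | ⟨t, _ | ⟨t', ts⟩⟩
  all_goals grind

theorem shots_ok (h : DupPhase (j + 1) n₁ n₂ a l r A cur base D C cols) :
    ∀ s ∈ shots a C cols, Shot s.1 s.2.1 s.2.2 := by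
  intro s hs; obtain ⟨k, hk, rfl⟩ := List.mem_map.mp hs
  by_cases hQ : Q a C k.name
  · obtain ⟨B, t, t', ts, h1, h2⟩ := h.two hk hQ
    simp only [hQ, if_true, Col.split, Col.items, h1, h2]; exact .dup
  · simp only [hQ, if_false, Col.split, Col.items]; exact .keep

theorem shots_items (a : ℕ) (C : Multiset (Prem ℕ Unit)) (cols : List Col) :
    ((shots a C cols).flatMap fun s => s.2.2) = Col.items (Col.splits (Q a C) cols) := by
  grind [shots, Col.splits, List.flatMap_map, Col.items]

theorem step_cut (h : DupPhase (j + 1) n₁ n₂ a l r A cur base D C cols) (h1 : a ∉ Col.ncs cols)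
    (h2 : a ∈ names C) :
    SimS (Col.items cols) (Col.ncs cols) ((n₁ ++ a :: n₂, cur) ::ₘ (D + C))
      (Col.items (Col.splits (Q a C) cols)) (Col.ncs1 (Q a C) cols) (prems1 n₁ n₂ a cur D C) := by
  obtain ⟨rs, h3, h4⟩ := shots_run (shots a C cols) [] (by simp) h.shots_ok
  have e1 : ((shots a C cols).map fun s => s.1) = Col.items cols := by
    unfold shots Col.items; rw [List.map_map]; rfl
  have e2 : ((shots a C cols).map fun s => s.1.1) = (Col.items cols).map Prod.fst := by
    rw [← e1, List.map_map]; rfl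
  have e3 : ((shots a C cols).map fun _ => [true]) = (Col.ncs cols).map fun _ => [true] := by
    unfold shots Col.ncs; rw [List.map_map, List.map_map]; rfl
  have e4 := blockSeq_shots _ h.shots_ok
  rw [e2, shots_items] at e4; simp only [List.flatMap_nil, List.nil_append, List.map_nil] at h3 h4
  rw [e1, shots_items] at h3; rw [e1, e2, e3] at h4
  refine .of_step h3 fun ρ ρ' i1 i2 => ⟨_, _, _, i1, .inr (.inl ?_)⟩
  refine ⟨(n₁ ++ a :: n₂, cur), D, C, l.length, 2, a, Col.ncs1 (Q a C) cols,
    (shots a C cols).map fun s => s.2.1, ρ', rfl, h.kid.1, by simp [← h.len], h.prom, h2, h1, h.sep, by simp [shots, Col.ncs], ?_, ?_,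
    h4 ρ', ?_⟩
  · intro k b hk; unfold Col.ncs at hk
    rw [List.getElem?_map] at hk; obtain ⟨c, hc, rfl⟩ := Option.map_eq_some_iff.mp hk
    have hne : c.name ≠ a := by
      rintro rfl; exact h1 (List.mem_map_of_mem (List.mem_of_getElem? hc))
    simp only [shots, List.map_map, List.getElem?_map, hc, Option.map_some, Function.comp]
    constructor
    · intro hb; rw [if_pos (h.Q_iff.mpr (Or.inl hb))]; rfl
    · intro hb; rw [if_neg fun hQ => (h.Q_iff.mp hQ).elim hb hne]
  · unfold shots Col.ncs Col.ncs1
    rw [List.map_map, List.zipWith_map_left, List.zipWith_map_right, List.zipWith_self, List.flatMap_def]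
    congr 1; refine List.map_congr_left fun k hk => ?_
    grind [List.range_succ]
  · rw [e4, h.openAt_eq, Finset.sum_range_succ, Finset.sum_range_one]; exact i2

theorem step_concl (h : DupPhase (j + 1) n₁ n₂ a l r A cur base D C cols) (h0 : C = 0)
    (h1 : a ∈ Col.ncs cols) :
    SimS (Col.items cols) (Col.ncs cols) ((n₁ ++ a :: n₂, cur) ::ₘ (D + C))
      (Col.items (Col.splits (Q a C) cols)) (Col.ncs1 (Q a C) cols) (prems1 n₁ n₂ a cur D C) := by
  subst h0
  have hQ : ∀ b, Q a 0 b ↔ b = a := fun b => by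
    rw [h.Q_iff]; simp [names]
  obtain ⟨k, hk, rfl⟩ := List.mem_map.mp h1; obtain ⟨c₁, c₂, rfl⟩ := List.append_of_mem hk
  have hnd := h.good.nc_nodup
  have hn1 : ∀ c ∈ c₁, ¬ Q k.name 0 c.name := by grind [Col.ncs]
  have hn2 : ∀ c ∈ c₂, ¬ Q k.name 0 c.name := by grind [Col.ncs]
  have hsp : ∀ cs : List Col, (∀ c ∈ cs, ¬ Q k.name 0 c.name) →
      Col.items (Col.splits (Q k.name 0) cs) = Col.items cs ∧
      Col.ncs1 (Q k.name 0) cs = (Col.ncs cs).map nm0 := by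
    intro cs hcs
    induction cs with
    | nil => exact ⟨rfl, rfl⟩
    | cons c cs ih =>
      obtain ⟨i1, i2⟩ := ih fun c hc => hcs c (by simp [hc])
      have := hcs c (by simp)
      unfold Col.items Col.splits Col.ncs1 Col.ncs at *
      rw [List.flatMap_cons, List.map_append, i1, List.flatMap_cons, i2]
      simp [Col.split, this, nm0]
  obtain ⟨B, t, t', ts, hB, hts⟩ := h.two hk ((hQ _).mpr rfl)
  have hkQ : Q k.name 0 k.name := (hQ _).mpr rfl
  have e1 : Col.items (c₁ ++ k :: c₂) = Col.items c₁ ++ (.quest () B, con t (conc (t' :: ts))) :: Col.items c₂ := by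
    simp [Col.items, hB, hts, conc]
  have e2 : Col.items (Col.splits (Q k.name 0) (c₁ ++ k :: c₂)) =
      Col.items c₁ ++ ([(.quest () B, t), (.quest () B, conc (t' :: ts))] ++ Col.items c₂) := by
    simp_all [Col.items, Col.splits, Col.split, conc]
  have e3 : Col.ncs1 (Q k.name 0) (c₁ ++ k :: c₂) =
      (Col.ncs c₁).map nm0 ++ ([(some k.name, 0), (some k.name, 1)] ++ (Col.ncs c₂).map nm0) := by
    grind [Col.ncs1]
  have e4 : Col.ncs (c₁ ++ k :: c₂) = Col.ncs c₁ ++ k.name :: Col.ncs c₂ := by simp [Col.ncs]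
  have hl1 : (Col.ncs c₁).length = ((Col.items c₁).map Prod.fst).length := by simp [Col.ncs, Col.items]
  have hl2 : (Col.ncs c₂).length = ((Col.items c₂).map Prod.fst).length := by simp [Col.ncs, Col.items]
  rw [e1, e2, e3, e4]; refine .of_step (.step .con .nil) fun ρ ρ' i1 i2 => ⟨_, _, _, i1, .inl ?_⟩
  rw [add_zero]; obtain ⟨k1, -⟩ := h.kid
  have hΓ : (Col.items c₁ ++ (Fm.quest () B, con t (conc (t' :: ts))) :: Col.items c₂).map Prod.fst =
      (Col.items c₁).map Prod.fst ++ .quest () B :: (Col.items c₂).map Prod.fst := by simp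
  have hpr : (Rule.contr (Col.items c₁).length 2).prems
      ((Col.items c₁ ++ (Fm.quest () B, con t (conc (t' :: ts))) :: Col.items c₂).map Prod.fst) =
      [replaceAt ((Col.items c₁).map Prod.fst ++ .quest () B :: (Col.items c₂).map Prod.fst)
        ((Col.items c₁).map Prod.fst).length [.quest () B, .quest () B]] := by
    rw [hΓ]; simp [Rule.prems, List.replicate]
  refine .comm (x := (n₁ ++ k.name :: n₂, cur)) (p := l.length) (q := (Col.items c₁).length)
    (a := k.name) (cs := [ρ']) (by
      change cur.rule.localPos = _
      rw [k1]; rfl) (by simp [← h.len]) (by simp [Col.ncs, Col.items]) ?_ fun i σ hi => ?_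
  · change Pf.IsNode _ _ (Rule.setPos _ cur.rule) _; rw [k1]
    exact Pf.mk1_isNode rfl ρ'
  · rcases i with _ | i
    · obtain rfl : ρ' = σ := by simpa using hi
      change IsMcut (((((Rule.setPos _ cur.rule).prems _)[0]?).getD []).map Occ.fm)
        (up _ ((((Rule.setPos _ cur.rule).prems _)[0]?).getD [])) _ _
      rw [k1]
      change IsMcut (((((Rule.contr (Col.items c₁).length 2).prems _)[0]?).getD []).map Occ.fm)
        (up _ ((((Rule.contr (Col.items c₁).length 2).prems _)[0]?).getD [])) _ _
      rw [hpr]; simp only [List.getElem?_cons_zero, Option.getD_some]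
      rw [up_replace _ _ _ _ _ _ _ hl1 hl2, replaceAt_fm, h.openAt_eq]; unfold prems1 at i2
      simpa [List.range_succ] using i2
    · simp at hi

theorem step (h : DupPhase (j + 1) n₁ n₂ a l r A cur base D C cols) :
    SimS (Col.items cols) (Col.ncs cols) ((n₁ ++ a :: n₂, cur) ::ₘ (D + C))
      (Col.items (Col.splits (Q a C) cols)) (Col.ncs1 (Q a C) cols) (prems1 n₁ n₂ a cur D C) :=
  h.cut.elim (fun h1 => h.step_concl h1.1 h1.2) fun h1 => h.step_cut h1.1 h1.2

end DupPhase

theorem Good.rename {N N' : Type} {Γ : Seq Unit} {nc : List N} {P : Multiset (Prem N Unit)}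
    (h : Good Γ nc P) {f : N → N'} (hf : Function.Injective f) : Good Γ (nc.map f) (P.map (ren f)) := by
  obtain ⟨ρ, h1, h2⟩ := h.exists; exact (h1.rename f hf.injOn).good h2

/-- Decoding of the names produced by iterated duplications. -/
noncomputable def shift : Name' → Name'
  | (some b, 0) => nm0 (Col.enc (some b, 0))
  | (some b, t + 1) => (some (Col.enc (some b, 1)), t)
  | (none, t) => (none, t)

theorem shift_inj : Function.Injective shift := by
  have hi := Col.enc_inj
  rintro ⟨_ | b, _ | t⟩ ⟨_ | b', _ | t'⟩ h <;> simp [shift, nm0, hi.eq_iff] at h ⊢ <;> simp [h]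

theorem names_map_ren {E : Type u} (f : ℕ → ℕ) (P : Multiset (Prem ℕ E)) (b : ℕ) :
    b ∈ names (P.map (ren f)) ↔ ∃ b' ∈ names P, f b' = b := by
  simp only [names, Set.mem_ofPred_eq, Multiset.mem_map]; constructor
  · rintro ⟨x, ⟨y, hy, rfl⟩, hb⟩; obtain ⟨b', hb', rfl⟩ := List.mem_map.mp hb
    exact ⟨b', ⟨y, hy, hb'⟩, rfl⟩
  · rintro ⟨b', ⟨y, hy, hb'⟩, rfl⟩; exact ⟨_, ⟨y, hy, rfl⟩, List.mem_map_of_mem hb'⟩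

/-- A copy, with encoded names. -/
noncomputable def copy {E : Type u} (t : ℕ) (P : Multiset (Prem ℕ E)) : Multiset (Prem ℕ E) :=
  (P.map (keep t)).map (ren Col.enc)

theorem copy_eq {E : Type u} (t : ℕ) (P : Multiset (Prem ℕ E)) :
    copy t P = P.map (ren fun b => Col.enc (some b, t)) := by
  grind [copy, Multiset.map_map, Multiset.map_congr, ren, keep, Function.comp_def]

theorem mem_names_copy {E : Type u} {t : ℕ} {P : Multiset (Prem ℕ E)} {b : ℕ} :
    b ∈ names (copy t P) ↔ ∃ b' ∈ names P, Col.enc (some b', t) = b := by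
  rw [copy_eq, names_map_ren]

namespace DupPhase
variable {j : ℕ} {n₁ n₂ : List ℕ} {a : ℕ} {l r : Seq Unit} {A : Fm Unit} {cur base : Pf Unit}
  {D C : Multiset (Prem ℕ Unit)} {cols : List Col}

theorem prems1_enc (n₁ n₂ : List ℕ) (a : ℕ) (cur : Pf Unit) (D C : Multiset (Prem ℕ Unit)) :
    (prems1 n₁ n₂ a cur D C).map (ren Col.enc) =
    (((n₁.map nm0 ++ [(some a, 0)]).map Col.enc ++ Col.enc (some a, 1) :: (n₂.map nm0).map Col.enc,
      cur.kid 0) : Prem ℕ Unit) ::ₘ (copy 0 D + copy 0 C + copy 1 C) := by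
  grind [prems1, copy, Multiset.map_cons, Multiset.map_add, ren]

theorem next (h : DupPhase (j + 1) n₁ n₂ a l r A cur base D C cols) :
    DupPhase j ((n₁.map nm0 ++ [(some a, 0)]).map Col.enc) ((n₂.map nm0).map Col.enc)
      (Col.enc (some a, 1)) (l ++ [.quest () A]) r A (cur.kid 0) base (copy 0 D + copy 0 C) (copy 1 C)
      (Col.splits (Q a C) cols) := by
  obtain ⟨-, -, h1, h2⟩ := h.kid
  have hi := Col.enc_inj
  have hC : ∀ b t, Col.enc (some b, t) ∈ names (copy 1 C) ↔ b ∈ names C ∧ t = 1 := by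
    grind [mem_names_copy]
  have hsp : ∀ k ∈ Col.splits (Q a C) cols, ∃ k' ∈ cols, k.fm = k'.fm ∧
      ((Q a C k'.name ∧ k.name = Col.enc (some k'.name, 0) ∧ k.ts.length = 1) ∨
        (Q a C k'.name ∧ k.name = Col.enc (some k'.name, 1) ∧ k.ts.length + 1 = k'.ts.length) ∨
        (¬ Q a C k'.name ∧ k.name = Col.enc (some k'.name, 0) ∧ k.ts.length = 1)) := by
    intro k hk; obtain ⟨k', hk', hk2⟩ := List.mem_flatMap.mp hk
    refine ⟨k', hk', ?_⟩; unfold Col.split at hk2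
    by_cases hQ : Q a C k'.name
    · obtain ⟨B, t, t', ts, hB, hts⟩ := h.two hk' hQ; grind
    · rw [if_neg hQ, List.mem_singleton] at hk2; subst hk2
      exact ⟨rfl, Or.inr (Or.inr ⟨hQ, rfl, h.single k' hk' fun h' => hQ (h.Q_iff.mpr h')⟩)⟩
  have hne : ∀ b, Col.enc (some b, 0) ≠ Col.enc (some a, 1) := fun b e => by
    have := hi e
    simp at this
  have he1 : ∀ b, Col.enc (some b, 1) = Col.enc (some a, 1) ↔ b = a := fun b => by
    rw [hi.eq_iff]; simp
  refine ⟨by simp [h.len], h1, ?_, ?_, ?_, ?_, ?_, ?_, ?_, ?_⟩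
  · simpa using h2
  · intro x hx; unfold copy at hx
    obtain ⟨y, hy, rfl⟩ := Multiset.mem_map.mp hx; obtain ⟨z, hz, rfl⟩ := Multiset.mem_map.mp hy
    exact h.prom z hz
  · intro b hb hb'; obtain ⟨c, hc, rfl⟩ := mem_names_copy.mp hb
    obtain ⟨x, hx, hbx⟩ := hb'; rcases Multiset.mem_cons.mp hx with rfl | hx
    · simp only [List.mem_append, List.mem_cons, List.mem_map] at hbx
      rcases hbx with ⟨o, ho, e⟩ | e | ⟨o, ⟨d, hd, rfl⟩, e⟩
      · rcases ho with ⟨d, -, rfl⟩ | ho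
        · simpa [nm0] using hi e
        grind
      · exact e
      · simpa [nm0] using hi e
    · have hx' : Col.enc (some c, 1) ∈ names (copy 0 D) ∨ Col.enc (some c, 1) ∈ names (copy 0 C) := by
        rcases Multiset.mem_add.mp hx with hx | hx
        · exact Or.inl ⟨x, hx, hbx⟩
        · exact Or.inr ⟨x, hx, hbx⟩
      rcases hx' with hx' | hx' <;>
      · obtain ⟨d, -, e⟩ := mem_names_copy.mp hx'; simpa using hi e
  · rw [Col.ncs_splits]
    have hmem : Col.enc (some a, 1) ∈ (Col.ncs1 (Q a C) cols).map Col.enc ↔ a ∈ Col.ncs cols := by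
      rw [List.mem_map_of_injective hi]; unfold Col.ncs1 Col.ncs
      rw [List.mem_flatMap, List.mem_map]; constructor
      · grind
      · rintro ⟨k, hk, rfl⟩; exact ⟨k, hk, by rw [if_pos (h.Q_iff.mpr (Or.inr rfl))]; simp⟩
    rw [hmem, hC]; rcases h.cut with ⟨rfl, h3⟩ | ⟨h3, h4⟩
    · exact Or.inl ⟨rfl, h3⟩
    · exact Or.inr ⟨h3, h4, rfl⟩
  · have := h.good1.rename Col.enc_inj
    rw [prems1_enc, ← Col.ncs_splits] at this; exact this
  · intro k hk hk2; obtain ⟨k', hk', -, ⟨-, e, e2⟩ | ⟨hQ, e, e2⟩ | ⟨-, e, e2⟩⟩ := hsp k hk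
    · grind
    · have := h.dup k' hk' (h.Q_iff.mp hQ)
      omega
    grind
  · intro k hk hk2; obtain ⟨k', hk', -, ⟨-, e, e2⟩ | ⟨hQ, e, e2⟩ | ⟨-, e, e2⟩⟩ := hsp k hk
    · exact e2
    · exfalso; apply hk2
      rw [e, hC, he1]; simpa using h.Q_iff.mp hQ
    · exact e2
  · intro k hk hk2; obtain ⟨k', hk', e1, ⟨-, e, e2⟩ | ⟨hQ, e, e2⟩ | ⟨-, e, e2⟩⟩ := hsp k hk
    · exact absurd e2 hk2
    · rw [e1]
      have := h.dup k' hk' (h.Q_iff.mp hQ)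
      exact h.quest k' hk' (by omega)
    · exact absurd e2 hk2

theorem ncs'_shift (h : DupPhase (j + 1) n₁ n₂ a l r A cur base D C cols) :
    (Col.ncs' cols).map shift = Col.ncs' (Col.splits (Q a C) cols) := by
  unfold Col.ncs' Col.splits; rw [List.map_flatMap, List.flatMap_assoc]
  refine List.flatMap_congr fun k hk => ?_
  unfold Col.split; by_cases hQ : Q a C k.name
  · obtain ⟨B, t, t', ts, hB, hts⟩ := h.two hk hQ; rw [if_pos hQ, hts]
    simp [List.range_succ_eq_map, shift, nm0, Function.comp_def]
  · have := h.single k hk fun h' => hQ (h.Q_iff.mpr h')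
    rw [if_neg hQ]; simp [this, shift, nm0]

theorem keep_zero_shift (P : Multiset (Prem ℕ Unit)) :
    (P.map (keep 0)).map (ren shift) = (copy 0 P).map (keep 0) := by
  unfold copy; rw [Multiset.map_map, Multiset.map_map, Multiset.map_map]
  refine Multiset.map_congr rfl fun x hx => ?_
  simp [ren, keep, shift, nm0, Function.comp_def]

theorem keep_succ_shift (t : ℕ) (P : Multiset (Prem ℕ Unit)) :
    (P.map (keep (t + 1))).map (ren shift) = (copy 1 P).map (keep t) := by
  unfold copy; rw [Multiset.map_map, Multiset.map_map, Multiset.map_map]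
  simp [ren, keep, shift, Function.comp_def]

theorem dupPrems_shift (n₁ n₂ : List ℕ) (a : ℕ) (base : Pf Unit) (D C : Multiset (Prem ℕ Unit)) :
    (dupPrems (j + 1) n₁ n₂ a base D C).map (ren shift) =
      dupPrems j ((n₁.map nm0 ++ [(some a, 0)]).map Col.enc) ((n₂.map nm0).map Col.enc)
      (Col.enc (some a, 1)) base (copy 0 D + copy 0 C) (copy 1 C) := by
  unfold dupPrems
  rw [Multiset.map_cons, Multiset.map_add, keep_zero_shift, Finset.sum_range_succ', Multiset.map_add,
    keep_zero_shift, Multiset.map_add]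
  have e : (∑ t ∈ Finset.range (j + 1), C.map (keep (t + 1))).map (ren shift) =
      ∑ t ∈ Finset.range (j + 1), (copy 1 C).map (keep t) := by
    rw [← Multiset.coe_mapAddMonoidHom, map_sum]; refine Finset.sum_congr rfl fun t ht => ?_
    rw [Multiset.coe_mapAddMonoidHom, keep_succ_shift]
  rw [e]; congr 1
  · rw [List.range_succ_eq_map (n := j + 1)]; simp [ren, shift, nm0, Function.comp_def]
  · abel

theorem zero (h : DupPhase 0 n₁ n₂ a l r A cur base D C cols) :
    Col.items' cols = Col.items cols ∧ Col.ncs' cols = (Col.ncs cols).map nm0 ∧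
      dupPrems 0 n₁ n₂ a base D C = ((n₁ ++ a :: n₂, cur) ::ₘ (D + C)).map (ren nm0) := by
  have h1 : ∀ k ∈ cols, k.ts.length = 1 := fun k hk => by
    by_cases h1 : k.name ∈ names C ∨ k.name = a
    · exact h.dup k hk h1
    · exact h.single k hk h1
  refine ⟨?_, ?_, ?_⟩
  · unfold Col.items' Col.items; rw [← List.flatMap_singleton' (cols.map _), List.flatMap_map]
    refine List.flatMap_congr fun k hk => ?_
    obtain ⟨t, ht⟩ := List.length_eq_one_iff.mp (h1 k hk); simp [ht, conc]
  · unfold Col.ncs' Col.ncs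
    rw [← List.flatMap_singleton' ((cols.map _).map _), List.map_map, List.flatMap_map]
    refine List.flatMap_congr fun k hk => ?_
    simp [h1 k hk, nm0]
  · have hcur : cur = base := h.chain
    unfold dupPrems
    rw [Multiset.map_cons, zero_add, Finset.sum_range_one, keep_zero, Multiset.map_add, hcur]
    congr 1; simp [ren, nm0]

/-- The duplication phase. -/
theorem run : ∀ (j : ℕ) {n₁ n₂ : List ℕ} {a : ℕ} {l r : Seq Unit} {A : Fm Unit} {cur base : Pf Unit}
    {D C : Multiset (Prem ℕ Unit)} {cols : List Col}, DupPhase j n₁ n₂ a l r A cur base D C cols →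
    (j ≠ 0 → SimS (Col.items cols) (Col.ncs cols) ((n₁ ++ a :: n₂, cur) ::ₘ (D + C))
      (Col.items' cols) (Col.ncs' cols) (dupPrems j n₁ n₂ a base D C)) ∧
    SimW (Col.items cols) (Col.ncs cols) ((n₁ ++ a :: n₂, cur) ::ₘ (D + C))
      (Col.items' cols) (Col.ncs' cols) (dupPrems j n₁ n₂ a base D C) := by
  intro j
  induction j with
  | zero =>
    intro n₁ n₂ a l r A cur base D C cols h; refine ⟨fun h => absurd rfl h, ?_⟩
    obtain ⟨e1, e2, e3⟩ := h.zero; rw [e1, e2, e3]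
    exact .of_imp fun ρ hρ => (isMcut_rename_iff nm0 nm0_inj.injOn).mp hρ
  | succ j ih =>
    intro n₁ n₂ a l r A cur base D C cols h
    suffices SimS (Col.items cols) (Col.ncs cols) ((n₁ ++ a :: n₂, cur) ::ₘ (D + C))
        (Col.items' cols) (Col.ncs' cols) (dupPrems (j + 1) n₁ n₂ a base D C) from
      ⟨fun _ => this, this.simW h.good⟩
    refine h.step.trans ?_
    have h1 : SimW (Col.items (Col.splits (Q a C) cols)) (Col.ncs1 (Q a C) cols) (prems1 n₁ n₂ a cur D C)
        (Col.items (Col.splits (Q a C) cols)) ((Col.ncs1 (Q a C) cols).map Col.enc)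
        ((prems1 n₁ n₂ a cur D C).map (ren Col.enc)) :=
      .of_imp fun ρ hρ => (isMcut_rename_iff Col.enc Col.enc_inj.injOn).mp hρ
    refine h1.trans ?_
    have h2 := (ih h.next).2
    rw [prems1_enc, ← Col.ncs_splits]; refine h2.trans ?_
    rw [Col.items'_splits _ _ h.ts_ne, ← h.ncs'_shift, ← dupPrems_shift]
    exact .of_imp fun ρ hρ => hρ.rename shift shift_inj.injOn

end DupPhase

section Plain
variable {E : Type u} {S : Sig E}

theorem Rule.Plain.not_FU {r : Rule E} (h : r.Plain) : ¬ r.IsF ∧ ¬ r.IsU := by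
  constructor
  · rintro ⟨p, rfl⟩
    have := h []
    simp [Rule.tr, Rule.tr1, derelictions] at this
  · rintro ⟨p, rfl⟩
    have := h []
    simp [Rule.tr, Rule.tr1, derelictions] at this

theorem Rule.tr1_setPos (r : Rule E) (q : ℕ) : (r.setPos q).tr1 = r.tr1.setPos q := by cases r <;> rfl

theorem Rule.Plain.setPos {r : Rule E} (h : r.Plain) (q : ℕ) : (r.setPos q).Plain := by
  have hl := fun Γ : Seq E => congrArg List.length (h Γ)
  obtain ⟨hF, hU⟩ := h.not_FU; cases r with
  | mpx p i =>
    rcases i with _ | _ | i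
    · exact fun Γ => rfl
    · exact fun Γ => rfl
    · have := hl []
      simp [Rule.tr] at this; omega
  | contr p i =>
    rcases i with _ | _ | _ | i
    · exact fun Γ => rfl
    · exact fun Γ => rfl
    · exact fun Γ => rfl
    · have := hl []
      simp [Rule.tr] at this
  | promF p => exact absurd ⟨p, rfl⟩ hF
  | promU p => exact absurd ⟨p, rfl⟩ hU
  | _ => exact fun _ => rfl

theorem Rule.localPos_tr1 (r : Rule E) : r.tr1.localPos = r.localPos := by cases r <;> rfl

theorem Rule.prem_tr {Γ : Seq E} {r : Rule E} (hok : r.Ok S Γ) (hp : r.Plain) (k : ℕ) :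
    ((r.tr1.prems (Γ.map Fm.tr))[k]?).getD [] = (((r.prems Γ)[k]?).getD []).map Occ.tr := by
  rw [Rule.prems_tr hok hp.not_FU.1 hp.not_FU.2, List.getElem?_map]; cases (r.prems Γ)[k]? <;> rfl

theorem up_tr (n : List ℕ) (O : List (Occ E)) : up n (O.map Occ.tr) = up n O := by
  unfold up; rw [List.map_map]; rfl

theorem fm_tr (O : List (Occ E)) : (O.map Occ.tr).map Occ.fm = (O.map Occ.fm).map Fm.tr := by
  rw [List.map_map, List.map_map]; rfl

theorem openAt_tr {x : Prem ℕ E} (hx : x.2.LocalOk S) (hp : x.2.rule.Plain) (k : ℕ) :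
    openAt (trP x) k = trP (openAt x k) := by
  obtain ⟨h1, h2, h3⟩ := Pf.tr_single (hp x.2.concl) (Rule.tr1_arity _); unfold openAt trP
  refine Prod.ext ?_ ?_
  · dsimp only; unfold Pf.occs
    rw [h1, h2, Rule.prem_tr hx.2.1 hp, up_tr]
  simp_all [Pf.kid]

theorem keep_tr (t : ℕ) (P : Multiset (Prem ℕ E)) :
    (P.map (keep t)).map trP = (P.map trP).map (keep t) := by
  rw [Multiset.map_map, Multiset.map_map]; rfl

theorem IsMcut.isProof {N : Type} {Γ : Seq E} {nc : List N} {P : Multiset (Prem N E)} {π : Pf E}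
    (h : IsMcut Γ nc P π) (hp : π.IsPreproof S) (hP : ∀ x ∈ P, x.2.IsProof S) : π.IsProof S := by
  refine Pf.isProof_of hp.localOk fun k ρ hk => ?_
  obtain ⟨L, iota, link, rfl, hnode, -⟩ := h; rw [hnode.2.2, List.getElem?_map] at hk
  obtain ⟨x, hx, rfl⟩ := Option.map_eq_some_iff.mp hk
  exact hP x (Multiset.mem_coe.mpr (List.mem_of_getElem? hx))

theorem node_isProof {π : Pf E} {Γ : Seq E} {r : Rule E} {cs : List (Pf E)} (h : π.IsNode Γ r cs)
    (hp : π.IsPreproof S) (hcs : ∀ (k : ℕ) ρ, cs[k]? = some ρ → ρ.IsPreproof S → ρ.IsProof S) :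
    π.IsProof S := by
  refine Pf.isProof_of hp.localOk fun k ρ hk => ?_
  have := hk
  rw [h.2.2] at this; exact hcs k ρ this (hp.child hk)

theorem AllProm.tr {P : Multiset (Prem ℕ E)} (h : AllProm P) : AllProm (P.map trP) := by
  intro x hx; obtain ⟨y, hy, rfl⟩ := Multiset.mem_map.mp hx
  obtain ⟨p, hp⟩ := h y hy; refine ⟨p, ?_⟩
  have : ∃ rs, y.2.rule.tr y.2.concl = .promG p :: rs := by
    cases hr : y.2.rule with
    | promG q => rw [hr] at hp; simp [Rule.promPos] at hp; subst hp; exact ⟨_, rfl⟩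
    | promF q => rw [hr] at hp; simp [Rule.promPos] at hp; subst hp; exact ⟨_, rfl⟩
    | promU q => rw [hr] at hp; simp [Rule.promPos] at hp; subst hp; exact ⟨_, rfl⟩
    | _ => rw [hr] at hp; simp [Rule.promPos] at hp
  obtain ⟨rs, hrs⟩ := this
  have : y.2.tr.rule = .promG p := by grind [Pf.tr_eq, trS_rule, remRules]
  change y.2.tr.rule.promPos = _; rw [this]; rfl

theorem Duel.plain {r r' : Rule E} {p q : ℕ} {ks ks' : List ℕ} (h : Duel r p ks r' q ks') :
    r.Plain ∧ r'.Plain ∧ Duel r.tr1 p ks r'.tr1 q ks' := by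
  cases h with
  | par_tens p q m => exact ⟨fun _ => rfl, fun _ => rfl, .par_tens p q m⟩
  | plus_wth p b q => exact ⟨fun _ => rfl, fun _ => rfl, .plus_wth p b q⟩
  | fix_fix p q => exact ⟨fun _ => rfl, fun _ => rfl, .fix_fix p q⟩
  | one_bot q => exact ⟨fun _ => rfl, fun _ => rfl, .one_bot q⟩

theorem tr_rule {π : Pf E} (h : π.rule.Plain) : π.tr.rule = π.rule.tr1 :=
  (Pf.tr_single (h π.concl) (Rule.tr1_arity _)).2.1

/-- A commutation of a multiplexing or of a contraction of several formulas. -/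
def ExpComm (Γ : Seq E) (nc : List ℕ) (P : Multiset (Prem ℕ E)) (π' : Pf E) : Prop :=
  ∃ (x : Prem ℕ E) (C : Multiset (Prem ℕ E)) (p q a : ℕ) (r : ℕ → Rule E) (ρ : Pf E),
    P = x ::ₘ C ∧ ((∃ i, r = fun p => .mpx p (i + 1)) ∨ ∃ i, r = fun p => .contr p (i + 2)) ∧
    x.2.rule = r p ∧ x.1[p]? = some a ∧ nc[q]? = some a ∧ π'.IsNode Γ (r q) [ρ] ∧
    IsMcut (((((r q).prems Γ)[0]?).getD []).map Occ.fm) (up nc ((((r q).prems Γ)[0]?).getD []))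
      (openAt x 0 ::ₘ C.map (keep 0)) ρ

theorem BaseRed.tr {Γ : Seq E} {nc : List ℕ} {P : Multiset (Prem ℕ E)} {π' : Pf E}
    (h : BaseRed Γ nc P π') (hP : ∀ x ∈ P, x.2.IsProof S) (hπ : π'.IsPreproof S) :
    (BaseRed (Γ.map Fm.tr) nc (P.map trP) π'.tr ∧ π'.tr.IsLLProof) ∨ ExpComm Γ nc P π' := by
  have ho : ∀ x ∈ P, ∀ k, (openAt x k).2.IsProof S := fun x hx k => (hP x hx).kid k
  cases h with
  | @ax_comm x π' h1 h2 =>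
    refine .inl ⟨?_, (node_isProof h2 hπ (by simp)).tr⟩
    rw [Multiset.map_singleton]
    have hpl : x.2.rule.Plain := by rw [h1]; exact fun _ => rfl
    refine .ax_comm ?_ (Pf.tr_isNode h2 rfl rfl); change x.2.tr.rule = _
    rw [tr_rule hpl, h1]; rfl
  | @one_comm x π' h1 h2 =>
    refine .inl ⟨?_, (node_isProof h2 hπ (by simp)).tr⟩
    rw [Multiset.map_singleton]
    have hpl : x.2.rule.Plain := by rw [h1]; exact fun _ => rfl
    refine .one_comm ?_ (Pf.tr_isNode h2 rfl rfl); change x.2.tr.rule = _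
    rw [tr_rule hpl, h1]; rfl
  | @comm x C p q a π' cs h1 h2 h3 h4 h5 =>
    by_cases hpl : x.2.rule.Plain
    · left
      have hok : (x.2.rule.setPos q).Ok S Γ := by
        have := hπ.localOk.2.1
        rwa [h4.1, h4.2.1] at this
      have hr : (trP x).2.rule = x.2.rule.tr1 := tr_rule hpl
      have hs : (trP x).2.rule.setPos q = (x.2.rule.setPos q).tr1 := by rw [hr, Rule.tr1_setPos]
      refine ⟨?_, (node_isProof h4 hπ fun k ρ hk hρ => (h5 k ρ hk).isProof hρ fun z hz => ?_).tr⟩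
      · rw [Multiset.map_cons]
        refine .comm (x := trP x) (p := p) (q := q) (a := a) (cs := cs.map Pf.tr)
          (by rw [hr, Rule.localPos_tr1, h1]) h2 h3 ?_ fun k ρ hk => ?_
        · rw [hs]; exact Pf.tr_isNode h4 (hpl.setPos q Γ) (Rule.tr1_arity _)
        · rw [List.getElem?_map] at hk; obtain ⟨σ, hσ, rfl⟩ := Option.map_eq_some_iff.mp hk
          have := (h5 k σ hσ).tr
          rw [Multiset.map_cons, keep_tr, ← openAt_tr (hP x (by simp)).1.localOk hpl] at this
          rw [hs, Rule.prem_tr hok (hpl.setPos q), up_tr, fm_tr]; exact this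
      · rcases Multiset.mem_cons.mp hz with rfl | hz
        · exact ho x (by simp) k
        · obtain ⟨y, hy, rfl⟩ := Multiset.mem_map.mp hz; exact hP y (by simp [hy])
    · right
      have hok := (hP x (by simp)).1.localOk.2.1
      have key : ∀ r : ℕ → Rule E, ((∃ i, r = fun p => .mpx p (i + 1)) ∨ ∃ i, r = fun p => .contr p (i + 2)) →
          x.2.rule = r p → x.2.rule.setPos q = r q → (r q).arity = 1 →
          ExpComm Γ nc (x ::ₘ C) π' := by
        intro r hr e1 e2 e3; rw [e2] at h4
        have hcs := h4.length
        obtain ⟨ρ, rfl⟩ := List.length_eq_one_iff.mp (hcs.trans e3)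
        refine ⟨x, C, p, q, a, r, ρ, rfl, hr, e1, h2, h3, h4, ?_⟩
        have := h5 0 ρ rfl
        rwa [e2] at this
      cases hr : x.2.rule with
      | mpx p' i =>
        rw [hr] at h1 hpl hok; obtain rfl : p' = p := by simpa [Rule.localPos] using h1
        rcases i with _ | i
        · exact absurd (fun _ => rfl) hpl
        · exact key (fun p => .mpx p (i + 1)) (Or.inl ⟨i, rfl⟩) hr (by rw [hr]; rfl) rfl
      | contr p' i =>
        rw [hr] at h1 hpl hok; obtain rfl : p' = p := by simpa [Rule.localPos] using h1
        obtain ⟨i, rfl⟩ := Nat.exists_eq_add_of_le' hok.1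
        exact key (fun p => .contr p (i + 2)) (Or.inr ⟨i, rfl⟩) hr (by rw [hr]; rfl) rfl
      | promF => rw [hr] at h1; simp [Rule.localPos] at h1
      | promU => rw [hr] at h1; simp [Rule.localPos] at h1
      | _ => rw [hr] at hpl; exact absurd (fun _ => rfl) hpl
  | @tens_comm x C₁ C₂ p m q m' a π' ρ₁ ρ₂ h1 h2 h3 h4 h5 h6 =>
    left
    have hpl : x.2.rule.Plain := by rw [h1]; exact fun _ => rfl
    have hok : (Rule.tens q m').Ok S Γ := by
      have := hπ.localOk.2.1
      rwa [h4.1, h4.2.1] at this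
    have hpl' : (Rule.tens q m' : Rule E).Plain := fun _ => rfl
    have hx := (hP x (by simp)).1.localOk
    refine ⟨?_, (node_isProof h4 hπ fun k ρ hk hρ => ?_).tr⟩
    · rw [Multiset.map_cons, Multiset.map_add]
      have e5 := h5.tr
      have e6 := h6.tr
      rw [Multiset.map_cons, keep_tr, ← openAt_tr hx hpl, ← fm_tr, ← up_tr, ← Rule.prem_tr hok hpl'] at e5 e6
      refine .tens_comm (p := p) (m := m) (q := q) (m' := m') (a := a) ?_ h2 h3
        (Pf.tr_isNode h4 rfl rfl) e5 e6
      change x.2.tr.rule = _; rw [tr_rule hpl, h1]; rfl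
    · rcases k with _ | _ | k
      · obtain rfl : ρ₁ = ρ := by simpa using hk
        refine h5.isProof hρ fun z hz => ?_
        rcases Multiset.mem_cons.mp hz with rfl | hz
        · exact ho x (by simp) 0
        · obtain ⟨y, hy, rfl⟩ := Multiset.mem_map.mp hz; exact hP y (by simp [hy])
      · obtain rfl : ρ₂ = ρ := by simpa using hk
        refine h6.isProof hρ fun z hz => ?_
        rcases Multiset.mem_cons.mp hz with rfl | hz
        · exact ho x (by simp) 1
        · obtain ⟨y, hy, rfl⟩ := Multiset.mem_map.mp hz; exact hP y (by simp [hy])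
      · simp at hk
  | @promG_comm x C p q a π' ρ h1 h2 h3 h4 h5 h6 =>
    left
    have hpl : x.2.rule.Plain := by rw [h1]; exact fun _ => rfl
    have hok : (Rule.promG q).Ok S Γ := by
      have := hπ.localOk.2.1
      rwa [h5.1, h5.2.1] at this
    have hpl' : (Rule.promG q : Rule E).Plain := fun _ => rfl
    have hx := (hP x (by simp)).1.localOk
    refine ⟨?_, (node_isProof h5 hπ fun k ρ' hk hρ => ?_).tr⟩
    · rw [Multiset.map_cons]
      have e6 := h6.tr
      unfold Rule.prem0 at e6
      rw [Multiset.map_cons, keep_tr, ← openAt_tr hx hpl, ← fm_tr, ← Rule.prem_tr hok hpl'] at e6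
      refine .promG_comm (p := p) (q := q) (a := a) ?_ h2 h3 h4.tr (Pf.tr_isNode h5 rfl rfl) e6
      change x.2.tr.rule = _; rw [tr_rule hpl, h1]; rfl
    · rcases k with _ | k
      · obtain rfl : ρ = ρ' := by simpa using hk
        refine h6.isProof hρ fun z hz => ?_
        rcases Multiset.mem_cons.mp hz with rfl | hz
        · exact ho x (by simp) 0
        · obtain ⟨y, hy, rfl⟩ := Multiset.mem_map.mp hz; exact hP y (by simp [hy])
      · simp at hk
  | @ax_princ x C a b π' h1 h2 h3 h4 =>
    left
    have hpl : x.2.rule.Plain := by rw [h1]; exact fun _ => rfl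
    refine ⟨?_, (h4.isProof hπ fun z hz => ?_).tr⟩
    · rw [Multiset.map_cons]; refine .ax_princ (a := a) (b := b) ?_ h2 (by simpa using h3) ?_
      · change x.2.tr.rule = _; rw [tr_rule hpl, h1]; rfl
      · have := h4.tr
        rw [Multiset.map_map] at this ⊢; exact this
    · obtain ⟨y, hy, rfl⟩ := Multiset.mem_map.mp hz; exact hP y (by simp [hy])
  | @cut_princ x C A m π' h1 h2 =>
    left
    have hpl : x.2.rule.Plain := by rw [h1]; exact fun _ => rfl
    have hx := (hP x (by simp)).1.localOk
    refine ⟨?_, (h2.isProof hπ fun z hz => ?_).tr⟩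
    · rw [Multiset.map_cons]; refine .cut_princ (A := A.tr) (m := m) ?_ ?_
      · change x.2.tr.rule = _; rw [tr_rule hpl, h1]; rfl
      · have := h2.tr
        grind [Multiset.map_cons, keep_tr, openAt_tr]
    · rcases Multiset.mem_cons.mp hz with rfl | hz
      · exact ho x (by simp) 0
      rcases Multiset.mem_cons.mp hz with rfl | hz
      · exact ho x (by simp) 1
      · obtain ⟨y, hy, rfl⟩ := Multiset.mem_map.mp hz; exact hP y (by simp [hy])
  | @princ x y C p ks q ks' a π' h1 h2 h3 h4 =>
    left; obtain ⟨hpx, hpy, hd⟩ := h1.plain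
    have hx := (hP x (by simp)).1.localOk
    have hy := (hP y (by simp)).1.localOk
    refine ⟨?_, (h4.isProof hπ fun z hz => ?_).tr⟩
    · rw [Multiset.map_cons, Multiset.map_cons]
      refine .princ (x := trP x) (y := trP y) (p := p) (ks := ks) (q := q) (ks' := ks') (a := a) ?_ h2 h3 ?_
      · grind [trP, tr_rule]
      · have := h4.tr
        rw [Multiset.map_add, keep_tr, Multiset.map_coe, List.map_append, List.map_map, List.map_map] at this
        have e1 : trP ∘ openAt x = openAt (trP x) := funext fun k => (openAt_tr hx hpx k).symm
        have e2 : trP ∘ openAt y = openAt (trP y) := funext fun k => (openAt_tr hy hpy k).symm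
        rwa [e1, e2] at this
    · rcases Multiset.mem_add.mp hz with hz | hz
      · rcases List.mem_append.mp (Multiset.mem_coe.mp hz) with hz | hz
        all_goals grind
      · obtain ⟨w, hw, rfl⟩ := Multiset.mem_map.mp hz; exact hP w (by simp [hw])

end Plain

section
variable {N N₁ N' : Type} {F F' : List Item} {nc : List N} {nc₁ : List N₁} {nc' : List N'}
  {P : Multiset (Prem N Unit)} {P₁ : Multiset (Prem N₁ Unit)} {P' : Multiset (Prem N' Unit)}

theorem SimS.of_left (h : SimS F nc₁ P₁ F' nc' P')
    (hi : ∀ ρ, IsMcut (F.map Prod.fst) nc P ρ → IsMcut (F.map Prod.fst) nc₁ P₁ ρ) :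
    SimS F nc P F' nc' P' := by
  obtain ⟨rs, h1, h2⟩ := h; exact ⟨rs, h1, fun ρ h3 h4 ρ' h5 h6 => h2 ρ (hi ρ h3) h4 ρ' h5 h6⟩

theorem Good.of_rename [Nonempty N] {Γ : Seq Unit} {f : N → N'} (hf : Function.Injective f)
    (h : Good Γ (nc.map f) (P.map (ren f))) : Good Γ nc P := by
  obtain ⟨ρ, h1, h2⟩ := h.exists; exact ((isMcut_rename_iff f hf.injOn).mp h1).good h2

end

namespace DupPhase
variable {n₁ n₂ : List ℕ} {a : ℕ} {l r : Seq Unit} {A : Fm Unit} {cur base : Pf Unit}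
  {D C : Multiset (Prem ℕ Unit)} {cols : List Col}

theorem good' : ∀ (j : ℕ) {n₁ n₂ : List ℕ} {a : ℕ} {l r : Seq Unit} {A : Fm Unit} {cur base : Pf Unit}
    {D C : Multiset (Prem ℕ Unit)} {cols : List Col}, DupPhase j n₁ n₂ a l r A cur base D C cols →
    Good ((Col.items' cols).map Prod.fst) (Col.ncs' cols) (dupPrems j n₁ n₂ a base D C) := by
  intro j
  induction j with
  | zero =>
    intro n₁ n₂ a l r A cur base D C cols h; obtain ⟨e1, e2, e3⟩ := h.zero
    rw [e1, e2, e3]; exact h.good.rename nm0_inj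
  | succ j ih =>
    intro n₁ n₂ a l r A cur base D C cols h
    have := ih h.next
    rw [Col.items'_splits _ _ h.ts_ne, ← h.ncs'_shift, ← dupPrems_shift] at this
    exact Good.of_rename shift_inj this

theorem simS {N' : Type} {F' : List Item} {nc' : List N'} {P' : Multiset (Prem N' Unit)} {j : ℕ}
    (h : DupPhase j n₁ n₂ a l r A cur base D C cols)
    (h' : SimS (Col.items' cols) (Col.ncs' cols) (dupPrems j n₁ n₂ a base D C) F' nc' P') :
    SimS (Col.items cols) (Col.ncs cols) ((n₁ ++ a :: n₂, cur) ::ₘ (D + C)) F' nc' P' := by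
  rcases j with _ | j
  · obtain ⟨e1, e2, e3⟩ := h.zero; rw [e1, e2, e3] at h'
    exact h'.of_left fun ρ hρ => hρ.rename nm0 nm0_inj.injOn
  · exact ((run _ h).1 (by omega)).trans (h'.simW (good' _ h))

end DupPhase

/-! ### Derived structural rules -/

section Der
variable {E : Type u} {S : Sig E} {g : Bool} {Γ : Seq E}

theorem StructDer.quest {st fin : List (List Bool)} {π ρ : Pf E} (h : StructDer S g Γ st π fin ρ)
    {k : ℕ} (hk : st[k]? ≠ fin[k]?) : ∃ s A, Γ[k]? = some (.quest s A) := by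
  induction h with
  | refl => exact absurd rfl hk
  | @step pre left right post s A r new π π' fin ρ h1 h2 h3 h4 h5 ih => grind

theorem StructDer.preproof {st fin : List (List Bool)} {π ρ : Pf E} (h : StructDer S g Γ st π fin ρ)
    (hπ : π.IsPreproof S) : ρ.IsPreproof S := by
  induction h with
  | refl => exact hπ
  | step h1 h2 h3 h4 h5 ih => exact ih (hπ.child (h4.2.2 0))

/-- The forest of a derived structural rule. -/
def forest (Γ : Seq E) (fin : List (List Bool)) : List Item :=
  List.zipWith (fun A b => ((A.tr, comb b) : Item)) Γ fin

theorem structDer_sim {nc : List ℕ} {P : Multiset (Prem ℕ E)} {σ π' ρ : Pf E} {fin : List (List Bool)}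
    {nc' : List Name'} {P' : Multiset (Prem Name' E)} {F' : List Item}
    (hσ : IsMcut Γ nc P σ) (hp : σ.IsProof S)
    (hd : StructDer S g Γ (nc.map fun _ => [true]) π' fin ρ)
    (hρ : IsMcut (blockSeq Γ fin) nc' P' ρ) (hρp : ρ.IsProof S)
    (hs : SimS (forest Γ fin) nc (P.map trP) F' nc' (P'.map trP)) (hl : Leaves F')
    (hF : F'.map Prod.fst = (blockSeq Γ fin).map Fm.tr) :
    ∃ θ, ReflTransGen PStep σ.tr θ ∧ ReflTransGen (PermZone g) θ π'.tr := by
  have hn : nc.map (fun _ => [true]) = Γ.map fun _ => [true] := by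
    rw [List.map_const', List.map_const', hσ.fits.1]
  rw [hn] at hd; obtain ⟨h1, h2⟩ := hd.perm hρ.tr.isMcutRule
  obtain ⟨rs, h3, h4⟩ := hs
  have e : (forest Γ fin).map Prod.fst = Γ.map Fm.tr := by
    unfold forest; rw [List.map_zipWith]
    apply List.ext_getElem
    · simp [h1]
    · intro i hi hi'; simp
  rw [e, hF] at h4; exact ⟨_, h4 σ.tr hσ.tr hp.tr ρ.tr hρ.tr hρp.tr, h2 rs F' h3 hl⟩

end Der

section Cols
variable {E : Type u}

/-- The columns of a derived structural rule. -/
def colsOf (nc : List ℕ) (Γ : Seq E) (fin : List (List Bool)) : List Col :=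
  List.zipWith (fun (b : ℕ) (x : Fm E × List Bool) => (⟨b, x.1.tr, x.2.map el⟩ : Col)) nc (Γ.zip fin)

/-- The names of the blocks. -/
def blockNames (nc : List ℕ) (fin : List (List Bool)) : List Name' :=
  (List.zipWith (fun b bl => (List.range (List.length bl)).map fun t => ((some b, t) : Name')) nc fin).flatten

theorem colsOf_spec (nc : List ℕ) (Γ : Seq E) (fin : List (List Bool)) (h1 : nc.length = Γ.length)
    (h2 : fin.length = nc.length) :
    Col.ncs (colsOf nc Γ fin) = nc ∧ Col.items (colsOf nc Γ fin) = forest Γ fin ∧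
      Col.ncs' (colsOf nc Γ fin) = blockNames nc fin ∧
      Col.items' (colsOf nc Γ fin) =
        (List.zipWith (fun A b => b.map fun e => ((Fm.tr A, el e) : Item)) Γ fin).flatten := by
  induction nc generalizing Γ fin with
  | nil =>
    obtain rfl : Γ = [] := List.length_eq_zero_iff.mp h1.symm; exact ⟨rfl, rfl, rfl, rfl⟩
  | cons b nc ih =>
    rcases Γ with _ | ⟨A, Γ⟩
    · simp at h1
    rcases fin with _ | ⟨bl, fin⟩
    · simp at h2
    obtain ⟨i1, i2, i3, i4⟩ := ih Γ fin (by simpa using h1) (by simpa using h2)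
    have e : colsOf (b :: nc) (A :: Γ) (bl :: fin) = ⟨b, A.tr, bl.map el⟩ :: colsOf nc Γ fin := rfl
    rw [e]; refine ⟨?_, ?_, ?_, ?_⟩
    · change b :: Col.ncs _ = _; rw [i1]
    · have : forest (A :: Γ) (bl :: fin) = (A.tr, comb bl) :: forest Γ fin := rfl
      rw [this, ← i2]; rfl
    all_goals grind [blockNames, Col.ncs', List.zipWith_cons_cons, Col.items', Function.comp_def]

theorem mem_colsOf {nc : List ℕ} {Γ : Seq E} {fin : List (List Bool)} {k : Col}
    (h : k ∈ colsOf nc Γ fin) : ∃ (i : ℕ) (A : Fm E) (bl : List Bool), nc[i]? = some k.name ∧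
      Γ[i]? = some A ∧ fin[i]? = some bl ∧ k.fm = A.tr ∧ k.ts = bl.map el := by
  obtain ⟨i, hi, rfl⟩ := List.getElem_of_mem h; unfold colsOf at hi ⊢
  simp only [List.length_zipWith, List.length_zip] at hi
  refine ⟨i, Γ[i]'(by omega), fin[i]'(by omega), ?_, List.getElem?_eq_getElem _, List.getElem?_eq_getElem _, ?_, ?_⟩
  · simp
  · simp
  · simp

theorem names_tr (P : Multiset (Prem ℕ E)) : names (P.map trP) = names P := by
  ext b; simp only [names, Set.mem_ofPred_eq, Multiset.mem_map]
  constructor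
  · rintro ⟨x, ⟨y, hy, rfl⟩, hb⟩; exact ⟨y, hy, hb⟩
  · rintro ⟨y, hy, hb⟩; exact ⟨_, ⟨y, hy, rfl⟩, hb⟩

end Cols

section
variable {E : Type u} {S : Sig E} {g : Bool} {Γ : Seq E} {nc : List ℕ} {P : Multiset (Prem ℕ E)}

/-- The duplication of the premises `C` of a multicut. -/
structure DupData (Γ : Seq E) (nc : List ℕ) (x : Prem ℕ E) (D C : Multiset (Prem ℕ E)) (a p i : ℕ)
    (fin : List (List Bool)) : Prop where
  name : x.1[p]? = some a
  prom : AllProm C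
  sep : ∀ b ∈ names C, b ∈ names (x ::ₘ D) → b = a
  cut : C = 0 ∧ a ∈ nc ∨ a ∉ nc ∧ a ∈ names C
  len : fin.length = nc.length
  dup : ∀ (k b : ℕ) bl, nc[k]? = some b → fin[k]? = some bl → b ∈ names C ∨ b = a → bl.length = i
  single : ∀ (k b : ℕ) bl, nc[k]? = some b → fin[k]? = some bl → ¬ (b ∈ names C ∨ b = a) → bl.length = 1
  quest : ∀ (k : ℕ) bl, fin[k]? = some bl → bl ≠ [true] → ∃ s A, Γ[k]? = some (Fm.quest s A)

theorem DupData.phase {σ : Pf E} {x : Prem ℕ E} {D C : Multiset (Prem ℕ E)} {a j : ℕ}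
    {fin : List (List Bool)} {n₁ n₂ : List ℕ} {l r : Seq E} {s : E} {A : Fm E} {mid : Pf Unit}
    (hσ : IsMcut Γ nc (x ::ₘ (D + C)) σ) (hp : σ.IsProof S)
    (h : DupData Γ nc x D C a l.length (j + 1) fin) (hx : x.1 = n₁ ++ a :: n₂) (hl : n₁.length = l.length)
    (hc : x.2.concl = l ++ .quest s A :: r)
    (hm : Pf.Chain (x.2.concl.map Fm.tr) (contrs l.length j) x.2.tr mid) :
    DupPhase j n₁ n₂ a (l.map Fm.tr) (r.map Fm.tr) A.tr x.2.tr mid (D.map trP) (C.map trP)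
      (colsOf nc Γ fin) := by
  obtain ⟨c1, c2, c3, c4⟩ := colsOf_spec nc Γ fin hσ.fits.1 h.len
  have hg := hσ.tr.good hp.tr
  rw [Multiset.map_cons, Multiset.map_add] at hg
  have hxt : trP x = (n₁ ++ a :: n₂, x.2.tr) := by rw [← hx]; rfl
  refine ⟨by simpa using hl, by rw [Pf.tr_concl, hc]; simp [Fm.tr], ?_, h.prom.tr, ?_, ?_, ?_, ?_, ?_, ?_⟩
  · rw [Pf.tr_concl, List.length_map]; exact hm
  · rw [← hxt, ← Multiset.map_cons, names_tr, names_tr]; exact h.sep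
  · rw [c1, names_tr]; rcases h.cut with ⟨rfl, h1⟩ | h1
    · exact Or.inl ⟨rfl, h1⟩
    · exact Or.inr h1
  · rw [c1, c2, ← hxt]
    have e : (forest Γ fin).map Prod.fst = Γ.map Fm.tr := by
      unfold forest; rw [List.map_zipWith]
      apply List.ext_getElem
      · simp [h.len, hσ.fits.1]
      · intro i hi hi'; simp
    rw [e]; exact hg
  · intro k hk hk'; obtain ⟨i, B, bl, e1, e2, e3, e4, e5⟩ := mem_colsOf hk
    rw [names_tr] at hk'; rw [e5, List.length_map]
    exact h.dup i _ bl e1 e3 hk'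
  · intro k hk hk'; obtain ⟨i, B, bl, e1, e2, e3, e4, e5⟩ := mem_colsOf hk
    rw [names_tr] at hk'; rw [e5, List.length_map]
    exact h.single i _ bl e1 e3 hk'
  · intro k hk hk'; obtain ⟨i, B, bl, e1, e2, e3, e4, e5⟩ := mem_colsOf hk
    rw [e5, List.length_map] at hk'
    obtain ⟨s', B', hB⟩ := h.quest i bl e3 (by rintro rfl; simp at hk')
    rw [e2] at hB; obtain rfl := Option.some.inj hB
    exact ⟨B'.tr, e4⟩

theorem quest_of_der {fin : List (List Bool)} {π ρ : Pf E} (hd : StructDer S g Γ (nc.map fun _ => [true]) π fin ρ)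
    (k : ℕ) (bl : List Bool) (hk : fin[k]? = some bl) (hb : bl ≠ [true]) : ∃ s A, Γ[k]? = some (Fm.quest s A) := by
  refine hd.quest (k := k) ?_; grind

theorem split_prem {σ : Pf E} (hσ : IsMcut Γ nc P σ) {x : Prem ℕ E} (hx : x ∈ P) {a p : ℕ} {B : Fm E}
    (h1 : x.1[p]? = some a) (h2 : x.2.concl[p]? = some B) :
    ∃ n₁ n₂ l r, x.1 = n₁ ++ a :: n₂ ∧ x.2.concl = l ++ B :: r ∧ l.length = p ∧ n₁.length = l.length ∧
      n₂.length = r.length := by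
  obtain ⟨n₁, n₂, e1, rfl⟩ := exists_split h1; obtain ⟨l, r, e2, e3⟩ := exists_split h2
  refine ⟨n₁, n₂, l, r, e1, e2, e3, e3.symm, ?_⟩
  have := hσ.fits.2 x hx
  rw [e1, e2] at this; simp at this
  omega

theorem IsMcut.prf {σ : Pf E} (hσ : IsMcut Γ nc P σ) (hp : σ.IsProof S) : ∀ x ∈ P, x.2.IsProof S := by
  intro x hx; obtain ⟨k, hk⟩ := hσ.mem_child hx
  exact hp.child hk

theorem sum_keep_prf {P : ℕ → Multiset (Prem Name' E)} {n : ℕ} {x : Prem Name' E}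
    (hx : x ∈ ∑ t ∈ Finset.range n, P t) : ∃ t, x ∈ P t := by
  obtain ⟨t, -, ht⟩ := Multiset.mem_sum.mp hx; exact ⟨t, ht⟩

theorem leaves_block {fin : List (List Bool)} (hfin : ∀ bl ∈ fin, ∀ e ∈ bl, e = true) :
    Leaves (List.zipWith (fun A b => b.map fun e => ((Fm.tr A, el e) : Item)) Γ fin).flatten ∧
      (List.zipWith (fun A b => b.map fun e => ((Fm.tr A, el e) : Item)) Γ fin).flatten.map Prod.fst =
        (blockSeq Γ fin).map Fm.tr := by
  constructor
  · intro t ht; obtain ⟨L, hL, ht⟩ := List.mem_flatten.mp ht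
    obtain ⟨k, hk, rfl⟩ := List.getElem_of_mem hL; rw [List.getElem_zipWith] at ht
    obtain ⟨e, he, rfl⟩ := List.mem_map.mp ht; obtain rfl := hfin _ (List.getElem_mem _) e he
    exact ⟨true, rfl⟩
  · unfold blockSeq; rw [List.map_flatten, List.map_flatten, List.map_zipWith, List.map_zipWith]
    congr 1; apply List.ext_getElem
    all_goals grind [List.map_congr_left]

/-- The key case of contraction. -/
theorem contr_sim {σ π' ρ : Pf E} {x : Prem ℕ E} {D C : Multiset (Prem ℕ E)} {a p i : ℕ}
    {fin : List (List Bool)} (hσ : IsMcut Γ nc (x ::ₘ (D + C)) σ) (hp : σ.IsProof S)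
    (hπ : π'.IsPreproof S) (hr : x.2.rule = .contr p i) (h : DupData Γ nc x D C a p i fin)
    (hfin : ∀ bl ∈ fin, ∀ e ∈ bl, e = true)
    (hd : StructDer S g Γ (nc.map fun _ => [true]) π' fin ρ)
    (hρ : IsMcut (blockSeq Γ fin) (blockNames nc fin)
      (openAt x 0 ::ₘ (D.map (keep 0) + ∑ t ∈ Finset.range i, C.map (keep t))) ρ) :
    ∃ θ, ReflTransGen PStep σ.tr θ ∧ ReflTransGen (PermZone g) θ π'.tr := by
  have hprf := hσ.prf hp
  have hxok := (hprf x (by simp)).1.localOk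
  have hok := hxok.2.1
  rw [hr] at hok; obtain ⟨hi, s, A, hA, -⟩ := hok
  obtain ⟨j, rfl⟩ := Nat.exists_eq_add_of_le' (show 1 ≤ i by omega)
  obtain ⟨n₁, n₂, l, r, e1, e2, rfl, e4, e5⟩ := split_prem hσ (by simp) h.name hA
  have htr : x.2.rule.tr x.2.concl = contrs l.length j := by
    rw [hr]; obtain ⟨j, rfl⟩ := Nat.exists_eq_add_of_le' (show 1 ≤ j by omega)
    rfl
  have hch := Pf.tr_chain (π := x.2) (by
    rw [htr]; intro r hr
    obtain ⟨k, -, rfl⟩ := List.mem_map.mp hr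
    rfl)
  rw [htr] at hch
  have hph := h.phase hσ hp e1 e4 e2 hch
  obtain ⟨c1, c2, c3, c4⟩ := colsOf_spec nc Γ fin hσ.fits.1 h.len
  have hsim := (DupPhase.run _ hph).1 (by omega)
  rw [c1, c2, c3, c4] at hsim
  have hxt : trP x = (n₁ ++ a :: n₂, x.2.tr) := by rw [← e1]; rfl
  have hopen : openAt x 0 = (n₁.map nm0 ++ ((List.range (j + 1)).map (fun t => ((some a, t) : Name')) ++
      n₂.map nm0), x.2.kid 0) := by
    grind [openAt, Pf.occs, prems_contr, up_replace]
  have hP' : (openAt x 0 ::ₘ (D.map (keep 0) + ∑ t ∈ Finset.range (j + 1), C.map (keep t))).map trP =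
      dupPrems j n₁ n₂ a (x.2.kid 0).tr (D.map trP) (C.map trP) := by
    unfold dupPrems; rw [Multiset.map_cons, Multiset.map_add, keep_tr, hopen]
    congr 2; rw [← Multiset.coe_mapAddMonoidHom, map_sum]
    refine Finset.sum_congr rfl fun t ht => ?_
    rw [Multiset.coe_mapAddMonoidHom, keep_tr]
  refine structDer_sim hσ hp hd hρ (hρ.isProof (hd.preproof hπ) fun z hz => ?_) ?_ ?_ ?_
    (F' := (List.zipWith (fun A b => b.map fun e => ((Fm.tr A, el e) : Item)) Γ fin).flatten)
  · simp only [Multiset.mem_cons, Multiset.mem_add] at hz; rcases hz with rfl | hz | hz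
    · exact (hprf x (by simp)).kid 0
    · obtain ⟨y, hy, rfl⟩ := Multiset.mem_map.mp hz; exact hprf y (by simp [hy])
    · obtain ⟨t, hz⟩ := sum_keep_prf hz; obtain ⟨y, hy, rfl⟩ := Multiset.mem_map.mp hz
      exact hprf y (by simp [hy])
  · rw [hP', Multiset.map_cons, Multiset.map_add, hxt]; exact hsim
  · exact (leaves_block hfin).1
  · exact (leaves_block hfin).2

end

section
variable {E : Type u} {S : Sig E} {g : Bool} {Γ : Seq E} {nc : List ℕ} {P : Multiset (Prem ℕ E)}

theorem contrPrinc_sim {σ π' : Pf E} (hσ : IsMcut Γ nc P σ) (hp : σ.IsProof S) (hπ : π'.IsPreproof S)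
    (h : ContrPrinc S g Γ nc P π') :
    ∃ θ, ReflTransGen PStep σ.tr θ ∧ ReflTransGen (PermZone g) θ π'.tr := by
  obtain ⟨x, D, C, p, i, a, nc', fin, ρ, rfl, h1, h2, h3, h4, h5, h6, h7, h8, rfl, h9, h10⟩ := h
  have hne : ∀ {k b : ℕ}, nc[k]? = some b → b ≠ a := by
    rintro k b hk rfl; exact h5 (List.mem_of_getElem? hk)
  refine contr_sim (fin := fin) hσ hp hπ h1 ⟨h2, h3, h6, Or.inr ⟨h5, h4⟩, h7, ?_, ?_, quest_of_der h9⟩ ?_ h9 h10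
  · grind
  · grind
  · intro bl hbl e he; obtain ⟨k, hk, rfl⟩ := List.getElem_of_mem hbl
    have hk' : k < nc.length := by omega
    have := h8 k nc[k] (List.getElem?_eq_getElem hk')
    grind [names]

/-- A multiplexing or contraction commuting with a multicut, as a derived rule. -/
theorem exp_comm_der {R : ℕ → Rule E} {new : List Bool} {q a : ℕ} {s : E} {A : Fm E} {π' ρ : Pf E}
    (hnc : nc.Nodup) (hl : nc.length = Γ.length) (hq : nc[q]? = some a) (hA : Γ[q]? = some (Fm.quest s A))
    (hop : BlockOp S s [] [] q (R q) new)
    (hpr : ((R q).prems Γ)[0]? = some (replaceAt Γ q (new.map fun e => if e then Fm.quest s A else A)))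
    (hπ : π'.IsNode Γ (R q) [ρ]) :
    ∃ fin, fin = nc.map (fun b => if b = a then new else [true]) ∧
      StructDer S g Γ (nc.map fun _ => [true]) π' fin ρ ∧
      blockSeq Γ fin = ((((R q).prems Γ)[0]?).getD []).map Occ.fm ∧
      blockNames nc fin = up nc ((((R q).prems Γ)[0]?).getD []) := by
  obtain ⟨n₁, n₂, rfl, hn⟩ := exists_split hq; obtain ⟨l, r, rfl, hl1⟩ := exists_split hA
  have hl2 : n₂.length = r.length := by simp at hl; omega
  have e1 : ∀ b ∈ n₁, b ≠ a := fun b hb h => (List.nodup_append.mp hnc).2.2 b hb a (by simp) h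
  have e2 : ∀ b ∈ n₂, b ≠ a := fun b hb h =>
    (List.nodup_cons.mp (List.nodup_append.mp hnc).2.1).1 (h ▸ hb)
  have hfin : (n₁ ++ a :: n₂).map (fun b => if b = a then new else [true]) =
      n₁.map (fun _ => [true]) ++ new :: n₂.map (fun _ => [true]) := by
    grind [List.map_congr_left]
  have htrue : ∀ (n : List ℕ) (Δ : Seq E), n.length = Δ.length → blockSeq Δ (n.map fun _ => [true]) = Δ := by
    intro n Δ hn
    have := blockSeq_trues Δ
    rwa [List.map_const', ← hn, ← List.map_const'] at this
  have hsing : ∀ n : List ℕ, blockNames n (n.map fun _ => [true]) = n.map nm0 := by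
    intro n
    induction n with
    | nil => rfl
    | cons b n ih =>
      unfold blockNames at ih ⊢; rw [List.map_cons, List.zipWith_cons_cons, List.flatten_cons, ih]
      rfl
  refine ⟨_, rfl, ?_, ?_, ?_⟩
  · rw [hfin, List.map_append, List.map_cons]
    refine .step (left := []) (right := []) (new := new) (s := s) (A := A) (r := R q) (π' := ρ)
      (by rw [List.length_map, hn]; exact hA) ?_ (Or.inr (Or.inl rfl)) ?_ ?_
    · have : (n₁.map fun _ => [true]).flatten.length + ([] : List Bool).length = q := by simp [hn]
      rw [this]; exact hop
    · grind
    · rw [List.nil_append, List.append_nil]; exact .refl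
  · grind [replaceAt_fm, blockSeq, List.zipWith_cons_cons, Fm.unquest]
  · rw [hfin, hpr, Option.getD_some, ← hl1, up_replace _ _ _ _ _ _ _ (by omega) hl2]
    grind [blockNames, List.zipWith_cons_cons]

theorem dupData_comm {x : Prem ℕ E} {D : Multiset (Prem ℕ E)} {new : List Bool} {q a p i : ℕ} {s : E}
    {A : Fm E} (hnc : nc.Nodup) (hl : nc.length = Γ.length) (hn : x.1[p]? = some a) (hq : nc[q]? = some a)
    (hA : Γ[q]? = some (Fm.quest s A)) (hi : new.length = i) :
    DupData Γ nc x D 0 a p i (nc.map fun b => if b = a then new else [true]) where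
  name := hn
  prom x hx := by simp at hx
  sep b hb := by simp [names] at hb
  cut := Or.inl ⟨rfl, List.mem_of_getElem? hq⟩
  len := by simp
  dup k b bl hk hbl hb := by grind [names]
  single k b bl hk hbl hb := by grind
  quest k bl hk hbl := by
    rw [List.getElem?_map] at hk; obtain ⟨b, hb, rfl⟩ := Option.map_eq_some_iff.mp hk
    split_ifs at hbl with h
    · subst h; obtain rfl : k = q := by
        obtain ⟨h1, h2⟩ := List.getElem?_eq_some_iff.mp hb
        obtain ⟨h3, h4⟩ := List.getElem?_eq_some_iff.mp hq
        exact hnc.getElem_inj_iff.mp (h2.trans h4.symm)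
      exact ⟨s, A, hA⟩
    · exact absurd rfl hbl

theorem contr_comm_sim {σ π' ρ : Pf E} {x : Prem ℕ E} {C : Multiset (Prem ℕ E)} {a p q i : ℕ}
    (hσ : IsMcut Γ nc (x ::ₘ C) σ) (hp : σ.IsProof S) (hπ : π'.IsPreproof S)
    (hr : x.2.rule = .contr p i) (h1 : x.1[p]? = some a) (h2 : nc[q]? = some a)
    (h3 : π'.IsNode Γ (.contr q i) [ρ])
    (h4 : IsMcut (((((Rule.contr q i).prems Γ)[0]?).getD []).map Occ.fm)
      (up nc ((((Rule.contr q i).prems Γ)[0]?).getD [])) (openAt x 0 ::ₘ C.map (keep 0)) ρ) :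
    ∃ θ, ReflTransGen PStep σ.tr θ ∧ ReflTransGen (PermZone g) θ π'.tr := by
  have hok := hπ.localOk.2.1
  rw [h3.1, h3.2.1] at hok; obtain ⟨hi, s, A, hA, hS⟩ := hok
  have hnd := (hσ.tr.good hp.tr).nc_nodup
  obtain ⟨fin, rfl, hd, e1, e2⟩ := exp_comm_der (S := S) (g := g) (R := fun q => Rule.contr q i)
    (new := List.replicate i true) hnd hσ.fits.1 h2 hA (.contr hi hS) (by simp [Rule.prems, hA]) h3
  rw [← e1, ← e2] at h4; rw [← add_zero C] at hσ
  refine contr_sim hσ hp hπ hr (dupData_comm hnd hσ.fits.1 h1 h2 hA (by simp)) ?_ hd (by simpa using h4)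
  grind

end

section Prom
variable {E : Type u} {S : Sig E}

/-- The derelictions above a translated promotion. -/
def Rule.derPos (n : ℕ) : Rule E → List ℕ
  | .promF p => (List.range n).filter (· ≠ p)
  | .promU p => (List.range n).filter (· ≠ p)
  | _ => []

/-- A translated promotion. -/
noncomputable def Act.ofProm (f : ℕ → ℕ) (y : Prem ℕ E) : Act :=
  ⟨y.1.map f, y.2.tr, y.2.rule.derPos y.2.concl.length, (y.2.kid 0).tr⟩

theorem Rule.derPos_spec {r : Rule E} {q n : ℕ} (hq : r.promPos = some q) :
    (r.derPos n).Nodup ∧ q ∉ r.derPos n ∧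
      ∀ Γ : Seq E, Γ.length = n → r.tr Γ = .promG q :: (r.derPos n).map fun p => .mpx p 1 := by
  have h1 : ((List.range n).filter (· ≠ q)).Nodup ∧ q ∉ (List.range n).filter (· ≠ q) :=
    ⟨List.nodup_range.filter _, by simp⟩
  cases r with
  | promG p =>
    obtain rfl : p = q := by simpa [Rule.promPos] using hq
    exact ⟨List.nodup_nil, List.not_mem_nil, fun _ _ => rfl⟩
  | promF p =>
    obtain rfl : p = q := by simpa [Rule.promPos] using hq
    exact ⟨h1.1, h1.2, by rintro Γ rfl; rfl⟩
  | promU p =>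
    obtain rfl : p = q := by simpa [Rule.promPos] using hq
    exact ⟨h1.1, h1.2, by rintro Γ rfl; rfl⟩
  | _ => simp [Rule.promPos] at hq

theorem prom_chain {π : Pf E} {q : ℕ} (hp : π.IsProof S) (hq : π.rule.promPos = some q) :
    π.tr.rule = .promG q ∧ Pf.Chain (π.tr.kid 0).concl
      ((π.rule.derPos π.concl.length).map fun p => .mpx p 1) (π.tr.kid 0) (π.kid 0).tr := by
  obtain ⟨-, -, h1⟩ := Rule.derPos_spec (n := π.concl.length) hq
  have h2 := Pf.tr_chain (π := π) (by
    rw [h1 _ rfl]; intro r hr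
    rcases List.mem_cons.mp hr with rfl | hr
    · rfl
    · obtain ⟨k, -, rfl⟩ := List.mem_map.mp hr
      rfl)
  rw [h1 _ rfl] at h2; exact chain_kid hp.tr h2

theorem Act.ofProm_open {y : Prem ℕ E} {q : ℕ} (hp : y.2.IsProof S) (hq : y.2.rule.promPos = some q)
    (f : ℕ → ℕ) : ((ofProm f y).pop (ofProm f y).ps).Open :=
  ⟨(Rule.derPos_spec hq).1, (prom_chain hp hq).2⟩

theorem Act.ofProm_closed {y : Prem ℕ E} {q : ℕ} {nc : List ℕ} (hp : y.2.IsProof S)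
    (hq : y.2.rule.promPos = some q) (f : ℕ → ℕ) (h : ∀ b, promName y = some b → f b ∉ nc) :
    (ofProm f y).Closed nc := by
  refine ⟨q, (prom_chain hp hq).1, (Rule.derPos_spec hq).2.1, ofProm_open hp hq f, fun b hb => ?_⟩
  change (y.1.map f)[q]? = some b at hb; grind [promName]

theorem up_prom {y : Prem ℕ E} {q : ℕ} (hl : y.1.length = y.2.concl.length) (hp : y.2.LocalOk S)
    (hq : y.2.rule.promPos = some q) : up y.1 (y.2.occs 0) = y.1.map nm0 := by
  have hok := hp.2.1
  obtain ⟨l, r, s, A, e1, e2, -⟩ := hok.prom_split hq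
  have hA : y.2.concl[q]? = some (.bang s A) := by rw [e1, ← e2]; simp
  have hm : ∀ (O : List (Occ E)) (f : Occ E → Occ E), (∀ o, (f o).anc = o.anc ∧ (f o).tag = o.tag) →
      up y.1 (O.map f) = up y.1 O := by
    intro O f hf; unfold up
    grind [List.map_congr_left]
  have hu := up_replace_one hl hA A
  unfold Pf.occs; cases hr : y.2.rule with
  | promG p => grind [Rule.promPos, Rule.prems]
  | promF p => grind [Rule.promPos, Rule.prems]
  | promU p => grind [Rule.promPos, Rule.prems]
  | _ => rw [hr] at hq; simp [Rule.promPos] at hq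

theorem openAt_prom {y : Prem ℕ E} {q : ℕ} (hl : y.1.length = y.2.concl.length) (hp : y.2.LocalOk S)
    (hq : y.2.rule.promPos = some q) : openAt y 0 = ren nm0 (y.1, y.2.kid 0) :=
  Prod.ext (up_prom hl hp hq) rfl

theorem openCopy_prom {y : Prem ℕ E} {q : ℕ} (hl : y.1.length = y.2.concl.length) (hp : y.2.LocalOk S)
    (hq : y.2.rule.promPos = some q) (t : ℕ) :
    openCopy t y = ren (fun b => ((some b, t) : Name')) (y.1, y.2.kid 0) := by
  refine Prod.ext ?_ rfl
  have := congrArg (List.map fun n : Name' => ((n.1, t) : Name')) (up_prom hl hp hq)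
  unfold up at this; rw [List.map_map, List.map_map] at this
  exact this

end Prom

theorem map_sum_range {α β : Type*} (f : α → β) (g : ℕ → Multiset α) (n : ℕ) :
    (∑ t ∈ Finset.range n, g t).map f = ∑ t ∈ Finset.range n, (g t).map f := by
  rw [← Multiset.coe_mapAddMonoidHom, map_sum]

section
variable {E : Type u} {S : Sig E} {g : Bool} {Γ : Seq E} {nc : List ℕ} {P : Multiset (Prem ℕ E)}

theorem mem_blockNames {fin : List (List Bool)} {n : Name'} (h : n ∈ blockNames nc fin) :
    ∃ b ∈ nc, n.1 = some b := by
  unfold blockNames at h; obtain ⟨L, hL, h⟩ := List.mem_flatten.mp h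
  obtain ⟨k, hk, rfl⟩ := List.getElem_of_mem hL; grind

theorem compat_block {fin : List (List Bool)}
    (h : ∀ (k : ℕ) bl, fin[k]? = some bl → bl ≠ [true] → ∃ s A, Γ[k]? = some (Fm.quest s A)) :
    Compat (List.zipWith (fun A b => b.map fun e => ((Fm.tr A, el e) : Item)) Γ fin).flatten
      ((blockSeq Γ fin).map Fm.tr) := by
  induction Γ generalizing fin with
  | nil => exact List.Forall₂.nil
  | cons A Γ ih =>
    rcases fin with _ | ⟨bl, fin⟩
    · exact List.Forall₂.nil
    · have h2 := ih (fin := fin) fun k bl hk hb => h (k + 1) bl hk hb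
      unfold blockSeq at h2 ⊢
      rw [List.zipWith_cons_cons, List.zipWith_cons_cons, List.flatten_cons, List.flatten_cons, List.map_append]
      refine List.rel_append ?_ h2
      rw [List.map_map, List.forall₂_map_left_iff, List.forall₂_map_right_iff, List.forall₂_same]
      rintro (_ | _) he
      · right; obtain ⟨s, B, hB⟩ := h 0 bl rfl (by rintro rfl; simp at he)
        obtain rfl : A = Fm.quest s B := by simpa using hB
        exact ⟨fun h => Fm.ne_quest () _ h.symm, rfl⟩
      · exact Or.inl ⟨rfl, true, rfl⟩

/-- The key case of multiplexing. -/
theorem mpx_sim {σ π' ρ : Pf E} {x : Prem ℕ E} {D K T : Multiset (Prem ℕ E)} {a p i : ℕ}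
    {fin : List (List Bool)} (hσ : IsMcut Γ nc (x ::ₘ (D + (K + T))) σ) (hp : σ.IsProof S)
    (hπ : π'.IsPreproof S) (hr : x.2.rule = .mpx p (i + 1)) (h : DupData Γ nc x D (K + T) a p (i + 1) fin)
    (hK : ∀ y ∈ K, ∀ b, promName y = some b → b ∉ nc)
    (hd : StructDer S g Γ (nc.map fun _ => [true]) π' fin ρ)
    (hρ : IsMcut (blockSeq Γ fin) (blockNames nc fin)
      (openAt x 0 ::ₘ (D.map (keep 0) + ∑ t ∈ Finset.range (i + 1), (K.map (openCopy t) + T.map (keep t)))) ρ) :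
    ∃ θ, ReflTransGen PStep σ.tr θ ∧ ReflTransGen (PermZone g) θ π'.tr := by
  have hprf := hσ.prf hp
  have hfits := hσ.fits.2
  have hok := (hprf x (by simp)).1.localOk.2.1
  rw [hr] at hok; obtain ⟨s, A, hA, -⟩ := hok
  obtain ⟨n₁, n₂, l, r, e1, e2, rfl, e4, e5⟩ := split_prem hσ (by simp) h.name hA
  have htr : x.2.rule.tr x.2.concl = contrs l.length i ++ ders l.length (i + 1) := by rw [hr]; rfl
  have hch := Pf.tr_chain (π := x.2) (by
    rw [htr]; intro r hr
    rcases List.mem_append.mp hr with hr | hr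
    all_goals
      obtain ⟨k, -, rfl⟩ := List.mem_map.mp hr
      rfl)
  rw [htr] at hch; obtain ⟨mid, hch1, hch2⟩ := hch.split
  have hph := h.phase hσ hp e1 e4 e2 hch1
  obtain ⟨c1, c2, c3, c4⟩ := colsOf_spec nc Γ fin hσ.fits.1 h.len
  have hgd := hph.good'
  rw [c3, c4] at hgd
  have hmid : mid.concl = Pf.topSeq (x.2.concl.map Fm.tr) (contrs l.length i) := by
    have h0 := hch2
    rw [ders_succ] at h0; obtain ⟨_, hn, -⟩ := h0
    exact hn.1
  rw [← hmid] at hch2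
  have hopen : openAt x 0 = (n₁.map nm0 ++ ((List.range (i + 1)).map (fun t => ((some a, t) : Name')) ++
      n₂.map nm0), x.2.kid 0) := by
    grind [openAt, Pf.occs, prems_mpx, up_replace]
  have hρp : ρ.IsProof S := by
    refine hρ.isProof (hd.preproof hπ) fun z hz => ?_
    simp only [Multiset.mem_cons, Multiset.mem_add] at hz; rcases hz with rfl | hz | hz
    · exact (hprf x (by simp)).kid 0
    · obtain ⟨y, hy, rfl⟩ := Multiset.mem_map.mp hz; exact hprf y (by simp [hy])
    · obtain ⟨t, hz⟩ := sum_keep_prf hz; rcases Multiset.mem_add.mp hz with hz | hz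
      · obtain ⟨y, hy, rfl⟩ := Multiset.mem_map.mp hz; exact (hprf y (by simp [hy])).kid 0
      · obtain ⟨y, hy, rfl⟩ := Multiset.mem_map.mp hz; exact hprf y (by simp [hy])
  obtain ⟨f, hf⟩ : ∃ f : ℕ → ℕ → ℕ, f = fun t b => Col.enc (some b, t) := ⟨_, rfl⟩
  obtain ⟨x₀, hx₀⟩ : ∃ x₀ : Act, x₀ = ⟨(openAt x 0).1.map Col.enc, mid,
    (List.range (i + 1)).map (l.length + ·), (x.2.kid 0).tr⟩ := ⟨_, rfl⟩
  obtain ⟨K', hK'⟩ : ∃ K' : Multiset Act, K' = ∑ t ∈ Finset.range (i + 1), K.map (Act.ofProm (f t)) := ⟨_, rfl⟩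
  obtain ⟨I, hI⟩ : ∃ I : Multiset (Prem ℕ Unit), I = ((D.map trP).map (keep 0)).map (ren Col.enc) +
    ∑ t ∈ Finset.range (i + 1), ((T.map trP).map (keep t)).map (ren Col.enc) := ⟨_, rfl⟩
  have hall : Act.all {x₀} K' I =
      (dupPrems i n₁ n₂ a mid (D.map trP) ((K + T).map trP)).map (ren Col.enc) := by
    unfold dupPrems Act.all
    rw [Multiset.map_cons, Multiset.map_add, map_sum_range, hI, hK', map_sum_range, Multiset.map_singleton,
      add_assoc, ← Multiset.singleton_add, hx₀, hopen]
    congr 1; rw [add_left_comm]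
    congr 1; rw [← Finset.sum_add_distrib]
    refine Finset.sum_congr rfl fun t ht => ?_
    rw [Multiset.map_add, Multiset.map_add, Multiset.map_add]; congr 1
    rw [Multiset.map_map, Multiset.map_map, Multiset.map_map]
    refine Multiset.map_congr rfl fun y hy => ?_
    subst hf; simp [Act.prem, Act.ofProm, ren, keep, trP, Function.comp_def]
  have hfin : Act.allFin {x₀} K' I = ((openAt x 0 ::ₘ (D.map (keep 0) + ∑ t ∈ Finset.range (i + 1),
        (K.map (openCopy t) + T.map (keep t)))).map trP).map (ren Col.enc) := by
    unfold Act.allFin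
    rw [Multiset.map_cons, Multiset.map_cons, Multiset.map_add, Multiset.map_add, map_sum_range, map_sum_range,
      hI, hK', map_sum_range, Multiset.map_singleton, add_assoc, ← Multiset.singleton_add, hx₀, keep_tr]
    congr 1; rw [add_left_comm]
    congr 1; rw [← Finset.sum_add_distrib]
    refine Finset.sum_congr rfl fun t ht => ?_
    rw [Multiset.map_add, Multiset.map_add, keep_tr]; congr 1
    rw [Multiset.map_map, Multiset.map_map, Multiset.map_map]
    refine Multiset.map_congr rfl fun y hy => ?_
    obtain ⟨q, hq⟩ := h.prom y (by simp [hy])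
    rw [Function.comp_apply, Function.comp_apply, Function.comp_apply,
      openCopy_prom (hfits y (by simp [hy])) (hprf y (by simp [hy])).1.localOk hq]
    subst hf; simp [Act.fin, Act.ofProm, ren, trP, Function.comp_def]
  have hder : DerPhase {x₀} K' I
      (List.zipWith (fun A b => b.map fun e => ((Fm.tr A, el e) : Item)) Γ fin).flatten
      ((blockNames nc fin).map Col.enc) ((blockSeq Γ fin).map Fm.tr) := by
    refine ⟨?_, ?_, ?_, ?_, ?_, compat_block h.quest⟩
    · intro z hz; rw [Multiset.mem_singleton] at hz
      subst hz hx₀; refine ⟨(List.nodup_range).map fun a b h => Nat.add_left_cancel h, ?_⟩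
      simp only [List.map_map]; exact hch2
    · intro z hz; rw [hK'] at hz
      obtain ⟨t, -, hz⟩ := Multiset.mem_sum.mp hz; obtain ⟨y, hy, rfl⟩ := Multiset.mem_map.mp hz
      obtain ⟨q, hq⟩ := h.prom y (by simp [hy])
      grind [Act.ofProm_closed, Col.enc_inj, mem_blockNames]
    · rw [hall]; exact hgd.rename Col.enc_inj
    · rw [List.length_map, List.length_map]; exact hρ.fits.1
    · rw [hfin]; exact ((hρ.tr.good hρp.tr).rename Col.enc_inj).mok
  obtain ⟨F', hF1, hF2, hF3, -⟩ := DerPhase.run _ rfl hder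
  have hs := hF3 ⟨x₀, by simp, by subst hx₀; simp⟩
  rw [hall, hfin] at hs
  have hs2 := (hs.of_left fun ρ hρ => hρ.rename Col.enc Col.enc_inj.injOn).trans
    (SimW.of_imp fun ρ hρ => hρ.rename Col.enc Col.enc_inj.injOn)
  rw [← c3, ← c4] at hs2
  have hs3 := hph.simS hs2
  rw [c1, c2, ← e1] at hs3; refine structDer_sim hσ hp hd hρ hρp ?_ hF1 hF2
  rw [Multiset.map_cons, Multiset.map_add]; rw [← c3]
  exact hs3

end

section
variable {E : Type u} {S : Sig E} {g : Bool} {Γ : Seq E} {nc : List ℕ} {P : Multiset (Prem ℕ E)}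

theorem mpx_comm_sim {σ π' ρ : Pf E} {x : Prem ℕ E} {C : Multiset (Prem ℕ E)} {a p q i : ℕ}
    (hσ : IsMcut Γ nc (x ::ₘ C) σ) (hp : σ.IsProof S) (hπ : π'.IsPreproof S)
    (hr : x.2.rule = .mpx p (i + 1)) (h1 : x.1[p]? = some a) (h2 : nc[q]? = some a)
    (h3 : π'.IsNode Γ (.mpx q (i + 1)) [ρ])
    (h4 : IsMcut (((((Rule.mpx q (i + 1)).prems Γ)[0]?).getD []).map Occ.fm)
      (up nc ((((Rule.mpx q (i + 1)).prems Γ)[0]?).getD [])) (openAt x 0 ::ₘ C.map (keep 0)) ρ) :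
    ∃ θ, ReflTransGen PStep σ.tr θ ∧ ReflTransGen (PermZone g) θ π'.tr := by
  have hok := hπ.localOk.2.1
  rw [h3.1, h3.2.1] at hok; obtain ⟨s, A, hA, hS⟩ := hok
  have hnd := (hσ.tr.good hp.tr).nc_nodup
  obtain ⟨fin, rfl, hd, e1, e2⟩ := exp_comm_der (S := S) (g := g) (R := fun q => Rule.mpx q (i + 1))
    (new := List.replicate (i + 1) false) hnd hσ.fits.1 h2 hA (.mpx hS fun _ => ⟨rfl, rfl⟩)
    (by simp [Rule.prems, hA]) h3
  rw [← e1, ← e2] at h4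
  have hC : C = C + (0 + 0) := by simp
  rw [hC] at hσ
  exact mpx_sim hσ hp hπ hr (dupData_comm hnd hσ.fits.1 h1 h2 hA (by simp)) (by simp) hd (by simpa using h4)

/-- Two premises of a multicut are not connected by a formula of its conclusion. -/
theorem IsMcut.shared {σ : Pf E} {y z : Prem ℕ E} {Q : Multiset (Prem ℕ E)} (hσ : IsMcut Γ nc (y ::ₘ Q) σ)
    (hp : σ.IsProof S) (hz : z ∈ Q) {b : ℕ} (h1 : b ∈ y.1) (h2 : b ∈ z.1) : b ∉ nc := by
  have hf := hσ.fits
  have hget : ∀ w ∈ y ::ₘ Q, b ∈ w.1 → ∃ A, (b, A) ∈ w.1.zip w.2.concl := by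
    intro w hw hb; obtain ⟨k, hk, rfl⟩ := List.getElem_of_mem hb
    exact ⟨_, mem_zip_get.mpr ⟨k, List.getElem?_eq_getElem hk, List.getElem?_eq_getElem (hf.2 w hw ▸ hk)⟩⟩
  obtain ⟨A₁, h3⟩ := hget y (by simp) h1
  obtain ⟨A₂, h4⟩ := hget z (by simp [hz]) h2
  have h5 := ((hσ.mok hp.1.localOk).wired.dual (le_sk_of_mem (x := y) (Q := Q) rfl hz) h3 h4).2.1
  intro h6; obtain ⟨k, hk, rfl⟩ := List.getElem_of_mem h6
  exact fil_eq_zero.mp h5 _ (Multiset.mem_coe.mpr (mem_zip_get.mpr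
    ⟨k, List.getElem?_eq_getElem hk, List.getElem?_eq_getElem (hf.1 ▸ hk)⟩))

theorem mem_of_promName {y : Prem ℕ E} {b : ℕ} (h : promName y = some b) : b ∈ y.1 := by
  obtain ⟨p, -, h⟩ := Option.bind_eq_some_iff.mp h; exact List.mem_of_getElem? h

theorem IsMcut.cutInto {σ : Pf E} (hσ : IsMcut Γ nc P σ) (hp : σ.IsProof S) {y : Prem ℕ E} (hy : y ∈ P)
    {Q : Multiset (Prem ℕ E)} (hQ : Q ⊆ P) (h : CutInto y Q) (b : ℕ) (hb : promName y = some b) : b ∉ nc := by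
  obtain ⟨a, h1, z, hz, h2, h3⟩ := h; obtain rfl := Option.some.inj (h1.symm.trans hb)
  obtain ⟨R, rfl⟩ := Multiset.exists_cons_of_mem hy
  exact hσ.shared hp ((Multiset.mem_cons.mp (hQ hz)).resolve_left h2) (mem_of_promName h1) h3

theorem mpxPrinc_sim {σ π' : Pf E} {i : ℕ} (hσ : IsMcut Γ nc P σ) (hp : σ.IsProof S) (hπ : π'.IsPreproof S)
    (h : MpxPrinc S g (i + 1) Γ nc P π') :
    ∃ θ, ReflTransGen PStep σ.tr θ ∧ ReflTransGen (PermZone g) θ π'.tr := by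
  obtain ⟨x, D, M, G, T, p, a, nc', fin, ρ, rfl, h1, h2, h3, h4, h5, h6, h7, h8, h9, h9', h10, h11, rfl, h12, h13⟩ := h
  have hne : ∀ {k b : ℕ}, nc[k]? = some b → b ≠ a := by
    rintro k b hk rfl; exact h7 (List.mem_of_getElem? hk)
  have hnm : ∀ {P Q : Multiset (Prem ℕ E)} {b : ℕ}, b ∈ names (P + Q) ↔ b ∈ names P ∨ b ∈ names Q := by
    simp [names, or_and_right, exists_or]
  refine mpx_sim (fin := fin) hσ hp hπ h1 ⟨h2, ?_, h8, Or.inr ⟨h7, h6⟩, h10, ?_, ?_, quest_of_der h12⟩ ?_ h12 h13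
  · intro y hy; simp only [Multiset.mem_add] at hy
    rcases hy with (hy | hy) | hy
    · rcases h3 y hy with ⟨q, hq⟩ | ⟨q, hq⟩ <;> exact ⟨q, by rw [hq]; rfl⟩
    · obtain ⟨q, hq⟩ := h4 y hy; exact ⟨q, by rw [hq]; rfl⟩
    · exact h5 y hy
  · intro k b bl hk hbl hb; obtain ⟨f1, f2, -⟩ := h11 k b hk
    grind
  · grind
  · intro y hy b hb; rcases h9 y hy with h | h
    · obtain rfl := Option.some.inj (h.symm.trans hb); exact h7
    · refine hσ.cutInto hp ?_ ?_ h b hb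
      · grind
      · intro z hz; simp [hz]

theorem MOk.not_twin {nc : List ℕ} {Γ : Seq E} {x : Prem ℕ E} {Q : Multiset (Prem ℕ E)}
    (h : MOk (nc.zip Γ) (sk (x ::ₘ Q))) (hx : x ∈ Q) {k b : ℕ} {s : E} {A : Fm E} (h1 : x.1[k]? = some b)
    (h2 : x.2.concl[k]? = some (.bang s A)) : False := by
  have hm : (b, Fm.bang s A) ∈ x.1.zip x.2.concl := mem_zip_get.mpr ⟨k, h1, h2⟩
  cases (h.wired.dual (le_sk_of_mem rfl hx) hm hm).1

theorem promName_tr {y : Prem ℕ E} {q : ℕ} (hp : y.2.IsProof S) (hq : y.2.rule.promPos = some q) :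
    promName (trP y) = promName y := by
  unfold promName; change y.2.tr.rule.promPos.bind _ = _
  rw [(prom_chain hp hq).1, hq]
  rfl

theorem CutInto.tr {σ : Pf E} (hσ : IsMcut Γ nc P σ) (hp : σ.IsProof S) {y : Prem ℕ E} (hy : y ∈ P)
    {q : ℕ} (hq : y.2.rule.promPos = some q) {Q : Multiset (Prem ℕ E)} (hQ : Q ⊆ P) (h : CutInto y Q) :
    CutInto (trP y) (Q.map trP) := by
  obtain ⟨b, h1, z, hz, h2, h3⟩ := h
  have hr := (prom_chain (hσ.prf hp y hy) hq).1
  have h4 : y.1[q]? = some b := by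
    unfold promName at h1; rw [hq] at h1
    exact h1
  refine ⟨b, (promName_tr (hσ.prf hp y hy) hq).trans h1, trP z, Multiset.mem_map_of_mem _ hz, fun he => ?_, h3⟩
  · obtain ⟨⟨B, hB⟩, -⟩ := opens_prom (hσ.prf hp y hy).tr hr
    have hm := (hσ.tr.good hp.tr).mok
    obtain ⟨R, rfl⟩ := Multiset.exists_cons_of_mem hy; rw [Multiset.map_cons] at hm
    refine hm.not_twin ?_ h4 hB.get; rw [← he]
    exact Multiset.mem_map_of_mem _ ((Multiset.mem_cons.mp (hQ hz)).resolve_left h2)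

/-- The key case of weakening. -/
theorem mpxPrinc_zero_sim {σ π' : Pf E} (hσ : IsMcut Γ nc P σ) (hp : σ.IsProof S) (hπ : π'.IsPreproof S)
    (h : MpxPrinc S g 0 Γ nc P π') :
    ∃ θ, ReflTransGen PStep σ.tr θ ∧ ReflTransGen (PermZone g) θ π'.tr := by
  classical
  obtain ⟨x, D, M, G, T, p, a, nc', fin, ρ, rfl, h1, h2, h3, h4, h5, h6, h7, h8, h9, h9', h10, h11, rfl, h12, h13⟩ := h
  obtain ⟨C, hC⟩ : ∃ C, C = M + G + T := ⟨_, rfl⟩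
  have hnm : ∀ {P Q : Multiset (Prem ℕ E)} {b : ℕ}, b ∈ names (P + Q) ↔ b ∈ names P ∨ b ∈ names Q := by
    simp [names, or_and_right, exists_or]
  have hfk : ∀ (k b : ℕ), nc[k]? = some b →
      (b ∈ names C → fin[k]? = some []) ∧ (b ∉ names C → fin[k]? = some [true]) := by
    grind
  have hcut : ∀ y ∈ C, promName y = some a ∨ CutInto y C := by
    intro y hy; rw [hC] at hy
    rcases Multiset.mem_add.mp hy with hy | hy
    · refine (h9 y hy).imp_right fun ⟨b, e1, z, hz, e2⟩ => ⟨b, e1, z, by simp [hC, hz], e2⟩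
    · obtain ⟨b, e1, z, hz, e2⟩ := h9' y hy; refine Or.inr ⟨b, e1, z, ?_, e2⟩
      simp only [hC, Multiset.mem_add] at hz ⊢; tauto
  have hprom : AllProm C := by
    intro y hy; simp only [hC, Multiset.mem_add] at hy
    rcases hy with (hy | hy) | hy
    · rcases h3 y hy with ⟨q, hq⟩ | ⟨q, hq⟩ <;> exact ⟨q, by rw [hq]; rfl⟩
    · obtain ⟨q, hq⟩ := h4 y hy; exact ⟨q, by rw [hq]; rfl⟩
    · exact h5 y hy
  rw [← hC] at h6 h8 hσ
  have hprf := hσ.prf hp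
  have hbl : ∀ bl ∈ fin, bl = [] ∨ bl = [true] := by
    intro bl hbl; obtain ⟨k, hk, rfl⟩ := List.getElem_of_mem hbl
    have := hfk k nc[k] (List.getElem?_eq_getElem (by omega))
    grind
  have hfin : ∀ bl ∈ fin, ∀ e ∈ bl, e = true := by grind
  obtain ⟨T₂, hT⟩ : ∃ T₂ : Shots, T₂ = List.zipWith (fun A bl =>
    (((A.tr, comb bl) : Item), bl, bl.map fun e => ((Fm.tr A, el e) : Item))) Γ fin := ⟨_, rfl⟩
  have hshot : ∀ s ∈ T₂, Shot s.1 s.2.1 s.2.2 := by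
    intro s hs; rw [hT] at hs
    obtain ⟨k, hk, rfl⟩ := List.getElem_of_mem hs; rw [List.getElem_zipWith]
    simp only [List.length_zipWith] at hk
    rcases hbl _ (List.getElem_mem (show k < fin.length by omega)) with h | h
    · obtain ⟨s, A, hA⟩ := quest_of_der h12 k _ (List.getElem?_eq_getElem (show k < fin.length by omega))
        (by rw [h]; simp)
      rw [List.getElem?_eq_getElem (by omega), Option.some.injEq] at hA
      rw [h, hA]; exact .weak
    · rw [h]; exact .keep
  obtain ⟨rs, hr1, hr2⟩ := shots_run T₂ [] (by simp) hshot
  have t1 : T₂.map (fun s => s.1) = forest Γ fin := by rw [hT, List.map_zipWith]; rfl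
  have t2 : T₂.flatMap (fun s => s.2.2) =
      (List.zipWith (fun A b => b.map fun e => ((Fm.tr A, el e) : Item)) Γ fin).flatten := by
    rw [hT, List.flatMap_def, List.map_zipWith]
  have t3 : T₂.map (fun s => s.2.1) = fin := by
    rw [hT, List.map_zipWith]; apply List.ext_getElem
    · simp [h10, hσ.fits.1]
    · intro i hi hi'; simp
  have t4 : T₂.map (fun s => s.1.1) = Γ.map Fm.tr := by
    rw [hT, List.map_zipWith]; apply List.ext_getElem
    · simp [h10, hσ.fits.1]
    · intro i hi hi'; simp
  have t5 : T₂.map (fun _ => [true]) = nc.map fun _ => [true] := by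
    rw [List.map_const', List.map_const', ← List.length_map (as := T₂) (f := fun s => s.2.1), t3, h10]
  have t6 : (T₂.map fun s => s.1).map Prod.fst = Γ.map Fm.tr := by rw [← t4, List.map_map]; rfl
  simp only [List.flatMap_nil, List.nil_append, List.map_nil, t6] at hr1 hr2; rw [t1, t2] at hr1
  rw [t3, t4, t5] at hr2
  have hpl : x.2.rule.Plain := by rw [h1]; exact fun _ => rfl
  refine structDer_sim hσ hp h12 h13 (h13.isProof (h12.preproof hπ) fun z hz => ?_) ?_
    (leaves_block hfin).1 (leaves_block hfin).2
  · simp only [Finset.range_zero, Finset.sum_empty, add_zero, Multiset.mem_cons] at hz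
    rcases hz with rfl | hz
    · exact (hprf x (by simp)).kid 0
    · obtain ⟨y, hy, rfl⟩ := Multiset.mem_map.mp hz; exact hprf y (by simp [hy])
  · refine .of_step hr1 fun θ θ' hθ hθ' => ⟨_, _, _, hθ, .inr (.inr (.inl ?_))⟩
    rw [(leaves_block hfin).2] at hθ'; rw [← t1, t6]
    obtain ⟨R, hR⟩ : ∃ R : Prem ℕ E → Prop, R = fun y => promName y = some a := ⟨_, rfl⟩
    have hsplit : C.filter R + C.filter (fun y => ¬ R y) = C := Multiset.filter_add_not _ _
    have hCP : C ⊆ x ::ₘ (D + C) := fun z hz => by simp [hz]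
    have hnames : names (0 + (C.filter R).map trP + (C.filter fun y => ¬ R y).map trP) = names C := by
      rw [zero_add, ← Multiset.map_add, hsplit, names_tr]
    refine ⟨trP x, D.map trP, 0, (C.filter R).map trP, (C.filter fun y => ¬ R y).map trP, p, a, _, fin, θ', ?_,
      ?_, h2, by simp, ?_, ?_, ?_, h7, ?_, ?_, ?_, h10, ?_, rfl, hr2 θ', ?_⟩
    · grind [Multiset.map_add, Multiset.map_cons]
    · change x.2.tr.rule = _; rw [tr_rule hpl, h1]; rfl
    · intro y hy; obtain ⟨z, hz, rfl⟩ := Multiset.mem_map.mp hy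
      have hz := (Multiset.mem_filter.mp hz).1
      obtain ⟨q, hq⟩ := hprom z hz; exact ⟨q, (prom_chain (hprf z (hCP hz)) hq).1⟩
    · exact AllProm.tr fun y hy => hprom y (Multiset.mem_filter.mp hy).1
    · rwa [hnames]
    · rw [hnames, ← Multiset.map_cons, names_tr]; exact h8
    · intro y hy; rw [zero_add] at hy
      obtain ⟨z, hz, rfl⟩ := Multiset.mem_map.mp hy; obtain ⟨hz, hz2⟩ := Multiset.mem_filter.mp hz
      obtain ⟨q, hq⟩ := hprom z hz; grind [promName_tr]
    · intro y hy; rw [← Multiset.map_add, hsplit]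
      obtain ⟨z, hz, rfl⟩ := Multiset.mem_map.mp hy; obtain ⟨hz, hz2⟩ := Multiset.mem_filter.mp hz
      obtain ⟨q, hq⟩ := hprom z hz; rw [hR] at hz2
      exact ((hcut z hz).resolve_left hz2).tr hσ hp (hCP hz) hq hCP
    · intro k b hk
      have h := hfk k b hk
      rw [hnames]; refine ⟨fun hb => by simp [names] at hb, fun hb => h.1 ?_, h.2⟩
      rwa [← Multiset.map_add, hsplit, names_tr] at hb
    · have hb := blockSeq_shots T₂ hshot
      rw [t4, t3, t2, (leaves_block hfin).2] at hb
      rw [hb, openAt_tr (hprf x (by simp)).1.localOk hpl, ← keep_tr]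
      simpa using hθ'

end

/-- The premises of a multicut when the principal formula of a promotion commutes with it. -/
theorem Good.open_prom {Γ : Seq Unit} {nc : List ℕ} {x : Prem ℕ Unit} {C : Multiset (Prem ℕ Unit)}
    (hg : Good Γ nc (x ::ₘ C)) {p q a : ℕ} (hr : x.2.rule = .promG p) (h1 : x.1[p]? = some a)
    (h2 : nc[q]? = some a) :
    (∃ B, Γ[q]? = some (.bang () B)) ∧ Good ((Rule.promG q).prem0 Γ) nc ((x.1, x.2.kid 0) ::ₘ C) := by
  have hx := hg.prf x (by simp)
  have hlx := hg.fits x (by simp)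
  obtain ⟨⟨B, ho⟩, -⟩ := opens_prom hx hr
  have hq : q < Γ.length := hg.len ▸ (List.getElem?_eq_some_iff.mp h2).1
  have hfx := fil_zip_single (hg.names_nodup (x := x) (by simp)) h1 ho.get
  obtain ⟨e1, e2⟩ := hg.mok.wired.concl_eq (mem_zip_get.mpr ⟨q, h2, List.getElem?_eq_getElem hq⟩)
    (mem_occM_sk.mpr ⟨x, by simp, p, h1, ho.get⟩)
  have hΓ : Γ[q]? = some (.bang () B) := by rw [List.getElem?_eq_getElem hq, e1]
  have hpr : (Rule.promG q).prem0 Γ = Γ.set q B := by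
    grind [Rule.prem0, Rule.prems, replaceAt_fm_set]
  have e4 : fil a (occM (sk C)) = 0 := by
    rw [e1, sk_cons, occM_cons, fil_add, hfx] at e2
    have := congrArg Multiset.card e2
    simp only [Multiset.card_add, Multiset.card_singleton] at this
    exact Multiset.card_eq_zero.mp (by omega)
  have hC : Fits C := fun z hz => hg.fits z (by simp [hz])
  rw [hpr]; refine ⟨⟨B, hΓ⟩, by rw [List.length_set, hg.len], ?_, ?_, ?_⟩
  · intro z hz; rcases Multiset.mem_cons.mp hz with rfl | hz
    · change x.1.length = (x.2.kid 0).concl.length; rw [ho.kid, List.length_set, hlx]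
    · exact hC z hz
  · have hst := hg.mok.stripName a
    rw [sk_cons, Multiset.map_cons, map_strip_sk hC e4, map_strip_single (hg.names_nodup (x := x) (by simp)) h1 ho.get,
      map_strip_single hg.nc_nodup h2 hΓ] at hst
    rw [sk_cons]; change MOk _ (x.1.zip (x.2.kid 0).concl ::ₘ _)
    rw [ho.kid]; exact hst
  · intro z hz; rcases Multiset.mem_cons.mp hz with rfl | hz
    · exact hx.kid 0
    · exact hg.prf z (by simp [hz])

section
variable {E : Type u} {S : Sig E} {g : Bool} {Γ : Seq E} {nc : List ℕ} {P : Multiset (Prem ℕ E)}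

theorem IsMcut.prom_cut {σ : Pf E} {x y : Prem ℕ E} {C : Multiset (Prem ℕ E)}
    (hσ : IsMcut Γ nc (x ::ₘ C) σ) (hp : σ.IsProof S) {p q a : ℕ} (h1 : x.1[p]? = some a)
    (h2 : nc[q]? = some a) (hΓ : ∀ k F, k ≠ q → Γ[k]? = some F → ∃ t B, F = .quest t B) (hy : y ∈ C)
    (hq : y.2.rule.IsProm) (b : ℕ) (hb : promName y = some b) : b ∉ nc := by
  intro hb'; obtain ⟨r, hr⟩ := hq
  obtain ⟨l, l', s, A, e1, rfl, -⟩ := (hσ.prf hp y (by simp [hy])).1.localOk.2.1.prom_split hr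
  have hn : y.1[l.length]? = some b := by
    unfold promName at hb; rw [hr] at hb
    exact hb
  obtain ⟨k, hk, hkb⟩ := List.getElem_of_mem hb'
  have hk' : k < Γ.length := hσ.fits.1 ▸ hk
  have hkb : nc[k]? = some b := by rw [List.getElem?_eq_getElem hk, hkb]
  have e2 := ((hσ.mok hp.1.localOk).wired.concl_eq (mem_zip_get.mpr ⟨k, hkb, List.getElem?_eq_getElem hk'⟩)
    (mem_occM_sk.mpr ⟨y, by simp [hy], l.length, hn, show _ = some (.bang s A) by rw [e1]; simp⟩)).1
  by_cases hkq : k = q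
  · subst hkq; obtain rfl := Option.some.inj (h2.symm.trans hkb)
    exact hσ.shared hp hy (List.mem_of_getElem? h1) (List.mem_of_getElem? hn) hb'
  · obtain ⟨t, B, hB⟩ := hΓ k _ hkq (List.getElem?_eq_getElem hk'); rw [e2] at hB
    cases hB

/-- The commutation of a promotion. -/
theorem prom_sim {σ π' : Pf E} {x : Prem ℕ E} {C : Multiset (Prem ℕ E)} {p q a : ℕ} {X : Act}
    {K : Multiset Act} {I : Multiset (Prem ℕ Unit)} {F F₀ : List Item} {Γf : Seq Unit} {rs₀ : List (Rule Unit)}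
    {ρ : Pf Unit} (hσ : IsMcut Γ nc (x ::ₘ C) σ) (hp : σ.IsProof S) (hx : x.2.rule.promPos = some p)
    (h1 : x.1[p]? = some a) (h2 : nc[q]? = some a) (hC : AllProm C)
    (hΓ : ∀ k F, k ≠ q → Γ[k]? = some F → ∃ t B, F = .quest t B)
    (hX : X.names = x.1) (hX' : X.cur = x.2.tr.kid 0) (hXo : X.Open) (hK : ∀ y ∈ K, y.Closed nc)
    (hI : C.map trP = K.map Act.prem + I) (hF : F.map Prod.fst = (Rule.promG q).prem0 (Γ.map Fm.tr))
    (hw : WfF F) (hFf : Compat F Γf) (hρ : IsMcut Γf (nc.map nm0) ((Act.allFin {X} K I).map (ren nm0)) ρ)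
    (hρp : ρ.IsLLProof) (hrun : FRun F rs₀ F₀) (hl : Leaves F₀)
    (hπ : π'.tr = Pf.mk1 (Γ.map Fm.tr) (.promG q) (Pf.mkChain (F.map Prod.fst) rs₀ ρ)) :
    ∃ θ, ReflTransGen PStep σ.tr θ ∧ ReflTransGen (PermZone g) θ π'.tr := by
  have hg := hσ.tr.good hp.tr
  rw [Multiset.map_cons] at hg
  have hr := (prom_chain (hσ.prf hp x (by simp)) hx).1
  obtain ⟨⟨B, hB⟩, hg1⟩ := hg.open_prom hr h1 h2
  have hall : Act.all {X} K I = (x.1, x.2.tr.kid 0) ::ₘ C.map trP := by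
    unfold Act.all
    rw [Multiset.map_singleton, add_assoc, ← hI, Multiset.singleton_add, ← hX, ← hX']
    rfl
  have hgf : Good Γf nc (Act.allFin {X} K I) := (hρ.good hρp).of_rename nm0_inj
  have hder : DerPhase {X} K I F nc Γf := by
    refine ⟨fun z hz => ?_, hK, ?_, hgf.len, hgf.mok, hFf⟩
    · rwa [Multiset.mem_singleton.mp hz]
    · rw [hall, hF]; exact hg1
  obtain ⟨F', hl', hF', -, rs, hrs, hW⟩ := DerPhase.run _ rfl hder; rw [hF'] at hW
  obtain ⟨ρ₁, m1, m2, m3⟩ := hW ρ ((isMcut_rename_iff nm0 nm0_inj.injOn).mp hρ) hρp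
  have hθ : (Pf.mk1 (Γ.map Fm.tr) (.promG q) ρ₁).IsLLProof := by
    refine Pf.isLLProof_of ⟨⟨?_, ⟨(), B, hB, fun k A hk hA => ?_⟩, fun k τ hk => ?_⟩, ?_, ?_⟩ fun k τ hk => ?_
    · have := hp.tr.ok.1.1
      rwa [hσ.tr.concl] at this
    · change (Γ.map Fm.tr)[k]? = some A at hA; rw [List.getElem?_map] at hA
      obtain ⟨A', hA', rfl⟩ := Option.map_eq_some_iff.mp hA; obtain ⟨t, D, rfl⟩ := hΓ k A' hk hA'
      exact ⟨(), D.tr, rfl, trivial⟩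
    · rw [(Pf.mk1_isNode rfl ρ₁).2.2] at hk; rcases k with _ | k
      · obtain rfl : ρ₁ = τ := by simpa using hk
        rw [m1.concl, hF]
        rfl
      · simp at hk
    · rintro ⟨_, h⟩; cases h
    · rintro ⟨_, h⟩; cases h
    · rw [(Pf.mk1_isNode rfl ρ₁).2.2] at hk; grind
  have hctx := IsCtx.comp_mk1 (Γ := Γ.map Fm.tr) (r := .promG q) rfl IsCtx.id
  refine ⟨_, .head ?_ (hctx.pSteps hθ m3), ?_⟩
  · refine ⟨hp.tr, hθ, hσ.tr.concl, [], .here ⟨_, _, _, hσ.tr, .inl ?_⟩⟩; rw [Multiset.map_cons]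
    refine .promG_comm (x := trP x) (p := p) (q := q) (a := a) hr h1 h2 hC.tr (Pf.mk1_isNode rfl ρ₁) ?_
    obtain ⟨⟨B', ho⟩, -⟩ := opens_prom (hσ.prf hp x (by simp)).tr hr
    have hoa : openAt (trP x) 0 = ren nm0 (x.1, x.2.tr.kid 0) := by
      refine ho.openAt ?_; rw [Pf.tr_concl, List.length_map]
      exact hσ.fits.2 x (by simp)
    rw [hoa, keep_zero, ← Multiset.map_cons, ← hall, ← hF]; exact m1.rename nm0 nm0_inj.injOn
  · rw [hπ]
    have hm : ρ.rule.IsMcutRule := hρ.isMcutRule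
    have h := FRun.perm g hw hrs hl' hrun hl ρ hm
    exact ReflTransGen.lift (p := PermZone g) (Pf.mk1 (Γ.map Fm.tr) (.promG q))
      (fun θ θ' (hz : PermZone g θ θ') => hz.mk1 rfl (by rintro ⟨_, _, _, h⟩; cases h)) _ _ h

end

theorem getElem?_replace {α : Type*} {l r : List α} (x y : α) {k : ℕ} (hk : k ≠ l.length) :
    (l ++ x :: r)[k]? = (l ++ y :: r)[k]? := by
  grind

theorem mem_of_getElem?_ne {α : Type*} {l r : List α} {x y : α} {k : ℕ} (hk : k ≠ l.length)
    (h : (l ++ x :: r)[k]? = some y) : y ∈ l ++ r := by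
  grind

theorem frun_derelict {ks : List ℕ} (hn : ks.Nodup) {F : List Item}
    (h : ∀ k ∈ ks, ∃ B, F[k]? = some (.quest () B, der)) :
    ∃ F₀, FRun F (ks.map fun k => .mpx k 1) F₀ ∧ (∀ k ∈ ks, ∃ B, F₀[k]? = some (B, leaf false)) ∧
      ∀ k, k ∉ ks → F₀[k]? = F[k]? := by
  induction ks generalizing F with
  | nil => exact ⟨F, .nil, by simp, fun _ _ => rfl⟩
  | cons k ks ih =>
    obtain ⟨h1, h2⟩ := List.nodup_cons.mp hn; obtain ⟨B, hB⟩ := h k (by simp)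
    obtain ⟨l, r, rfl, rfl⟩ := exists_split hB
    have hne : ∀ k', k' ≠ l.length →
        (l ++ ((B, leaf false) :: r))[k']? = (l ++ ((Fm.quest () B, der) :: r))[k']? :=
      fun k' hk' => getElem?_replace _ _ hk'
    obtain ⟨F₀, h5, h6, h7⟩ := ih h2 (F := l ++ ((B, leaf false) :: r)) fun k' hk' => by
      rw [hne k' fun e => h1 (e ▸ hk')]
      exact h k' (by simp [hk'])
    refine ⟨F₀, .step .der h5, fun k' hk' => ?_, fun k' hk' => ?_⟩
    all_goals grind

section
variable {E : Type u} {S : Sig E} {g : Bool} {Γ : Seq E} {nc : List ℕ} {P : Multiset (Prem ℕ E)}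

theorem Chain.isProof {rs : List (Rule E)} {π ρ : Pf E} (h : Pf.Chain Γ rs π ρ) (hπ : π.IsPreproof S)
    (hρ : ρ.IsProof S) : π.IsProof S := by
  induction rs generalizing Γ π with
  | nil => exact (show π = ρ from h) ▸ hρ
  | cons r rs ih =>
    obtain ⟨π', h1, h2⟩ := h; grind [node_isProof]

theorem Chain.tr_ders {ps : List ℕ} {π ρ : Pf E} (h : Pf.Chain Γ (ps.map fun p => .mpx p 1) π ρ)
    (hπ : π.IsPreproof S) :
    Pf.Chain (Γ.map Fm.tr) (ps.map fun p => .mpx p 1) π.tr ρ.tr := by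
  induction ps generalizing Γ π with
  | nil => exact congrArg Pf.tr (show π = ρ from h)
  | cons p ps ih =>
    obtain ⟨π', h1, h2⟩ := h
    have hok := hπ.localOk.2.1
    rw [h1.1, h1.2.1] at hok
    have hpl : (Rule.mpx (E := E) p 1).Plain := fun _ => rfl
    refine ⟨π'.tr, Pf.tr_isNode h1 rfl rfl, ?_⟩
    have h3 := ih h2 (hπ.child (h1.2.2 0))
    have h4 := congrArg (List.map Occ.fm) (Rule.prem_tr hok hpl 0)
    rw [fm_tr] at h4
    change Pf.Chain ((((Rule.mpx p 1).prems (Γ.map Fm.tr))[0]?.getD []).map Occ.fm) _ _ _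
    rw [show (Rule.mpx p 1 : Rule Unit) = (Rule.mpx (E := E) p 1).tr1 from rfl, h4]
    exact h3

theorem prem0_promG_tr {q : ℕ} {s : E} {A : Fm E} (h : Γ[q]? = some (.bang s A)) :
    (Rule.promG q).prem0 (Γ.map Fm.tr) = ((Rule.promG q).prem0 Γ).map Fm.tr := by
  obtain ⟨l, r, rfl, rfl⟩ := exists_split h; grind [Rule.prem0, prems_promG, replaceAt_fm, Fm.tr]

theorem DerelictedPremise.tr {x : Prem ℕ E} {y : Prem Name' E} (h : DerelictedPremise x y)
    (hx : x.2.IsProof S) (hy : y.2.IsPreproof S) :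
    y.1 = x.1.map nm0 ∧ y.2.IsProof S ∧ y.2.tr = x.2.tr.kid 0 ∧ ∃ p, x.2.rule.promPos = some p := by
  obtain ⟨p, h1, h2, h3⟩ := h
  have hp : x.2.rule.promPos = some p := by rw [h1]; rfl
  obtain ⟨h4, h5⟩ := prom_chain hx hp
  obtain ⟨l, r, s, A, e1, rfl, -⟩ := hx.1.localOk.2.1.prom_split hp
  refine ⟨h2, Chain.isProof h3 hy (hx.kid 0), ?_, _, hp⟩; rw [derelictions_eq] at h3
  have h6 := Chain.tr_ders h3 hy
  rw [← prem0_promG_tr (s := s) (A := A) (by rw [e1]; simp)] at h6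
  have h7 : (x.2.tr.kid 0).concl = (Rule.promG l.length).prem0 (x.2.concl.map Fm.tr) := by
    rw [← Pf.tr_concl, ← h4]
    exact hx.tr.ok.1.2.2 0 _ (Pf.child_of_lt (by rw [h4]; exact Nat.one_pos))
  rw [h7, h1] at h5; exact h6.unique h5

theorem map_ofProm_prem (C : Multiset (Prem ℕ E)) :
    (C.map (Act.ofProm id)).map Act.prem = C.map trP := by
  rw [Multiset.map_map]; refine Multiset.map_congr rfl fun y hy => ?_
  simp [Act.prem, Act.ofProm, trP]

/-- The opened promotions, in the translation. -/
theorem map_ofProm_fin {C : Multiset (Prem ℕ E)} (hf : Fits C) (hp : ∀ y ∈ C, y.2.IsProof S) (hC : AllProm C) :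
    ((C.map (Act.ofProm id)).map Act.fin).map (ren nm0) = (C.map (openAt · 0)).map trP := by
  rw [Multiset.map_map, Multiset.map_map, Multiset.map_map]
  refine Multiset.map_congr rfl fun y hy => ?_
  obtain ⟨q, hq⟩ := hC y hy; simp only [Function.comp_apply]
  rw [openAt_prom (hf y hy) (hp y hy).1.localOk hq]; simp [Act.fin, Act.ofProm, trP, ren]

/-- A promotion commuting as a functorial or a unary one. -/
theorem promFU_sim {σ π' ρ : Pf E} {x : Prem ℕ E} {C : Multiset (Prem ℕ E)} {p q a : ℕ} {R : Rule E}
    (hσ : IsMcut Γ nc (x ::ₘ C) σ) (hp : σ.IsProof S) (hπ : π'.IsPreproof S)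
    (hx : x.2.rule.promPos = some p) (h1 : x.1[p]? = some a) (h2 : nc[q]? = some a) (hC : AllProm C)
    (hR : R = .promF q ∨ R = .promU q) (hn : π'.IsNode Γ R [ρ])
    (hρ : IsMcut (R.prem0 Γ) (nc.map nm0) ((x ::ₘ C).map (openAt · 0)) ρ) :
    ∃ θ, ReflTransGen PStep σ.tr θ ∧ ReflTransGen (PermZone g) θ π'.tr := by
  have hprf := hσ.prf hp
  have hq : R.promPos = some q := by rcases hR with rfl | rfl <;> rfl
  have hok := hπ.localOk.2.1
  rw [hn.1, hn.2.1] at hok; obtain ⟨l, r, s, A, rfl, rfl, hlr⟩ := hok.prom_split hq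
  have hΓ : ∀ k F, k ≠ l.length → (l ++ Fm.bang s A :: r)[k]? = some F → ∃ t B, F = .quest t B :=
    fun k F hk hF => hlr F (mem_of_getElem?_ne hk hF)
  have hpr := prem0_promFU l r s A R hR
  have hρp : ρ.IsProof S := by
    refine hρ.isProof (hπ.child (hn.2.2 0)) fun z hz => ?_
    obtain ⟨y, hy, rfl⟩ := Multiset.mem_map.mp hz; exact (hprf y hy).kid 0
  obtain ⟨F, hFd⟩ : ∃ F : List Item, F = l.map (fun B => (B.tr, der)) ++ (A.tr, leaf true) ::
    r.map (fun B => (B.tr, der)) := ⟨_, rfl⟩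
  have hFq : ∀ k, k ≠ l.length → k < F.length → ∃ B, F[k]? = some (.quest () B, der) := by
    intro k hk hk'; rw [List.getElem?_eq_getElem hk']
    have h3 := List.getElem?_eq_getElem hk'
    generalize F[k] = z at h3 ⊢; rw [hFd] at h3
    have h4 := mem_of_getElem?_ne (by simpa using hk) h3
    rw [← List.map_append] at h4; obtain ⟨B, hB, rfl⟩ := List.mem_map.mp h4
    obtain ⟨t, B, rfl⟩ := hlr B hB; exact ⟨B.tr, rfl⟩
  have hF : F.map Prod.fst = (Rule.promG l.length).prem0 ((l ++ Fm.bang s A :: r).map Fm.tr) := by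
    grind [prem0_promG_tr, Rule.prem0, prems_promG, replaceAt_fm, Function.comp_def]
  obtain ⟨d1, d2, d3⟩ := Rule.derPos_spec (n := F.length) hq
  obtain ⟨F₀, f1, f2, f3⟩ := frun_derelict (F := F) d1 fun k hk => hFq k (fun e => d2 (e ▸ hk)) (by
    rcases hR with rfl | rfl <;> simpa using (List.mem_filter.mp hk).1)
  have hmem : ∀ k, k < F.length → k ≠ l.length → k ∈ R.derPos F.length := by
    intro k hk hk'
    rcases hR with rfl | rfl <;> exact List.mem_filter.mpr ⟨List.mem_range.mpr hk, by simpa using hk'⟩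
  have hl : Leaves F₀ := by
    intro z hz; obtain ⟨k, hk⟩ := List.mem_iff_getElem?.mp hz
    by_cases hkd : k ∈ R.derPos F.length
    · obtain ⟨B, hB⟩ := f2 k hkd; obtain rfl := Option.some.inj (hk.symm.trans hB)
      exact ⟨false, rfl⟩
    · rw [f3 k hkd] at hk; by_cases hkl : k = l.length
      · rw [hkl, hFd] at hk; obtain rfl : (A.tr, leaf true) = z := by simpa using hk
        exact ⟨true, rfl⟩
      · exact absurd (hmem k (List.getElem?_eq_some_iff.mp hk).1 hkl) hkd
  have hw : WfF F := by
    intro z hz; rw [hFd] at hz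
    have hq' : ∀ B ∈ l ++ r, STree.Wf B.tr der := by
      intro B hB; obtain ⟨t, B, rfl⟩ := hlr B hB
      exact ⟨B.tr, rfl⟩
    rcases List.mem_append.mp hz with hz | hz
    · grind
    · rcases List.mem_cons.mp hz with rfl | hz
      · trivial
      grind
  have hcm : ∀ l' : Seq E, (∀ F ∈ l', ∃ t B, F = Fm.quest t B) →
      Compat (l'.map fun B => (B.tr, der)) ((l'.map Fm.unquest).map Fm.tr) := by
    intro l' hl'; unfold Compat
    rw [List.map_map, List.forall₂_map_left_iff, List.forall₂_map_right_iff, List.forall₂_same]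
    intro B hB; obtain ⟨t, B, rfl⟩ := hl' B hB
    exact Or.inr ⟨fun h => Fm.ne_quest () _ h.symm, rfl⟩
  have hAll : AllProm (x ::ₘ C) := by
    intro y hy; rcases Multiset.mem_cons.mp hy with rfl | hy
    · exact ⟨p, hx⟩
    · exact hC y hy
  refine prom_sim (X := (Act.ofProm id x).pop (Act.ofProm id x).ps) (K := C.map (Act.ofProm id)) (I := 0)
    (F := F) (F₀ := F₀) (ρ := ρ.tr) (Γf := (R.prem0 (l ++ Fm.bang s A :: r)).map Fm.tr) hσ hp hx h1 h2 hC hΓ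
    (List.map_id _) rfl (Act.ofProm_open (hprf x (by simp)) hx id) ?_ ?_ hF hw ?_ ?_ hρp.tr f1 hl ?_
  · intro y hy; obtain ⟨z, hz, rfl⟩ := Multiset.mem_map.mp hy
    obtain ⟨q', hq'⟩ := hC z hz
    exact Act.ofProm_closed (hprf z (by simp [hz])) hq' id (hσ.prom_cut hp h1 h2 hΓ hz ⟨q', hq'⟩)
  · rw [add_zero, map_ofProm_prem]
  · rw [hpr, hFd, List.map_append, List.map_cons]
    exact List.rel_append (hcm l fun B hB => hlr B (by simp [hB]))
      (.cons (Or.inl ⟨rfl, true, rfl⟩) (hcm r fun B hB => hlr B (by simp [hB])))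
  · have e : (Act.allFin {(Act.ofProm id x).pop (Act.ofProm id x).ps} (C.map (Act.ofProm id)) 0).map (ren nm0) =
        ((x ::ₘ C).map (openAt · 0)).map trP := by
      rw [← map_ofProm_fin hσ.fits.2 hprf hAll]; unfold Act.allFin
      rw [Multiset.map_cons, Multiset.map_cons, Multiset.map_singleton, add_zero, Multiset.singleton_add]
      rfl
    rw [e]; exact hρ.tr
  · have hrt := d3 (l ++ Fm.bang s A :: r) (by rw [hFd]; simp)
    have h3 := Pf.tr_chain (π := π') (by
      rw [hn.1, hn.2.1, hrt]; intro r hr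
      rcases List.mem_cons.mp hr with rfl | hr
      · rfl
      · obtain ⟨k, -, rfl⟩ := List.mem_map.mp hr
        rfl)
    rw [hn.1, hn.2.1, hrt, Pf.kid_of_child (show π'.child 0 = some ρ from hn.2.2 0)] at h3
    rw [h3.eq_mkChain, Pf.mkChain, hF]

end

section
variable {E : Type u} {S : Sig E} {g : Bool} {Γ : Seq E} {nc : List ℕ} {P : Multiset (Prem ℕ E)}

/-- A promotion commuting as a guarded one. -/
theorem promG_sim {σ π' ρ : Pf E} {x : Prem ℕ E} {C : Multiset (Prem ℕ E)} {P' : Multiset (Prem Name' E)}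
    {p q a : ℕ} {X : Act} {K : Multiset Act} {I : Multiset (Prem ℕ Unit)}
    (hσ : IsMcut Γ nc (x ::ₘ C) σ) (hp : σ.IsProof S) (hπ : π'.IsPreproof S)
    (hx : x.2.rule.promPos = some p) (h1 : x.1[p]? = some a) (h2 : nc[q]? = some a) (hC : AllProm C)
    (hn : π'.IsNode Γ (.promG q) [ρ]) (hX : X.names = x.1) (hX' : X.cur = x.2.tr.kid 0) (hXo : X.Open)
    (hK : (∀ y ∈ C, ∀ b, promName y = some b → b ∉ nc) → ∀ y ∈ K, y.Closed nc)
    (hI : C.map trP = K.map Act.prem + I)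
    (hρ : IsMcut ((Rule.promG q).prem0 Γ) (nc.map nm0) P' ρ) (hP : ∀ z ∈ P', z.2.IsProof S)
    (hP' : P'.map trP = (Act.allFin {X} K I).map (ren nm0)) :
    ∃ θ, ReflTransGen PStep σ.tr θ ∧ ReflTransGen (PermZone g) θ π'.tr := by
  have hok := hπ.localOk.2.1
  rw [hn.1, hn.2.1] at hok; obtain ⟨s, A, hA, hq⟩ := hok
  have hΓ : ∀ k F, k ≠ q → Γ[k]? = some F → ∃ t B, F = .quest t B := by grind
  obtain ⟨Δ, hΔ⟩ : ∃ Δ, Δ = ((Rule.promG q).prem0 Γ).map Fm.tr := ⟨_, rfl⟩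
  have hF : (Δ.map fun A => ((A, leaf true) : Item)).map Prod.fst = Δ := by simp [Function.comp_def]
  have hl : Leaves (Δ.map fun A => ((A, leaf true) : Item)) := by
    intro z hz; obtain ⟨A, -, rfl⟩ := List.mem_map.mp hz
    exact ⟨true, rfl⟩
  refine prom_sim (F := Δ.map fun A => (A, leaf true)) (Γf := Δ) (ρ := ρ.tr) hσ hp hx h1 h2 hC hΓ hX hX' hXo
    (hK fun y hy => hσ.prom_cut hp h1 h2 hΓ hy (hC y hy)) hI ?_ ?_ ?_ ?_
    (hρ.isProof (hπ.child (hn.2.2 0)) hP).tr .nil hl ?_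
  · rw [hF, hΔ, prem0_promG_tr hA]
  · intro z hz; obtain ⟨A, -, rfl⟩ := List.mem_map.mp hz
    trivial
  · unfold Compat; rw [List.forall₂_map_left_iff, List.forall₂_same]
    exact fun A _ => Or.inl ⟨rfl, true, rfl⟩
  · rw [← hP', hΔ]; exact hρ.tr
  · rw [(Pf.tr_isNode hn rfl rfl).eq_mk1]
    rfl

theorem promRed_sim {σ π' : Pf E} (hσ : IsMcut Γ nc P σ) (hp : σ.IsProof S) (hπ : π'.IsPreproof S)
    (h : PromRed Γ nc P π') : ∃ θ, ReflTransGen PStep σ.tr θ ∧ ReflTransGen (PermZone g) θ π'.tr := by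
  have hpf : ∀ {r : Rule E} {p}, r = .promF p → r.promPos = some p := by rintro _ _ rfl; rfl
  have hpu : ∀ {r : Rule E} {p}, r = .promU p → r.promPos = some p := by rintro _ _ rfl; rfl
  have hU : ∀ {y : Prem ℕ E}, y.2.rule.IsU → y.2.rule.IsProm := fun ⟨q, hq⟩ => ⟨q, hpu hq⟩
  have hprf := hσ.prf hp
  have hkeep : ∀ {C : Multiset (Prem ℕ E)}, C ⊆ P → ∀ z ∈ C.map (keep 0), z.2.IsProof S := by
    intro C hC z hz; obtain ⟨y, hy, rfl⟩ := Multiset.mem_map.mp hz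
    exact hprf y (hC hy)
  have hopen : ∀ {C : Multiset (Prem ℕ E)}, C ⊆ P → ∀ z ∈ C.map (openAt · 0), z.2.IsProof S := by
    intro C hC z hz; obtain ⟨y, hy, rfl⟩ := Multiset.mem_map.mp hz
    exact (hprf y (hC hy)).kid 0
  have hfin : ∀ {C : Multiset (Prem ℕ E)}, C ⊆ P → AllProm C →
      ((C.map (Act.ofProm id)).map Act.fin).map (ren nm0) = (C.map (openAt · 0)).map trP := fun hC h =>
    map_ofProm_fin (fun y hy => hσ.fits.2 y (hC hy)) (fun y hy => hprf y (hC hy)) h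
  have hclosed : ∀ {C : Multiset (Prem ℕ E)}, C ⊆ P → AllProm C → (∀ y ∈ C, ∀ b, promName y = some b → b ∉ nc) →
      ∀ y ∈ C.map (Act.ofProm id), y.Closed nc := by
    intro C hC hC' h y hy; obtain ⟨z, hz, rfl⟩ := Multiset.mem_map.mp hy
    obtain ⟨q, hq⟩ := hC' z hz; exact Act.ofProm_closed (hprf z (hC hz)) hq id (h z hz)
  cases h with
  | f1 h1 h2 h3 h4 h5 h6 h7 => exact promFU_sim hσ hp hπ (hpf h1) h2 h3 h4 (.inl rfl) h6 h7
  | u1 h1 h2 h3 h4 h5 h6 =>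
    exact promFU_sim hσ hp hπ (hpu h1) h2 h3 (fun z hz => hU (h4 z hz)) (.inr rfl) h5 h6
  | u2 h1 h2 h3 h4 h5 h6 h7 h8 => exact promFU_sim hσ hp hπ (hpu h1) h2 h3 h4 (.inl rfl) h7 h8
  | @f2 x y C p q a _ ρ h1 h2 h3 h4 h5 h6 h7 h8 =>
    obtain ⟨k, hk⟩ := hσ.mem_child (x := x) (by simp)
    obtain ⟨k', hk'⟩ := h8.mem_child (x := y) (by simp)
    obtain ⟨e1, e2, e3, -⟩ := h7.tr (hprf x (by simp)) ((hπ.child (h6.2.2 0)).child hk')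
    refine promG_sim (X := ⟨x.1, x.2.tr.kid 0, [], y.2.tr⟩) (K := 0) (I := C.map trP) hσ hp hπ (hpf h1) h2 h3 h4 h6
      rfl rfl ⟨List.nodup_nil, e3.symm⟩ (fun _ => by simp) (by simp) h8 (fun z hz => ?_) ?_
    · rcases Multiset.mem_cons.mp hz with rfl | hz
      · exact e2
      · exact hkeep (fun w hw => by simp [hw]) z hz
    · rw [Multiset.map_cons, keep_tr, keep_zero]; unfold Act.allFin
      simp [Act.fin, ren, trP, e1]
  | @u3 x C₁ z z' C₂ p q a _ ρ h1 h2 h3 h4 h5 h6 h7 h8 h9 h10 h11 =>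
    obtain ⟨k', hk'⟩ := h11.mem_child (x := z') (by simp)
    obtain ⟨e1, e2, e3, r, hr⟩ := h5.tr (hprf z (by simp)) ((hπ.child (h10.2.2 0)).child hk')
    have hs1 : C₁ ⊆ x ::ₘ (C₁ + z ::ₘ C₂) := fun w hw => by simp [hw]
    have hx1 : x ::ₘ C₁ ⊆ x ::ₘ (C₁ + z ::ₘ C₂) := fun w hw => by
      rcases Multiset.mem_cons.mp hw with rfl | hw <;> simp [*]
    have hp1 : AllProm C₁ := fun w hw => hU (h4 w hw)
    have hpx : AllProm (x ::ₘ C₁) := fun w hw => by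
      rcases Multiset.mem_cons.mp hw with rfl | hw
      · exact ⟨p, hpu h1⟩
      · exact hp1 w hw
    have hrz := (prom_chain (hprf z (by simp)) hr).1
    refine promG_sim (X := (Act.ofProm id x).pop (Act.ofProm id x).ps)
      (K := ⟨z.1, z.2.tr, [], z'.2.tr⟩ ::ₘ C₁.map (Act.ofProm id)) (I := C₂.map trP) hσ hp hπ (hpu h1) h2 h3
      (fun w hw => ?_) h10 (List.map_id _) rfl (Act.ofProm_open (hprf x (by simp)) (hpu h1) id)
      (fun hb y hy => ?_) ?_ h11 (fun w hw => ?_) ?_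
    · simp only [Multiset.mem_add, Multiset.mem_cons] at hw; rcases hw with hw | rfl | hw
      · exact hp1 w hw
      · exact ⟨r, hr⟩
      · exact h6 w hw
    · rcases Multiset.mem_cons.mp hy with rfl | hy
      · refine ⟨r, hrz, List.not_mem_nil, ⟨List.nodup_nil, e3.symm⟩, fun b hb' => hb z (by simp) b ?_⟩
        unfold promName; rw [hr]
        exact hb'
      · exact hclosed hs1 hp1 (fun w hw => hb w (by simp [hw])) y hy
    · rw [Multiset.map_cons, map_ofProm_prem, Multiset.map_add, Multiset.map_cons, Multiset.cons_add, Multiset.add_cons]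
      rfl
    · simp only [Multiset.mem_add, Multiset.mem_cons] at hw; rcases hw with hw | rfl | hw
      · exact hopen hx1 w hw
      · exact e2
      · exact hkeep (fun w hw => by simp [hw]) w hw
    · rw [Multiset.map_add, ← hfin hx1 hpx, Multiset.map_cons trP, keep_tr, keep_zero]
      unfold Act.allFin; simp [Act.fin, ren, trP, e1, Act.pop, Act.ofProm]
  | @u4 x C₁ z C₂ p q a _ ρ h1 h2 h3 h4 h5 h6 h7 h8 h9 h10 =>
    obtain ⟨r, hr⟩ := h5
    have hr : z.2.rule.promPos = some r := by rw [hr]; rfl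
    have hs1 : z ::ₘ C₁ ⊆ x ::ₘ (C₁ + z ::ₘ C₂) := fun w hw => by
      rcases Multiset.mem_cons.mp hw with rfl | hw <;> simp [*]
    have hx1 : x ::ₘ z ::ₘ C₁ ⊆ x ::ₘ (C₁ + z ::ₘ C₂) := fun w hw => by grind
    have hp1 : AllProm (z ::ₘ C₁) := fun w hw => by
      rcases Multiset.mem_cons.mp hw with rfl | hw
      · exact ⟨r, hr⟩
      · exact hU (h4 w hw)
    have hpx : AllProm (x ::ₘ z ::ₘ C₁) := fun w hw => by
      rcases Multiset.mem_cons.mp hw with rfl | hw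
      · exact ⟨p, hpu h1⟩
      · exact hp1 w hw
    refine promG_sim (X := (Act.ofProm id x).pop (Act.ofProm id x).ps)
      (K := (z ::ₘ C₁).map (Act.ofProm id)) (I := C₂.map trP) hσ hp hπ (hpu h1) h2 h3
      (fun w hw => ?_) h9 (List.map_id _) rfl (Act.ofProm_open (hprf x (by simp)) (hpu h1) id)
      (fun hb => hclosed hs1 hp1 fun w hw => hb w ?_) ?_ h10 (fun w hw => ?_) ?_
    · simp only [Multiset.mem_add, Multiset.mem_cons] at hw; rcases hw with hw | rfl | hw
      · exact hU (h4 w hw)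
      · exact ⟨r, hr⟩
      · exact h6 w hw
    · rcases Multiset.mem_cons.mp hw with rfl | hw <;> simp [*]
    · rw [map_ofProm_prem, Multiset.map_cons, Multiset.map_add, Multiset.map_cons, Multiset.cons_add, Multiset.add_cons]
    · rcases Multiset.mem_add.mp hw with hw | hw
      · exact hopen hx1 w hw
      · exact hkeep (fun w hw => by simp [hw]) w hw
    · rw [Multiset.map_add, ← hfin hx1 hpx, keep_tr, keep_zero]; unfold Act.allFin
      simp [Act.fin, ren, trP, Act.pop, Act.ofProm]; exact Multiset.cons_swap _ _ _

theorem BaseRed.concl {π' : Pf E} (h : BaseRed Γ nc P π') : π'.concl = Γ := by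
  cases h with
  | ax_comm _ h => exact h.1
  | one_comm _ h => exact h.1
  | comm _ _ _ h => exact h.1
  | tens_comm _ _ _ h => exact h.1
  | promG_comm _ _ _ _ h => exact h.1
  | ax_princ _ _ _ h => exact h.concl
  | cut_princ _ h => exact h.concl
  | princ _ _ _ h => exact h.concl

theorem superRed_sim {σ σ' : Pf E} (hp : σ.IsProof S) (hp' : σ'.IsPreproof S) (h : SuperRed S g σ σ') :
    σ.tr.rule.IsMcutRule ∧ ∃ θ, ReflTransGen PStep σ.tr θ ∧ ReflTransGen (PermZone g) θ σ'.tr := by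
  obtain ⟨Γ, nc, P, hσ, h⟩ := h; refine ⟨hσ.tr.isMcutRule, ?_⟩
  rcases h with h | h | h | ⟨_ | i, h⟩
  · rcases h.tr (hσ.prf hp) hp' with ⟨h1, h2⟩ | ⟨x, C, p, q, a, r, ρ, rfl, hr, h1, h2, h3, h4, h5⟩
    · refine ⟨_, .single ⟨hp.tr, h2, ?_, [], .here ⟨_, _, _, hσ.tr, .inl h1⟩⟩, .refl⟩
      rw [hσ.tr.concl, h1.concl]
    · rcases hr with ⟨i, rfl⟩ | ⟨i, rfl⟩
      · exact mpx_comm_sim hσ hp hp' h1 h2 h3 h4 h5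
      · exact contr_comm_sim hσ hp hp' h1 h2 h3 h4 h5
  · exact promRed_sim hσ hp hp' h
  all_goals grind [contrPrinc_sim, mpxPrinc_zero_sim, mpxPrinc_sim]

end

end SuperLL

open SuperLL in
theorem mainTheorem3 {E : Type*} (S : Sig E) (g : Bool) (π₀ π₁ : Pf E)
    (h₀ : π₀.IsProof S) (h₁ : SuperStep S g π₀ π₁) :
    ∃ (n : ℕ) (θ : ℕ → Pf Unit), θ 0 = π₀.tr ∧
      (∀ i ≤ n, (θ i).IsLLProof) ∧ (∀ i < n, LLStep (θ i) (θ (i + 1))) ∧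
      Relation.ReflTransGen (PermMoved g π₀.tr) (θ n) π₁.tr := by
  exact SuperLL.simulation_of_local S g (fun _ _ => SuperLL.superRed_sim) π₀ π₁ h₀ h₁
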